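/- **Setting.** Let $-\infty\le r_1<r_2<\infty$, $-\infty<s_2<s_1\le\infty$ with $r_1<s_2$, $r_2<s_1$; put $\mathcal I^{(3)}=(r_1,r_2)$, $\mathcal I^{(4)}=(s_2,s_1)$, $D=\{(r,s): r\in\mathcal I^{(3)},\ s\in\mathcal I^{(4)},\ r<s\}$. Fix $\mathbf x_0=(r_0,s_0)\in D$ such that $r<s_0$ for all $r\in\mathcal I^{(3)}$ and $r_0<s$ for all $s\in\mathcal I^{(4)}$. Let $z=\frac{r+s}2$, $z_0=\frac{r_0+s_0}2$, $\rho_0=\frac{s_0-r_0}2$, $J=\begin{pmatrix}0&1\\-1&0\end{pmatrix}$, $\Omega=iJ$. For $\mathbf x=(r,s)\in D$ let $\mathcal I^{(3)}(\mathbf x)$, $\mathcal I^{(4)}(\mathbf x)$ be the open intervals with end points $r,r_0$ and $s,s_0$, $\mathcal I(\mathbf x)$ their union, and $\bar{\mathcal I}=\bar{\mathcal I}(\mathbf x)$ the union of their closures (empty if the end points coincide). Let $\nu(\tau)=\left(\frac{\tau-r_0}{\tau-r}\right)^{1/2}\left(\frac{\tau-s_0}{\tau-s}\right)^{1/2}$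 be the branch holomorphic off $\bar{\mathcal I}$ with $\nu(\infty)=1$. For a function $f$ of $\tau$, $f^{\pm}(\sigma)$ denotes its limit at $\sigma\in\mathcal I(\mathbf x)$ from the upper/lower half plane. A function with domain $S\subset\mathbb R$ is $C^{n+}$ if it is $C^n$ and its $n$-th derivative obeys on each closed subinterval of $S$ a Hölder condition of some index in $(0,1]$ (depending on the subinterval); similarly for $C^{0+}$ functions of two variables, with closed rectangles. $K^{n+}$ is the set of pairs $\mathbf v=(v^{(3)},v^{(4)})$ of $C^{n+}$ functions $v^{(i)}:\mathcal I^{(i)}\to\mathbb C^{2\times2}$ with $\det v^{(i)}=1$ and $v^{(i)}(\sigma)^\dagger\mathcal A(\sigma)v^{(i)}(\sigma)=\mathcal A(\sigma)$, where $\mathcal A(\sigma)=(\sigma-z_0)\Omega+\Omega\,\mathrm{diag}(\rho_0^2,1)\,\Omega$. Let $$\mathcal F^M(\tau)=\begin{pmatrix}1&-i(\tau-z)\\0&1\end{pmatrix}\begin{pmatrix}1&0\\0&\nu(\tau)\end{pmatrix}\begin{pmatrix}1&i(\tau-z_0)\\0&1\end{pmatrix}.$$ A *solution of the HHP* corresponding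 to $(\mathbf v,\mathcal F^M,\mathbf x)$ is a $2\times2$ matrix function $\mathcal F$, holomorphic on the Riemann sphere minus $\bar{\mathcal I}$, with $\mathcal F(\infty)=I$, such that $\mathcal F^\pm$ exist on $\mathcal I(\mathbf x)$; $Y:=\mathcal F^+v^{(i)}(\mathcal F^{M+})^{-1}=\mathcal F^-v^{(i)}(\mathcal F^{M-})^{-1}$ on each $\mathcal I^{(i)}(\mathbf x)$; $\mathcal F$ is bounded near $\{r_0,s_0\}$, $\nu^{-1}\mathcal F$ is bounded near $\{r,s\}$, and $Y$ is bounded near $\{r_0,s_0\}$ and near $\{r,s\}$. For $\sigma\in\overline{\mathcal I^{(i)}(\mathbf x)}$ let $W(\sigma)=v^{(i)}(\sigma)\begin{pmatrix}1&-i(\sigma-z_0)\\0&1\end{pmatrix}$, with columns $W_1,W_2$ and entries $W_{ab}$, and $d_{21}(\sigma',\sigma)=W_{22}(\sigma')W_{11}(\sigma)-W_{12}(\sigma')W_{21}(\sigma)$, $k_{21}(\sigma',\sigma)=\frac{d_{21}(\sigma',\sigma)-1}{\sigma'-\sigma}$ (extended to the diagonal by its limit). On $\bar{\mathcal I}$ and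 $\bar{\mathcal I}\times\bar{\mathcal I}$ respectively define $$U_1(\sigma)=W_1(\sigma)-\frac1{\pi i}\int_{\bar{\mathcal I}}\nu^+(\sigma')\frac{W_1(\sigma')-W_1(\sigma)}{\sigma'-\sigma}\,d\sigma',$$ $$K_{21}(\sigma',\sigma)=k_{21}(\sigma',\sigma)-\frac1{\pi i}\int_{\bar{\mathcal I}}\nu^+(\sigma'')\frac{k_{21}(\sigma',\sigma'')-k_{21}(\sigma',\sigma)}{\sigma''-\sigma}\,d\sigma''.$$ For a column function $\mathcal Y_1:\bar{\mathcal I}\to\mathbb C^2$ consider the Alekseev equation (principal value integral, assumed to exist) $$0=W_1(\sigma)-\frac1{\pi i}\int_{\bar{\mathcal I}}\nu^+(\sigma')^{-1}\,\mathcal Y_1(\sigma')\,\frac{W_2^T(\sigma')JW_1(\sigma)}{\sigma'-\sigma}\,d\sigma'\qquad(\sigma\in\mathcal I(\mathbf x)),\tag{A}$$ the Fredholm equation of the second kind (integrand summable for each $\sigma$) $$\mathcal Y_1(\sigma)-\frac1{\pi i}\int_{\bar{\mathcal I}}\nu^+(\sigma')^{-1}\,\mathcal Y_1(\sigma')K_{21}(\sigma',\sigma)\,d\sigma'=U_1(\sigma)\qquad(\sigma\in\bar{\mathcal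 I}),\tag{6.7}$$ and the representation $$\nu(\tau)^{-1}\mathcal F(\tau)=I-\frac1{\pi i}\int_{\bar{\mathcal I}}\nu^+(\sigma')^{-1}\,\mathcal Y_1(\sigma')\frac{W_2^T(\sigma')J}{\sigma'-\tau}\,d\sigma'\qquad(\tau\in\mathbb C\setminus\bar{\mathcal I}).\tag{B}$$ **Theorem.** Let $\mathbf v\in K^{2+}$ and $\mathbf x\in D$. 1. For $\sigma\in\bar{\mathcal I}\setminus\{r,s\}$ one has, as a principal value integral that exists, $$U_1(\sigma)=-\frac1{\pi i}\int_{\bar{\mathcal I}}\nu^+(\sigma')\frac{W_1(\sigma')}{\sigma'-\sigma}\,d\sigma',$$ and likewise, for distinct $\sigma,\sigma'\in\bar{\mathcal I}\setminus\{r,s\}$, $$K_{21}(\sigma',\sigma)=-\frac1{\pi i}\int_{\bar{\mathcal I}}\nu^+(\sigma'')\frac{d_{21}(\sigma',\sigma'')}{(\sigma''-\sigma)(\sigma'-\sigma'')}\,d\sigma''.$$ Moreover $U_1$ is $C^{1+}$ on $\bar{\mathcal I}$ and $K_{21}$ is $C^{0+}$ on $\bar{\mathcal I}\times\bar{\mathcal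 I}$. 2. For every $\mathcal Y_1:\bar{\mathcal I}\to\mathbb C^2$: $\mathcal Y_1$ is $C^{0+}$ and satisfies (A) if and only if $\mathcal Y_1$ is summable over $\bar{\mathcal I}$ and satisfies (6.7). 3. For every $2\times2$ matrix function $\mathcal F$ on $\mathbb C\setminus\bar{\mathcal I}$ and every $\mathcal Y_1:\bar{\mathcal I}\to\mathbb C^2$ the following are equivalent: (i) $\mathcal F$ is a solution of the HHP corresponding to $(\mathbf v,\mathcal F^M,\mathbf x)$, and $\mathcal Y_1$ is continuous on $\bar{\mathcal I}$ with $\mathcal Y_1=\frac12(\mathcal F^++\mathcal F^-)W_1$ on $\mathcal I(\mathbf x)$; (ii) $\mathcal Y_1$ is $C^{0+}$ and satisfies (A), and $\mathcal F$ is given by (B); (iii) $\mathcal Y_1$ is summable over $\bar{\mathcal I}$ and satisfies (6.7), and $\mathcal F$ is given by (B). -/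

import Mathlib

open Set Filter Topology MeasureTheory Matrix
open scoped NNReal

noncomputable section

/-- Complex `2 × 2` matrices. -/
abbrev Mat2 : Type := Matrix (Fin 2) (Fin 2) ℂ

/-! ### Regularity classes, boundary values, principal values -/

/-- `f`, with domain `S ⊆ ℝ`, is `C^{n+}`: it is `C^n` on `S`, and on each closed subinterval of `S`
its `n`-th derivative obeys a Hölder condition of some index `0 < γ ≤ 1`, which may depend on the
subinterval. Derivatives at points of `S` are taken within `S`. -/
def IsCPlus {E : Type*} [NormedAddCommGroup E] [NormedSpace ℝ E] (n : ℕ) (f : ℝ → E)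
    (S : Set ℝ) : Prop :=
  ContDiffOn ℝ n f S ∧
    ∀ a b : ℝ, Icc a b ⊆ S → ∃ γ : ℝ≥0, 0 < γ ∧ γ ≤ 1 ∧
      ∃ M : ℝ≥0, HolderOnWith M γ (iteratedDerivWithin n f S) (Icc a b)

/-- The class `C^{0+}` for functions of two real variables with domain `S`: continuity, and a Hölder
condition on each closed rectangle contained in `S`. -/
def IsCZeroPlus₂ (f : ℝ × ℝ → ℂ) (S : Set (ℝ × ℝ)) : Prop :=
  ContinuousOn f S ∧
    ∀ a b c d : ℝ, Icc a b ×ˢ Icc c d ⊆ S → ∃ γ : ℝ≥0, 0 < γ ∧ γ ≤ 1 ∧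
      ∃ M : ℝ≥0, HolderOnWith M γ f (Icc a b ×ˢ Icc c d)

/-- Points `σ + ζ` with `ζ → 0`, `Im ζ > 0`. -/
def fromAbove (σ : ℝ) : Filter ℂ := 𝓝[{τ : ℂ | 0 < τ.im}] (σ : ℂ)

/-- Points `σ - ζ` with `ζ → 0`, `Im ζ > 0`. -/
def fromBelow (σ : ℝ) : Filter ℂ := 𝓝[{τ : ℂ | τ.im < 0}] (σ : ℂ)

/-- The boundary value `f⁺(σ)` (meaningful where the limit exists). -/
def plusValue {E : Type*} [TopologicalSpace E] [Nonempty E] (f : ℂ → E) (σ : ℝ) : E :=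
  limUnder (fromAbove σ) f

/-- The boundary value `f⁻(σ)` (meaningful where the limit exists). -/
def minusValue {E : Type*} [TopologicalSpace E] [Nonempty E] (f : ℂ → E) (σ : ℝ) : E :=
  limUnder (fromBelow σ) f

/-- `f` is summable over `S` in the principal value sense with respect to the singular points `P`,
and the principal value integral is `L`: symmetric `ε`-intervals about the points of `P` are removed
and `ε → 0+`. -/
def HasPVIntegral {E : Type*} [NormedAddCommGroup E] [NormedSpace ℝ E] (S P : Set ℝ)
    (f : ℝ → E) (L : E) : Prop :=
  (∀ ε : ℝ, 0 < ε → IntegrableOn f (S \ Metric.thickening ε P)) ∧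
    Tendsto (fun ε : ℝ => ∫ t in S \ Metric.thickening ε P, f t) (𝓝[>] 0) (𝓝 L)

/-- A matrix function with domain `Sᶜ` is bounded at the set `P`: it is bounded on `U \ S` for some
neighbourhood `U` of `P`. -/
def BoundedAt {X : Type*} [TopologicalSpace X] (P S : Set X) (F : X → Mat2) : Prop :=
  ∃ U ∈ 𝓝ˢ P, ∃ M : ℝ, ∀ t ∈ U \ S, ∀ a b, ‖F t a b‖ ≤ M

/-! ### Constant matrices and elementary factors -/

/-- `J = (0, 1; -1, 0)`. -/
def matJ : Mat2 := !![0, 1; -1, 0]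

/-- `Ω = (0, i; -i, 0)`. -/
def matΩ : Mat2 := !![0, Complex.I; -Complex.I, 0]

/-- The upper triangular matrix `(1, w; 0, 1)`. -/
def unip (w : ℂ) : Mat2 := !![1, w; 0, 1]

/-- The branch of `((τ - a₀) / (τ - a)) ^ (1/2)` that has the cut `[a, a₀]` and the value `1` at
infinity; it is identically `1` if `a = a₀`. -/
def rootFactor (a₀ a : ℝ) (τ : ℂ) : ℂ :=
  open Classical in if a = a₀ then 1 else ((τ - a₀) / (τ - a)) ^ (1 / 2 : ℂ)

/-- The data `r₁, r₂, s₁, s₂` (with `r₁ = -∞` and `s₁ = +∞` allowed) of a domain in null coordinates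
`(r, s)`, together with the base point `(r₀, s₀)`, which lies in the domain together with the two
null line segments through it. -/
structure NullDomain where
  r₁ : EReal
  r₂ : ℝ
  s₂ : ℝ
  s₁ : EReal
  r₀ : ℝ
  s₀ : ℝ
  r₁_lt_s₂ : r₁ < s₂
  r₂_lt_s₁ : r₂ < s₁
  r₁_lt_r₀ : r₁ < r₀
  r₀_lt_r₂ : r₀ < r₂
  s₂_lt_s₀ : s₂ < s₀
  s₀_lt_s₁ : s₀ < s₁
  r₀_lt_s₀ : r₀ < s₀
  segment_r : ∀ r : ℝ, r₁ < r → r < r₂ → r < s₀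
  segment_s : ∀ s : ℝ, s₂ < s → s < s₁ → r₀ < s

namespace NullDomain

variable (G : NullDomain)

/-- The interval `𝓘⁽³⁾ = {r : r₁ < r < r₂}`. -/
def dom₃ : Set ℝ := {r | G.r₁ < r ∧ r < G.r₂}

/-- The interval `𝓘⁽⁴⁾ = {s : s₂ < s < s₁}`. -/
def dom₄ : Set ℝ := {s | G.s₂ < s ∧ s < G.s₁}

/-- The domain `D`. -/
def D : Set (ℝ × ℝ) := {x | x.1 ∈ G.dom₃ ∧ x.2 ∈ G.dom₄ ∧ x.1 < x.2}

/-- `z₀ = (r₀ + s₀) / 2`. -/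
def z₀ : ℝ := (G.r₀ + G.s₀) / 2

/-- `ρ₀ = (s₀ - r₀) / 2`. -/
def ρ₀ : ℝ := (G.s₀ - G.r₀) / 2

/-- `𝓘⁽³⁾(x)`, the open interval with end points `r, r₀`. -/
def I₃ (x : ℝ × ℝ) : Set ℝ := Ioo (min x.1 G.r₀) (max x.1 G.r₀)

/-- `𝓘⁽⁴⁾(x)`, the open interval with end points `s, s₀`. -/
def I₄ (x : ℝ × ℝ) : Set ℝ := Ioo (min x.2 G.s₀) (max x.2 G.s₀)

/-- `𝓘(x)`. -/
def arcs (x : ℝ × ℝ) : Set ℝ := G.I₃ x ∪ G.I₄ x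

/-- The union of the closures of `𝓘⁽³⁾(x)` and `𝓘⁽⁴⁾(x)`. -/
def arcsBar (x : ℝ × ℝ) : Set ℝ := closure (G.I₃ x) ∪ closure (G.I₄ x)

/-- The closed arcs as a subset of the complex plane. -/
def cut (x : ℝ × ℝ) : Set ℂ := (fun σ : ℝ => (σ : ℂ)) '' G.arcsBar x

/-- `ν(x, τ)`. -/
def nu (x : ℝ × ℝ) (τ : ℂ) : ℂ := rootFactor G.r₀ x.1 τ * rootFactor G.s₀ x.2 τ

/-- `ν⁺(x, σ)`. -/
def nuPlus (x : ℝ × ℝ) (σ : ℝ) : ℂ := plusValue (G.nu x) σ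

/-- The Minkowski space potential `𝓕ᴹ(x, τ)`. -/
def FM (x : ℝ × ℝ) (τ : ℂ) : Mat2 :=
  unip (-Complex.I * (τ - ((x.1 + x.2) / 2 : ℝ))) * !![1, 0; 0, G.nu x τ] *
    unip (Complex.I * (τ - G.z₀))

/-- `𝓐ᴹ(x₀, σ) = (σ - z₀) Ω + Ω hᴹ(x₀) Ω` with `hᴹ(x₀) = diag(ρ₀², 1)`. -/
def AM (σ : ℝ) : Mat2 :=
  ((σ - G.z₀ : ℝ) : ℂ) • matΩ + matΩ * !![((G.ρ₀ ^ 2 : ℝ) : ℂ), 0; 0, 1] * matΩ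

/-- `w` is one of the two members of a pair in `K^{n+}`, with domain `S`. -/
def IsKComponent (n : ℕ) (w : ℝ → Mat2) (S : Set ℝ) : Prop :=
  (∀ a b, IsCPlus n (fun σ => w σ a b) S) ∧ (∀ σ ∈ S, (w σ).det = 1) ∧
    ∀ σ ∈ S, (w σ)ᴴ * G.AM σ * w σ = G.AM σ

/-- The group `K^{n+}` of pairs `v = (v⁽³⁾, v⁽⁴⁾)` of matrix functions with domains `𝓘⁽³⁾`, `𝓘⁽⁴⁾`
(values outside these domains are irrelevant). -/
def KPlus (n : ℕ) : Set ((ℝ → Mat2) × (ℝ → Mat2)) :=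
  {v | G.IsKComponent n v.1 G.dom₃ ∧ G.IsKComponent n v.2 G.dom₄}

/-! ### The homogeneous Hilbert problem -/

/-- `Y(x, σ) = 𝓕⁺(σ) v⁽ⁱ⁾(σ) [𝓕₀⁺(σ)]⁻¹` for `σ ∈ 𝓘⁽ⁱ⁾(x)`. -/
def hhpY (v : (ℝ → Mat2) × (ℝ → Mat2)) (x : ℝ × ℝ) (F₀ F : ℂ → Mat2) (σ : ℝ) : Mat2 :=
  open Classical in
  plusValue F σ * (if σ ∈ G.I₃ x then v.1 σ else v.2 σ) * (plusValue F₀ σ)⁻¹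

/-- `F` is a solution of the HHP corresponding to `(v, 𝓕₀, x)`; here `F₀ = 𝓕₀(x, ·)`. The domain of
`F` is the Riemann sphere minus the closed arcs; being holomorphic at `∞` with value `1` there is
expressed by the limit at infinity. -/
structure IsHHPSolution (v : (ℝ → Mat2) × (ℝ → Mat2)) (x : ℝ × ℝ) (F₀ F : ℂ → Mat2) :
    Prop where
  holomorphic : ∀ a b, DifferentiableOn ℂ (fun τ => F τ a b) (G.cut x)ᶜ
  at_infinity : Tendsto F (cocompact ℂ) (𝓝 1)
  plus_exists : ∀ σ ∈ G.arcs x, ∃ L, Tendsto F (fromAbove σ) (𝓝 L)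
  minus_exists : ∀ σ ∈ G.arcs x, ∃ L, Tendsto F (fromBelow σ) (𝓝 L)
  jump₃ : ∀ σ ∈ G.I₃ x, plusValue F σ * v.1 σ * (plusValue F₀ σ)⁻¹ =
    minusValue F σ * v.1 σ * (minusValue F₀ σ)⁻¹
  jump₄ : ∀ σ ∈ G.I₄ x, plusValue F σ * v.2 σ * (plusValue F₀ σ)⁻¹ =
    minusValue F σ * v.2 σ * (minusValue F₀ σ)⁻¹
  bounded_base : BoundedAt {(G.r₀ : ℂ), (G.s₀ : ℂ)} (G.cut x) F
  bounded_point : BoundedAt {(x.1 : ℂ), (x.2 : ℂ)} (G.cut x) (fun τ => (G.nu x τ)⁻¹ • F τ)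
  Y_bounded_base : BoundedAt {G.r₀, G.s₀} (G.arcs x)ᶜ (G.hhpY v x F₀ F)
  Y_bounded_point : BoundedAt {x.1, x.2} (G.arcs x)ᶜ (G.hhpY v x F₀ F)

/-! ### The Alekseev-type equation -/

/-- `W(x, σ) = v⁽ⁱ⁾(σ) (1, -i(σ - z₀); 0, 1)` for `σ` in the closure of `𝓘⁽ⁱ⁾(x)`. -/
def W (v : (ℝ → Mat2) × (ℝ → Mat2)) (x : ℝ × ℝ) (σ : ℝ) : Mat2 :=
  open Classical in
  (if σ ∈ closure (G.I₃ x) then v.1 σ else v.2 σ) *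
    unip (-Complex.I * ((σ - G.z₀ : ℝ) : ℂ))

/-- The first column `W₁(x, σ)`. -/
def W₁ (v : (ℝ → Mat2) × (ℝ → Mat2)) (x : ℝ × ℝ) (σ : ℝ) : Fin 2 → ℂ := (G.W v x σ).col 0

/-- The second column `W₂(x, σ)`. -/
def W₂ (v : (ℝ → Mat2) × (ℝ → Mat2)) (x : ℝ × ℝ) (σ : ℝ) : Fin 2 → ℂ := (G.W v x σ).col 1

/-- For every `σ ∈ 𝓘(x)`, the integral below exists in the principal value sense and
`0 = W₁(σ) - (1/πi) ∫ ν⁺(σ')⁻¹ 𝓨₁(σ') W₂ᵀ(σ') J W₁(σ) / (σ' - σ) dσ'`. -/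
def SolvesAlekseev (v : (ℝ → Mat2) × (ℝ → Mat2)) (x : ℝ × ℝ) (Y₁ : ℝ → Fin 2 → ℂ) : Prop :=
  ∀ σ ∈ G.arcs x, ∃ L : Fin 2 → ℂ,
    HasPVIntegral (G.arcsBar x) {σ}
      (fun σ' => ((G.nuPlus x σ')⁻¹ * (G.W₂ v x σ' ⬝ᵥ matJ *ᵥ G.W₁ v x σ) /
        ((σ' - σ : ℝ) : ℂ)) • Y₁ σ') L ∧
    0 = G.W₁ v x σ - (1 / (Real.pi * Complex.I)) • L

/-- `ν(τ)⁻¹ F(τ) = I - (1/πi) ∫ ν⁺(σ')⁻¹ 𝓨₁(σ') W₂ᵀ(σ') J / (σ' - τ) dσ'` off the closed arcs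
(the integral of a matrix is taken entry by entry). -/
def IsFOfY (v : (ℝ → Mat2) × (ℝ → Mat2)) (x : ℝ × ℝ) (F : ℂ → Mat2) (Y₁ : ℝ → Fin 2 → ℂ) :
    Prop :=
  ∀ τ ∈ (G.cut x)ᶜ, (G.nu x τ)⁻¹ • F τ =
    1 - (1 / (Real.pi * Complex.I)) • Matrix.of fun a b =>
      ∫ σ' in G.arcsBar x, (G.nuPlus x σ')⁻¹ *
        (vecMulVec (Y₁ σ') (G.W₂ v x σ') * matJ) a b / (σ' - τ)

/-- `Y₁` is continuous on the closed arcs and its restriction to `𝓘(x)` is the first column of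
`(1/2) (F⁺ + F⁻) W`. -/
def IsYOfF (v : (ℝ → Mat2) × (ℝ → Mat2)) (x : ℝ × ℝ) (F : ℂ → Mat2) (Y₁ : ℝ → Fin 2 → ℂ) :
    Prop :=
  ContinuousOn Y₁ (G.arcsBar x) ∧
    ∀ σ ∈ G.arcs x, Y₁ σ = ((1 / 2 : ℂ) • (plusValue F σ + minusValue F σ)) *ᵥ G.W₁ v x σ

/-! ### The Fredholm equation -/

/-- `d₂₁(σ', σ) = W₂₂(σ') W₁₁(σ) - W₁₂(σ') W₂₁(σ)`. -/
def d₂₁ (v : (ℝ → Mat2) × (ℝ → Mat2)) (x : ℝ × ℝ) (σ' σ : ℝ) : ℂ :=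
  G.W v x σ' 1 1 * G.W v x σ 0 0 - G.W v x σ' 0 1 * G.W v x σ 1 0

/-- `k₂₁(σ', σ) = (d₂₁(σ', σ) - 1) / (σ' - σ)`, with its limiting value on the diagonal (recall
`d₂₁(σ, σ) = 1`). -/
def k₂₁ (v : (ℝ → Mat2) × (ℝ → Mat2)) (x : ℝ × ℝ) (σ' σ : ℝ) : ℂ :=
  open Classical in
  if σ' = σ then derivWithin (fun t => G.d₂₁ v x t σ) (G.arcsBar x) σ
  else (G.d₂₁ v x σ' σ - 1) / ((σ' - σ : ℝ) : ℂ)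

/-- The inhomogeneous term `U₁` on the closed arcs, in the form that makes sense at all of their
points:
`U₁(σ) = W₁(σ) - (1/πi) ∫ ν⁺(σ') (W₁(σ') - W₁(σ)) / (σ' - σ) dσ'`. -/
def U₁ (v : (ℝ → Mat2) × (ℝ → Mat2)) (x : ℝ × ℝ) (σ : ℝ) : Fin 2 → ℂ :=
  G.W₁ v x σ - (1 / (Real.pi * Complex.I)) •
    ∫ σ' in G.arcsBar x,
      (G.nuPlus x σ' / ((σ' - σ : ℝ) : ℂ)) • (G.W₁ v x σ' - G.W₁ v x σ)

/-- The kernel `K₂₁`, in the form that makes sense at all pairs of points of the closed arcs: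
`K₂₁(σ', σ) = k₂₁(σ', σ) - (1/πi) ∫ ν⁺(σ'') (k₂₁(σ', σ'') - k₂₁(σ', σ)) / (σ'' - σ) dσ''`. -/
def K₂₁ (v : (ℝ → Mat2) × (ℝ → Mat2)) (x : ℝ × ℝ) (σ' σ : ℝ) : ℂ :=
  G.k₂₁ v x σ' σ - (1 / (Real.pi * Complex.I)) *
    ∫ σ'' in G.arcsBar x,
      G.nuPlus x σ'' * (G.k₂₁ v x σ' σ'' - G.k₂₁ v x σ' σ) / ((σ'' - σ : ℝ) : ℂ)

/-- For every `σ` in the closed arcs, the integral below exists and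
`𝓨₁(σ) - (1/πi) ∫ ν⁺(σ')⁻¹ 𝓨₁(σ') K₂₁(σ', σ) dσ' = U₁(σ)`. -/
def SolvesFredholm (v : (ℝ → Mat2) × (ℝ → Mat2)) (x : ℝ × ℝ) (Y₁ : ℝ → Fin 2 → ℂ) : Prop :=
  ∀ σ ∈ G.arcsBar x,
    IntegrableOn (fun σ' => ((G.nuPlus x σ')⁻¹ * G.K₂₁ v x σ' σ) • Y₁ σ') (G.arcsBar x) ∧
    Y₁ σ - (1 / (Real.pi * Complex.I)) •
      ∫ σ' in G.arcsBar x, ((G.nuPlus x σ')⁻¹ * G.K₂₁ v x σ' σ) • Y₁ σ' = G.U₁ v x σ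

end NullDomain

end

/-!
The proof rests on one device of complex analysis. A function that is holomorphic off a compact set
of real numbers, has boundary values on both sides of it, and grows at most like an inverse square
root at finitely many exceptional points, is its value at infinity plus the Cauchy integral of its
jump (`IsSectHolo.eq_cauchyInt`); without a jump it is constant (`IsSectHolo.eq_const`). Applied to
`ν` and `ν⁻¹` this gives `ν - 1 = (1/πi) ∫ ν⁺(σ) / (σ - τ) dσ` and the like for `ν⁻¹`; with the
Sokhotski–Plemelj formulas (`plemelj`) it turns the singular integrals in the statement into the
absolutely convergent ones that define `U₁` and `K₂₁`. The properties of `ν` that matter are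
collected in `IsCutRoot`, and all of the analysis is done for such a root.

Let `u` be the first column of `W` and `w` the first row of its inverse, so that `w · u = 1` and
`d₂₁(σ', σ) = w(σ') · u(σ)`. The kernel is a difference quotient of the inhomogeneous term,
`K₂₁(σ', σ) = -w(σ') · (U₁(σ) - U₁(σ')) / (σ - σ')`. Since `W` is of class `C^{2+}`, the term `U₁`
is a superposition of affine reparametrizations of derivatives of `u`; this gives its regularity and,
the kernel being a mean of `U₁'` over a segment, that of `K₂₁`.

The equivalence of the singular equation with the one of the second kind is `IsCutRoot.link`. Take
one component `y` of the density, `H = c + (1/πi) ∫ (ν⁺)⁻¹ y w / (σ - τ)`, and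
`P = -H · (1/πi) ∫ ν⁺ u / (σ - τ) - (1/πi) ∫ (ν⁺)⁻¹ y w · U₁ / (σ - τ)`. Its boundary values are
`∓ ν⁺ H± · u + c · U₁ + (1/πi) ∫ (ν⁺)⁻¹ y K₂₁`. The singular equation says that `(H⁺ + H⁻) · u = 0`,
that is, that `P` has no jump; the equation of the second kind says that `P / ν` has none. In both
cases `P` vanishes, and its boundary values then give the other equation.

That a summable solution of the Fredholm equation is of Hölder class
(`IsKernelData.isHolder_of_fredholm`) follows once `y / ν⁺` is integrable, and only a zero `e` of
`ν` may prevent this. If `K₂₁(e, σ) ≠ 0` for some `σ`, the convergence of the integral at `σ` gives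
integrability near `e`; otherwise `w(e)` is orthogonal to all `U₁(σ) - U₁(e)`, so that `K₂₁(σ', σ)`
is of the order of `σ' - e` and compensates the singularity.

For the Hilbert problem, the jump condition says that the first columns of `𝓕⁺ W` and `𝓕⁻ W`
coincide and that the second ones are opposite (`NullDomain.jump_iff`). Hence `𝓕⁺ + 𝓕⁻` is twice the
density times `w`, and Cauchy's formula for `ν⁻¹ 𝓕` is the representation by the density.
Conversely the Plemelj formulas for the representation give back the jump condition; the second
column of `Y` is bounded because `w(σ') · W₂(σ)` vanishes for `σ' = σ`.
-/

noncomputable section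

/-! ### Boundary values -/

theorem tendsto_add_mul_I (σ : ℝ) :
    Tendsto (fun y : ℝ => (σ : ℂ) + y * Complex.I) (𝓝[>] 0) (fromAbove σ) := by
  refine tendsto_nhdsWithin_iff.2 ⟨?_, ?_⟩
  · have : Continuous fun y : ℝ => (σ : ℂ) + y * Complex.I := by fun_prop
    simpa using (this.tendsto 0).mono_left nhdsWithin_le_nhds
  · filter_upwards [self_mem_nhdsWithin] with y hy
    simpa using hy

theorem tendsto_sub_mul_I (σ : ℝ) :
    Tendsto (fun y : ℝ => (σ : ℂ) - y * Complex.I) (𝓝[>] 0) (fromBelow σ) := by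
  refine tendsto_nhdsWithin_iff.2 ⟨?_, ?_⟩
  · have : Continuous fun y : ℝ => (σ : ℂ) - y * Complex.I := by fun_prop
    simpa using (this.tendsto 0).mono_left nhdsWithin_le_nhds
  · filter_upwards [self_mem_nhdsWithin] with y hy
    simpa using hy

instance fromAbove_neBot (σ : ℝ) : (fromAbove σ).NeBot := (tendsto_add_mul_I σ).neBot

instance fromBelow_neBot (σ : ℝ) : (fromBelow σ).NeBot := (tendsto_sub_mul_I σ).neBot

theorem fromAbove_le (σ : ℝ) : fromAbove σ ≤ 𝓝 (σ : ℂ) := nhdsWithin_le_nhds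

theorem fromBelow_le (σ : ℝ) : fromBelow σ ≤ 𝓝 (σ : ℂ) := nhdsWithin_le_nhds

theorem eventually_im_pos (σ : ℝ) : ∀ᶠ τ in fromAbove σ, 0 < τ.im := self_mem_nhdsWithin

theorem eventually_im_neg (σ : ℝ) : ∀ᶠ τ in fromBelow σ, τ.im < 0 := self_mem_nhdsWithin

theorem plusValue_eq {E : Type*} [TopologicalSpace E] [T2Space E] [Nonempty E] {f : ℂ → E} {σ : ℝ}
    {L : E} (h : Tendsto f (fromAbove σ) (𝓝 L)) : plusValue f σ = L := h.limUnder_eq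

theorem minusValue_eq {E : Type*} [TopologicalSpace E] [T2Space E] [Nonempty E] {f : ℂ → E} {σ : ℝ}
    {L : E} (h : Tendsto f (fromBelow σ) (𝓝 L)) : minusValue f σ = L := h.limUnder_eq

/-! ### Elementary integrals -/

theorem integral_inv_sub_mul_I (ρ : ℝ) {y : ℝ} (hy : y ≠ 0) :
    ∫ s in (-ρ)..ρ, ((s : ℂ) - y * Complex.I)⁻¹ = 2 * Complex.I * Real.arctan (ρ / y) := by
  have hne : ∀ s : ℝ, (s : ℂ) - y * Complex.I ≠ 0 := fun s h => hy (by
    simpa using congrArg Complex.im h)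
  have hpos : ∀ s : ℝ, 0 < s ^ 2 + y ^ 2 := fun s => by positivity
  have hder : ∀ s : ℝ, HasDerivAt
      (fun s : ℝ => ((Real.log (s ^ 2 + y ^ 2) / 2 : ℝ) : ℂ) + Real.arctan (s / y) * Complex.I)
      ((s : ℂ) - y * Complex.I)⁻¹ s := by
    intro s
    have h1 : HasDerivAt (fun s : ℝ => Real.log (s ^ 2 + y ^ 2) / 2) (s / (s ^ 2 + y ^ 2)) s := by
      have := (((hasDerivAt_id s).pow 2).add_const (y ^ 2)).log (by simpa using (hpos s).ne')
      refine (this.div_const 2).congr_deriv ?_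
      have := (hpos s).ne'
      simp
      field_simp
    have h2 : HasDerivAt (fun s : ℝ => Real.arctan (s / y)) (y / (s ^ 2 + y ^ 2)) s := by
      have := ((hasDerivAt_id s).div_const y).arctan
      refine this.congr_deriv ?_
      have := (hpos s).ne'
      simp only [id]
      have h3 : 1 + (s / y) ^ 2 ≠ 0 := by positivity
      field_simp
      ring
    refine (h1.ofReal_comp.add (h2.ofReal_comp.mul_const Complex.I)).congr_deriv ?_
    have h3 : ((s : ℂ) ^ 2 + (y : ℂ) ^ 2) ≠ 0 := by exact_mod_cast (hpos s).ne'
    push_cast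
    rw [eq_comm]
    refine inv_eq_of_mul_eq_one_right ?_
    field_simp
    linear_combination (-(y : ℂ) ^ 2) * Complex.I_sq
  rw [intervalIntegral.integral_eq_sub_of_hasDerivAt (fun s _ => hder s)]
  · simp only [neg_div, Real.arctan_neg, neg_sq]
    push_cast
    ring
  · refine ContinuousOn.intervalIntegrable ?_
    exact ((by fun_prop : Continuous fun s : ℝ => (s : ℂ) - y * Complex.I).inv₀ hne).continuousOn

theorem locallyIntegrable_abs_rpow {p : ℝ} (hp : -1 < p) (c : ℝ) :
    LocallyIntegrable (fun x : ℝ => |x - c| ^ p) := by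
  have h : LocallyIntegrable (fun x : ℝ => |x| ^ p) := by
    refine locallyIntegrable_of_norm_le_rpow (by simp) (C := 1) (α := -p) (by simp; linarith)
      (ae_of_all _ fun x => ?_) (continuous_abs.measurable.pow_const p).aestronglyMeasurable
    rw [one_mul, neg_neg, Real.norm_eq_abs, Real.norm_eq_abs, abs_of_nonneg (by positivity)]
  rw [locallyIntegrable_iff] at h ⊢
  intro K hK
  have h1 := h ((fun x => x - c) '' K) (hK.image (by fun_prop))
  have h2 := (measurePreserving_sub_right volume c).integrableOn_image
    (MeasurableEquiv.subRight c).measurableEmbedding (f := fun x : ℝ => |x| ^ p) (s := K)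
  exact h2.1 h1

theorem integrableOn_abs_rpow {p : ℝ} (hp : -1 < p) (c : ℝ) {S : Set ℝ} (hS : IsCompact S) :
    IntegrableOn (fun x : ℝ => |x - c| ^ p) S :=
  (locallyIntegrable_abs_rpow hp c).integrableOn_isCompact hS

/-- The integrals of `|x - c| ^ p` over a bounded set are bounded uniformly in `c`. -/
theorem exists_integral_abs_rpow_le {p : ℝ} (hp : -1 < p) (hp0 : p ≤ 0) {S : Set ℝ}
    (hS : IsCompact S) : ∃ B, ∀ c : ℝ, ∫ x in S, |x - c| ^ p ≤ B := by
  refine ⟨(∫ x in Icc (-1 : ℝ) 1, |x - 0| ^ p) + volume.real S, fun c => ?_⟩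
  have hSf : volume S ≠ ⊤ := hS.measure_lt_top.ne
  have h1 : ∀ x ∈ S, |x - c| ^ p ≤ (Icc (c - 1) (c + 1)).indicator (fun x => |x - c| ^ p) x + 1 := by
    intro x _
    by_cases h : x ∈ Icc (c - 1) (c + 1)
    · rw [indicator_of_mem h]; linarith
    · rw [indicator_of_notMem h, zero_add]
      refine Real.rpow_le_one_of_one_le_of_nonpos ?_ hp0
      by_contra! h'
      rw [abs_lt] at h'
      exact h ⟨by linarith, by linarith⟩
  have hi : Integrable ((Icc (c - 1) (c + 1)).indicator (fun x => |x - c| ^ p)) :=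
    (integrable_indicator_iff measurableSet_Icc).2 (integrableOn_abs_rpow hp c isCompact_Icc)
  have hshift : ∫ x in Icc (c - 1) (c + 1), |x - c| ^ p = ∫ x in Icc (-1 : ℝ) 1, |x - 0| ^ p := by
    have := (measurePreserving_sub_right volume c).setIntegral_preimage_emb
      (MeasurableEquiv.subRight c).measurableEmbedding (fun x : ℝ => |x| ^ p) (Icc (-1) 1)
    simp only [sub_zero]
    rw [← this]
    simp [sub_eq_add_neg, add_comm]
  have h1i : IntegrableOn (fun _ : ℝ => (1 : ℝ)) S := integrableOn_const hSf
  calc ∫ x in S, |x - c| ^ p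
      ≤ ∫ x in S, ((Icc (c - 1) (c + 1)).indicator (fun x => |x - c| ^ p) x + 1) :=
        setIntegral_mono_on (integrableOn_abs_rpow hp c hS) (hi.integrableOn.add h1i)
          hS.measurableSet h1
    _ = (∫ x in S, (Icc (c - 1) (c + 1)).indicator (fun x => |x - c| ^ p) x) + volume.real S := by
        rw [integral_add hi.integrableOn h1i]
        simp
    _ ≤ (∫ x, (Icc (c - 1) (c + 1)).indicator (fun x => |x - c| ^ p) x) + volume.real S := by
        gcongr
        · refine ae_of_all _ fun x => ?_
          exact indicator_nonneg (fun _ _ => by positivity) _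
        · exact Measure.restrict_le_self
    _ = _ := by rw [integral_indicator measurableSet_Icc, hshift]

/-- The exponents being nonpositive, the smaller of `a`, `b` may replace the larger one. -/
theorem rpow_mul_rpow_le {a b p q : ℝ} (ha : 0 < a) (hb : 0 < b) (hp : p ≤ 0) (hq : q ≤ 0) :
    a ^ p * b ^ q ≤ a ^ (p + q) + b ^ (p + q) := by
  rcases le_total a b with h | h
  · have := Real.rpow_le_rpow_of_nonpos ha h hq
    calc a ^ p * b ^ q ≤ a ^ p * a ^ q := by gcongr
      _ = a ^ (p + q) := (Real.rpow_add ha _ _).symm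
      _ ≤ _ := by have : 0 ≤ b ^ (p + q) := by positivity
                  linarith
  · have := Real.rpow_le_rpow_of_nonpos hb h hp
    calc a ^ p * b ^ q ≤ b ^ p * b ^ q := by gcongr
      _ = b ^ (p + q) := (Real.rpow_add hb _ _).symm
      _ ≤ _ := by have : 0 ≤ a ^ (p + q) := by positivity
                  linarith

/-! ### Cauchy integrals over compact subsets of the real line -/

/-- The Cauchy integral `∫_S f(σ) / (σ - τ) dσ`. -/
def cauchyInt (S : Set ℝ) (f : ℝ → ℂ) (τ : ℂ) : ℂ := ∫ σ in S, f σ / (σ - τ)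

theorem ofReal_sub_ne_zero {S : Set ℝ} {τ : ℂ} (hτ : τ ∉ (fun σ : ℝ => (σ : ℂ)) '' S) {σ : ℝ}
    (hσ : σ ∈ S) : (σ : ℂ) - τ ≠ 0 := fun h => hτ ⟨σ, hσ, sub_eq_zero.1 h⟩

theorem notMem_image_of_im_ne_zero (S : Set ℝ) {τ : ℂ} (hτ : τ.im ≠ 0) :
    τ ∉ (fun σ : ℝ => (σ : ℂ)) '' S := by
  rintro ⟨σ, _, rfl⟩
  exact hτ (Complex.ofReal_im σ)

theorem isClosed_image_ofReal {S : Set ℝ} (hS : IsCompact S) :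
    IsClosed ((fun σ : ℝ => (σ : ℂ)) '' S) :=
  (hS.image Complex.continuous_ofReal).isClosed

theorem exists_ball_dist_ge {S : Set ℝ} (hS : IsCompact S) {τ : ℂ}
    (hτ : τ ∉ (fun σ : ℝ => (σ : ℂ)) '' S) :
    ∃ δ > 0, ∀ ζ ∈ Metric.ball τ δ, ∀ σ ∈ S, δ ≤ ‖(σ : ℂ) - ζ‖ := by
  obtain ⟨δ, hδ, h⟩ := Metric.isOpen_iff.1 (isClosed_image_ofReal hS).isOpen_compl τ hτ
  refine ⟨δ / 2, by positivity, fun ζ hζ σ hσ => ?_⟩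
  by_contra! hlt
  refine h ?_ ⟨σ, hσ, rfl⟩
  rw [Metric.mem_ball, dist_eq_norm] at hζ ⊢
  calc ‖(σ : ℂ) - τ‖ = ‖((σ : ℂ) - ζ) + (ζ - τ)‖ := by ring_nf
    _ ≤ _ := norm_add_le _ _
    _ < δ := by linarith

theorem integrableOn_div_sub {S : Set ℝ} (hS : IsCompact S) {f : ℝ → ℂ} (hf : IntegrableOn f S)
    {τ : ℂ} (hτ : τ ∉ (fun σ : ℝ => (σ : ℂ)) '' S) :
    IntegrableOn (fun σ : ℝ => f σ / (σ - τ)) S := by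
  simp only [div_eq_mul_inv]
  refine hf.mul_continuousOn ?_ hS
  exact ContinuousOn.inv₀ (by fun_prop) fun σ hσ => ofReal_sub_ne_zero hτ hσ

theorem differentiableAt_cauchyInt {S : Set ℝ} (hS : IsCompact S) {f : ℝ → ℂ}
    (hf : IntegrableOn f S) {τ : ℂ} (hτ : τ ∉ (fun σ : ℝ => (σ : ℂ)) '' S) :
    DifferentiableAt ℂ (cauchyInt S f) τ := by
  obtain ⟨δ, hδ, h⟩ := exists_ball_dist_ge hS hτ
  refine (hasDerivAt_integral_of_dominated_loc_of_deriv_le (Metric.ball_mem_nhds τ hδ)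
    (F := fun τ σ => f σ / (σ - τ)) (F' := fun τ σ => f σ / (σ - τ) ^ 2)
    (bound := fun σ => ‖f σ‖ / δ ^ 2) ?_ (integrableOn_div_sub hS hf hτ) ?_ ?_
    (hf.norm.div_const _) ?_).2.differentiableAt
  · refine Eventually.of_forall fun ζ => ?_
    exact hf.aestronglyMeasurable.div₀ (by fun_prop)
  · exact hf.aestronglyMeasurable.div₀ (by fun_prop)
  · refine (ae_restrict_iff' hS.measurableSet).2 (ae_of_all _ fun σ hσ ζ hζ => ?_)
    rw [norm_div, norm_pow]
    have := h ζ hζ σ hσ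
    gcongr
  · refine (ae_restrict_iff' hS.measurableSet).2 (ae_of_all _ fun σ hσ ζ hζ => ?_)
    have h0 : (σ : ℂ) - ζ ≠ 0 := norm_pos_iff.1 (hδ.trans_le (h ζ hζ σ hσ))
    have := ((hasDerivAt_id ζ).const_sub (σ : ℂ)).inv h0
    simp only [div_eq_mul_inv]
    refine (this.const_mul (f σ)).congr_deriv ?_
    simp

theorem tendsto_cauchyInt_cocompact {S : Set ℝ} (hS : IsCompact S) {f : ℝ → ℂ}
    (hf : IntegrableOn f S) : Tendsto (cauchyInt S f) (cocompact ℂ) (𝓝 0) := by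
  obtain ⟨R, hR0, hR⟩ := hS.isBounded.exists_pos_norm_le
  have hnorm := tendsto_norm_cocompact_atTop (E := ℂ)
  refine squeeze_zero_norm' (a := fun τ : ℂ => (∫ σ in S, ‖f σ‖) * (‖τ‖ - R)⁻¹) ?_ ?_
  · filter_upwards [hnorm.eventually_gt_atTop R] with τ hτ
    rw [cauchyInt, ← integral_mul_const]
    refine norm_integral_le_of_norm_le (hf.norm.mul_const _) ?_
    refine (ae_restrict_iff' hS.measurableSet).2 (ae_of_all _ fun σ hσ => ?_)
    rw [norm_div, div_eq_mul_inv]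
    have h1 := hR σ hσ
    have h2 := norm_sub_norm_le τ (σ : ℂ)
    rw [Complex.norm_real, norm_sub_rev] at h2
    have : 0 < ‖τ‖ - R := by linarith
    gcongr
    linarith
  · simpa [sub_eq_add_neg] using (tendsto_inv_atTop_zero.comp
      (tendsto_atTop_add_const_right _ (-R) hnorm)).const_mul (∫ σ in S, ‖f σ‖)

/-! ### Representation of sectionally holomorphic functions by Cauchy integrals -/

/-- Cauchy's theorem for the upper half `[-N, N] × [0, N]` of a square, for a function that
has boundary values almost everywhere on the base and is dominated there. -/
theorem upper_half_square {φ : ℂ → ℂ} {φp : ℝ → ℂ} {N : ℝ} (hN : 0 < N)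
    (hd : ∀ z : ℂ, 0 < z.im → DifferentiableAt ℂ φ z)
    (hr : Continuous fun y : ℝ => φ (N + y * Complex.I))
    (hl : Continuous fun y : ℝ => φ (-N + y * Complex.I))
    (hlim : ∀ᵐ x : ℝ, x ∈ Ioc (-N) N →
      Tendsto (fun y : ℝ => φ (x + y * Complex.I)) (𝓝[>] 0) (𝓝 (φp x)))
    {g : ℝ → ℝ} (hg : IntervalIntegrable g volume (-N) N)
    (hb : ∀ᶠ y : ℝ in 𝓝[>] 0, ∀ᵐ x : ℝ, x ∈ Ioc (-N) N → ‖φ (x + y * Complex.I)‖ ≤ g x) :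
    IntervalIntegrable φp volume (-N) N ∧
    (∫ x in (-N)..N, φp x) - (∫ x in (-N)..N, φ (x + N * Complex.I)) +
      Complex.I * (∫ y in (0 : ℝ)..N, φ (N + y * Complex.I)) -
      Complex.I * (∫ y in (0 : ℝ)..N, φ (-N + y * Complex.I)) = 0 := by
  have huI : Set.uIoc (-N) N = Ioc (-N) N := uIoc_of_le (by linarith)
  have hcont : ∀ y : ℝ, 0 < y → Continuous fun x : ℝ => φ (x + y * Complex.I) := by
    intro y hy
    refine continuous_iff_continuousAt.2 fun x => ?_
    have := (hd (x + y * Complex.I) (by simpa using hy)).continuousAt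
    exact ContinuousAt.comp (f := fun x : ℝ => (x : ℂ) + y * Complex.I) this (by fun_prop)
  have hmeas : ∀ᶠ y : ℝ in 𝓝[>] 0, AEStronglyMeasurable (fun x : ℝ => φ (x + y * Complex.I))
      (volume.restrict (Set.uIoc (-N) N)) := by
    filter_upwards [self_mem_nhdsWithin] with y hy
    exact (hcont y hy).aestronglyMeasurable
  have hbase : Tendsto (fun y : ℝ => ∫ x in (-N)..N, φ (x + y * Complex.I)) (𝓝[>] 0)
      (𝓝 (∫ x in (-N)..N, φp x)) := by
    refine intervalIntegral.tendsto_integral_filter_of_dominated_convergence g hmeas ?_ hg ?_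
    · rwa [huI]
    · rwa [huI]
  have hside : ∀ ψ : ℝ → ℂ, Continuous ψ →
      Tendsto (fun ε : ℝ => ∫ y in ε..N, ψ y) (𝓝[>] 0) (𝓝 (∫ y in (0 : ℝ)..N, ψ y)) := by
    intro ψ hψ
    have h1 := (intervalIntegral.continuous_primitive (μ := volume)
      (fun a b => hψ.intervalIntegrable a b) N).neg.tendsto 0
    rw [intervalIntegral.integral_symm N 0]
    refine (h1.mono_left nhdsWithin_le_nhds).congr fun ε => ?_
    rw [intervalIntegral.integral_symm N ε]
    rfl
  refine ⟨?_, ?_⟩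
  · rw [intervalIntegrable_iff, huI]
    rw [intervalIntegrable_iff, huI] at hg
    rw [huI] at hmeas
    have hlim' : ∀ᵐ x : ℝ ∂volume.restrict (Ioc (-N) N),
        Tendsto (fun y : ℝ => φ (x + y * Complex.I)) (𝓝[>] 0) (𝓝 (φp x)) :=
      (ae_restrict_iff' measurableSet_Ioc).2 hlim
    obtain ⟨ys, hys⟩ := exists_seq_tendsto (𝓝[>] (0 : ℝ))
    have hbs := hys.eventually (hb.and hmeas)
    obtain ⟨n₀, hn₀⟩ := eventually_atTop.1 hbs
    have hys' := (tendsto_add_atTop_iff_nat n₀).2 hys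
    refine Integrable.mono' hg ?_ ?_
    · refine aestronglyMeasurable_of_tendsto_ae atTop
        (f := fun n (x : ℝ) => φ (x + ys (n + n₀) * Complex.I)) (fun n => ?_) ?_
      · exact (hn₀ (n + n₀) (by omega)).2
      · filter_upwards [hlim'] with x hx using hx.comp hys'
    · have h2 : ∀ n, ∀ᵐ x : ℝ ∂volume.restrict (Ioc (-N) N),
          ‖φ (x + ys (n + n₀) * Complex.I)‖ ≤ g x := fun n =>
        (ae_restrict_iff' measurableSet_Ioc).2 (hn₀ (n + n₀) (by omega)).1
      filter_upwards [hlim', ae_all_iff.2 h2] with x hx hx2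
      exact le_of_tendsto (hx.comp hys').norm (Eventually.of_forall hx2)
  · have hT := ((hbase.sub (tendsto_const_nhds (x := ∫ x in (-N)..N, φ (x + N * Complex.I)))).add
      ((hside _ hr).const_mul Complex.I)).sub ((hside _ hl).const_mul Complex.I)
    refine tendsto_nhds_unique hT (tendsto_const_nhds.congr' ?_)
    filter_upwards [Ioo_mem_nhdsGT hN] with ε hε
    have := Complex.integral_boundary_rect_eq_zero_of_differentiableOn φ
      (-N + ε * Complex.I) (N + N * Complex.I) ?_
    · simpa using this.symm
    · intro z hz
      refine (hd z ?_).differentiableWithinAt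
      have := hz.2
      simp [uIcc_of_le hε.2.le] at this
      linarith [this.1, hε.1]

/-- The contribution of one side of a large square, the side being obtained from the lower one by
the rotation `ω`. -/
theorem tendsto_side {g : ℂ → ℂ} {g₀ c τ ω : ℂ} {R : ℝ} (hω : ‖ω‖ = 1)
    (hc : ContinuousOn g {z | R < ‖z‖}) (hinf : Tendsto g (cocompact ℂ) (𝓝 g₀)) :
    Tendsto (fun N : ℝ => ω * ∫ x in (-N)..N,
      (g (ω * (x - N * Complex.I)) - c) / (ω * (x - N * Complex.I) - τ)) atTop
      (𝓝 ((g₀ - c) * (Complex.I * (Real.pi / 2)))) := by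
  have hω0 : ω ≠ 0 := norm_pos_iff.1 (by rw [hω]; exact one_pos)
  have hone : ∀ s : ℝ, 1 ≤ ‖(s : ℂ) - Complex.I‖ := fun s => by
    have := Complex.abs_im_le_norm ((s : ℂ) - Complex.I)
    simpa using this
  have hsI : ∀ s : ℝ, (s : ℂ) - Complex.I ≠ 0 := fun s =>
    norm_pos_iff.1 (one_pos.trans_le (hone s))
  have hbig : ∀ s N : ℝ, 0 ≤ N → N ≤ ‖ω * (N * ((s : ℂ) - Complex.I))‖ := fun s N hN => by
    rw [norm_mul, hω, one_mul, norm_mul, Complex.norm_real, Real.norm_of_nonneg hN]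
    exact le_mul_of_one_le_right hN (hone s)
  obtain ⟨R', hR'⟩ : ∃ R', ∀ z : ℂ, R' ≤ ‖z‖ → ‖g z‖ ≤ ‖g₀‖ + 1 := by
    have h1 : ∀ᶠ z in cocompact ℂ, ‖g z‖ ≤ ‖g₀‖ + 1 :=
      hinf.norm.eventually (eventually_le_nhds (by linarith))
    rw [← Metric.cobounded_eq_cocompact] at h1
    obtain ⟨R', -, hR'⟩ := (hasBasis_cobounded_norm (E := ℂ)).eventually_iff.1 h1
    exact ⟨R', fun z hz => hR' hz⟩
  have hscale : ∀ᶠ N : ℝ in atTop, ω * ∫ x in (-N)..N,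
      (g (ω * (x - N * Complex.I)) - c) / (ω * (x - N * Complex.I) - τ) =
      ∫ s in (-1 : ℝ)..1, (g (ω * (N * (s - Complex.I))) - c) *
        (ω * N / (ω * (N * (s - Complex.I)) - τ)) := by
    filter_upwards [eventually_gt_atTop 0] with N hN
    have := intervalIntegral.smul_integral_comp_mul_left (a := -1) (b := 1)
      (fun x : ℝ => (g (ω * (x - N * Complex.I)) - c) / (ω * (x - N * Complex.I) - τ)) N
    rw [mul_neg_one, mul_one] at this
    rw [← this, ← intervalIntegral.integral_smul, ← intervalIntegral.integral_const_mul]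
    refine intervalIntegral.integral_congr fun s _ => ?_
    simp only [Complex.ofReal_mul, mul_sub, Complex.real_smul]
    ring
  have hval : (g₀ - c) * (Complex.I * (Real.pi / 2)) =
      ∫ s in (-1 : ℝ)..1, (g₀ - c) * ((s : ℂ) - Complex.I)⁻¹ := by
    have := integral_inv_sub_mul_I 1 one_ne_zero
    rw [intervalIntegral.integral_const_mul]
    simp only [Complex.ofReal_one, one_mul, div_one, Real.arctan_one] at this
    rw [this]
    push_cast
    ring
  rw [hval]
  refine Tendsto.congr' (hscale.mono fun _ h => h.symm) ?_
  refine intervalIntegral.tendsto_integral_filter_of_dominated_convergence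
    (fun _ => (‖g₀‖ + 1 + ‖c‖) * 2) ?_ ?_ (by simp) ?_
  · filter_upwards [eventually_gt_atTop R, eventually_gt_atTop 0] with N hN hN0
    refine AEStronglyMeasurable.mul ?_ (measurable_const.div (by fun_prop)).aestronglyMeasurable
    refine (Continuous.sub ?_ continuous_const).aestronglyMeasurable
    refine hc.comp_continuous (by fun_prop) fun s => ?_
    exact hN.trans_le (hbig s N hN0.le)
  · filter_upwards [eventually_ge_atTop R', eventually_ge_atTop (2 * ‖τ‖), eventually_gt_atTop 0]
      with N h1 h2 h3
    refine ae_of_all _ fun s _ => ?_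
    rw [norm_mul]
    refine mul_le_mul ?_ ?_ (norm_nonneg _) (by positivity)
    · refine (norm_sub_le _ _).trans ?_
      gcongr
      exact hR' _ (h1.trans (hbig s N h3.le))
    · rw [norm_div, norm_mul, hω, one_mul, Complex.norm_real, Real.norm_of_nonneg h3.le]
      have h4 := norm_sub_norm_le (ω * (N * ((s : ℂ) - Complex.I))) τ
      have h5 := hbig s N h3.le
      rw [div_le_iff₀] <;> linarith
  · refine ae_of_all _ fun s _ => ?_
    have h1 : Tendsto (fun N : ℝ => ω * (N * ((s : ℂ) - Complex.I))) atTop (cocompact ℂ) := by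
      rw [← Metric.cobounded_eq_cocompact, ← tendsto_norm_atTop_iff_cobounded]
      exact tendsto_atTop_mono' _ ((eventually_ge_atTop 0).mono fun N hN => hbig s N hN) tendsto_id
    refine ((hinf.comp h1).sub_const c).mul ?_
    have h2 : Tendsto (fun N : ℝ => (ω * ((s : ℂ) - Complex.I) - τ * ((N⁻¹ : ℝ) : ℂ))) atTop
        (𝓝 (ω * ((s : ℂ) - Complex.I))) := by
      have h3 : Tendsto (fun N : ℝ => ((N⁻¹ : ℝ) : ℂ)) atTop (𝓝 ((0 : ℝ) : ℂ)) :=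
        (Complex.continuous_ofReal.tendsto 0).comp tendsto_inv_atTop_zero
      simpa using (tendsto_const_nhds (x := ω * ((s : ℂ) - Complex.I))).sub (h3.const_mul τ)
    have h3 := (tendsto_const_nhds (x := ω) (f := (atTop : Filter ℝ))).div h2
      (mul_ne_zero hω0 (hsI s))
    have h4 : ω / (ω * ((s : ℂ) - Complex.I)) = ((s : ℂ) - Complex.I)⁻¹ := by
      rw [div_mul_eq_div_div, div_self hω0, one_div]
    rw [h4] at h3
    refine h3.congr' ?_
    filter_upwards [eventually_gt_atTop 0] with N hN
    have hN' : (N : ℂ) ≠ 0 := by exact_mod_cast hN.ne'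
    have h6 : ω * (N * ((s : ℂ) - Complex.I)) - τ
        = N * (ω * ((s : ℂ) - Complex.I) - τ * ((N⁻¹ : ℝ) : ℂ)) := by
      push_cast
      field_simp
    rw [h6, Pi.div_apply, mul_comm ω (N : ℂ), mul_div_mul_left _ _ hN']

/-- The weight `1 + ∑ |τ - e| ^ (-1/2)`, the sum being over the points `e` of `E`. -/
def endWeight (E : Finset ℝ) (τ : ℂ) : ℝ := 1 + ∑ e ∈ E, ‖τ - e‖ ^ (-(1 / 2) : ℝ)

theorem one_le_endWeight (E : Finset ℝ) (τ : ℂ) : 1 ≤ endWeight E τ :=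
  le_add_of_nonneg_right (Finset.sum_nonneg fun _ _ => by positivity)

theorem endWeight_le {E : Finset ℝ} {x : ℝ} (hx : x ∉ E) (y : ℝ) :
    endWeight E (x + y * Complex.I) ≤ 1 + ∑ e ∈ E, |x - e| ^ (-(1 / 2) : ℝ) := by
  unfold endWeight
  refine add_le_add le_rfl (Finset.sum_le_sum fun e he => ?_)
  have h0 : 0 < |x - e| := abs_pos.2 (sub_ne_zero.2 fun h => hx (h ▸ he))
  refine Real.rpow_le_rpow_of_nonpos h0 ?_ (by norm_num)
  have := Complex.abs_re_le_norm ((x : ℂ) + y * Complex.I - e)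
  simpa using this

theorem locallyIntegrable_endWeight (E : Finset ℝ) :
    LocallyIntegrable (fun x : ℝ => 1 + ∑ e ∈ E, |x - e| ^ (-(1 / 2) : ℝ)) :=
  (locallyIntegrable_const 1).add
    (locallyIntegrable_finsetSum _ fun e _ => locallyIntegrable_abs_rpow (by norm_num) e)

/-- Bounds by the weight near the points of a compact interval combine to a bound on a strip. -/
theorem exists_strip_bound {E : Finset ℝ} {g : ℂ → ℂ}
    (hg : ∀ p : ℝ, ∃ C, ∀ᶠ τ in 𝓝 (p : ℂ), τ.im ≠ 0 → ‖g τ‖ ≤ C * endWeight E τ) (N : ℝ) :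
    ∃ C, 0 ≤ C ∧ ∃ ε > 0, ∀ x ∈ Icc (-N) N, ∀ y : ℝ, 0 < |y| → |y| < ε →
      ‖g (x + y * Complex.I)‖ ≤ C * endWeight E (x + y * Complex.I) := by
  refine isCompact_Icc.induction_on (p := fun s : Set ℝ => ∃ C, 0 ≤ C ∧ ∃ ε > 0, ∀ x ∈ s,
    ∀ y : ℝ, 0 < |y| → |y| < ε → ‖g (x + y * Complex.I)‖ ≤ C * endWeight E (x + y * Complex.I))
    ⟨0, le_rfl, 1, one_pos, by simp⟩ ?_ ?_ ?_
  · rintro s t hst ⟨C, hC, ε, hε, h⟩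
    exact ⟨C, hC, ε, hε, fun x hx => h x (hst hx)⟩
  · rintro s t ⟨C, hC, ε, hε, h⟩ ⟨C', hC', ε', hε', h'⟩
    refine ⟨max C C', le_max_of_le_left hC, min ε ε', lt_min hε hε', fun x hx y hy hy' => ?_⟩
    have hw := (zero_le_one.trans (one_le_endWeight E (x + y * Complex.I)))
    rcases hx with hx | hx
    · exact (h x hx y hy (hy'.trans_le (min_le_left _ _))).trans (by gcongr; exact le_max_left _ _)
    · exact (h' x hx y hy (hy'.trans_le (min_le_right _ _))).trans
        (by gcongr; exact le_max_right _ _)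
  · intro p _
    obtain ⟨C, hC⟩ := hg p
    obtain ⟨δ, hδ, h⟩ := Metric.eventually_nhds_iff.1 hC
    refine ⟨Metric.ball p (δ / 2), mem_nhdsWithin_of_mem_nhds (Metric.ball_mem_nhds _ (by positivity)),
      max C 0, le_max_right _ _, δ / 2, by positivity, fun x hx y hy hy' => ?_⟩
    have hw := (zero_le_one.trans (one_le_endWeight E (x + y * Complex.I)))
    refine (h ?_ (by simpa using hy)).trans (by gcongr; exact le_max_left _ _)
    rw [Metric.mem_ball, Real.dist_eq] at hx
    rw [dist_eq_norm]
    have : (x : ℂ) + y * Complex.I - p = ((x - p : ℝ) : ℂ) + y * Complex.I := by push_cast; ring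
    rw [this]
    refine (norm_add_le _ _).trans_lt ?_
    rw [norm_mul, Complex.norm_I, Complex.norm_real, Complex.norm_real, Real.norm_eq_abs,
      Real.norm_eq_abs]
    linarith

/-- The hypotheses on a sectionally holomorphic function with jumps on a compact set `S` of real
numbers: it is holomorphic off `S`, has the limit `g₀` at infinity, has boundary values `gp`, `gm`
at the points of `S` outside a finite set `E`, and grows at most like `|τ - e| ^ (-1/2)` at the
points `e` of `E`. -/
structure IsSectHolo (S : Set ℝ) (E : Finset ℝ) (g : ℂ → ℂ) (g₀ : ℂ) (gp gm : ℝ → ℂ) : Prop where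
  diff : ∀ τ ∉ (fun σ : ℝ => (σ : ℂ)) '' S, DifferentiableAt ℂ g τ
  inf : Tendsto g (cocompact ℂ) (𝓝 g₀)
  plus : ∀ σ ∈ S, σ ∉ E → Tendsto g (fromAbove σ) (𝓝 (gp σ))
  minus : ∀ σ ∈ S, σ ∉ E → Tendsto g (fromBelow σ) (𝓝 (gm σ))
  growth : ∀ e ∈ E, e ∈ S → ∃ C, ∀ᶠ τ in 𝓝 (e : ℂ), τ.im ≠ 0 → ‖g τ‖ ≤ C * endWeight E τ

namespace IsSectHolo

variable {S : Set ℝ} {E : Finset ℝ} {g : ℂ → ℂ} {g₀ : ℂ} {gp gm : ℝ → ℂ}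

/-- The growth condition holds at every real point, being trivial where `g` stays bounded. -/
theorem growth' (h : IsSectHolo S E g g₀ gp gm) (p : ℝ) :
    ∃ C, ∀ᶠ τ in 𝓝 (p : ℂ), τ.im ≠ 0 → ‖g τ‖ ≤ C * endWeight E τ := by
  have key : ∀ C : ℝ, 0 ≤ C → ∀ τ, ‖g τ‖ ≤ C → ‖g τ‖ ≤ C * endWeight E τ := fun C hC τ hτ =>
    hτ.trans (le_mul_of_one_le_right hC (one_le_endWeight E τ))
  by_cases hp : p ∈ S
  · by_cases hpE : p ∈ E
    · exact h.growth p hpE hp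
    · refine ⟨max (‖gp p‖ + 1) (‖gm p‖ + 1), ?_⟩
      have h1 : ∀ᶠ τ in fromAbove p, ‖g τ‖ ≤ ‖gp p‖ + 1 :=
        (h.plus p hp hpE).norm.eventually (eventually_le_nhds (by linarith))
      have h2 : ∀ᶠ τ in fromBelow p, ‖g τ‖ ≤ ‖gm p‖ + 1 :=
        (h.minus p hp hpE).norm.eventually (eventually_le_nhds (by linarith))
      filter_upwards [eventually_nhdsWithin_iff.1 h1, eventually_nhdsWithin_iff.1 h2] with τ a b hτ
      refine key _ (le_max_of_le_left (by positivity)) τ ?_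
      rcases lt_or_gt_of_ne hτ with h3 | h3
      · exact (b h3).trans (le_max_right _ _)
      · exact (a h3).trans (le_max_left _ _)
  · have hp' : (p : ℂ) ∉ (fun σ : ℝ => (σ : ℂ)) '' S := by
      rintro ⟨σ, hσ, h⟩
      exact hp (Complex.ofReal_injective h ▸ hσ)
    refine ⟨‖g p‖ + 1, ?_⟩
    have h1 : ∀ᶠ τ in 𝓝 (p : ℂ), ‖g τ‖ ≤ ‖g p‖ + 1 :=
      (h.diff p hp').continuousAt.norm.eventually (eventually_le_nhds (by linarith))
    filter_upwards [h1] with τ hτ _ using key _ (by positivity) τ hτ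

/-- Cauchy's theorem in the square `[-N, N]²` slit along the real line, applied to the difference
quotient of `g` at `τ`. -/
theorem square_identity (h : IsSectHolo S E g g₀ gp gm) (hS : IsCompact S) {τ : ℂ} (hτ : τ.im ≠ 0)
    {N : ℝ} (hN : 0 < N) (hSN : S ⊆ Ioo (-N) N) :
    IntegrableOn (fun σ => (gp σ - gm σ) / (σ - τ)) S ∧
    (∫ σ in S, (gp σ - gm σ) / (σ - τ)) +
      ((∫ x in (-N)..N, dslope g τ (x - N * Complex.I)) -
        (∫ x in (-N)..N, dslope g τ (x + N * Complex.I)) +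
        Complex.I * (∫ y in (-N)..N, dslope g τ (N + y * Complex.I)) -
        Complex.I * (∫ y in (-N)..N, dslope g τ (-N + y * Complex.I))) = 0 := by
  classical
  set φ := dslope g τ with hφ
  have hopen : IsOpen ((fun σ : ℝ => (σ : ℂ)) '' S)ᶜ := (isClosed_image_ofReal hS).isOpen_compl
  have hφd : ∀ z ∉ (fun σ : ℝ => (σ : ℂ)) '' S, DifferentiableAt ℂ φ z := by
    have : DifferentiableOn ℂ φ ((fun σ : ℝ => (σ : ℂ)) '' S)ᶜ := by
      rw [hφ, Complex.differentiableOn_dslope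
        (hopen.mem_nhds (notMem_image_of_im_ne_zero S hτ))]
      exact fun z hz => (h.diff z hz).differentiableWithinAt
    exact fun z hz => this.differentiableAt (hopen.mem_nhds hz)
  have hne : ∀ x : ℝ, (x : ℂ) - τ ≠ 0 := fun x hx => hτ (by
    have := congrArg Complex.im hx
    simpa using this)
  have hside : ∀ (M : ℝ), |M| = N → Continuous fun y : ℝ => φ (M + y * Complex.I) := by
    intro M hM
    refine continuous_iff_continuousAt.2 fun y => ?_
    refine ContinuousAt.comp (f := fun y : ℝ => (M : ℂ) + y * Complex.I)
      (hφd _ ?_).continuousAt (by fun_prop)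
    rintro ⟨σ, hσ, hσ'⟩
    have h1 := congrArg Complex.re hσ'
    simp at h1
    have h2 := hSN hσ
    have := abs_lt.2 h2
    rw [h1, hM] at this
    exact lt_irrefl _ this
  have hr := hside N (abs_of_pos hN)
  have hl : Continuous fun y : ℝ => φ (-N + y * Complex.I) := by
    have := hside (-N) (by rw [abs_neg, abs_of_pos hN])
    simpa using this
  obtain ⟨C, hC, ε, hε, hb⟩ := exists_strip_bound h.growth' N
  set W : ℝ → ℝ := fun x => (C * (1 + ∑ e ∈ E, |x - e| ^ (-(1 / 2) : ℝ)) + ‖g τ‖) * (2 / |τ.im|)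
    with hW
  have hEae : ∀ᵐ x : ℝ, x ∉ E := by
    have := E.finite_toSet.countable.ae_notMem (volume : Measure ℝ)
    simpa using this
  have hbφ : ∀ x : ℝ, x ∈ Icc (-N) N → x ∉ E → ∀ y : ℝ, 0 < |y| → |y| < min ε (|τ.im| / 2) →
      ‖φ (x + y * Complex.I)‖ ≤ W x := by
    intro x hx hxE y hy hy'
    have h1 : |τ.im| / 2 ≤ ‖(x : ℂ) + y * Complex.I - τ‖ := by
      have h2 := Complex.abs_im_le_norm ((x : ℂ) + y * Complex.I - τ)
      simp at h2
      have h3 := abs_sub_abs_le_abs_sub τ.im y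
      rw [abs_sub_comm] at h3
      have := hy'.trans_le (min_le_right _ _)
      linarith
    have hτ2 : 0 < |τ.im| / 2 := by positivity
    have h2 : (x : ℂ) + y * Complex.I ≠ τ := by
      intro h3
      rw [h3, sub_self, norm_zero] at h1
      linarith
    rw [hφ, dslope_of_ne _ h2, slope_def_field, norm_div, div_eq_mul_inv, hW]
    refine mul_le_mul ?_ ?_ (by positivity) (by positivity)
    · refine (norm_sub_le _ _).trans ?_
      gcongr
      refine (hb x hx y hy (hy'.trans_le (min_le_left _ _))).trans ?_
      gcongr
      exact endWeight_le hxE y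
    · rw [← inv_div]
      exact inv_anti₀ hτ2 h1
  have hWi : IntervalIntegrable W volume (-N) N := by
    rw [intervalIntegrable_iff_integrableOn_Icc_of_le (by linarith)]
    have h1 := (locallyIntegrable_endWeight E).integrableOn_isCompact
      (isCompact_Icc (a := -N) (b := N))
    exact ((h1.const_mul C).add (integrableOn_const (by simp))).mul_const _
  have hεpos : 0 < min ε (|τ.im| / 2) := lt_min hε (by positivity)
  -- boundary values of the difference quotient on the whole base of the square
  set φp : ℝ → ℂ := fun x => ((if x ∈ S then gp x else g x) - g τ) / (x - τ) with hφp
  set φm : ℝ → ℂ := fun x => ((if x ∈ S then gm x else g x) - g τ) / (x - τ) with hφm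
  have hlim : ∀ (l : Filter ℂ) (f : ℝ → ℂ) (x : ℝ), l ≤ 𝓝 (x : ℂ) → x ∉ E →
      (x ∈ S → Tendsto g l (𝓝 (f x))) →
      Tendsto φ l (𝓝 (((if x ∈ S then f x else g x) - g τ) / (x - τ))) := by
    intro l f x hl hxE hf
    have h1 : Tendsto g l (𝓝 (if x ∈ S then f x else g x)) := by
      split_ifs with hxS
      · exact hf hxS
      · have : (x : ℂ) ∉ (fun σ : ℝ => (σ : ℂ)) '' S := by
          rintro ⟨σ, hσ, h⟩
          exact hxS (Complex.ofReal_injective h ▸ hσ)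
        exact (h.diff _ this).continuousAt.mono_left hl
    have h2 : Tendsto (fun z : ℂ => z - τ) l (𝓝 (x - τ)) :=
      ((continuous_id.sub continuous_const).tendsto _).mono_left hl
    refine ((h1.sub_const (g τ)).div h2 (hne x)).congr' ?_
    have h3 : ∀ᶠ z in l, z ≠ τ := by
      have := (h2.eventually_ne (hne x))
      filter_upwards [this] with z hz using sub_ne_zero.1 hz
    filter_upwards [h3] with z hz
    rw [hφ, dslope_of_ne _ hz, slope_def_field]
    rfl
  have hup := upper_half_square (φ := φ) (φp := φp) hN
    (fun z hz => hφd z (notMem_image_of_im_ne_zero S hz.ne')) hr hl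
    (by
      filter_upwards [hEae] with x hx _
      exact (hlim _ gp x (fromAbove_le x) hx (fun hxS => h.plus x hxS hx)).comp
        (tendsto_add_mul_I x)) hWi
    (by
      filter_upwards [Ioo_mem_nhdsGT hεpos] with y hy
      filter_upwards [hEae] with x hx hxN
      refine hbφ x ⟨hxN.1.le, hxN.2⟩ hx y (abs_pos.2 hy.1.ne') ?_
      rw [abs_of_pos hy.1]
      exact hy.2)
  have hWneg : IntervalIntegrable (fun x => W (-x)) volume (-N) N := by
    have := hWi.comp_sub_left 0
    simpa using this.symm
  have hEae' : ∀ᵐ x : ℝ, -x ∉ E := by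
    have := (E.image Neg.neg).finite_toSet.countable.ae_notMem (volume : Measure ℝ)
    filter_upwards [this] with x hx hx'
    exact hx (by simpa using hx')
  -- the lower half of the square is reflected at the origin
  have hdown := upper_half_square (φ := fun z => φ (-z)) (φp := fun x => φm (-x)) hN
    (fun z hz => (hφd (-z) (notMem_image_of_im_ne_zero S (by simpa using hz.ne'))).comp z
      differentiableAt_id.neg)
    (by
      have := hl.comp continuous_neg
      refine this.congr fun y => ?_
      simp only [Function.comp]
      push_cast
      ring_nf)
    (by
      have := hr.comp continuous_neg
      refine this.congr fun y => ?_
      simp only [Function.comp]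
      push_cast
      ring_nf)
    (by
      filter_upwards [hEae'] with x hx _
      have := (hlim _ gm (-x) (fromBelow_le (-x)) hx (fun hxS => h.minus _ hxS hx)).comp
        (tendsto_sub_mul_I (-x))
      refine this.congr fun y => ?_
      simp only [Function.comp]
      push_cast
      ring_nf) hWneg
    (by
      filter_upwards [Ioo_mem_nhdsGT hεpos] with y hy
      filter_upwards [hEae'] with x hx hxN
      have := hbφ (-x) ⟨by linarith [hxN.2], by linarith [hxN.1]⟩ hx (-y)
        (by rw [abs_neg]; exact abs_pos.2 hy.1.ne')
        (by rw [abs_neg, abs_of_pos hy.1]; exact hy.2)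
      refine le_trans (le_of_eq ?_) this
      push_cast
      ring_nf)
  obtain ⟨hip, hup⟩ := hup
  obtain ⟨him, hdown⟩ := hdown
  have him' : IntervalIntegrable φm volume (-N) N := by
    have := him.comp_sub_left 0
    simpa using this.symm
  have hsubset : S ⊆ Ioc (-N) N := hSN.trans Ioo_subset_Ioc_self
  have hdiff : ∀ x, φp x - φm x = S.indicator (fun σ => (gp σ - gm σ) / (σ - τ)) x := by
    intro x
    by_cases hxS : x ∈ S
    · simp [hφp, hφm, hxS, ← sub_div]
    · simp [hφp, hφm, hxS]
  have hint : (∫ σ in S, (gp σ - gm σ) / (σ - τ)) =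
      (∫ x in (-N)..N, φp x) - ∫ x in (-N)..N, φm x := by
    rw [← intervalIntegral.integral_sub hip him', intervalIntegral.integral_of_le (by linarith)]
    simp only [hdiff]
    rw [setIntegral_indicator hS.measurableSet, inter_eq_self_of_subset_right hsubset]
  refine ⟨?_, ?_⟩
  · have h1 := (hip.sub him').1.mono_set hsubset
    refine h1.congr_fun (fun x hx => ?_) hS.measurableSet
    exact (hdiff x).trans (indicator_of_mem hx _)
  · have e1 : (∫ x in (-N)..N, φm (-x)) = ∫ x in (-N)..N, φm x := by
      rw [intervalIntegral.integral_comp_neg, neg_neg]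
    have e2 : (∫ x in (-N)..N, φ (-((x : ℂ) + N * Complex.I))) =
        ∫ x in (-N)..N, φ (x - N * Complex.I) := by
      have := intervalIntegral.integral_comp_neg (a := -N) (b := N)
        (fun x : ℝ => φ (x - N * Complex.I))
      rw [neg_neg] at this
      rw [← this]
      refine intervalIntegral.integral_congr fun x _ => ?_
      push_cast
      ring_nf
    have e3 : ∀ M : ℂ, (∫ y in (0 : ℝ)..N, φ (-(M + y * Complex.I))) =
        ∫ y in (-N)..0, φ (-M + y * Complex.I) := by
      intro M
      have := intervalIntegral.integral_comp_neg (a := 0) (b := N)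
        (fun y : ℝ => φ (-M + y * Complex.I))
      rw [neg_zero] at this
      rw [← this]
      refine intervalIntegral.integral_congr fun x _ => ?_
      push_cast
      ring_nf
    rw [e1, e2, e3, e3, neg_neg] at hdown
    rw [hint, ← intervalIntegral.integral_add_adjacent_intervals
      (hr.intervalIntegrable (-N) 0) (hr.intervalIntegrable 0 N),
      ← intervalIntegral.integral_add_adjacent_intervals
      (hl.intervalIntegrable (-N) 0) (hl.intervalIntegrable 0 N)]
    linear_combination hup - hdown

/-- Each of the four sides contributes a quarter of `2πi (g₀ - g τ)` in the limit, and the sides are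
carried into one another by rotations through a right angle. -/
theorem tendsto_square (h : IsSectHolo S E g g₀ gp gm) (hS : IsCompact S) (τ : ℂ) :
    Tendsto (fun N : ℝ => (∫ x in (-N)..N, dslope g τ (x - N * Complex.I)) -
        (∫ x in (-N)..N, dslope g τ (x + N * Complex.I)) +
        Complex.I * (∫ y in (-N)..N, dslope g τ (N + y * Complex.I)) -
        Complex.I * (∫ y in (-N)..N, dslope g τ (-N + y * Complex.I))) atTop
      (𝓝 ((g₀ - g τ) * (2 * Real.pi * Complex.I))) := by
  obtain ⟨R, hR0, hR⟩ := hS.isBounded.exists_pos_norm_le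
  have hc : ContinuousOn g {z | R < ‖z‖} := by
    intro z hz
    refine (h.diff z ?_).continuousAt.continuousWithinAt
    rintro ⟨σ, hσ, rfl⟩
    have := hR σ hσ
    simp only [mem_ofPred_eq, Complex.norm_real] at hz
    linarith
  have h1 := tendsto_side (τ := τ) (c := g τ) (ω := 1) (by simp) hc h.inf
  have h2 := tendsto_side (τ := τ) (c := g τ) (ω := -1) (by simp) hc h.inf
  have h3 := tendsto_side (τ := τ) (c := g τ) (ω := Complex.I) (by simp) hc h.inf
  have h4 := tendsto_side (τ := τ) (c := g τ) (ω := -Complex.I) (by simp) hc h.inf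
  have h5 := ((h1.add h2).add h3).add h4
  have e : (g₀ - g τ) * (2 * Real.pi * Complex.I) = (g₀ - g τ) * (Complex.I * (Real.pi / 2)) +
      (g₀ - g τ) * (Complex.I * (Real.pi / 2)) + (g₀ - g τ) * (Complex.I * (Real.pi / 2)) +
      (g₀ - g τ) * (Complex.I * (Real.pi / 2)) := by ring
  rw [e]
  refine h5.congr' ?_
  filter_upwards [eventually_gt_atTop ‖τ‖] with N hN
  have hN0 : 0 < N := (norm_nonneg _).trans_lt hN
  have hds : ∀ z : ℂ, N ≤ ‖z‖ → (g z - g τ) / (z - τ) = dslope g τ z := by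
    intro z hz
    rw [dslope_of_ne, slope_def_field]
    rintro rfl
    linarith
  have key : ∀ ω : ℂ, ‖ω‖ = 1 → (∫ x in (-N)..N,
      (g (ω * (x - N * Complex.I)) - g τ) / (ω * (x - N * Complex.I) - τ)) =
      ∫ x in (-N)..N, dslope g τ (ω * (x - N * Complex.I)) := by
    intro ω hω
    refine intervalIntegral.integral_congr fun x _ => hds _ ?_
    rw [norm_mul, hω, one_mul]
    have := Complex.abs_im_le_norm ((x : ℂ) - N * Complex.I)
    simpa [abs_of_pos hN0] using this
  rw [key 1 (by simp), key (-1) (by simp), key Complex.I (by simp), key (-Complex.I) (by simp)]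
  have e2 : (∫ x in (-N)..N, dslope g τ (-1 * ((x : ℂ) - N * Complex.I))) =
      ∫ x in (-N)..N, dslope g τ (x + N * Complex.I) := by
    have := intervalIntegral.integral_comp_neg (a := -N) (b := N)
      (fun x : ℝ => dslope g τ (x + N * Complex.I))
    rw [neg_neg] at this
    rw [← this]
    refine intervalIntegral.integral_congr fun x _ => ?_
    push_cast
    ring_nf
  have e3 : (∫ x in (-N)..N, dslope g τ (Complex.I * ((x : ℂ) - N * Complex.I))) =
      ∫ x in (-N)..N, dslope g τ (N + x * Complex.I) := by
    refine intervalIntegral.integral_congr fun x _ => ?_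
    have : Complex.I * ((x : ℂ) - N * Complex.I) = N + x * Complex.I := by
      linear_combination (-(N : ℂ)) * Complex.I_sq
    simp only [this]
  have e4 : (∫ x in (-N)..N, dslope g τ (-Complex.I * ((x : ℂ) - N * Complex.I))) =
      ∫ x in (-N)..N, dslope g τ (-N + x * Complex.I) := by
    have := intervalIntegral.integral_comp_neg (a := -N) (b := N)
      (fun x : ℝ => dslope g τ (-N + x * Complex.I))
    rw [neg_neg] at this
    rw [← this]
    refine intervalIntegral.integral_congr fun x _ => ?_
    have : -Complex.I * ((x : ℂ) - N * Complex.I) = -N + ((-x : ℝ) : ℂ) * Complex.I := by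
      push_cast
      linear_combination (N : ℂ) * Complex.I_sq
    simp only [this]
  rw [e2, e3, e4]
  simp only [one_mul]
  ring

theorem integrableOn_jump (h : IsSectHolo S E g g₀ gp gm) (hS : IsCompact S) :
    IntegrableOn (fun σ => gp σ - gm σ) S := by
  obtain ⟨R, hR0, hR⟩ := hS.isBounded.exists_pos_norm_lt
  have h1 := (h.square_identity hS (τ := Complex.I) (by simp) hR0
    (fun σ hσ => abs_lt.1 (hR σ hσ))).1
  have h2 := h1.mul_continuousOn (g' := fun σ : ℝ => (σ : ℂ) - Complex.I) (by fun_prop) hS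
  refine h2.congr_fun (fun σ _ => ?_) hS.measurableSet
  have : (σ : ℂ) - Complex.I ≠ 0 := fun h0 => by simpa using congrArg Complex.im h0
  exact div_mul_cancel₀ _ this

/-- A sectionally holomorphic function is the sum of its value at infinity and the Cauchy integral
of its jump. -/
theorem eq_cauchyInt (h : IsSectHolo S E g g₀ gp gm) (hS : IsCompact S) {τ : ℂ}
    (hτ : τ ∉ (fun σ : ℝ => (σ : ℂ)) '' S) :
    g τ = g₀ + 1 / (2 * Real.pi * Complex.I) * cauchyInt S (fun σ => gp σ - gm σ) τ := by
  have hpi : (2 * Real.pi * Complex.I : ℂ) ≠ 0 := Complex.two_pi_I_ne_zero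
  have main : ∀ τ : ℂ, τ.im ≠ 0 →
      g τ = g₀ + 1 / (2 * Real.pi * Complex.I) * cauchyInt S (fun σ => gp σ - gm σ) τ := by
    intro τ hτ
    obtain ⟨R, hR0, hR⟩ := hS.isBounded.exists_pos_norm_lt
    have h1 := h.tendsto_square hS τ
    have h2 : cauchyInt S (fun σ => gp σ - gm σ) τ
        + (g₀ - g τ) * (2 * Real.pi * Complex.I) = 0 := by
      refine tendsto_nhds_unique (h1.const_add _) (tendsto_const_nhds.congr' ?_)
      filter_upwards [eventually_ge_atTop R] with N hN
      exact ((h.square_identity hS hτ (hR0.trans_le hN)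
        (fun σ hσ => abs_lt.1 ((hR σ hσ).trans_le hN))).2).symm
    field_simp
    linear_combination -h2
  -- at a real point off `S` both sides are continuous
  by_cases him : τ.im = 0
  · have hre : ((τ.re : ℝ) : ℂ) = τ := by
      apply Complex.ext <;> simp [him]
    have hτ' := hτ
    rw [← hre] at hτ' ⊢
    have hc := (h.diff _ hτ').continuousAt.mono_left (fromAbove_le τ.re)
    have hc2 := ((differentiableAt_cauchyInt hS (h.integrableOn_jump hS) hτ').continuousAt.mono_left
      (fromAbove_le τ.re)).const_mul (1 / (2 * Real.pi * Complex.I)) |>.const_add g₀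
    refine tendsto_nhds_unique hc (hc2.congr' ?_)
    filter_upwards [eventually_im_pos τ.re] with z hz
    exact (main z hz.ne').symm
  · exact main τ him

/-- A sectionally holomorphic function without jump is constant. -/
theorem eq_const (h : IsSectHolo S E g g₀ gp gm) (hS : IsCompact S)
    (hj : ∀ σ ∈ S, σ ∉ E → gp σ = gm σ) {τ : ℂ} (hτ : τ ∉ (fun σ : ℝ => (σ : ℂ)) '' S) :
    g τ = g₀ := by
  rw [h.eq_cauchyInt hS hτ, cauchyInt, setIntegral_congr_ae (g := fun _ => (0 : ℂ))
    hS.measurableSet, integral_zero, mul_zero, add_zero]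
  have := E.finite_toSet.countable.ae_notMem (volume : Measure ℝ)
  filter_upwards [this] with σ hσ hσS
  rw [hj σ hσS (by simpa using hσ), sub_self, zero_div]

end IsSectHolo

/-! ### Principal value integrals -/

namespace HasPVIntegral

variable {E : Type*} [NormedAddCommGroup E] [NormedSpace ℝ E] {S P : Set ℝ} {f g : ℝ → E} {L L' : E}

theorem unique (h : HasPVIntegral S P f L) (h' : HasPVIntegral S P f L') : L = L' :=
  tendsto_nhds_unique h.2 h'.2

theorem congr (h : HasPVIntegral S P f L) (hS : MeasurableSet S)
    (hfg : ∀ x ∈ S, x ∉ P → f x = g x) : HasPVIntegral S P g L := by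
  have key : ∀ ε : ℝ, 0 < ε → EqOn f g (S \ Metric.thickening ε P) := fun ε hε x hx =>
    hfg x hx.1 fun hxP => hx.2 (Metric.self_subset_thickening hε _ hxP)
  have hm : ∀ ε : ℝ, MeasurableSet (S \ Metric.thickening ε P) := fun ε =>
    hS.diff Metric.isOpen_thickening.measurableSet
  refine ⟨fun ε hε => (h.1 ε hε).congr_fun (key ε hε) (hm ε), h.2.congr' ?_⟩
  filter_upwards [self_mem_nhdsWithin] with ε hε
  exact setIntegral_congr_fun (hm ε) (key ε hε)

theorem add (h : HasPVIntegral S P f L) (h' : HasPVIntegral S P g L') :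
    HasPVIntegral S P (fun x => f x + g x) (L + L') := by
  refine ⟨fun ε hε => (h.1 ε hε).add (h'.1 ε hε), (h.2.add h'.2).congr' ?_⟩
  filter_upwards [self_mem_nhdsWithin] with ε hε
  exact (integral_add (h.1 ε hε) (h'.1 ε hε)).symm

theorem clm {F : Type*} [NormedAddCommGroup F] [NormedSpace ℝ F] [CompleteSpace E] [CompleteSpace F]
    (h : HasPVIntegral S P f L) (T : E →L[ℝ] F) :
    HasPVIntegral S P (fun x => T (f x)) (T L) := by
  refine ⟨fun ε hε => T.integrable_comp (h.1 ε hε), ((T.continuous.tendsto L).comp h.2).congr' ?_⟩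
  filter_upwards [self_mem_nhdsWithin] with ε hε
  exact (T.integral_comp_comm (h.1 ε hε)).symm

theorem const_mul {f : ℝ → ℂ} {L : ℂ} (h : HasPVIntegral S P f L) (c : ℂ) :
    HasPVIntegral S P (fun x => c * f x) (c * L) :=
  h.clm ((ContinuousLinearMap.mul ℂ ℂ c).restrictScalars ℝ)

theorem of_integrableOn (hP : P.Finite) (hf : IntegrableOn f S) :
    HasPVIntegral S P f (∫ x in S, f x) := by
  refine ⟨fun ε hε => hf.mono_set sdiff_subset, ?_⟩
  have hTm : ∀ ε : ℝ, MeasurableSet (Metric.thickening ε P)ᶜ := fun ε =>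
    Metric.isOpen_thickening.measurableSet.compl
  have key : ∀ ε : ℝ, ∫ x in S \ Metric.thickening ε P, f x =
      ∫ x in S, (Metric.thickening ε P)ᶜ.indicator f x := fun ε => by
    rw [setIntegral_indicator (hTm ε), sdiff_eq]
  simp only [key]
  refine tendsto_integral_filter_of_dominated_convergence (fun x => ‖f x‖) ?_ ?_ hf.norm ?_
  · exact Eventually.of_forall fun ε => hf.aestronglyMeasurable.indicator (hTm ε)
  · exact Eventually.of_forall fun ε => ae_of_all _ fun x => norm_indicator_le_norm_self _ _
  · have h0 : ∀ᵐ x ∂(volume.restrict S), x ∉ P :=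
      ae_restrict_of_ae (hP.countable.ae_notMem (volume : Measure ℝ))
    filter_upwards [h0] with x hx
    have : ∃ δ > 0, x ∉ Metric.thickening δ P := by
      rw [← hP.isClosed.closure_eq, Metric.closure_eq_iInter_thickening] at hx
      simpa using hx
    obtain ⟨δ, hδ, hx'⟩ := this
    refine tendsto_const_nhds.congr' ?_
    filter_upwards [Ioo_mem_nhdsGT hδ] with ε hε
    rw [indicator_of_mem]
    exact fun h => hx' (Metric.thickening_mono hε.2.le P h)

/-- A further exceptional point, at which the integrand is integrable, does not matter. -/
theorem pair {σ σ' : ℝ} (h : HasPVIntegral S {σ} f L) (hS : MeasurableSet S) (hne : σ' ≠ σ) :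
    HasPVIntegral S {σ, σ'} f L := by
  have hT : ∀ ε : ℝ, Metric.thickening ε {σ, σ'} = Metric.ball σ ε ∪ Metric.ball σ' ε := fun ε => by
    rw [insert_eq, Metric.thickening_union, Metric.thickening_singleton,
      Metric.thickening_singleton]
  refine ⟨fun ε hε => (h.1 ε hε).mono_set (sdiff_subset_sdiff_right
    (Metric.thickening_subset_of_subset _ (by simp))), ?_⟩
  set ε₀ := |σ' - σ| / 2 with hε₀
  have hε₀pos : 0 < ε₀ := by
    have := abs_pos.2 (sub_ne_zero.2 hne)
    positivity
  set A := S \ Metric.thickening ε₀ {σ} with hA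
  have hAm : MeasurableSet A := hS.diff Metric.isOpen_thickening.measurableSet
  have hAi := h.1 ε₀ hε₀pos
  have h2 := (of_integrableOn (finite_singleton σ') hAi).2
  have h3 := (h.2.sub (tendsto_const_nhds (x := ∫ x in A, f x))).add h2
  rw [sub_add_cancel] at h3
  refine h3.congr' ?_
  filter_upwards [Ioo_mem_nhdsGT hε₀pos] with ε hε
  have hdisj : ∀ x ∈ Metric.ball σ' ε, x ∉ Metric.ball σ ε₀ := by
    intro x hx hx'
    rw [Metric.mem_ball, Real.dist_eq] at hx hx'
    have := abs_sub_le σ' x σ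
    rw [abs_sub_comm σ' x] at this
    linarith [hε.2]
  have e1 : S \ Metric.thickening ε {σ} =
      (S \ Metric.thickening ε {σ, σ'}) ∪ (A ∩ Metric.ball σ' ε) := by
    ext x
    rw [hT, hA, Metric.thickening_singleton, Metric.thickening_singleton]
    have h4 := hdisj x
    have h5 : x ∈ Metric.ball σ ε → x ∈ Metric.ball σ ε₀ := fun h =>
      Metric.ball_subset_ball hε.2.le h
    simp only [Set.mem_sdiff, mem_union, mem_inter_iff]
    tauto
  have e2 : A = (A \ Metric.thickening ε {σ'}) ∪ (A ∩ Metric.ball σ' ε) := by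
    rw [Metric.thickening_singleton, sdiff_union_inter]
  have hi1 : IntegrableOn f (S \ Metric.thickening ε {σ}) := h.1 ε hε.1
  have hd1 : Disjoint (S \ Metric.thickening ε {σ, σ'}) (A ∩ Metric.ball σ' ε) := by
    rw [hT]
    exact disjoint_left.2 fun x hx hx' => hx.2 (Or.inr hx'.2)
  have hd2 : Disjoint (A \ Metric.thickening ε {σ'}) (A ∩ Metric.ball σ' ε) := by
    rw [Metric.thickening_singleton]
    exact disjoint_left.2 fun x hx hx' => hx.2 hx'.2
  have hBm : MeasurableSet (A ∩ Metric.ball σ' ε) := hAm.inter Metric.isOpen_ball.measurableSet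
  have i1 : ∫ x in S \ Metric.thickening ε {σ}, f x = (∫ x in S \ Metric.thickening ε {σ, σ'}, f x)
      + ∫ x in A ∩ Metric.ball σ' ε, f x := by
    conv_lhs => rw [e1]
    rw [e1] at hi1
    exact setIntegral_union hd1 hBm hi1.left_of_union hi1.right_of_union
  have i2 : ∫ x in A, f x = (∫ x in A \ Metric.thickening ε {σ'}, f x)
      + ∫ x in A ∩ Metric.ball σ' ε, f x := by
    conv_lhs => rw [e2]
    exact setIntegral_union hd2 hBm (hAi.mono_set sdiff_subset) (hAi.mono_set inter_subset_left)
  rw [i1, i2]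
  abel

end HasPVIntegral

theorem hasPVIntegral_inv_sub (σ ρ : ℝ) {S : Set ℝ}
    (hI : Ioo (σ - ρ) (σ + ρ) ⊆ S) :
    HasPVIntegral S {σ} (fun x => (Ioo (σ - ρ) (σ + ρ)).indicator
      (fun x => 1 / ((x : ℂ) - σ)) x) 0 := by
  have hm : ∀ ε : ℝ, MeasurableSet (Ioo (σ - ρ) (σ + ρ) \ Metric.ball σ ε) := fun ε =>
    measurableSet_Ioo.diff Metric.isOpen_ball.measurableSet
  have e : ∀ ε : ℝ, S \ Metric.thickening ε {σ} ∩ Ioo (σ - ρ) (σ + ρ) =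
      Ioo (σ - ρ) (σ + ρ) \ Metric.ball σ ε := by
    intro ε
    rw [Metric.thickening_singleton]
    ext x
    have := @hI x
    simp only [Set.mem_sdiff, mem_inter_iff]
    tauto
  have hz : ∀ ε : ℝ, ∫ x in S \ Metric.thickening ε {σ}, (Ioo (σ - ρ) (σ + ρ)).indicator
      (fun x => 1 / ((x : ℂ) - σ)) x = 0 := by
    intro ε
    rw [setIntegral_indicator measurableSet_Ioo, e]
    have h1 := (Measure.measurePreserving_sub_left volume (2 * σ)).setIntegral_preimage_emb
      (MeasurableEquiv.subLeft (2 * σ)).measurableEmbedding (fun x : ℝ => 1 / ((x : ℂ) - σ))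
      (Ioo (σ - ρ) (σ + ρ) \ Metric.ball σ ε)
    have h2 : (fun x => 2 * σ - x) ⁻¹' (Ioo (σ - ρ) (σ + ρ) \ Metric.ball σ ε) =
        Ioo (σ - ρ) (σ + ρ) \ Metric.ball σ ε := by
      ext x
      simp only [mem_preimage, Set.mem_sdiff, mem_Ioo, Metric.mem_ball, Real.dist_eq]
      have : |2 * σ - x - σ| = |x - σ| := by rw [← abs_neg]; ring_nf
      rw [this]
      refine and_congr_left fun _ => ⟨fun h => ⟨?_, ?_⟩, fun h => ⟨?_, ?_⟩⟩ <;> linarith [h.1, h.2]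
    rw [h2] at h1
    have h3 : ∀ x : ℝ, 1 / (((2 * σ - x : ℝ) : ℂ) - σ) = -(1 / ((x : ℂ) - σ)) := by
      intro x
      rw [← div_neg]
      push_cast
      ring_nf
    simp only [h3] at h1
    rw [integral_neg] at h1
    linear_combination (1 / 2 : ℂ) * (-h1)
  refine ⟨fun ε hε => ?_, by simp only [hz, tendsto_const_nhds]⟩
  rw [integrableOn_indicator_iff measurableSet_Ioo, inter_comm, e]
  refine Integrable.mono' (g := fun _ => 1 / ε) (integrableOn_const
    ((measure_mono sdiff_subset).trans_lt (by simp)).ne)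
    (measurable_const.div (by fun_prop)).aestronglyMeasurable
    ((ae_restrict_iff' (hm ε)).2 (ae_of_all _ fun x hx => ?_))
  have h1 : ε ≤ |x - σ| := by
    have := hx.2
    rw [Metric.mem_ball, Real.dist_eq] at this
    exact not_lt.1 this
  rw [norm_div, norm_one, ← Complex.ofReal_sub, Complex.norm_real]
  exact one_div_le_one_div_of_le hε h1

/-! ### The Sokhotski–Plemelj formulas -/

theorem tendsto_arctan_div_right {ρ : ℝ} (hρ : 0 < ρ) :
    Tendsto (fun y : ℝ => Real.arctan (ρ / y)) (𝓝[>] 0) (𝓝 (Real.pi / 2)) :=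
  (Real.tendsto_arctan_atTop.mono_right nhdsWithin_le_nhds).comp
    (tendsto_inv_nhdsGT_zero.const_mul_atTop hρ)

theorem tendsto_arctan_div_left {ρ : ℝ} (hρ : 0 < ρ) :
    Tendsto (fun y : ℝ => Real.arctan (ρ / y)) (𝓝[<] 0) (𝓝 (-(Real.pi / 2))) :=
  (Real.tendsto_arctan_atBot.mono_right nhdsWithin_le_nhds).comp
    (tendsto_inv_nhdsLT_zero.const_mul_atBot hρ)

/-- The Sokhotski–Plemelj formulas at a point near which the density obeys a Hölder condition. -/
theorem plemelj {S : Set ℝ} (hS : IsCompact S) {f : ℝ → ℂ} (hf : IntegrableOn f S) {σ ρ C γ : ℝ}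
    (hρ : 0 < ρ) (hI : Ioo (σ - 2 * ρ) (σ + 2 * ρ) ⊆ S) (hγ : 0 < γ)
    (hC : ∀ x ∈ Ioo (σ - 2 * ρ) (σ + 2 * ρ), ∀ y ∈ Ioo (σ - 2 * ρ) (σ + 2 * ρ),
      ‖f x - f y‖ ≤ C * |x - y| ^ γ) :
    ∃ L : ℂ, HasPVIntegral S {σ} (fun x => f x / (x - σ)) L ∧
      Tendsto (cauchyInt S f) (fromAbove σ) (𝓝 (L + Real.pi * Complex.I * f σ)) ∧
      Tendsto (cauchyInt S f) (fromBelow σ) (𝓝 (L - Real.pi * Complex.I * f σ)) := by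
  have hC0 : 0 ≤ C := by
    have h1 := hC σ ⟨by linarith, by linarith⟩ (σ + ρ) ⟨by linarith, by linarith⟩
    have h2 : |σ - (σ + ρ)| = ρ := by rw [sub_add_cancel_left, abs_neg, abs_of_pos hρ]
    rw [h2] at h1
    have h3 : 0 < ρ ^ γ := by positivity
    by_contra! h4
    have := mul_neg_of_neg_of_pos h4 h3
    linarith [norm_nonneg (f σ - f (σ + ρ))]
  -- the quotients that occur in the part of the integral near `σ` have an integrable majorant
  have hquot : ∀ t ∈ Ioo (σ - ρ) (σ + ρ), ∀ s ∈ Ioo (-ρ) ρ, ∀ y : ℝ, s ≠ 0 →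
      ‖(f (t + s) - f t) / ((s : ℂ) - y * Complex.I)‖ ≤ C * |s - 0| ^ (γ - 1) := by
    intro t ht s hs y hs0
    have h1 := hC (t + s) ⟨by linarith [ht.1, hs.1], by linarith [ht.2, hs.2]⟩ t
      ⟨by linarith [ht.1], by linarith [ht.2]⟩
    rw [add_sub_cancel_left] at h1
    have h2 : |s| ≤ ‖(s : ℂ) - y * Complex.I‖ := by
      have := Complex.abs_re_le_norm ((s : ℂ) - y * Complex.I)
      simpa using this
    have h3 : 0 < |s| := abs_pos.2 hs0
    rw [norm_div, sub_zero, Real.rpow_sub_one h3.ne', ← mul_div_assoc]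
    gcongr
  have hmaj : IntegrableOn (fun s : ℝ => C * |s - 0| ^ (γ - 1)) (Ioo (-ρ) ρ) :=
    ((integrableOn_abs_rpow (by linarith) 0 isCompact_Icc).mono_set Ioo_subset_Icc_self).const_mul C
  have hae0 : ∀ᵐ s : ℝ ∂(volume.restrict (Ioo (-ρ) ρ)), s ∈ Ioo (-ρ) ρ ∧ s ≠ 0 := by
    have h0 : ∀ᵐ s : ℝ ∂(volume.restrict (Ioo (-ρ) ρ)), s ≠ 0 :=
      ae_restrict_of_ae (Measure.ae_ne volume 0)
    filter_upwards [h0, ae_restrict_mem measurableSet_Ioo] with s h1 h2 using ⟨h2, h1⟩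
  have hcontf : ∀ t ∈ Ioo (σ - 2 * ρ) (σ + 2 * ρ), ContinuousAt f t := by
    intro t ht
    have h1 : Tendsto (fun x => C * |x - t| ^ γ) (𝓝 t) (𝓝 0) := by
      have : Continuous fun x : ℝ => C * |x - t| ^ γ :=
        continuous_const.mul ((continuous_id.sub continuous_const).abs.rpow_const
          fun _ => Or.inr hγ.le)
      simpa [Real.zero_rpow hγ.ne'] using this.tendsto t
    rw [ContinuousAt, tendsto_iff_norm_sub_tendsto_zero]
    refine squeeze_zero' (Eventually.of_forall fun _ => norm_nonneg _) ?_ h1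
    filter_upwards [isOpen_Ioo.mem_nhds ht] with x hx using hC x hx t ht
  -- translation of an integral over an interval of length `2ρ`
  have htrans : ∀ (t : ℝ) (g : ℝ → ℂ), ∫ s in Ioo (-ρ) ρ, g (t + s) =
      ∫ x in Ioo (t - ρ) (t + ρ), g x := by
    intro t g
    have := (measurePreserving_add_left volume t).setIntegral_preimage_emb
      (MeasurableEquiv.addLeft t).measurableEmbedding g (Ioo (t - ρ) (t + ρ))
    rw [← this]
    simp
  have htransi : ∀ (t : ℝ) (g : ℝ → ℂ), IntegrableOn g (Ioo (t - ρ) (t + ρ)) →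
      IntegrableOn (fun s => g (t + s)) (Ioo (-ρ) ρ) := by
    intro t g hg
    have := ((measurePreserving_add_left volume t).integrableOn_comp_preimage
      (MeasurableEquiv.addLeft t).measurableEmbedding (f := g) (s := Ioo (t - ρ) (t + ρ))).2 hg
    simpa [Function.comp_def] using this
  set far : ℂ → ℂ := fun τ => ∫ x in S, (Ioo (τ.re - ρ) (τ.re + ρ))ᶜ.indicator
    (fun x : ℝ => f x / (x - τ)) x with hfar
  set near : ℂ → ℂ := fun τ => ∫ s in Ioo (-ρ) ρ,
    (f (τ.re + s) - f τ.re) / ((s : ℂ) - τ.im * Complex.I) with hnear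
  have hsub : ∀ t ∈ Ioo (σ - ρ) (σ + ρ), Ioo (t - ρ) (t + ρ) ⊆ S := by
    intro t ht x hx
    exact hI ⟨by linarith [ht.1, hx.1], by linarith [ht.2, hx.2]⟩
  have hsplit : ∀ τ : ℂ, τ.im ≠ 0 → τ.re ∈ Ioo (σ - ρ) (σ + ρ) → cauchyInt S f τ =
      far τ + near τ + f τ.re * (2 * Complex.I * Real.arctan (ρ / τ.im)) := by
    intro τ hτ hre
    have hi := integrableOn_div_sub hS hf (notMem_image_of_im_ne_zero S hτ)
    have h1 : cauchyInt S f τ = far τ + ∫ x in Ioo (τ.re - ρ) (τ.re + ρ), f x / (x - τ) := by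
      rw [cauchyInt, hfar]
      simp only
      rw [setIntegral_indicator measurableSet_Ioo.compl, add_comm, ← sdiff_eq,
        ← inter_eq_self_of_subset_right (hsub _ hre)]
      rw [inter_eq_self_of_subset_right (hsub _ hre)]
      have h3 := integral_inter_add_sdiff (s := S) (t := Ioo (τ.re - ρ) (τ.re + ρ))
        measurableSet_Ioo hi
      rw [inter_eq_self_of_subset_right (hsub _ hre)] at h3
      exact h3.symm
    have h2 : ∀ s : ℝ, (((τ.re + s : ℝ)) : ℂ) - τ = s - τ.im * Complex.I := by
      intro s
      apply Complex.ext <;> simp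
    have hne : ∀ s : ℝ, (s : ℂ) - τ.im * Complex.I ≠ 0 := fun s h =>
      hτ (by simpa using congrArg Complex.im h)
    rw [h1, ← htrans, add_assoc]
    congr 1
    simp only [h2]
    have h3 : ∫ s in Ioo (-ρ) ρ, f τ.re * ((s : ℂ) - τ.im * Complex.I)⁻¹ =
        f τ.re * (2 * Complex.I * Real.arctan (ρ / τ.im)) := by
      rw [← integral_inv_sub_mul_I ρ hτ, integral_const_mul,
        intervalIntegral.integral_of_le (by linarith), integral_Ioc_eq_integral_Ioo]
    have hinv : IntegrableOn (fun s : ℝ => f τ.re * ((s : ℂ) - τ.im * Complex.I)⁻¹) (Ioo (-ρ) ρ) := by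
      have : Continuous fun s : ℝ => f τ.re * ((s : ℂ) - τ.im * Complex.I)⁻¹ :=
        continuous_const.mul (Continuous.inv₀ (by fun_prop) hne)
      exact this.integrableOn_Icc.mono_set Ioo_subset_Icc_self
    have hall := htransi τ.re _ (hi.mono_set (hsub _ hre))
    simp only [h2] at hall
    rw [← h3, hnear]
    simp only
    rw [← integral_add _ hinv]
    · refine integral_congr_ae (ae_of_all _ fun s => ?_)
      simp only
      rw [sub_div, ← div_eq_mul_inv]
      ring
    · refine (hall.sub hinv).congr (ae_of_all _ fun s => ?_)
      simp only [Pi.sub_apply]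
      rw [sub_div, ← div_eq_mul_inv]
  have hre_tendsto : ∀ᶠ τ : ℂ in 𝓝 (σ : ℂ), τ.re ∈ Ioo (σ - ρ) (σ + ρ) :=
    Complex.continuous_re.continuousAt.eventually (isOpen_Ioo.mem_nhds
      ⟨by simp; linarith, by simp; linarith⟩)
  have hfar_lim : Tendsto far (𝓝 (σ : ℂ)) (𝓝 (far σ)) := by
    refine tendsto_integral_filter_of_dominated_convergence (fun x => ‖f x‖ / ρ) ?_ ?_
      (hf.norm.div_const _) ?_
    · refine Eventually.of_forall fun τ => AEStronglyMeasurable.indicator ?_ measurableSet_Ioo.compl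
      exact hf.aestronglyMeasurable.div₀ (by fun_prop)
    · refine Eventually.of_forall fun τ => ae_of_all _ fun x => ?_
      by_cases hx : x ∈ (Ioo (τ.re - ρ) (τ.re + ρ))ᶜ
      · rw [indicator_of_mem hx, norm_div]
        have h1 : ρ ≤ |x - τ.re| := by
          by_contra! h
          rw [abs_lt] at h
          exact hx ⟨by linarith, by linarith⟩
        have h2 := Complex.abs_re_le_norm ((x : ℂ) - τ)
        simp only [Complex.sub_re, Complex.ofReal_re] at h2
        gcongr
        linarith
      · rw [indicator_of_notMem hx, norm_zero]
        positivity
    · have h0 : ∀ c : ℝ, ∀ᵐ x ∂(volume.restrict S), x ≠ c := fun c =>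
        ae_restrict_of_ae (Measure.ae_ne volume c)
      filter_upwards [h0 (σ - ρ), h0 (σ + ρ)] with x hx1 hx2
      have hre : Tendsto (fun τ : ℂ => τ.re) (𝓝 (σ : ℂ)) (𝓝 σ) := by
        simpa using Complex.continuous_re.tendsto (σ : ℂ)
      by_cases hx : x ∈ Ioo (σ - ρ) (σ + ρ)
      · have : ∀ᶠ τ : ℂ in 𝓝 (σ : ℂ), x ∈ Ioo (τ.re - ρ) (τ.re + ρ) := by
          filter_upwards [hre.eventually (gt_mem_nhds (show σ < x + ρ by linarith [hx.1])),
            hre.eventually (lt_mem_nhds (show x - ρ < σ by linarith [hx.2]))] with τ h1 h2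
          exact ⟨by linarith, by linarith⟩
        refine tendsto_nhds_of_eventually_eq ?_
        filter_upwards [this] with τ hτ
        rw [indicator_of_notMem (by simpa using hτ), indicator_of_notMem (by simpa using hx)]
      · have hxne : x < σ - ρ ∨ σ + ρ < x := by
          by_contra! h
          exact hx ⟨lt_of_le_of_ne h.1 (Ne.symm hx1), lt_of_le_of_ne h.2 hx2⟩
        have : ∀ᶠ τ : ℂ in 𝓝 (σ : ℂ), x ∉ Ioo (τ.re - ρ) (τ.re + ρ) := by
          rcases hxne with h | h
          · filter_upwards [hre.eventually (lt_mem_nhds (show x + ρ < σ by linarith))] with τ h1 h2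
            linarith [h2.1]
          · filter_upwards [hre.eventually (gt_mem_nhds (show σ < x - ρ by linarith))] with τ h1 h2
            linarith [h2.2]
        have hxσ : (x : ℂ) - σ ≠ 0 := by
          rw [sub_ne_zero]
          intro h
          have := Complex.ofReal_injective h
          rcases hxne with h | h <;> linarith
        rw [indicator_of_mem (by simpa using hx)]
        have h3 : Tendsto (fun τ : ℂ => f x / (x - τ)) (𝓝 (σ : ℂ)) (𝓝 (f x / (x - σ))) :=
          tendsto_const_nhds.div ((continuous_const.sub continuous_id).tendsto _) hxσ
        refine h3.congr' ?_
        filter_upwards [this] with τ hτ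
        rw [indicator_of_mem hτ]
  have hnear_meas : ∀ τ : ℂ, τ.re ∈ Ioo (σ - ρ) (σ + ρ) → AEStronglyMeasurable
      (fun s : ℝ => (f (τ.re + s) - f τ.re) / ((s : ℂ) - τ.im * Complex.I))
      (volume.restrict (Ioo (-ρ) ρ)) := by
    intro τ hτ
    have h1 := (htransi τ.re f (hf.mono_set (hsub _ hτ))).aestronglyMeasurable
    exact (h1.sub aestronglyMeasurable_const).div₀ (by fun_prop)
  have hnear_lim : Tendsto near (𝓝 (σ : ℂ)) (𝓝 (near σ)) := by
    refine tendsto_integral_filter_of_dominated_convergence (fun s => C * |s - 0| ^ (γ - 1)) ?_ ?_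
      hmaj ?_
    · filter_upwards [hre_tendsto] with τ hτ using hnear_meas τ hτ
    · filter_upwards [hre_tendsto] with τ hτ
      filter_upwards [hae0] with s hs
      exact hquot _ hτ s hs.1 _ hs.2
    · filter_upwards [hae0] with s hs
      have hre : Tendsto (fun τ : ℂ => τ.re) (𝓝 (σ : ℂ)) (𝓝 (σ : ℂ).re) :=
        Complex.continuous_re.tendsto (σ : ℂ)
      have him : Tendsto (fun τ : ℂ => (s : ℂ) - τ.im * Complex.I) (𝓝 (σ : ℂ))
          (𝓝 ((s : ℂ) - (σ : ℂ).im * Complex.I)) := by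
        have : Continuous fun τ : ℂ => (s : ℂ) - τ.im * Complex.I := by fun_prop
        exact this.tendsto _
      refine Tendsto.div ?_ him (by simpa using hs.2)
      have c1 := hcontf σ ⟨by linarith, by linarith⟩
      have c2 := hcontf (σ + s) ⟨by linarith [hs.1.1], by linarith [hs.1.2]⟩
      refine Tendsto.sub ?_ ?_
      · exact (show Tendsto f (𝓝 ((σ : ℂ).re + s)) (𝓝 (f ((σ : ℂ).re + s))) by
          simpa using c2.tendsto).comp (hre.add_const s)
      · exact (show Tendsto f (𝓝 ((σ : ℂ).re)) (𝓝 (f ((σ : ℂ).re))) by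
          simpa using c1.tendsto).comp hre
  have hside : ∀ (l : Filter ℂ) (c : ℝ), l ≤ 𝓝 (σ : ℂ) → (∀ᶠ τ in l, τ.im ≠ 0) →
      Tendsto (fun τ : ℂ => Real.arctan (ρ / τ.im)) l (𝓝 c) →
      Tendsto (cauchyInt S f) l (𝓝 (far σ + near σ + f σ * (2 * Complex.I * c))) := by
    intro l c hl him hc
    have h1 : Tendsto (fun τ : ℂ => f τ.re) l (𝓝 (f σ)) := by
      have hre : Tendsto (fun τ : ℂ => τ.re) l (𝓝 σ) := by
        simpa using (Complex.continuous_re.tendsto (σ : ℂ)).mono_left hl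
      exact (hcontf σ ⟨by linarith, by linarith⟩).tendsto.comp hre
    have h2 : Tendsto (fun τ : ℂ => ((Real.arctan (ρ / τ.im) : ℝ) : ℂ)) l (𝓝 (c : ℂ)) :=
      (Complex.continuous_ofReal.tendsto c).comp hc
    refine (((hfar_lim.mono_left hl).add (hnear_lim.mono_left hl)).add
      (h1.mul (h2.const_mul (2 * Complex.I)))).congr' ?_
    filter_upwards [him, hl hre_tendsto] with τ h3 h4
    exact (hsplit τ h3 h4).symm
  have him0 : Tendsto (fun τ : ℂ => τ.im) (𝓝 (σ : ℂ)) (𝓝 0) := by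
    simpa using Complex.continuous_im.tendsto (σ : ℂ)
  refine ⟨far σ + near σ, ?_, ?_, ?_⟩
  · have hfari : IntegrableOn (fun x : ℝ => (Ioo (σ - ρ) (σ + ρ))ᶜ.indicator
        (fun x : ℝ => f x / (x - σ)) x) S := by
      refine Integrable.mono' (hf.norm.div_const ρ) (AEStronglyMeasurable.indicator
        (hf.aestronglyMeasurable.div₀ (by fun_prop)) measurableSet_Ioo.compl)
        (ae_of_all _ fun x => ?_)
      by_cases hx : x ∈ (Ioo (σ - ρ) (σ + ρ))ᶜ
      · rw [indicator_of_mem hx, norm_div, ← Complex.ofReal_sub, Complex.norm_real,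
          Real.norm_eq_abs]
        gcongr
        by_contra! h
        rw [abs_lt] at h
        exact hx ⟨by linarith, by linarith⟩
      · rw [indicator_of_notMem hx, norm_zero]
        positivity
    have hmem : σ ∈ Ioo (σ - ρ) (σ + ρ) := ⟨by linarith, by linarith⟩
    have hni : IntegrableOn (fun s : ℝ => (f (σ + s) - f σ) / s) (Ioo (-ρ) ρ) := by
      refine Integrable.mono' hmaj ?_ ?_
      · simpa using hnear_meas σ (by simpa using hρ)
      · filter_upwards [hae0] with s hs
        simpa using hquot σ hmem s hs.1 0 hs.2
    have hni' : IntegrableOn (fun x : ℝ => (f x - f σ) / (x - σ)) (Ioo (σ - ρ) (σ + ρ)) := by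
      rw [← (measurePreserving_add_left volume σ).integrableOn_comp_preimage
        (MeasurableEquiv.addLeft σ).measurableEmbedding]
      simpa [Function.comp_def] using hni
    have hnear_eq : near σ = ∫ x in S, (Ioo (σ - ρ) (σ + ρ)).indicator
        (fun x : ℝ => (f x - f σ) / (x - σ)) x := by
      rw [setIntegral_indicator measurableSet_Ioo, inter_eq_self_of_subset_right (hsub σ hmem),
        ← htrans, hnear]
      simp
    have hni'' : IntegrableOn ((Ioo (σ - ρ) (σ + ρ)).indicator
        (fun x : ℝ => (f x - f σ) / (x - σ))) S := by
      rw [integrableOn_indicator_iff measurableSet_Ioo]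
      exact hni'.mono_set inter_subset_left
    have p1 := HasPVIntegral.of_integrableOn (P := {σ}) (finite_singleton σ) hfari
    have p2 := HasPVIntegral.of_integrableOn (P := {σ}) (finite_singleton σ) hni''
    have p3 := (hasPVIntegral_inv_sub σ ρ (hsub σ hmem)).const_mul (f σ)
    have p4 := (p1.add p2).add p3
    rw [mul_zero, add_zero, ← hnear_eq] at p4
    have hfσ : far σ = ∫ x in S, (Ioo (σ - ρ) (σ + ρ))ᶜ.indicator
        (fun x : ℝ => f x / (x - σ)) x := by simp [hfar]
    rw [← hfσ] at p4
    refine p4.congr hS.measurableSet fun x _ _ => ?_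
    by_cases hx : x ∈ Ioo (σ - ρ) (σ + ρ)
    · rw [indicator_of_mem hx, indicator_of_mem hx, indicator_of_notMem (by simpa using hx)]
      ring
    · rw [indicator_of_notMem hx, indicator_of_notMem hx, indicator_of_mem (by simpa using hx)]
      ring
  · have him : Tendsto (fun τ : ℂ => τ.im) (fromAbove σ) (𝓝[>] 0) :=
      tendsto_nhdsWithin_iff.2 ⟨(him0.mono_left (fromAbove_le σ)), eventually_im_pos σ⟩
    have := hside (fromAbove σ) _ (fromAbove_le σ) ((eventually_im_pos σ).mono fun _ h => h.ne')
      ((tendsto_arctan_div_right hρ).comp him)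
    convert this using 2
    push_cast
    ring
  · have him : Tendsto (fun τ : ℂ => τ.im) (fromBelow σ) (𝓝[<] 0) :=
      tendsto_nhdsWithin_iff.2 ⟨(him0.mono_left (fromBelow_le σ)), eventually_im_neg σ⟩
    have := hside (fromBelow σ) _ (fromBelow_le σ) ((eventually_im_neg σ).mono fun _ h => h.ne)
      ((tendsto_arctan_div_left hρ).comp him)
    convert this using 2
    push_cast
    ring

/-! ### Hölder conditions -/

/-- `f` obeys on `s` a Hölder condition of some positive index; the index is taken to be at most
`1/2`, which is no restriction on bounded sets. -/
def IsHolder {X E : Type*} [PseudoMetricSpace X] [SeminormedAddCommGroup E] (f : X → E)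
    (s : Set X) : Prop :=
  ∃ γ : ℝ, 0 < γ ∧ γ ≤ 1 / 2 ∧ ∃ C : ℝ, 0 ≤ C ∧ ∀ x ∈ s, ∀ y ∈ s, ‖f x - f y‖ ≤ C * dist x y ^ γ

section Holder

variable {X E : Type*} [PseudoMetricSpace X] [SeminormedAddCommGroup E] {s : Set X}

theorem rpow_le_of_index_le {d R γ γ' : ℝ} (hd : 0 ≤ d) (hR : d ≤ R) (hγ : 0 < γ') (hγγ : γ' ≤ γ)
    (hγ1 : γ ≤ 1) : d ^ γ ≤ max R 1 * d ^ γ' := by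
  rcases hd.eq_or_lt with rfl | hd
  · rw [Real.zero_rpow (by linarith), Real.zero_rpow hγ.ne', mul_zero]
  · have h1 : d ^ γ = d ^ (γ - γ') * d ^ γ' := by rw [← Real.rpow_add hd]; ring_nf
    rw [h1]
    gcongr
    calc d ^ (γ - γ') ≤ (max R 1) ^ (γ - γ') := by
          exact Real.rpow_le_rpow hd.le (hR.trans (le_max_left _ _)) (by linarith)
      _ ≤ (max R 1) ^ (1 : ℝ) := by
          refine Real.rpow_le_rpow_of_exponent_le (le_max_right _ _) (by linarith)
      _ = _ := Real.rpow_one _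

theorem IsHolder.of_index {f : X → E} (hs : Bornology.IsBounded s) {γ C : ℝ} (hγ : 0 < γ)
    (hγ1 : γ ≤ 1) (hC : 0 ≤ C) (h : ∀ x ∈ s, ∀ y ∈ s, ‖f x - f y‖ ≤ C * dist x y ^ γ) :
    IsHolder f s := by
  obtain ⟨R, hR⟩ := Metric.isBounded_iff.1 hs
  refine ⟨min γ (1 / 2), lt_min hγ (by norm_num), min_le_right _ _, C * max R 1, by positivity,
    fun x hx y hy => (h x hx y hy).trans ?_⟩
  rw [mul_assoc]
  gcongr
  exact rpow_le_of_index_le dist_nonneg (hR hx hy) (lt_min hγ (by norm_num)) (min_le_left _ _) hγ1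

theorem IsHolder.of_lipschitz {f : X → E} (hs : Bornology.IsBounded s) {C : ℝ} (hC : 0 ≤ C)
    (h : ∀ x ∈ s, ∀ y ∈ s, ‖f x - f y‖ ≤ C * dist x y) : IsHolder f s :=
  IsHolder.of_index hs one_pos le_rfl hC fun x hx y hy => by
    rw [Real.rpow_one]; exact h x hx y hy

theorem IsHolder.mono {f : X → E} {t : Set X} (h : IsHolder f s) (ht : t ⊆ s) : IsHolder f t := by
  obtain ⟨γ, h1, h2, C, h3, h4⟩ := h
  exact ⟨γ, h1, h2, C, h3, fun x hx y hy => h4 x (ht hx) y (ht hy)⟩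

theorem IsHolder.congr {f g : X → E} (h : IsHolder f s) (hfg : EqOn f g s) : IsHolder g s := by
  obtain ⟨γ, h1, h2, C, h3, h4⟩ := h
  refine ⟨γ, h1, h2, C, h3, fun x hx y hy => ?_⟩
  rw [← hfg hx, ← hfg hy]
  exact h4 x hx y hy

/-- Two Hölder conditions on a bounded set may be taken to have the same index. -/
theorem IsHolder.common {F : Type*} [SeminormedAddCommGroup F] {f : X → E} {g : X → F}
    (hs : Bornology.IsBounded s) (hf : IsHolder f s) (hg : IsHolder g s) :
    ∃ γ : ℝ, 0 < γ ∧ γ ≤ 1 / 2 ∧ ∃ C : ℝ, 0 ≤ C ∧ ∀ x ∈ s, ∀ y ∈ s,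
      ‖f x - f y‖ ≤ C * dist x y ^ γ ∧ ‖g x - g y‖ ≤ C * dist x y ^ γ := by
  obtain ⟨R, hR⟩ := Metric.isBounded_iff.1 hs
  obtain ⟨γ, h1, h2, C, h3, h4⟩ := hf
  obtain ⟨γ', h1', h2', C', h3', h4'⟩ := hg
  have hpos : 0 < min γ γ' := lt_min h1 h1'
  refine ⟨min γ γ', hpos, (min_le_left _ _).trans h2, max C C' * max R 1, by positivity,
    fun x hx y hy => ⟨(h4 x hx y hy).trans ?_, (h4' x hx y hy).trans ?_⟩⟩
  · rw [mul_assoc]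
    gcongr
    · exact le_max_left _ _
    · exact rpow_le_of_index_le dist_nonneg (hR hx hy) hpos (min_le_left _ _) (by linarith)
  · rw [mul_assoc]
    gcongr
    · exact le_max_right _ _
    · exact rpow_le_of_index_le dist_nonneg (hR hx hy) hpos (min_le_right _ _) (by linarith)

theorem IsHolder.add {f g : X → E} (hs : Bornology.IsBounded s) (hf : IsHolder f s)
    (hg : IsHolder g s) : IsHolder (fun x => f x + g x) s := by
  obtain ⟨γ, h1, h2, C, h3, h4⟩ := hf.common hs hg
  refine ⟨γ, h1, h2, C + C, by positivity, fun x hx y hy => ?_⟩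
  rw [add_sub_add_comm, add_mul]
  exact (norm_add_le _ _).trans (add_le_add (h4 x hx y hy).1 (h4 x hx y hy).2)

theorem IsHolder.exists_bound {f : X → E} (hs : Bornology.IsBounded s) (hf : IsHolder f s) :
    ∃ B, 0 ≤ B ∧ ∀ x ∈ s, ‖f x‖ ≤ B := by
  obtain ⟨R, hR⟩ := Metric.isBounded_iff.1 hs
  obtain ⟨γ, h1, h2, C, h3, h4⟩ := hf
  rcases s.eq_empty_or_nonempty with rfl | ⟨y, hy⟩
  · exact ⟨0, le_rfl, by simp⟩
  · have hR0 : 0 ≤ R := dist_nonneg.trans (hR hy hy)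
    refine ⟨‖f y‖ + C * R ^ γ, by positivity, fun x hx => ?_⟩
    have h5 := h4 x hx y hy
    have h6 : dist x y ^ γ ≤ R ^ γ := Real.rpow_le_rpow dist_nonneg (hR hx hy) h1.le
    have h7 := norm_add_le (f y) (f x - f y)
    rw [add_sub_cancel] at h7
    have h8 : C * dist x y ^ γ ≤ C * R ^ γ := by gcongr
    linarith

theorem IsHolder.mul {f g : X → ℂ} (hs : Bornology.IsBounded s) (hf : IsHolder f s)
    (hg : IsHolder g s) : IsHolder (fun x => f x * g x) s := by
  obtain ⟨B, hB0, hB⟩ := hf.exists_bound hs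
  obtain ⟨B', hB0', hB'⟩ := hg.exists_bound hs
  obtain ⟨γ, h1, h2, C, h3, h4⟩ := hf.common hs hg
  refine ⟨γ, h1, h2, (B + B') * C, by positivity, fun x hx y hy => ?_⟩
  have e : f x * g x - f y * g y = f x * (g x - g y) + (f x - f y) * g y := by ring
  rw [e]
  refine (norm_add_le _ _).trans ?_
  rw [norm_mul, norm_mul, add_mul, add_mul, mul_assoc, mul_assoc, mul_comm B' (C * _)]
  exact add_le_add (mul_le_mul (hB x hx) (h4 x hx y hy).2 (norm_nonneg _) hB0)
    (mul_le_mul (h4 x hx y hy).1 (hB' y hy) (norm_nonneg _) (by positivity))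

theorem isHolder_const (c : E) : IsHolder (fun _ : X => c) s :=
  ⟨1 / 2, by norm_num, le_rfl, 0, le_rfl, fun x _ y _ => by simp⟩

theorem IsHolder.continuousOn {f : X → E} (hf : IsHolder f s) : ContinuousOn f s := by
  obtain ⟨γ, h1, h2, C, h3, h4⟩ := hf
  intro x hx
  have h5 : Tendsto (fun y => C * dist y x ^ γ) (𝓝[s] x) (𝓝 0) := by
    have : Continuous fun y : X => C * dist y x ^ γ :=
      continuous_const.mul ((continuous_id.dist continuous_const).rpow_const fun _ => Or.inr h1.le)
    simpa [Real.zero_rpow h1.ne'] using (this.tendsto x).mono_left nhdsWithin_le_nhds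
  rw [ContinuousWithinAt, tendsto_iff_norm_sub_tendsto_zero]
  refine squeeze_zero' (Eventually.of_forall fun _ => norm_nonneg _) ?_ h5
  filter_upwards [self_mem_nhdsWithin] with y hy using h4 y hy x hx

end Holder

theorem IsHolder.exists_holderOnWith {X E : Type*} [PseudoMetricSpace X] [SeminormedAddCommGroup E]
    {f : X → E} {s : Set X} (h : IsHolder f s) :
    ∃ γ : ℝ≥0, 0 < γ ∧ γ ≤ 1 ∧ ∃ M : ℝ≥0, HolderOnWith M γ f s := by
  obtain ⟨γ, h1, h2, C, h3, h4⟩ := h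
  refine ⟨γ.toNNReal, Real.toNNReal_pos.2 h1, ?_, C.toNNReal, fun x hx y hy => ?_⟩
  · exact Real.toNNReal_le_one.2 (by linarith)
  · have h5 := h4 x hx y hy
    rw [← dist_eq_norm] at h5
    rw [edist_dist, edist_dist, Real.coe_toNNReal _ h1.le,
      ENNReal.ofReal_rpow_of_nonneg dist_nonneg h1.le]
    change _ ≤ ENNReal.ofReal C * _
    rw [← ENNReal.ofReal_mul h3]
    exact ENNReal.ofReal_le_ofReal h5

theorem IsHolder.of_holderOnWith {X E : Type*} [PseudoMetricSpace X] [SeminormedAddCommGroup E]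
    {f : X → E} {s : Set X} (hs : Bornology.IsBounded s) {γ M : ℝ≥0} (h0 : 0 < γ) (h1 : γ ≤ 1)
    (h : HolderOnWith M γ f s) : IsHolder f s :=
  IsHolder.of_index hs (γ := γ) (C := M) h0 (by exact_mod_cast h1) M.coe_nonneg
    fun x hx y hy => by rw [← dist_eq_norm]; exact h.dist_le hx hy

/-! ### Cauchy integrals with a subtracted density -/

/-- A choice of nearest points in a compact set of real numbers. -/
theorem exists_nearest {S : Set ℝ} (hS : IsCompact S) (hne : S.Nonempty) :
    ∃ p : ℂ → ℝ, (∀ τ, p τ ∈ S) ∧ ∀ τ : ℂ, ∀ σ ∈ S, |σ - p τ| ≤ 2 * ‖(σ : ℂ) - τ‖ := by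
  choose p hp hd using fun τ : ℂ => hS.exists_infDist_eq_dist hne τ.re
  refine ⟨p, hp, fun τ σ hσ => ?_⟩
  have h1 : dist τ.re (p τ) ≤ dist τ.re σ := hd τ ▸ Metric.infDist_le_dist_of_mem hσ
  rw [Real.dist_eq, Real.dist_eq, abs_sub_comm τ.re σ] at h1
  have h2 := Complex.abs_re_le_norm ((σ : ℂ) - τ)
  simp only [Complex.sub_re, Complex.ofReal_re] at h2
  have h3 := abs_sub_le σ τ.re (p τ)
  linarith

/-- The Cauchy integral of `f (q - c)`. -/
def subInt (S : Set ℝ) (f q : ℝ → ℂ) (c : ℂ) (τ : ℂ) : ℂ := ∫ σ in S, f σ * (q σ - c) / (σ - τ)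

section SubInt

variable {S : Set ℝ} {f q : ℝ → ℂ} {p : ℂ → ℝ}

theorem cauchyInt_mul_eq (hS : IsCompact S) (hf : IntegrableOn f S) (hq : ContinuousOn q S) (c : ℂ)
    {τ : ℂ} (hτ : τ ∉ (fun σ : ℝ => (σ : ℂ)) '' S) :
    cauchyInt S (fun σ => f σ * q σ) τ = subInt S f q c τ + c * cauchyInt S f τ := by
  have h1 := integrableOn_div_sub hS (hf.mul_continuousOn hq hS) hτ
  have h2 := (integrableOn_div_sub hS hf hτ).const_mul c
  rw [cauchyInt, cauchyInt, subInt, ← integral_const_mul, ← integral_add _ h2]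
  · refine integral_congr_ae (ae_of_all _ fun σ => ?_)
    simp only
    ring
  · refine (h1.sub h2).congr (ae_of_all _ fun σ => ?_)
    simp only [Pi.sub_apply]
    ring

variable {K : ℝ}

theorem norm_sub_div_le (hpS : ∀ τ, p τ ∈ S)
    (hp : ∀ τ : ℂ, ∀ σ ∈ S, |σ - p τ| ≤ 2 * ‖(σ : ℂ) - τ‖) (hK0 : 0 ≤ K)
    (hK : ∀ x ∈ S, ∀ y ∈ S, ‖q x - q y‖ ≤ K * |x - y|) (τ : ℂ) {σ : ℝ} (hσ : σ ∈ S) :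
    ‖f σ * (q σ - q (p τ)) / (σ - τ)‖ ≤ 2 * K * ‖f σ‖ := by
  rw [norm_div, norm_mul]
  refine div_le_of_le_mul₀ (norm_nonneg _) (by positivity) ?_
  have h1 := hK σ hσ _ (hpS τ)
  have h2 := hp τ σ hσ
  calc ‖f σ‖ * ‖q σ - q (p τ)‖ ≤ ‖f σ‖ * (K * (2 * ‖(σ : ℂ) - τ‖)) := by
        gcongr
        exact h1.trans (by gcongr)
    _ = _ := by ring

theorem norm_subInt_le (hS : IsCompact S) (hf : IntegrableOn f S) (hpS : ∀ τ, p τ ∈ S)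
    (hp : ∀ τ : ℂ, ∀ σ ∈ S, |σ - p τ| ≤ 2 * ‖(σ : ℂ) - τ‖) (hK0 : 0 ≤ K)
    (hK : ∀ x ∈ S, ∀ y ∈ S, ‖q x - q y‖ ≤ K * |x - y|) (τ : ℂ) :
    ‖subInt S f q (q (p τ)) τ‖ ≤ 2 * K * ∫ σ in S, ‖f σ‖ := by
  rw [← integral_const_mul]
  exact norm_integral_le_of_norm_le (hf.norm.const_mul _)
    ((ae_restrict_iff' hS.measurableSet).2 (ae_of_all _ fun σ hσ =>
      norm_sub_div_le hpS hp hK0 hK τ hσ))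

theorem continuousOn_of_lipschitz (hK0 : 0 ≤ K)
    (hK : ∀ x ∈ S, ∀ y ∈ S, ‖q x - q y‖ ≤ K * |x - y|) : ContinuousOn q S :=
  (LipschitzOnWith.of_dist_le_mul (K := ⟨K, hK0⟩) fun x hx y hy => by
    rw [dist_eq_norm, Real.dist_eq]; exact hK x hx y hy).continuousOn

theorem tendsto_comp_nearest (hpS : ∀ τ, p τ ∈ S)
    (hp : ∀ τ : ℂ, ∀ σ ∈ S, |σ - p τ| ≤ 2 * ‖(σ : ℂ) - τ‖) (hK0 : 0 ≤ K)
    (hK : ∀ x ∈ S, ∀ y ∈ S, ‖q x - q y‖ ≤ K * |x - y|) {σ₀ : ℝ} (hσ₀ : σ₀ ∈ S) :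
    Tendsto (fun τ => q (p τ)) (𝓝 (σ₀ : ℂ)) (𝓝 (q σ₀)) := by
  rw [tendsto_iff_norm_sub_tendsto_zero]
  have h1 : Tendsto (fun τ : ℂ => K * (2 * ‖(σ₀ : ℂ) - τ‖)) (𝓝 (σ₀ : ℂ)) (𝓝 0) := by
    have : Continuous fun τ : ℂ => K * (2 * ‖(σ₀ : ℂ) - τ‖) := by fun_prop
    simpa using this.tendsto (σ₀ : ℂ)
  refine squeeze_zero (fun _ => norm_nonneg _) (fun τ => ?_) h1
  refine (hK _ (hpS τ) _ hσ₀).trans ?_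
  rw [abs_sub_comm]
  gcongr
  exact hp τ σ₀ hσ₀

/-- Cauchy integrals with a subtracted Lipschitz density are continuous up to `S`. -/
theorem tendsto_subInt (hS : IsCompact S) (hf : IntegrableOn f S) (hpS : ∀ τ, p τ ∈ S)
    (hp : ∀ τ : ℂ, ∀ σ ∈ S, |σ - p τ| ≤ 2 * ‖(σ : ℂ) - τ‖) (hK0 : 0 ≤ K)
    (hK : ∀ x ∈ S, ∀ y ∈ S, ‖q x - q y‖ ≤ K * |x - y|) {σ₀ : ℝ} (hσ₀ : σ₀ ∈ S) :
    Tendsto (fun τ => subInt S f q (q (p τ)) τ) (𝓝 (σ₀ : ℂ)) (𝓝 (subInt S f q (q σ₀) σ₀)) := by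
  have hq := continuousOn_of_lipschitz hK0 hK
  refine tendsto_integral_filter_of_dominated_convergence (fun σ => 2 * K * ‖f σ‖) ?_ ?_
    (hf.norm.const_mul _) ?_
  · refine Eventually.of_forall fun τ => ?_
    refine (hf.aestronglyMeasurable.mul ?_).div₀ (by fun_prop)
    exact (hq.aestronglyMeasurable hS.measurableSet).sub aestronglyMeasurable_const
  · exact Eventually.of_forall fun τ => (ae_restrict_iff' hS.measurableSet).2
      (ae_of_all _ fun σ hσ => norm_sub_div_le hpS hp hK0 hK τ hσ)
  · have h0 : ∀ᵐ x ∂(volume.restrict S), x ≠ σ₀ := ae_restrict_of_ae (Measure.ae_ne volume σ₀)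
    filter_upwards [h0] with σ hσ
    refine Tendsto.div (((tendsto_comp_nearest hpS hp hK0 hK hσ₀).const_sub _).const_mul _)
      ((continuous_const.sub continuous_id).tendsto _) ?_
    rw [sub_ne_zero]
    exact fun h => hσ (Complex.ofReal_injective h)

/-- The growth at the points of `B` of the Cauchy integral of the product of a function that grows
like `|σ - b| ^ (-1/2)` there with a function that obeys a Hölder condition, after subtraction of
the value of the latter at the nearest point of `S`. -/
theorem exists_norm_subInt_le (hS : IsCompact S) {B : Finset ℝ} {A : ℝ} (hA : 0 ≤ A)
    (hf : ∀ σ ∈ S, σ ∉ B → ‖f σ‖ ≤ A * (1 + ∑ b ∈ B, |σ - b| ^ (-(1 / 2) : ℝ)))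
    (hpS : ∀ τ, p τ ∈ S)
    (hp : ∀ τ : ℂ, ∀ σ ∈ S, |σ - p τ| ≤ 2 * ‖(σ : ℂ) - τ‖) (hq : IsHolder q S) :
    ∃ C, 0 ≤ C ∧ ∀ τ : ℂ, τ.im ≠ 0 → ‖subInt S f q (q (p τ)) τ‖ ≤ C * endWeight B τ := by
  obtain ⟨γ, hγ0, hγ1, M, hM, hHold⟩ := hq
  obtain ⟨I₀, hI₀⟩ := exists_integral_abs_rpow_le (p := γ - 1) (by linarith) (by linarith) hS
  have hI₀nn : 0 ≤ I₀ := le_trans (integral_nonneg fun x => by positivity) (hI₀ 0)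
  refine ⟨6 * A * M * I₀, by positivity, fun τ hτ => ?_⟩
  have hτb : ∀ b : ℝ, 0 < ‖τ - b‖ := fun b => norm_pos_iff.2 fun h => hτ (by
    simpa using congrArg Complex.im h)
  have hint : ∀ c : ℝ, IntegrableOn (fun σ : ℝ => |σ - c| ^ (γ - 1)) S := fun c =>
    integrableOn_abs_rpow (by linarith) c hS
  set bd : ℝ → ℝ := fun σ => 2 * A * M * (|σ - τ.re| ^ (γ - 1) + ∑ b ∈ B,
    ‖τ - b‖ ^ (-(1 / 2) : ℝ) * (|σ - b| ^ (γ - 1) + 2 * |σ - τ.re| ^ (γ - 1))) with hbd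
  have hterm : ∀ b ∈ B, IntegrableOn (fun σ : ℝ => ‖τ - b‖ ^ (-(1 / 2) : ℝ) *
      (|σ - b| ^ (γ - 1) + 2 * |σ - τ.re| ^ (γ - 1))) S := fun b _ =>
    ((hint b).add ((hint _).const_mul 2)).const_mul _
  have hbdi : IntegrableOn bd S := by
    exact Integrable.const_mul ((hint _).add (integrable_finsetSum _ hterm)) _
  have hpt : ∀ σ ∈ S, σ ∉ B → σ ≠ τ.re → ‖f σ * (q σ - q (p τ)) / (σ - τ)‖ ≤ bd σ := by
    intro σ hσ hσB hστ
    have hy : 0 < |σ - τ.re| := abs_pos.2 (sub_ne_zero.2 hστ)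
    have hyY : |σ - τ.re| ≤ ‖(σ : ℂ) - τ‖ := by
      have := Complex.abs_re_le_norm ((σ : ℂ) - τ)
      simpa using this
    set Y := ‖(σ : ℂ) - τ‖ with hY
    have hY0 : 0 < Y := hy.trans_le hyY
    have h1 : ‖q σ - q (p τ)‖ / Y ≤ 2 * M * Y ^ (γ - 1) := by
      have h2 := hHold σ hσ _ (hpS τ)
      rw [Real.dist_eq] at h2
      have h3 : |σ - p τ| ^ γ ≤ 2 * Y ^ γ := by
        calc |σ - p τ| ^ γ ≤ (2 * Y) ^ γ := by
              gcongr
              exact hp τ σ hσ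
          _ = 2 ^ γ * Y ^ γ := Real.mul_rpow (by norm_num) hY0.le
          _ ≤ 2 ^ (1 : ℝ) * Y ^ γ := by
              gcongr
              · norm_num
              · linarith
          _ = _ := by rw [Real.rpow_one]
      rw [Real.rpow_sub_one hY0.ne', ← mul_div_assoc]
      gcongr
      calc _ ≤ M * |σ - p τ| ^ γ := h2
        _ ≤ M * (2 * Y ^ γ) := by gcongr
        _ = _ := by ring
    have h2 : ∀ e : ℝ, e ≤ 0 → Y ^ e ≤ |σ - τ.re| ^ e := fun e he =>
      Real.rpow_le_rpow_of_nonpos hy hyY he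
    have h3 : ∀ b ∈ B, |σ - b| ^ (-(1 / 2) : ℝ) * Y ^ (γ - 1) ≤
        ‖τ - b‖ ^ (-(1 / 2) : ℝ) * (|σ - b| ^ (γ - 1) + 2 * |σ - τ.re| ^ (γ - 1)) := by
      intro b hb
      have hx : 0 < |σ - b| := abs_pos.2 (sub_ne_zero.2 fun h => hσB (h ▸ hb))
      have h4 : ‖τ - b‖ ≤ Y + |σ - b| := by
        have h5 : τ - b = -((σ : ℂ) - τ) + ((σ - b : ℝ) : ℂ) := by push_cast; ring
        rw [h5]
        refine (norm_add_le _ _).trans ?_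
        rw [norm_neg, Complex.norm_real, Real.norm_eq_abs]
      have h5 : ‖τ - b‖ ^ (1 / 2 : ℝ) ≤ Y ^ (1 / 2 : ℝ) + |σ - b| ^ (1 / 2 : ℝ) :=
        (Real.rpow_le_rpow (norm_nonneg _) h4 (by norm_num)).trans
          (Real.rpow_add_le_add_rpow hY0.le hx.le (by norm_num) (by norm_num))
      have h6 : |σ - b| ^ (-(1 / 2) : ℝ) * Y ^ (γ - 1) * ‖τ - b‖ ^ (1 / 2 : ℝ) ≤
          |σ - b| ^ (γ - 1) + 2 * |σ - τ.re| ^ (γ - 1) := by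
        calc _ ≤ |σ - b| ^ (-(1 / 2) : ℝ) * Y ^ (γ - 1) * (Y ^ (1 / 2 : ℝ) + |σ - b| ^ (1 / 2 : ℝ)) := by
              gcongr
          _ = |σ - b| ^ (-(1 / 2) : ℝ) * (Y ^ (γ - 1) * Y ^ (1 / 2 : ℝ)) +
              (|σ - b| ^ (-(1 / 2) : ℝ) * |σ - b| ^ (1 / 2 : ℝ)) * Y ^ (γ - 1) := by ring
          _ = |σ - b| ^ (-(1 / 2) : ℝ) * Y ^ (γ - 1 + 1 / 2) + Y ^ (γ - 1) := by
              rw [← Real.rpow_add hY0, ← Real.rpow_add hx, neg_add_cancel, Real.rpow_zero, one_mul]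
          _ ≤ |σ - b| ^ (-(1 / 2) : ℝ) * |σ - τ.re| ^ (γ - 1 + 1 / 2) + |σ - τ.re| ^ (γ - 1) := by
              exact add_le_add (mul_le_mul_of_nonneg_left (h2 _ (by linarith)) (by positivity))
                (h2 _ (by linarith))
          _ ≤ (|σ - b| ^ (-(1 / 2) + (γ - 1 + 1 / 2)) + |σ - τ.re| ^ (-(1 / 2) + (γ - 1 + 1 / 2)))
              + |σ - τ.re| ^ (γ - 1) := by
              gcongr
              exact rpow_mul_rpow_le hx hy (by norm_num) (by linarith)
          _ = _ := by
              have : -(1 / 2) + (γ - 1 + 1 / 2) = γ - 1 := by ring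
              rw [this]
              ring
      rw [Real.rpow_neg (norm_nonneg _), ← div_eq_inv_mul, le_div_iff₀ (by have := hτb b; positivity)]
      exact h6
    rw [norm_div, norm_mul, mul_div_assoc]
    have h1' : ‖q σ - q (p τ)‖ / ‖(σ : ℂ) - τ‖ ≤ 2 * M * Y ^ (γ - 1) := h1
    calc ‖f σ‖ * (‖q σ - q (p τ)‖ / ‖(σ : ℂ) - τ‖)
        ≤ (A * (1 + ∑ b ∈ B, |σ - b| ^ (-(1 / 2) : ℝ))) * (2 * M * Y ^ (γ - 1)) :=
          mul_le_mul (hf σ hσ hσB) h1' (by positivity) (by positivity)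
      _ = 2 * A * M * (Y ^ (γ - 1) + ∑ b ∈ B, |σ - b| ^ (-(1 / 2) : ℝ) * Y ^ (γ - 1)) := by
          rw [← Finset.sum_mul]
          ring
      _ ≤ bd σ := by
          rw [hbd]
          simp only
          exact mul_le_mul_of_nonneg_left (add_le_add (h2 _ (by linarith))
            (Finset.sum_le_sum h3)) (by positivity)
  have hBae : ∀ᵐ x : ℝ, x ∉ B := by
    have := B.finite_toSet.countable.ae_notMem (volume : Measure ℝ)
    simpa using this
  calc ‖subInt S f q (q (p τ)) τ‖ ≤ ∫ σ in S, bd σ := by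
        refine norm_integral_le_of_norm_le hbdi ?_
        filter_upwards [ae_restrict_of_ae hBae, ae_restrict_of_ae (Measure.ae_ne volume τ.re),
          ae_restrict_mem hS.measurableSet] with σ h1 h2 h3 using hpt σ h3 h1 h2
    _ = 2 * A * M * ((∫ σ in S, |σ - τ.re| ^ (γ - 1)) + ∑ b ∈ B, ‖τ - b‖ ^ (-(1 / 2) : ℝ) *
        ((∫ σ in S, |σ - b| ^ (γ - 1)) + 2 * ∫ σ in S, |σ - τ.re| ^ (γ - 1))) := by
        rw [hbd, integral_const_mul, integral_add (hint _) (integrable_finsetSum _ hterm),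
          integral_finsetSum _ hterm]
        congr 2
        refine Finset.sum_congr rfl fun b _ => ?_
        rw [integral_const_mul, integral_add (hint b) ((hint _).const_mul 2), integral_const_mul]
    _ ≤ 2 * A * M * (I₀ + ∑ b ∈ B, ‖τ - b‖ ^ (-(1 / 2) : ℝ) * (I₀ + 2 * I₀)) := by
        gcongr
        all_goals exact hI₀ _
    _ ≤ 6 * A * M * I₀ * endWeight B τ := by
        rw [← Finset.sum_mul, endWeight]
        have h1 : 0 ≤ A * M * I₀ := by positivity
        nlinarith [h1]

end SubInt

/-! ### The square root of a linear fractional function -/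

theorem cpow_half_of_im_pos {z : ℂ} (hz : 0 < z.im) :
    z ^ (1 / 2 : ℂ) = Complex.I * (-z) ^ (1 / 2 : ℂ) := by
  have h0 : z ≠ 0 := fun h => by simp [h] at hz
  have hlog : Complex.log (-z) = Complex.log z - Real.pi * Complex.I := by
    rw [Complex.log, Complex.log, norm_neg, Complex.arg_neg_eq_arg_sub_pi_of_im_pos hz]
    push_cast
    ring
  have e : Complex.exp (-(Real.pi * Complex.I) / 2) = -Complex.I := by
    have : -(Real.pi * Complex.I) / 2 = ((-(Real.pi / 2) : ℝ) : ℂ) * Complex.I := by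
      push_cast
      ring
    rw [this, Complex.exp_mul_I, ← Complex.ofReal_cos, ← Complex.ofReal_sin]
    simp
  rw [Complex.cpow_def_of_ne_zero h0, Complex.cpow_def_of_ne_zero (neg_ne_zero.2 h0), hlog]
  have : (Complex.log z - Real.pi * Complex.I) * (1 / 2) =
      Complex.log z * (1 / 2) + -(Real.pi * Complex.I) / 2 := by ring
  rw [this, Complex.exp_add, e]
  linear_combination Complex.exp (Complex.log z * (1 / 2)) * Complex.I_sq

theorem cpow_half_of_im_neg {z : ℂ} (hz : z.im < 0) :
    z ^ (1 / 2 : ℂ) = -(Complex.I * (-z) ^ (1 / 2 : ℂ)) := by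
  have := cpow_half_of_im_pos (z := -z) (by simpa using hz)
  rw [neg_neg] at this
  rw [this]
  linear_combination z ^ (1 / 2 : ℂ) * Complex.I_sq

theorem rootFactor_self (a : ℝ) : rootFactor a a = fun _ => 1 := by
  funext τ
  simp [rootFactor]

theorem rootFactor_of_ne {b a : ℝ} (h : a ≠ b) (τ : ℂ) :
    rootFactor b a τ = ((τ - b) / (τ - a)) ^ (1 / 2 : ℂ) := by
  simp [rootFactor, h]

/-- The closed cut of `rootFactor b a`. -/
theorem closure_Ioo_min_max {b a : ℝ} (h : a ≠ b) :
    closure (Ioo (min a b) (max a b)) = Icc (min a b) (max a b) :=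
  closure_Ioo (by simpa using h)

theorem div_mem_slitPlane {b a : ℝ} (h : a ≠ b) {τ : ℂ}
    (hτ : ∀ σ ∈ closure (Ioo (min a b) (max a b)), (σ : ℂ) ≠ τ) :
    τ - a ≠ 0 ∧ (τ - b) / (τ - a) ∈ Complex.slitPlane := by
  rw [closure_Ioo_min_max h] at hτ
  have ha : τ - a ≠ 0 := fun h0 => hτ a ⟨min_le_left _ _, le_max_left _ _⟩ (sub_eq_zero.1 h0).symm
  refine ⟨ha, ?_⟩
  by_contra hs
  rw [Complex.mem_slitPlane_iff, not_or, not_lt, not_not] at hs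
  set k : ℝ := -((τ - b) / (τ - a)).re with hk
  have hk0 : 0 ≤ k := by linarith [hs.1]
  have hz : (τ - b) / (τ - a) = -(k : ℂ) := by
    apply Complex.ext <;> simp [hk, hs.2]
  rw [div_eq_iff ha] at hz
  have h1k : (1 + k) ≠ 0 := by positivity
  have h1k' : (1 + (k : ℂ)) ≠ 0 := by exact_mod_cast h1k
  have hτe : τ = (((b + k * a) / (1 + k) : ℝ) : ℂ) := by
    push_cast
    rw [eq_div_iff h1k']
    linear_combination hz
  refine hτ ((b + k * a) / (1 + k)) ⟨?_, ?_⟩ hτe.symm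
  · rw [le_div_iff₀ (by positivity)]
    have h1 := min_le_left a b
    have h2 := min_le_right a b
    nlinarith
  · rw [div_le_iff₀ (by positivity)]
    have h1 := le_max_left a b
    have h2 := le_max_right a b
    nlinarith

theorem differentiableAt_rootFactor {b a : ℝ} {τ : ℂ}
    (hτ : ∀ σ ∈ closure (Ioo (min a b) (max a b)), (σ : ℂ) ≠ τ) :
    DifferentiableAt ℂ (rootFactor b a) τ ∧ rootFactor b a τ ≠ 0 := by
  by_cases h : a = b
  · subst h
    rw [rootFactor_self]
    exact ⟨differentiableAt_const _, one_ne_zero⟩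
  · obtain ⟨h1, h2⟩ := div_mem_slitPlane h hτ
    have e : rootFactor b a = fun τ : ℂ => ((τ - b) / (τ - a)) ^ (1 / 2 : ℂ) :=
      funext fun τ => rootFactor_of_ne h τ
    rw [e]
    refine ⟨?_, fun h0 => ?_⟩
    · exact DifferentiableAt.cpow (f := fun τ : ℂ => (τ - b) / (τ - a))
        (DifferentiableAt.div (by fun_prop) (by fun_prop) h1) (by fun_prop) h2
    · exact Complex.slitPlane_ne_zero h2 ((Complex.cpow_eq_zero_iff _ _).1 h0).1

theorem tendsto_rootFactor_cocompact (b a : ℝ) :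
    Tendsto (rootFactor b a) (cocompact ℂ) (𝓝 1) := by
  by_cases h : a = b
  · subst h
    rw [rootFactor_self]
    exact tendsto_const_nhds
  · have h1 : Tendsto (fun τ : ℂ => τ - a) (cocompact ℂ) (cocompact ℂ) :=
      (Homeomorph.subRight (a : ℂ)).isClosedEmbedding.tendsto_cocompact
    have h2 : Tendsto (fun τ : ℂ => (τ - a)⁻¹) (cocompact ℂ) (𝓝 0) := by
      rw [← Metric.cobounded_eq_cocompact] at h1 ⊢
      exact tendsto_inv₀_cobounded.comp h1
    have h3 : Tendsto (fun τ : ℂ => 1 + ((a : ℂ) - b) * (τ - a)⁻¹) (cocompact ℂ) (𝓝 1) := by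
      simpa using (h2.const_mul ((a : ℂ) - b)).const_add 1
    have h4 : Tendsto (fun z : ℂ => z ^ (1 / 2 : ℂ)) (𝓝 1) (𝓝 1) := by
      have := (continuousAt_cpow_const (b := (1 / 2 : ℂ)) Complex.one_mem_slitPlane).tendsto
      simpa using this
    refine (h4.comp h3).congr' ?_
    have h5 : ∀ᶠ τ : ℂ in cocompact ℂ, τ ∈ ({(a : ℂ)} : Set ℂ)ᶜ :=
      isCompact_singleton.compl_mem_cocompact
    filter_upwards [h5] with τ hτ
    have hne : τ - a ≠ 0 := sub_ne_zero.2 hτ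
    rw [rootFactor_of_ne h, Function.comp]
    congr 1
    field_simp
    ring

theorem norm_rootFactor {b a : ℝ} (h : a ≠ b) (τ : ℂ) :
    ‖rootFactor b a τ‖ = (‖τ - b‖ / ‖τ - a‖) ^ (1 / 2 : ℝ) := by
  rw [rootFactor_of_ne h]
  have := Complex.norm_cpow_real ((τ - b) / (τ - a)) (1 / 2)
  push_cast at this
  rw [this, norm_div]

/-- The ratio of distances grows at most like the inverse of its denominator. -/
theorem rpow_half_div_le {x y d : ℝ} (hx : 0 ≤ x) (hy : 0 < y) (hd : 0 ≤ d) (h : x ≤ y + d) :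
    (x / y) ^ (1 / 2 : ℝ) ≤ (1 + d ^ (1 / 2 : ℝ)) * (1 + y ^ (-(1 / 2) : ℝ)) := by
  have h1 : x / y ≤ 1 + d / y := by
    rw [div_le_iff₀ hy, add_mul, div_mul_cancel₀ _ hy.ne', one_mul]
    exact h
  calc (x / y) ^ (1 / 2 : ℝ) ≤ (1 + d / y) ^ (1 / 2 : ℝ) := by
        exact Real.rpow_le_rpow (by positivity) h1 (by norm_num)
    _ ≤ 1 ^ (1 / 2 : ℝ) + (d / y) ^ (1 / 2 : ℝ) :=
        Real.rpow_add_le_add_rpow (by norm_num) (by positivity) (by norm_num) (by norm_num)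
    _ = 1 + d ^ (1 / 2 : ℝ) * y ^ (-(1 / 2) : ℝ) := by
        rw [Real.one_rpow, Real.div_rpow hd hy.le, Real.rpow_neg hy.le, div_eq_mul_inv]
    _ ≤ _ := by
        have h2 : 0 ≤ d ^ (1 / 2 : ℝ) := by positivity
        have h3 : 0 ≤ y ^ (-(1 / 2) : ℝ) := by positivity
        nlinarith

theorem norm_sub_le_add (τ : ℂ) (a b : ℝ) : ‖τ - a‖ ≤ ‖τ - b‖ + |a - b| := by
  have h : τ - a = (τ - b) + ((b - a : ℝ) : ℂ) := by push_cast; ring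
  rw [h]
  refine (norm_add_le _ _).trans ?_
  rw [Complex.norm_real, Real.norm_eq_abs, abs_sub_comm]

theorem norm_rootFactor_le {b a : ℝ} {τ : ℂ} (hτ : τ.im ≠ 0) :
    ‖rootFactor b a τ‖ ≤ (1 + |a - b| ^ (1 / 2 : ℝ)) * (1 + ‖τ - a‖ ^ (-(1 / 2) : ℝ)) ∧
    ‖(rootFactor b a τ)⁻¹‖ ≤ (1 + |a - b| ^ (1 / 2 : ℝ)) * (1 + ‖τ - b‖ ^ (-(1 / 2) : ℝ)) := by
  have hpos : ∀ c : ℝ, 0 < ‖τ - c‖ := fun c => norm_pos_iff.2 fun h => hτ (by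
    simpa using congrArg Complex.im h)
  by_cases h : a = b
  · subst h
    rw [rootFactor_self]
    have h2 : 0 ≤ |a - a| ^ (1 / 2 : ℝ) := by positivity
    have h3 : 0 ≤ ‖τ - a‖ ^ (-(1 / 2) : ℝ) := by positivity
    simp only [norm_one, inv_one]
    constructor <;> nlinarith
  · refine ⟨?_, ?_⟩
    · rw [norm_rootFactor h]
      refine rpow_half_div_le (norm_nonneg _) (hpos a) (abs_nonneg _) ?_
      rw [abs_sub_comm]
      exact norm_sub_le_add τ b a
    · rw [norm_inv, norm_rootFactor h, ← Real.inv_rpow (by positivity), inv_div]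
      exact rpow_half_div_le (norm_nonneg _) (hpos b) (abs_nonneg _) (norm_sub_le_add τ a b)

theorem norm_rootFactor_le_of_zero {b a : ℝ} (h : a ≠ b) :
    ∃ C, 0 ≤ C ∧ ∀ᶠ τ in 𝓝 (b : ℂ), ‖rootFactor b a τ‖ ≤ C * ‖τ - b‖ ^ (1 / 2 : ℝ) := by
  have hab : 0 < |b - a| := abs_pos.2 (sub_ne_zero.2 (Ne.symm h))
  refine ⟨(|b - a| / 2)⁻¹ ^ (1 / 2 : ℝ), by positivity, ?_⟩
  have h1 : ∀ᶠ τ : ℂ in 𝓝 (b : ℂ), |b - a| / 2 < ‖τ - a‖ := by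
    have : Tendsto (fun τ : ℂ => ‖τ - a‖) (𝓝 (b : ℂ)) (𝓝 ‖(b : ℂ) - a‖) :=
      (by fun_prop : Continuous fun τ : ℂ => ‖τ - a‖).tendsto _
    refine this.eventually (lt_mem_nhds ?_)
    rw [← Complex.ofReal_sub, Complex.norm_real, Real.norm_eq_abs]
    linarith
  filter_upwards [h1] with τ hτ
  rw [norm_rootFactor h, ← Real.mul_rpow (by positivity) (by positivity)]
  refine Real.rpow_le_rpow (by positivity) ?_ (by norm_num)
  rw [div_eq_inv_mul]
  gcongr

/-- On its two sides the square root continues, up to the sign, to one function that is holomorphic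
and without zeros near the given point of the cut. -/
theorem exists_branch_rootFactor {b a σ : ℝ} (hσ : σ ∈ Ioo (min a b) (max a b)) :
    ∃ g : ℂ → ℂ, DifferentiableAt ℂ g σ ∧ g σ ≠ 0 ∧ (∀ᶠ τ in 𝓝 (σ : ℂ), DifferentiableAt ℂ g τ) ∧
      ∀ τ : ℂ, (0 < τ.im → rootFactor b a τ = g τ) ∧ (τ.im < 0 → rootFactor b a τ = -g τ) := by
  have hab : a ≠ b := by
    rintro rfl
    simp at hσ
  have hpos : 0 < (b - σ) / (σ - a) := by
    rcases lt_or_gt_of_ne hab with h | h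
    · rw [min_eq_left h.le, max_eq_right h.le] at hσ
      exact div_pos (by linarith [hσ.2]) (by linarith [hσ.1])
    · rw [min_eq_right h.le, max_eq_left h.le] at hσ
      exact div_pos_of_neg_of_neg (by linarith [hσ.1]) (by linarith [hσ.2])
  have hσa : σ - a ≠ 0 := fun h0 => by rw [h0, div_zero] at hpos; exact lt_irrefl _ hpos
  have hσa' : (σ : ℂ) - a ≠ 0 := by exact_mod_cast hσa
  have hslit : ((b : ℂ) - σ) / (σ - a) ∈ Complex.slitPlane := by
    left
    have : ((b : ℂ) - σ) / (σ - a) = (((b - σ) / (σ - a) : ℝ) : ℂ) := by push_cast; rfl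
    rw [this, Complex.ofReal_re]
    exact hpos
  set h : ℂ → ℂ := fun τ => (((b : ℂ) - τ) / (τ - a)) ^ (1 / 2 : ℂ) with hh
  have hd : ∀ τ : ℂ, τ - a ≠ 0 → ((b : ℂ) - τ) / (τ - a) ∈ Complex.slitPlane →
      DifferentiableAt ℂ h τ := fun τ h1 h2 =>
    DifferentiableAt.cpow (f := fun τ : ℂ => ((b : ℂ) - τ) / (τ - a))
      (DifferentiableAt.div (by fun_prop) (by fun_prop) h1) (by fun_prop) h2
  have hev : ∀ᶠ τ in 𝓝 (σ : ℂ), DifferentiableAt ℂ h τ := by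
    have c1 : ContinuousAt (fun τ : ℂ => τ - a) σ := by fun_prop
    have c2 : ContinuousAt (fun τ : ℂ => ((b : ℂ) - τ) / (τ - a)) σ :=
      ContinuousAt.div (by fun_prop) c1 hσa'
    filter_upwards [c1.eventually_ne hσa', c2.eventually
      (Complex.isOpen_slitPlane.mem_nhds hslit)] with τ h1 h2 using hd τ h1 h2
  have hne : h σ ≠ 0 := fun h0 =>
    Complex.slitPlane_ne_zero hslit ((Complex.cpow_eq_zero_iff _ _).1 h0).1
  have him : ∀ τ : ℂ, τ.im ≠ 0 →
      0 < ((τ - b) / (τ - a)).im * τ.im * (b - a) := by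
    intro τ hτ
    have h0 : τ - a ≠ 0 := fun h => hτ (by simpa using congrArg Complex.im h)
    have h1 : (τ - b) / (τ - a) = 1 + ((a - b : ℝ) : ℂ) * (τ - a)⁻¹ := by
      push_cast
      field_simp
      ring
    have h2 : ((τ - b) / (τ - a)).im = (a - b) * (-τ.im / Complex.normSq (τ - a)) := by
      rw [h1, Complex.add_im, Complex.one_im, Complex.im_ofReal_mul,
        Complex.inv_im]
      simp
    rw [h2]
    have h3 : 0 < Complex.normSq (τ - a) := Complex.normSq_pos.2 h0
    have h4 : (a - b) * (-τ.im / Complex.normSq (τ - a)) * τ.im * (b - a) =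
        ((b - a) * τ.im) ^ 2 / Complex.normSq (τ - a) := by ring
    rw [h4]
    have h5 : (b - a) * τ.im ≠ 0 := mul_ne_zero (sub_ne_zero.2 (Ne.symm hab)) hτ
    positivity
  have hneg : ∀ τ : ℂ, (-((τ - b) / (τ - a))) ^ (1 / 2 : ℂ) = h τ := by
    intro τ
    rw [hh]
    simp only
    rw [← neg_div, neg_sub]
  rcases lt_or_gt_of_ne hab with hlt | hlt
  · refine ⟨fun τ => Complex.I * h τ, (hd σ hσa' hslit).const_mul _, mul_ne_zero Complex.I_ne_zero hne,
      hev.mono fun τ hτ => hτ.const_mul _, fun τ => ⟨fun hτ => ?_, fun hτ => ?_⟩⟩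
    · have h1 := him τ hτ.ne'
      have h2 : 0 < ((τ - b) / (τ - a)).im := by
        by_contra! h
        have : ((τ - b) / (τ - a)).im * τ.im * (b - a) ≤ 0 :=
          mul_nonpos_of_nonpos_of_nonneg (mul_nonpos_of_nonpos_of_nonneg h hτ.le) (by linarith)
        linarith
      rw [rootFactor_of_ne hab, cpow_half_of_im_pos h2, hneg]
    · have h1 := him τ hτ.ne
      have h2 : ((τ - b) / (τ - a)).im < 0 := by
        by_contra! h
        have : ((τ - b) / (τ - a)).im * τ.im * (b - a) ≤ 0 :=
          mul_nonpos_of_nonpos_of_nonneg (mul_nonpos_of_nonneg_of_nonpos h hτ.le) (by linarith)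
        linarith
      rw [rootFactor_of_ne hab, cpow_half_of_im_neg h2, hneg]
  · refine ⟨fun τ => -(Complex.I * h τ), ((hd σ hσa' hslit).const_mul _).neg,
      neg_ne_zero.2 (mul_ne_zero Complex.I_ne_zero hne),
      hev.mono fun τ hτ => (hτ.const_mul _).neg, fun τ => ⟨fun hτ => ?_, fun hτ => ?_⟩⟩
    · have h1 := him τ hτ.ne'
      have h2 : ((τ - b) / (τ - a)).im < 0 := by
        by_contra! h
        have : ((τ - b) / (τ - a)).im * τ.im * (b - a) ≤ 0 :=
          mul_nonpos_of_nonneg_of_nonpos (mul_nonneg h hτ.le) (by linarith)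
        linarith
      rw [rootFactor_of_ne hab, cpow_half_of_im_neg h2, hneg]
    · have h1 := him τ hτ.ne
      have h2 : 0 < ((τ - b) / (τ - a)).im := by
        by_contra! h
        have : ((τ - b) / (τ - a)).im * τ.im * (b - a) ≤ 0 :=
          mul_nonpos_of_nonneg_of_nonpos (mul_nonneg_of_nonpos_of_nonpos h hτ.le) (by linarith)
        linarith
      rw [rootFactor_of_ne hab, cpow_half_of_im_pos h2, hneg, neg_neg]

/-! ### Square roots on a slit plane -/

/-- `n` is a square root type function with cut `S`: the points of `B` are the branch points at
which `n` vanishes, those of `X` the ones at which it is infinite, `A` is dense in `S` and exhausts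
`S` up to these points, and `n` has the boundary values `± np` on the two sides of `A`.
Branch points outside `S` are allowed: they belong to arcs that have shrunk to a point. -/
structure IsCutRoot (S A : Set ℝ) (B X : Finset ℝ) (n : ℂ → ℂ) (np : ℝ → ℂ) : Prop where
  compact : IsCompact S
  subset : A ⊆ S
  dense : S ⊆ closure A
  ends : ∀ σ ∈ S, σ ∉ A → σ ∈ B ∨ σ ∈ X
  notMem : ∀ σ ∈ A, σ ∉ B ∧ σ ∉ X
  disj : ∀ b ∈ B, b ∈ S → b ∉ X
  diff : ∀ τ ∉ (fun σ : ℝ => (σ : ℂ)) '' S, DifferentiableAt ℂ n τ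
  ne_zero : ∀ τ ∉ (fun σ : ℝ => (σ : ℂ)) '' S, n τ ≠ 0
  inf : Tendsto n (cocompact ℂ) (𝓝 1)
  plus : ∀ σ ∈ A, Tendsto n (fromAbove σ) (𝓝 (np σ))
  minus : ∀ σ ∈ A, Tendsto n (fromBelow σ) (𝓝 (-np σ))
  np_ne_zero : ∀ σ ∈ A, np σ ≠ 0
  holder : ∀ σ ∈ A, ∃ ρ > 0, Ioo (σ - 2 * ρ) (σ + 2 * ρ) ⊆ A ∧
    IsHolder np (Ioo (σ - 2 * ρ) (σ + 2 * ρ)) ∧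
    IsHolder (fun σ => (np σ)⁻¹) (Ioo (σ - 2 * ρ) (σ + 2 * ρ))
  growth : ∃ C, 0 ≤ C ∧ ∀ τ : ℂ, τ.im ≠ 0 →
    ‖n τ‖ ≤ C * endWeight X τ ∧ ‖(n τ)⁻¹‖ ≤ C * endWeight B τ
  zero : ∀ b ∈ B, b ∈ S → ∃ C, 0 ≤ C ∧ ∀ᶠ τ : ℂ in 𝓝 (b : ℂ), ‖n τ‖ ≤ C * ‖τ - b‖ ^ (1 / 2 : ℝ)

theorem endWeight_mono {E E' : Finset ℝ} (h : E ⊆ E') (τ : ℂ) : endWeight E τ ≤ endWeight E' τ :=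
  add_le_add le_rfl (Finset.sum_le_sum_of_subset_of_nonneg h fun _ _ _ => by positivity)

theorem exists_endWeight_le {E : Finset ℝ} {p : ℝ} (hp : p ∉ E) :
    ∃ C, 0 ≤ C ∧ ∀ᶠ τ : ℂ in 𝓝 (p : ℂ), endWeight E τ ≤ C := by
  have hc : ContinuousAt (endWeight E) (p : ℂ) := by
    unfold endWeight
    refine continuousAt_const.add (tendsto_finsetSum _ fun e he => ?_)
    have h1 : ContinuousAt (fun τ : ℂ => ‖τ - e‖) (p : ℂ) := by fun_prop
    refine h1.rpow_const (Or.inl ?_)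
    have : (p : ℂ) - e ≠ 0 := sub_ne_zero.2 fun h => hp (by
      have : p = e := by exact_mod_cast h
      rwa [this])
    exact norm_ne_zero_iff.2 this
  refine ⟨endWeight E p + 1, by linarith [one_le_endWeight E (p : ℂ)], ?_⟩
  exact hc.eventually (eventually_le_nhds (by linarith))

/-- Near one of its points the weight is comparable to the inverse square root of the distance. -/
theorem exists_endWeight_le_rpow {E : Finset ℝ} (b : ℝ) :
    ∃ C, 0 ≤ C ∧ ∀ᶠ τ : ℂ in 𝓝 (b : ℂ), τ ≠ b →
      endWeight E τ ≤ C * ‖τ - b‖ ^ (-(1 / 2) : ℝ) := by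
  obtain ⟨C, hC0, hC⟩ := exists_endWeight_le (E := E.erase b) (p := b) (Finset.notMem_erase b E)
  refine ⟨C + 1, by positivity, ?_⟩
  filter_upwards [hC, Metric.ball_mem_nhds (b : ℂ) one_pos] with τ h1 h2 hne
  have hpos : 0 < ‖τ - b‖ := norm_pos_iff.2 (sub_ne_zero.2 hne)
  have hle : ‖τ - b‖ ≤ 1 := by
    rw [Metric.mem_ball, dist_eq_norm] at h2
    exact h2.le
  have h3 : (1 : ℝ) ≤ ‖τ - b‖ ^ (-(1 / 2) : ℝ) :=
    Real.one_le_rpow_of_pos_of_le_one_of_nonpos hpos hle (by norm_num)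
  have h4 : endWeight E τ ≤ endWeight (E.erase b) τ + ‖τ - b‖ ^ (-(1 / 2) : ℝ) := by
    unfold endWeight
    by_cases hb : b ∈ E
    · rw [← Finset.sum_erase_add _ _ hb]
      linarith
    · rw [Finset.erase_eq_of_notMem hb]
      linarith
  calc endWeight E τ ≤ C + ‖τ - b‖ ^ (-(1 / 2) : ℝ) := by linarith
    _ ≤ (C + 1) * ‖τ - b‖ ^ (-(1 / 2) : ℝ) := by nlinarith

theorem IsSectHolo.growth_of_le {E : Finset ℝ} {g : ℂ → ℂ} {p : ℝ} {C : ℝ} (hC : 0 ≤ C)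
    (h : ∀ᶠ τ : ℂ in 𝓝 (p : ℂ), τ.im ≠ 0 → ‖g τ‖ ≤ C) :
    ∃ C, ∀ᶠ τ : ℂ in 𝓝 (p : ℂ), τ.im ≠ 0 → ‖g τ‖ ≤ C * endWeight E τ :=
  ⟨C, h.mono fun τ hτ him => (hτ him).trans (le_mul_of_one_le_right hC (one_le_endWeight E τ))⟩

theorem cauchyInt_const_mul (S : Set ℝ) (f : ℝ → ℂ) (c τ : ℂ) :
    cauchyInt S (fun σ => c * f σ) τ = c * cauchyInt S f τ := by
  unfold cauchyInt
  rw [← integral_const_mul]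
  simp only [mul_div_assoc]

theorem cauchyInt_congr {S A : Set ℝ} (hS : MeasurableSet S) (hA : (S \ A).Finite) {f g : ℝ → ℂ}
    (h : ∀ σ ∈ A, f σ = g σ) (τ : ℂ) : cauchyInt S f τ = cauchyInt S g τ := by
  refine setIntegral_congr_ae hS ?_
  have : ∀ᵐ σ : ℝ, σ ∉ S \ A := measure_eq_zero_iff_ae_notMem.1 (hA.measure_zero _)
  filter_upwards [this] with σ h1 h2
  rw [h σ (by_contra fun h3 => h1 ⟨h2, h3⟩)]

namespace IsCutRoot

variable {S A : Set ℝ} {B X : Finset ℝ} {n : ℂ → ℂ} {np : ℝ → ℂ}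

theorem mem_arcs (h : IsCutRoot S A B X n np) {σ : ℝ} (hσ : σ ∈ S) (hE : σ ∉ B ∪ X) : σ ∈ A := by
  by_contra hA
  exact hE (Finset.mem_union.2 (h.ends σ hσ hA))

theorem finite_sdiff (h : IsCutRoot S A B X n np) : (S \ A).Finite :=
  (B ∪ X).finite_toSet.subset fun σ hσ => by
    by_contra hE
    exact hσ.2 (h.mem_arcs hσ.1 hE)

theorem isSectHolo (h : IsCutRoot S A B X n np) :
    IsSectHolo S (B ∪ X) n 1 np (fun σ => -np σ) where
  diff := h.diff
  inf := h.inf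
  plus σ hσ hE := h.plus σ (h.mem_arcs hσ hE)
  minus σ hσ hE := h.minus σ (h.mem_arcs hσ hE)
  growth e _ _ := by
    obtain ⟨C, hC0, hC⟩ := h.growth
    refine ⟨C, Eventually.of_forall fun τ hτ => (hC τ hτ).1.trans ?_⟩
    exact mul_le_mul_of_nonneg_left (endWeight_mono Finset.subset_union_right τ) hC0

theorem isSectHolo_inv (h : IsCutRoot S A B X n np) :
    IsSectHolo S (B ∪ X) (fun τ => (n τ)⁻¹) 1 (fun σ => (np σ)⁻¹) (fun σ => -(np σ)⁻¹) where
  diff τ hτ := (h.diff τ hτ).inv (h.ne_zero τ hτ)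
  inf := by simpa using h.inf.inv₀ one_ne_zero
  plus σ hσ hE := (h.plus σ (h.mem_arcs hσ hE)).inv₀ (h.np_ne_zero σ (h.mem_arcs hσ hE))
  minus σ hσ hE := by
    rw [← inv_neg]
    exact (h.minus σ (h.mem_arcs hσ hE)).inv₀ (neg_ne_zero.2 (h.np_ne_zero σ (h.mem_arcs hσ hE)))
  growth e _ _ := by
    obtain ⟨C, hC0, hC⟩ := h.growth
    refine ⟨C, Eventually.of_forall fun τ hτ => (hC τ hτ).2.trans ?_⟩
    exact mul_le_mul_of_nonneg_left (endWeight_mono Finset.subset_union_left τ) hC0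

theorem pi_I_ne : (Real.pi : ℂ) * Complex.I ≠ 0 :=
  mul_ne_zero (by exact_mod_cast Real.pi_ne_zero) Complex.I_ne_zero

theorem isSectHolo_eq {E : Finset ℝ} {g : ℂ → ℂ} {g₀ : ℂ} {f : ℝ → ℂ} (hS : IsCompact S)
    (h : IsSectHolo S E g g₀ f (fun σ => -f σ)) :
    IntegrableOn f S ∧ ∀ τ ∉ (fun σ : ℝ => (σ : ℂ)) '' S,
      g τ = g₀ + 1 / (Real.pi * Complex.I) * cauchyInt S f τ := by
  have e : (fun σ => f σ - -f σ) = fun σ => 2 * f σ := by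
    funext σ
    ring
  constructor
  · have h1 := (h.integrableOn_jump hS).const_mul (1 / 2 : ℂ)
    refine h1.congr (Eventually.of_forall fun σ => ?_)
    simp only
    ring
  · intro τ hτ
    rw [h.eq_cauchyInt hS hτ, e, cauchyInt_const_mul]
    have := pi_I_ne
    field_simp

theorem integrableOn (h : IsCutRoot S A B X n np) : IntegrableOn np S :=
  (isSectHolo_eq h.compact h.isSectHolo).1

theorem integrableOn_inv (h : IsCutRoot S A B X n np) : IntegrableOn (fun σ => (np σ)⁻¹) S :=
  (isSectHolo_eq h.compact h.isSectHolo_inv).1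

theorem cauchyInt_eq (h : IsCutRoot S A B X n np) {τ : ℂ} (hτ : τ ∉ (fun σ : ℝ => (σ : ℂ)) '' S) :
    cauchyInt S np τ = Real.pi * Complex.I * (n τ - 1) := by
  rw [(isSectHolo_eq h.compact h.isSectHolo).2 τ hτ]
  have := pi_I_ne
  field_simp
  ring

theorem cauchyInt_inv_eq (h : IsCutRoot S A B X n np) {τ : ℂ}
    (hτ : τ ∉ (fun σ : ℝ => (σ : ℂ)) '' S) :
    cauchyInt S (fun σ => (np σ)⁻¹) τ = Real.pi * Complex.I * ((n τ)⁻¹ - 1) := by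
  have h1 := (isSectHolo_eq h.compact h.isSectHolo_inv).2 τ hτ
  rw [h1]
  have := pi_I_ne
  field_simp
  ring

/-- Division by `τ - b` at a zero `b` of the root keeps the admissible order of growth. -/
theorem isSectHolo_div (h : IsCutRoot S A B X n np) {b : ℝ} (hb : b ∈ B) (hbS : b ∈ S) :
    IsSectHolo S (B ∪ X) (fun τ => n τ / (τ - b)) 0 (fun σ => np σ / (σ - b))
      (fun σ => -(np σ / (σ - b))) where
  diff τ hτ := (h.diff τ hτ).div (by fun_prop) fun h0 => hτ ⟨b, hbS, (sub_eq_zero.1 h0).symm⟩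
  inf := by
    have h1 : Tendsto (fun τ : ℂ => τ - b) (cocompact ℂ) (cocompact ℂ) :=
      (Homeomorph.subRight (b : ℂ)).isClosedEmbedding.tendsto_cocompact
    have h2 : Tendsto (fun τ : ℂ => (τ - b)⁻¹) (cocompact ℂ) (𝓝 0) := by
      rw [← Metric.cobounded_eq_cocompact] at h1 ⊢
      exact tendsto_inv₀_cobounded.comp h1
    simpa [div_eq_mul_inv] using h.inf.mul h2
  plus σ hσ hE := by
    have hA := h.mem_arcs hσ hE
    have hne : (σ : ℂ) - b ≠ 0 := sub_ne_zero.2 fun h0 => (h.notMem σ hA).1 (by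
      rwa [show σ = b by exact_mod_cast h0])
    refine (h.plus σ hA).div ?_ hne
    exact ((by fun_prop : Continuous fun τ : ℂ => τ - b).tendsto (σ : ℂ)).mono_left (fromAbove_le σ)
  minus σ hσ hE := by
    have hA := h.mem_arcs hσ hE
    have hne : (σ : ℂ) - b ≠ 0 := sub_ne_zero.2 fun h0 => (h.notMem σ hA).1 (by
      rwa [show σ = b by exact_mod_cast h0])
    rw [← neg_div]
    refine (h.minus σ hA).div ?_ hne
    exact ((by fun_prop : Continuous fun τ : ℂ => τ - b).tendsto (σ : ℂ)).mono_left (fromBelow_le σ)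
  growth e he heS := by
    by_cases heb : e = b
    · subst heb
      obtain ⟨C, hC0, hC⟩ := h.zero e hb hbS
      refine ⟨C, ?_⟩
      filter_upwards [hC] with τ h1 him
      have hpos : 0 < ‖τ - e‖ := norm_pos_iff.2 fun h => him (by simpa using congrArg Complex.im h)
      rw [norm_div, div_le_iff₀ hpos]
      have h2 : ‖τ - e‖ ^ (1 / 2 : ℝ) = ‖τ - e‖ ^ (-(1 / 2) : ℝ) * ‖τ - e‖ := by
        rw [← Real.rpow_add_one hpos.ne']
        norm_num
      have h3 : ‖τ - e‖ ^ (-(1 / 2) : ℝ) ≤ endWeight (B ∪ X) τ := by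
        unfold endWeight
        have := Finset.single_le_sum (f := fun e : ℝ => ‖τ - e‖ ^ (-(1 / 2) : ℝ))
          (fun _ _ => by positivity) he
        linarith
      calc ‖n τ‖ ≤ C * ‖τ - e‖ ^ (1 / 2 : ℝ) := h1
        _ = C * ‖τ - e‖ ^ (-(1 / 2) : ℝ) * ‖τ - e‖ := by rw [h2, mul_assoc]
        _ ≤ C * endWeight (B ∪ X) τ * ‖τ - e‖ :=
          mul_le_mul_of_nonneg_right (mul_le_mul_of_nonneg_left h3 hC0) hpos.le
    · obtain ⟨C, hC0, hC⟩ := h.growth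
      have hd : 0 < |e - b| := abs_pos.2 (sub_ne_zero.2 heb)
      have h1 : ∀ᶠ τ : ℂ in 𝓝 (e : ℂ), |e - b| / 2 < ‖τ - b‖ := by
        have : Tendsto (fun τ : ℂ => ‖τ - b‖) (𝓝 (e : ℂ)) (𝓝 ‖(e : ℂ) - b‖) :=
          (by fun_prop : Continuous fun τ : ℂ => ‖τ - b‖).tendsto _
        refine this.eventually (lt_mem_nhds ?_)
        rw [← Complex.ofReal_sub, Complex.norm_real, Real.norm_eq_abs]
        linarith
      refine ⟨C / (|e - b| / 2), ?_⟩
      filter_upwards [h1] with τ h2 him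
      have h3 := (hC τ him).1.trans
        (mul_le_mul_of_nonneg_left (endWeight_mono Finset.subset_union_right τ) hC0 :
          _ ≤ C * endWeight (B ∪ X) τ)
      rw [norm_div, div_mul_eq_mul_div]
      exact div_le_div₀ ((norm_nonneg _).trans h3) h3 (by positivity) h2.le

/-- At a branch point of vanishing the singular integral of `np` converges absolutely. -/
theorem integral_div_base (h : IsCutRoot S A B X n np) {b : ℝ} (hb : b ∈ B) (hbS : b ∈ S) :
    IntegrableOn (fun σ => np σ / (σ - b)) S ∧
      ∫ σ in S, np σ / (σ - b) = -(Real.pi * Complex.I) := by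
  obtain ⟨h1, h2⟩ := isSectHolo_eq h.compact (h.isSectHolo_div hb hbS)
  refine ⟨h1, ?_⟩
  have hτ : Complex.I ∉ (fun σ : ℝ => (σ : ℂ)) '' S := notMem_image_of_im_ne_zero S (by simp)
  have h3 := h2 _ hτ
  have h4 : cauchyInt S (fun σ => np σ / (σ - b)) Complex.I * (Complex.I - b) =
      cauchyInt S np Complex.I - ∫ σ in S, np σ / (σ - b) := by
    unfold cauchyInt
    rw [← integral_mul_const, ← integral_sub (integrableOn_div_sub h.compact h.integrableOn hτ) h1]
    refine setIntegral_congr_ae h.compact.measurableSet ?_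
    have : ∀ᵐ σ : ℝ, σ ∉ ({b} : Set ℝ) := measure_eq_zero_iff_ae_notMem.1 (by simp)
    filter_upwards [this] with σ hσ hσS
    have e1 : (σ : ℂ) - b ≠ 0 := sub_ne_zero.2 fun h0 => hσ (by exact_mod_cast h0)
    have e2 := ofReal_sub_ne_zero hτ hσS
    field_simp
    ring
  rw [h.cauchyInt_eq hτ] at h4
  have e3 : Complex.I - (b : ℂ) ≠ 0 := fun h0 => hτ ⟨b, hbS, (sub_eq_zero.1 h0).symm⟩
  have e4 := pi_I_ne
  have h5 : n Complex.I * (Real.pi * Complex.I) =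
      cauchyInt S (fun σ => np σ / (σ - b)) Complex.I * (Complex.I - b) := by
    rw [zero_add, div_eq_iff e3] at h3
    rw [h3]
    field_simp
  linear_combination h5 + h4

/-- By Plemelj's formula and the explicit form `πi (n - 1)` of the Cauchy integral of `np`. -/
theorem hasPVIntegral (h : IsCutRoot S A B X n np) {σ : ℝ} (hσ : σ ∈ A) :
    HasPVIntegral S {σ} (fun x => np x / (x - σ)) (-(Real.pi * Complex.I)) := by
  obtain ⟨ρ, hρ, hI, ⟨γ, hγ, hγ1, C, hC0, hC⟩, -⟩ := h.holder σ hσ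
  obtain ⟨L, hL, hp, -⟩ := plemelj h.compact h.integrableOn hρ (hI.trans h.subset) hγ hC
  have h1 : Tendsto (cauchyInt S np) (fromAbove σ) (𝓝 (Real.pi * Complex.I * (np σ - 1))) := by
    refine (((h.plus σ hσ).sub_const 1).const_mul (Real.pi * Complex.I : ℂ)).congr' ?_
    filter_upwards [eventually_im_pos σ] with τ hτ
    exact (h.cauchyInt_eq (notMem_image_of_im_ne_zero S hτ.ne')).symm
  have h2 := tendsto_nhds_unique hp h1
  have : L = -(Real.pi * Complex.I) := by linear_combination h2
  rwa [← this]

theorem norm_le (h : IsCutRoot S A B X n np) : ∃ C, 0 ≤ C ∧ ∀ σ ∈ A,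
    ‖np σ‖ ≤ C * (1 + ∑ b ∈ X, |σ - b| ^ (-(1 / 2) : ℝ)) ∧
    ‖(np σ)⁻¹‖ ≤ C * (1 + ∑ b ∈ B, |σ - b| ^ (-(1 / 2) : ℝ)) := by
  obtain ⟨C, hC0, hC⟩ := h.growth
  refine ⟨C, hC0, fun σ hσ => ⟨?_, ?_⟩⟩
  · refine le_of_tendsto (((h.plus σ hσ).comp (tendsto_add_mul_I σ)).norm) ?_
    filter_upwards [self_mem_nhdsWithin] with y hy
    refine ((hC _ ?_).1).trans (mul_le_mul_of_nonneg_left (endWeight_le (h.notMem σ hσ).2 y) hC0)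
    simpa using (ne_of_gt hy)
  · refine le_of_tendsto ((((h.plus σ hσ).inv₀ (h.np_ne_zero σ hσ)).comp
      (tendsto_add_mul_I σ)).norm) ?_
    filter_upwards [self_mem_nhdsWithin] with y hy
    refine ((hC _ ?_).2).trans (mul_le_mul_of_nonneg_left (endWeight_le (h.notMem σ hσ).1 y) hC0)
    simpa using (ne_of_gt hy)

theorem norm_inv_le (h : IsCutRoot S A B X n np) : ∃ C, 0 ≤ C ∧ ∀ σ ∈ S, σ ∉ B →
    ‖(np σ)⁻¹‖ ≤ C * (1 + ∑ b ∈ B, |σ - b| ^ (-(1 / 2) : ℝ)) := by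
  obtain ⟨C, hC0, hC⟩ := h.norm_le
  have hX : 0 ≤ ∑ x ∈ X, ‖(np x)⁻¹‖ := Finset.sum_nonneg fun _ _ => norm_nonneg _
  refine ⟨C + ∑ x ∈ X, ‖(np x)⁻¹‖, by positivity, fun σ hσ hB => ?_⟩
  have hw : 1 ≤ 1 + ∑ b ∈ B, |σ - b| ^ (-(1 / 2) : ℝ) :=
    le_add_of_nonneg_right (Finset.sum_nonneg fun _ _ => by positivity)
  by_cases hA : σ ∈ A
  · refine (hC σ hA).2.trans (mul_le_mul_of_nonneg_right (by linarith) (by linarith))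
  · have hσX : σ ∈ X := (h.ends σ hσ hA).resolve_left hB
    have h1 := Finset.single_le_sum (f := fun x => ‖(np x)⁻¹‖) (fun _ _ => norm_nonneg _) hσX
    nlinarith

end IsCutRoot

/-! ### The algebraic link between the singular and the regularized equation -/

namespace IsSectHolo

variable {S : Set ℝ} {E : Finset ℝ} {g g' : ℂ → ℂ} {g₀ g₀' : ℂ} {gp gm gp' gm' : ℝ → ℂ}

theorem add (h : IsSectHolo S E g g₀ gp gm) (h' : IsSectHolo S E g' g₀' gp' gm') :
    IsSectHolo S E (fun τ => g τ + g' τ) (g₀ + g₀') (fun σ => gp σ + gp' σ)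
      (fun σ => gm σ + gm' σ) where
  diff τ hτ := (h.diff τ hτ).add (h'.diff τ hτ)
  inf := h.inf.add h'.inf
  plus σ hσ hE := (h.plus σ hσ hE).add (h'.plus σ hσ hE)
  minus σ hσ hE := (h.minus σ hσ hE).add (h'.minus σ hσ hE)
  growth e he heS := by
    obtain ⟨C, hC⟩ := h.growth e he heS
    obtain ⟨C', hC'⟩ := h'.growth e he heS
    refine ⟨C + C', ?_⟩
    filter_upwards [hC, hC'] with τ h1 h2 him
    rw [add_mul]
    exact (norm_add_le _ _).trans (add_le_add (h1 him) (h2 him))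

end IsSectHolo

namespace IsCutRoot

variable {S A : Set ℝ} {B X : Finset ℝ} {n : ℂ → ℂ} {np : ℝ → ℂ}

/-- The defect of the approximation of `-(1/πi) ∫ np u / (σ - τ)` by `U - n u`, the functions `u`
and `U` being taken at a point `p τ` of the cut next to `τ`. -/
def defect (S : Set ℝ) (np : ℝ → ℂ) (u U : ℝ → ℂ) (p : ℂ → ℝ) (τ : ℂ) : ℂ :=
  u (p τ) - U (p τ) - 1 / (Real.pi * Complex.I) * subInt S np u (u (p τ)) τ

/-- One summand of the auxiliary function whose two boundary values encode both integral
equations. -/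
def linkTerm (S : Set ℝ) (np : ℝ → ℂ) (c : ℂ) (f u U : ℝ → ℂ) (τ : ℂ) : ℂ :=
  (c + 1 / (Real.pi * Complex.I) * cauchyInt S f τ) *
      (-(1 / (Real.pi * Complex.I)) * cauchyInt S (fun σ => np σ * u σ) τ) -
    1 / (Real.pi * Complex.I) * cauchyInt S (fun σ => f σ * U σ) τ

variable {p : ℂ → ℝ} {u U f : ℝ → ℂ} {K : ℝ} {c : ℂ}

/-- The terms of a summand, with the values of `u` and `U` at `p τ` split off. -/
theorem linkTerm_eq (h : IsCutRoot S A B X n np) (hf : IntegrableOn f S) (hK0 : 0 ≤ K)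
    (hu : ∀ x ∈ S, ∀ y ∈ S, ‖u x - u y‖ ≤ K * |x - y|)
    (hU : ∀ x ∈ S, ∀ y ∈ S, ‖U x - U y‖ ≤ K * |x - y|)
    {τ : ℂ} (hτ : τ ∉ (fun σ : ℝ => (σ : ℂ)) '' S) :
    linkTerm S np c f u U τ =
      -(n τ * (c + 1 / (Real.pi * Complex.I) * cauchyInt S f τ) * u (p τ)) +
      (c + 1 / (Real.pi * Complex.I) * cauchyInt S f τ) * defect S np u U p τ + c * U (p τ) -
      1 / (Real.pi * Complex.I) * subInt S f U (U (p τ)) τ := by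
  unfold linkTerm defect
  rw [cauchyInt_mul_eq h.compact h.integrableOn (continuousOn_of_lipschitz hK0 hu) (u (p τ)) hτ,
    cauchyInt_mul_eq h.compact hf (continuousOn_of_lipschitz hK0 hU) (U (p τ)) hτ,
    h.cauchyInt_eq hτ]
  have := pi_I_ne
  field_simp
  ring

theorem tendsto_defect (h : IsCutRoot S A B X n np) (hpS : ∀ τ, p τ ∈ S)
    (hp : ∀ τ : ℂ, ∀ σ ∈ S, |σ - p τ| ≤ 2 * ‖(σ : ℂ) - τ‖) (hK0 : 0 ≤ K)
    (hu : ∀ x ∈ S, ∀ y ∈ S, ‖u x - u y‖ ≤ K * |x - y|)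
    (hU : ∀ x ∈ S, ∀ y ∈ S, ‖U x - U y‖ ≤ K * |x - y|)
    (hUu : ∀ σ ∈ S, U σ = u σ - 1 / (Real.pi * Complex.I) * subInt S np u (u σ) σ)
    {σ : ℝ} (hσ : σ ∈ S) : Tendsto (defect S np u U p) (𝓝 (σ : ℂ)) (𝓝 0) := by
  have h1 := ((tendsto_comp_nearest hpS hp hK0 hu hσ).sub
    (tendsto_comp_nearest hpS hp hK0 hU hσ)).sub
    ((tendsto_subInt h.compact h.integrableOn hpS hp hK0 hu hσ).const_mul
      (1 / (Real.pi * Complex.I) : ℂ))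
  have h2 : u σ - U σ - 1 / (Real.pi * Complex.I) * subInt S np u (u σ) σ = 0 := by
    rw [hUu σ hσ]
    ring
  rwa [h2] at h1

/-- At a zero of the root the defect vanishes to first order. -/
theorem norm_defect_le (h : IsCutRoot S A B X n np) (hpS : ∀ τ, p τ ∈ S)
    (hp : ∀ τ : ℂ, ∀ σ ∈ S, |σ - p τ| ≤ 2 * ‖(σ : ℂ) - τ‖) (hK0 : 0 ≤ K)
    (hu : ∀ x ∈ S, ∀ y ∈ S, ‖u x - u y‖ ≤ K * |x - y|)
    (hU : ∀ x ∈ S, ∀ y ∈ S, ‖U x - U y‖ ≤ K * |x - y|)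
    (hUu : ∀ σ ∈ S, U σ = u σ - 1 / (Real.pi * Complex.I) * subInt S np u (u σ) σ)
    {b : ℝ} (hb : b ∈ B) (hbS : b ∈ S) :
    ∃ C, 0 ≤ C ∧ ∀ τ : ℂ, τ.im ≠ 0 → ‖defect S np u U p τ‖ ≤ C * ‖τ - b‖ := by
  obtain ⟨hg, hgI⟩ := h.integral_div_base hb hbS
  set g : ℝ → ℂ := fun σ => np σ / (σ - b) with hgdef
  have huc := continuousOn_of_lipschitz hK0 hu
  have hgu : IntegrableOn (fun σ => g σ * u σ) S := hg.mul_continuousOn huc h.compact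
  have hae : ∀ᵐ σ : ℝ, σ ∉ ({b} : Set ℝ) := measure_eq_zero_iff_ae_notMem.1 (by simp)
  have hgc : ∀ c : ℂ, IntegrableOn (fun σ => g σ * (u σ - c)) S := fun c =>
    hg.mul_continuousOn (huc.sub continuousOn_const) h.compact
  have hI : ∀ c : ℂ, ∫ σ in S, g σ * (u σ - c) =
      (∫ σ in S, g σ * u σ) + c * (Real.pi * Complex.I) := by
    intro c
    simp only [mul_sub]
    rw [integral_sub hgu (hg.mul_const c), integral_mul_const, hgI]
    ring
  have e1 : subInt S np u (u b) b = ∫ σ in S, g σ * (u σ - u b) := by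
    unfold subInt
    refine integral_congr_ae (Eventually.of_forall fun σ => ?_)
    simp only [hgdef]
    ring
  have e2 : ∀ τ : ℂ, τ.im ≠ 0 → ∀ c : ℂ, subInt S np u c τ =
      (∫ σ in S, g σ * (u σ - c)) + (τ - b) * subInt S g u c τ := by
    intro τ him c
    have hτ := notMem_image_of_im_ne_zero S him
    unfold subInt
    rw [← integral_const_mul, ← integral_add (hgc c)
      ((integrableOn_div_sub h.compact (hgc c) hτ).const_mul _)]
    refine setIntegral_congr_ae h.compact.measurableSet ?_
    filter_upwards [hae] with σ hσ hσS
    have e1 : (σ : ℂ) - b ≠ 0 := sub_ne_zero.2 fun h0 => hσ (by exact_mod_cast h0)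
    have e2 := ofReal_sub_ne_zero hτ hσS
    simp only [hgdef]
    field_simp
    ring
  refine ⟨K * 2 + ‖(1 / (Real.pi * Complex.I) : ℂ)‖ * (2 * K * ∫ σ in S, ‖g σ‖), ?_, ?_⟩
  · have : 0 ≤ ∫ σ in S, ‖g σ‖ := integral_nonneg fun _ => norm_nonneg _
    positivity
  intro τ him
  have e3 : defect S np u U p τ = (U b - U (p τ)) -
      1 / (Real.pi * Complex.I) * ((τ - b) * subInt S g u (u (p τ)) τ) := by
    unfold defect
    rw [e2 τ him, hUu b hbS, e1, hI, hI]
    have := pi_I_ne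
    field_simp
    ring
  rw [e3]
  refine (norm_sub_le _ _).trans ?_
  have h1 : ‖U b - U (p τ)‖ ≤ K * (2 * ‖τ - b‖) := by
    refine (hU b hbS _ (hpS τ)).trans (mul_le_mul_of_nonneg_left ?_ hK0)
    rw [norm_sub_rev]
    exact hp τ b hbS
  have h2 := norm_subInt_le h.compact hg hpS hp hK0 hu τ
  rw [norm_mul, norm_mul]
  have h3 : ‖τ - b‖ * ‖subInt S g u (u (p τ)) τ‖ ≤ ‖τ - b‖ * (2 * K * ∫ σ in S, ‖g σ‖) :=
    mul_le_mul_of_nonneg_left h2 (norm_nonneg _)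
  have h4 := mul_le_mul_of_nonneg_left h3 (norm_nonneg (1 / (Real.pi * Complex.I) : ℂ))
  linarith

theorem exists_bound_of_lipschitz (hS : IsCompact S) (hK0 : 0 ≤ K)
    (hu : ∀ x ∈ S, ∀ y ∈ S, ‖u x - u y‖ ≤ K * |x - y|) : ∃ M, 0 ≤ M ∧ ∀ x ∈ S, ‖u x‖ ≤ M := by
  obtain ⟨M, hM⟩ := hS.exists_bound_of_continuousOn (continuousOn_of_lipschitz hK0 hu)
  exact ⟨max M 0, le_max_right _ _, fun x hx => (hM x hx).trans (le_max_left _ _)⟩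

theorem exists_norm_defect_le (h : IsCutRoot S A B X n np) (hpS : ∀ τ, p τ ∈ S)
    (hp : ∀ τ : ℂ, ∀ σ ∈ S, |σ - p τ| ≤ 2 * ‖(σ : ℂ) - τ‖) (hK0 : 0 ≤ K)
    (hu : ∀ x ∈ S, ∀ y ∈ S, ‖u x - u y‖ ≤ K * |x - y|)
    (hU : ∀ x ∈ S, ∀ y ∈ S, ‖U x - U y‖ ≤ K * |x - y|) :
    ∃ C, 0 ≤ C ∧ ∀ τ, ‖defect S np u U p τ‖ ≤ C := by
  obtain ⟨M, hM0, hM⟩ := exists_bound_of_lipschitz h.compact hK0 hu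
  obtain ⟨M', hM0', hM'⟩ := exists_bound_of_lipschitz h.compact hK0 hU
  refine ⟨M + M' + ‖(1 / (Real.pi * Complex.I) : ℂ)‖ * (2 * K * ∫ σ in S, ‖np σ‖), ?_,
    fun τ => ?_⟩
  · have : 0 ≤ ∫ σ in S, ‖np σ‖ := integral_nonneg fun _ => norm_nonneg _
    positivity
  unfold defect
  refine (norm_sub_le _ _).trans (add_le_add ((norm_sub_le _ _).trans
    (add_le_add (hM _ (hpS τ)) (hM' _ (hpS τ)))) ?_)
  rw [norm_mul]
  exact mul_le_mul_of_nonneg_left (norm_subInt_le h.compact h.integrableOn hpS hp hK0 hu τ)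
    (norm_nonneg _)

/-- Near a base point `n⁻¹` is at most of the order of the inverse square root. -/
theorem exists_norm_inv_sq_le (h : IsCutRoot S A B X n np) (b : ℝ) :
    ∃ C, 0 ≤ C ∧ ∀ᶠ τ : ℂ in 𝓝 (b : ℂ), τ.im ≠ 0 → ‖(n τ)⁻¹‖ ^ 2 * ‖τ - b‖ ≤ C := by
  obtain ⟨C, hC0, hC⟩ := h.growth
  obtain ⟨C', hC0', hC'⟩ := exists_endWeight_le_rpow (E := B) b
  refine ⟨(C * C') ^ 2, by positivity, ?_⟩
  filter_upwards [hC'] with τ h1 him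
  have hpos : 0 < ‖τ - b‖ := norm_pos_iff.2 fun h => him (by simpa using congrArg Complex.im h)
  have h2 : ‖(n τ)⁻¹‖ ≤ C * C' * ‖τ - b‖ ^ (-(1 / 2) : ℝ) := by
    rw [mul_assoc]
    exact (hC τ him).2.trans
      (mul_le_mul_of_nonneg_left (h1 (sub_ne_zero.1 (norm_pos_iff.1 hpos))) hC0)
  have h3 : (‖τ - b‖ ^ (-(1 / 2) : ℝ)) ^ 2 * ‖τ - b‖ = 1 := by
    rw [← Real.rpow_natCast, ← Real.rpow_mul hpos.le, ← Real.rpow_add_one hpos.ne']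
    norm_num
  calc ‖(n τ)⁻¹‖ ^ 2 * ‖τ - b‖ ≤ (C * C' * ‖τ - b‖ ^ (-(1 / 2) : ℝ)) ^ 2 * ‖τ - b‖ := by gcongr
    _ = (C * C') ^ 2 * ((‖τ - b‖ ^ (-(1 / 2) : ℝ)) ^ 2 * ‖τ - b‖) := by ring
    _ = (C * C') ^ 2 := by rw [h3, mul_one]

variable {hp hm : ℝ → ℂ}

/-- A summand and its quotient by the root are sectionally holomorphic, with explicit boundary
values. The second statement needs that the defect vanishes to
first order at the zeros of the root. -/
theorem isSectHolo_linkTerm (h : IsCutRoot S A B X n np) (hne : S.Nonempty)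
    (hf : IntegrableOn f S) (hK0 : 0 ≤ K)
    (hu : ∀ x ∈ S, ∀ y ∈ S, ‖u x - u y‖ ≤ K * |x - y|)
    (hU : ∀ x ∈ S, ∀ y ∈ S, ‖U x - U y‖ ≤ K * |x - y|)
    (hUu : ∀ σ ∈ S, U σ = u σ - 1 / (Real.pi * Complex.I) * subInt S np u (u σ) σ)
    (hplus : ∀ σ ∈ A, Tendsto (fun τ => c + 1 / (Real.pi * Complex.I) * cauchyInt S f τ)
      (fromAbove σ) (𝓝 (hp σ)))
    (hminus : ∀ σ ∈ A, Tendsto (fun τ => c + 1 / (Real.pi * Complex.I) * cauchyInt S f τ)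
      (fromBelow σ) (𝓝 (hm σ)))
    (hB : ∀ b ∈ B, b ∈ S → ∃ C, ∀ᶠ τ : ℂ in 𝓝 (b : ℂ), τ.im ≠ 0 →
      ‖n τ * (c + 1 / (Real.pi * Complex.I) * cauchyInt S f τ)‖ ≤ C)
    (hX : ∀ x ∈ X, x ∈ S → ∃ C, ∀ᶠ τ : ℂ in 𝓝 (x : ℂ), τ.im ≠ 0 →
      ‖c + 1 / (Real.pi * Complex.I) * cauchyInt S f τ‖ ≤ C) :
    IsSectHolo S (B ∪ X) (linkTerm S np c f u U) 0
      (fun σ => -(np σ * hp σ * u σ) +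
        (c * U σ - 1 / (Real.pi * Complex.I) * subInt S f U (U σ) σ))
      (fun σ => np σ * hm σ * u σ +
        (c * U σ - 1 / (Real.pi * Complex.I) * subInt S f U (U σ) σ)) ∧
    IsSectHolo S (B ∪ X) (fun τ => linkTerm S np c f u U τ / n τ) 0
      (fun σ => (-(np σ * hp σ * u σ) +
        (c * U σ - 1 / (Real.pi * Complex.I) * subInt S f U (U σ) σ)) / np σ)
      (fun σ => (np σ * hm σ * u σ +
        (c * U σ - 1 / (Real.pi * Complex.I) * subInt S f U (U σ) σ)) / (-np σ)) := by
  obtain ⟨p, hpS, hpp⟩ := exists_nearest h.compact hne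
  set H : ℂ → ℂ := fun τ => c + 1 / (Real.pi * Complex.I) * cauchyInt S f τ with hH
  have hnu : IntegrableOn (fun σ => np σ * u σ) S :=
    h.integrableOn.mul_continuousOn (continuousOn_of_lipschitz hK0 hu) h.compact
  have hfU : IntegrableOn (fun σ => f σ * U σ) S :=
    hf.mul_continuousOn (continuousOn_of_lipschitz hK0 hU) h.compact
  have hdiff : ∀ τ ∉ (fun σ : ℝ => (σ : ℂ)) '' S, DifferentiableAt ℂ (linkTerm S np c f u U) τ := by
    intro τ hτ
    exact (((differentiableAt_cauchyInt h.compact hf hτ).const_mul _).const_add _ |>.mul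
      ((differentiableAt_cauchyInt h.compact hnu hτ).const_mul _)).sub
      ((differentiableAt_cauchyInt h.compact hfU hτ).const_mul _)
  have hinf : Tendsto (linkTerm S np c f u U) (cocompact ℂ) (𝓝 0) := by
    have := (((tendsto_cauchyInt_cocompact h.compact hf).const_mul
      (1 / (Real.pi * Complex.I) : ℂ)).const_add c |>.mul
      ((tendsto_cauchyInt_cocompact h.compact hnu).const_mul (-(1 / (Real.pi * Complex.I)) : ℂ))).sub
      ((tendsto_cauchyInt_cocompact h.compact hfU).const_mul (1 / (Real.pi * Complex.I) : ℂ))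
    simp only [mul_zero, sub_zero] at this
    exact this
  have hV : ∀ σ ∈ S, Tendsto (defect S np u U p) (𝓝 (σ : ℂ)) (𝓝 0) := fun σ hσ =>
    h.tendsto_defect hpS hpp hK0 hu hU hUu hσ
  -- both boundary values at once: the root tends to `N`, the Cauchy integral of `f` to `L`
  have hlim : ∀ σ ∈ A, ∀ l : Filter ℂ, l ≤ 𝓝 (σ : ℂ) → (∀ᶠ τ in l, τ.im ≠ 0) → ∀ N L : ℂ,
      Tendsto n l (𝓝 N) → Tendsto H l (𝓝 L) → Tendsto (linkTerm S np c f u U) l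
        (𝓝 (-(N * L * u σ) + (c * U σ - 1 / (Real.pi * Complex.I) * subInt S f U (U σ) σ))) := by
    intro σ hσ l hl him N L hN hL
    have hσS := h.subset hσ
    have h1 := (((hN.mul hL).mul ((tendsto_comp_nearest hpS hpp hK0 hu hσS).mono_left hl)).neg.add
      (hL.mul ((hV σ hσS).mono_left hl))).add
      (((tendsto_comp_nearest hpS hpp hK0 hU hσS).mono_left hl).const_mul c) |>.sub
      (((tendsto_subInt h.compact hf hpS hpp hK0 hU hσS).mono_left hl).const_mul
        (1 / (Real.pi * Complex.I) : ℂ))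
    have e : -(N * L * u σ) + L * 0 + c * U σ -
        1 / (Real.pi * Complex.I) * subInt S f U (U σ) σ =
        -(N * L * u σ) + (c * U σ - 1 / (Real.pi * Complex.I) * subInt S f U (U σ) σ) := by ring
    rw [e] at h1
    refine h1.congr' ?_
    filter_upwards [him] with τ hτ
    exact (h.linkTerm_eq hf hK0 hu hU (notMem_image_of_im_ne_zero S hτ)).symm
  have hplus' : ∀ σ ∈ A, Tendsto (linkTerm S np c f u U) (fromAbove σ) (𝓝 (-(np σ * hp σ * u σ) +
        (c * U σ - 1 / (Real.pi * Complex.I) * subInt S f U (U σ) σ))) := fun σ hσ =>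
    hlim σ hσ _ (fromAbove_le σ) ((eventually_im_pos σ).mono fun _ h => ne_of_gt h) _ _
      (h.plus σ hσ) (hplus σ hσ)
  have hminus' : ∀ σ ∈ A, Tendsto (linkTerm S np c f u U) (fromBelow σ) (𝓝 (np σ * hm σ * u σ +
        (c * U σ - 1 / (Real.pi * Complex.I) * subInt S f U (U σ) σ))) := by
    intro σ hσ
    have := hlim σ hσ _ (fromBelow_le σ) ((eventually_im_neg σ).mono fun _ h => ne_of_lt h) _ _
      (h.minus σ hσ) (hminus σ hσ)
    rwa [neg_mul, neg_mul, neg_neg] at this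
  obtain ⟨Mu, hMu0, hMu⟩ := exists_bound_of_lipschitz h.compact hK0 hu
  obtain ⟨MU, hMU0, hMU⟩ := exists_bound_of_lipschitz h.compact hK0 hU
  obtain ⟨MV, hMV0, hMV⟩ := h.exists_norm_defect_le hpS hpp hK0 hu hU
  obtain ⟨Cn, hCn0, hCn⟩ := h.growth
  set M₁ : ℝ := ‖c‖ * MU + ‖(1 / (Real.pi * Complex.I) : ℂ)‖ * (2 * K * ∫ σ in S, ‖f σ‖) with hM₁
  have hM₁0 : 0 ≤ M₁ := by
    have : 0 ≤ ∫ σ in S, ‖f σ‖ := integral_nonneg fun _ => norm_nonneg _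
    positivity
  -- the part of the summand that is bounded near every point
  have hrest : ∀ τ, ‖c * U (p τ) - 1 / (Real.pi * Complex.I) * subInt S f U (U (p τ)) τ‖ ≤ M₁ := by
    intro τ
    refine (norm_sub_le _ _).trans (add_le_add ?_ ?_)
    · rw [norm_mul]
      exact mul_le_mul_of_nonneg_left (hMU _ (hpS τ)) (norm_nonneg _)
    · rw [norm_mul]
      exact mul_le_mul_of_nonneg_left (norm_subInt_le h.compact hf hpS hpp hK0 hU τ) (norm_nonneg _)
  have heq : ∀ τ : ℂ, τ.im ≠ 0 → linkTerm S np c f u U τ = -(n τ * H τ * u (p τ)) +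
      H τ * defect S np u U p τ +
      (c * U (p τ) - 1 / (Real.pi * Complex.I) * subInt S f U (U (p τ)) τ) := by
    intro τ him
    rw [h.linkTerm_eq (p := p) hf hK0 hu hU (notMem_image_of_im_ne_zero S him)]
    simp only [hH]
    ring
  refine ⟨⟨hdiff, hinf, fun σ hσ hE => hplus' σ (h.mem_arcs hσ hE),
    fun σ hσ hE => hminus' σ (h.mem_arcs hσ hE), fun e he heS => ?_⟩,
    ⟨fun τ hτ => (hdiff τ hτ).div (h.diff τ hτ) (h.ne_zero τ hτ), ?_,
    fun σ hσ hE => (hplus' σ (h.mem_arcs hσ hE)).div (h.plus σ (h.mem_arcs hσ hE))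
      (h.np_ne_zero σ (h.mem_arcs hσ hE)),
    fun σ hσ hE => (hminus' σ (h.mem_arcs hσ hE)).div (h.minus σ (h.mem_arcs hσ hE))
      (neg_ne_zero.2 (h.np_ne_zero σ (h.mem_arcs hσ hE))), fun e he heS => ?_⟩⟩
  · rcases Finset.mem_union.1 he with heB | heX
    · obtain ⟨C, hC⟩ := hB e heB heS
      refine ⟨C * Mu + C * (Cn * MV) + M₁, ?_⟩
      filter_upwards [hC] with τ h1 him
      have h1 := h1 him
      have hw : 1 ≤ endWeight (B ∪ X) τ := one_le_endWeight _ _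
      have hC0 : 0 ≤ C := (norm_nonneg _).trans h1
      have hn := h.ne_zero τ (notMem_image_of_im_ne_zero S him)
      have h2 : ‖H τ‖ ≤ C * (Cn * endWeight (B ∪ X) τ) := by
        have e : H τ = n τ * H τ * (n τ)⁻¹ := by field_simp
        rw [e, norm_mul]
        exact mul_le_mul h1 ((hCn τ him).2.trans (mul_le_mul_of_nonneg_left
          (endWeight_mono Finset.subset_union_left τ) hCn0)) (norm_nonneg _) hC0
      rw [heq τ him]
      have t1 : ‖-(n τ * H τ * u (p τ))‖ ≤ C * Mu * endWeight (B ∪ X) τ := by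
        rw [norm_neg, norm_mul]
        exact (mul_le_mul h1 (hMu _ (hpS τ)) (norm_nonneg _) hC0).trans
          (le_mul_of_one_le_right (by positivity) hw)
      have t2 : ‖H τ * defect S np u U p τ‖ ≤ C * (Cn * MV) * endWeight (B ∪ X) τ := by
        rw [norm_mul]
        refine (mul_le_mul h2 (hMV τ) (norm_nonneg _) (by positivity)).trans_eq (by ring)
      have t3 := (hrest τ).trans (le_mul_of_one_le_right hM₁0 hw)
      refine (norm_add_le _ _).trans ((add_le_add ((norm_add_le _ _).trans (add_le_add t1 t2))
        t3).trans_eq (by ring))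
    · obtain ⟨C, hC⟩ := hX e heX heS
      refine ⟨Cn * C * Mu + C * MV + M₁, ?_⟩
      filter_upwards [hC] with τ h1 him
      have h1 := h1 him
      have hw : 1 ≤ endWeight (B ∪ X) τ := one_le_endWeight _ _
      have hC0 : 0 ≤ C := (norm_nonneg _).trans h1
      have hn := (hCn τ him).1.trans (mul_le_mul_of_nonneg_left
          (endWeight_mono (Finset.subset_union_right (s₁ := B)) τ) hCn0)
      rw [heq τ him]
      have t1 : ‖-(n τ * H τ * u (p τ))‖ ≤ Cn * C * Mu * endWeight (B ∪ X) τ := by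
        rw [norm_neg, norm_mul, norm_mul]
        refine (mul_le_mul (mul_le_mul hn h1 (norm_nonneg _) (by positivity)) (hMu _ (hpS τ))
          (norm_nonneg _) (by positivity)).trans_eq (by ring)
      have t2 : ‖H τ * defect S np u U p τ‖ ≤ C * MV * endWeight (B ∪ X) τ := by
        rw [norm_mul]
        exact (mul_le_mul h1 (hMV τ) (norm_nonneg _) hC0).trans
          (le_mul_of_one_le_right (by positivity) hw)
      have t3 := (hrest τ).trans (le_mul_of_one_le_right hM₁0 hw)
      refine (norm_add_le _ _).trans ((add_le_add ((norm_add_le _ _).trans (add_le_add t1 t2))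
        t3).trans_eq (by ring))
  · have := hinf.div h.inf one_ne_zero
    rwa [zero_div] at this
  · have hdiv : ∀ τ : ℂ, τ.im ≠ 0 → linkTerm S np c f u U τ / n τ = -(H τ * u (p τ)) +
        H τ * defect S np u U p τ / n τ +
        (c * U (p τ) - 1 / (Real.pi * Complex.I) * subInt S f U (U (p τ)) τ) / n τ := by
      intro τ him
      have hn := h.ne_zero τ (notMem_image_of_im_ne_zero S him)
      rw [heq τ him]
      field_simp
    rcases Finset.mem_union.1 he with heB | heX
    · obtain ⟨C, hC⟩ := hB e heB heS
      obtain ⟨C₂, hC₂0, hC₂⟩ := h.norm_defect_le hpS hpp hK0 hu hU hUu heB heS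
      obtain ⟨C₃, hC₃0, hC₃⟩ := h.exists_norm_inv_sq_le e
      refine ⟨C * Cn * Mu + C * (C₂ * C₃) + M₁ * Cn, ?_⟩
      filter_upwards [hC, hC₃] with τ h1 h3 him
      have h1 := h1 him
      have hw : 1 ≤ endWeight (B ∪ X) τ := one_le_endWeight _ _
      have hC0 : 0 ≤ C := (norm_nonneg _).trans h1
      have hn := h.ne_zero τ (notMem_image_of_im_ne_zero S him)
      have hni : ‖(n τ)⁻¹‖ ≤ Cn * endWeight (B ∪ X) τ := (hCn τ him).2.trans
        (mul_le_mul_of_nonneg_left (endWeight_mono Finset.subset_union_left τ) hCn0)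
      rw [hdiv τ him]
      have t1 : ‖-(H τ * u (p τ))‖ ≤ C * Cn * Mu * endWeight (B ∪ X) τ := by
        have e : H τ = n τ * H τ * (n τ)⁻¹ := by field_simp
        rw [norm_neg, e, norm_mul, norm_mul]
        refine (mul_le_mul (mul_le_mul h1 hni (norm_nonneg _) hC0) (hMu _ (hpS τ))
          (norm_nonneg _) (by positivity)).trans_eq (by ring)
      have t2 : ‖H τ * defect S np u U p τ / n τ‖ ≤ C * (C₂ * C₃) * endWeight (B ∪ X) τ := by
        have hq : H τ * defect S np u U p τ / n τ =
          n τ * H τ * (defect S np u U p τ * (n τ)⁻¹ ^ 2) := by field_simp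
        rw [hq, norm_mul (n τ * H τ), norm_mul (defect S np u U p τ), norm_pow]
        have h4 : ‖defect S np u U p τ‖ * ‖(n τ)⁻¹‖ ^ 2 ≤ C₂ * C₃ := by
          calc _ ≤ C₂ * ‖τ - e‖ * ‖(n τ)⁻¹‖ ^ 2 := by
                exact mul_le_mul_of_nonneg_right (hC₂ τ him) (by positivity)
            _ = C₂ * (‖(n τ)⁻¹‖ ^ 2 * ‖τ - e‖) := by ring
            _ ≤ _ := mul_le_mul_of_nonneg_left (h3 him) hC₂0
        exact (mul_le_mul h1 h4 (by positivity) hC0).trans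
          (le_mul_of_one_le_right (by positivity) hw)
      have t3 : ‖(c * U (p τ) - 1 / (Real.pi * Complex.I) * subInt S f U (U (p τ)) τ) / n τ‖ ≤
          M₁ * Cn * endWeight (B ∪ X) τ := by
        rw [div_eq_mul_inv, norm_mul, mul_assoc]
        exact mul_le_mul (hrest τ) hni (norm_nonneg _) hM₁0
      refine (norm_add_le _ _).trans ((add_le_add ((norm_add_le _ _).trans (add_le_add t1 t2))
        t3).trans_eq (by ring))
    · obtain ⟨C, hC⟩ := hX e heX heS
      refine ⟨C * Mu + C * MV * Cn + M₁ * Cn, ?_⟩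
      filter_upwards [hC] with τ h1 him
      have h1 := h1 him
      have hw : 1 ≤ endWeight (B ∪ X) τ := one_le_endWeight _ _
      have hC0 : 0 ≤ C := (norm_nonneg _).trans h1
      have hni : ‖(n τ)⁻¹‖ ≤ Cn * endWeight (B ∪ X) τ := (hCn τ him).2.trans
        (mul_le_mul_of_nonneg_left (endWeight_mono Finset.subset_union_left τ) hCn0)
      rw [hdiv τ him]
      have t1 : ‖-(H τ * u (p τ))‖ ≤ C * Mu * endWeight (B ∪ X) τ := by
        rw [norm_neg, norm_mul]
        exact (mul_le_mul h1 (hMu _ (hpS τ)) (norm_nonneg _) hC0).trans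
          (le_mul_of_one_le_right (by positivity) hw)
      have t2 : ‖H τ * defect S np u U p τ / n τ‖ ≤ C * MV * Cn * endWeight (B ∪ X) τ := by
        rw [div_eq_mul_inv, norm_mul, norm_mul]
        refine (mul_le_mul (mul_le_mul h1 (hMV τ) (norm_nonneg _) hC0) hni (norm_nonneg _)
          (by positivity)).trans_eq (by ring)
      have t3 : ‖(c * U (p τ) - 1 / (Real.pi * Complex.I) * subInt S f U (U (p τ)) τ) / n τ‖ ≤
          M₁ * Cn * endWeight (B ∪ X) τ := by
        rw [div_eq_mul_inv, norm_mul, mul_assoc]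
        exact mul_le_mul (hrest τ) hni (norm_nonneg _) hM₁0
      refine (norm_add_le _ _).trans ((add_le_add ((norm_add_le _ _).trans (add_le_add t1 t2))
        t3).trans_eq (by ring))

/-- The homogeneous condition on the sum of the boundary values is equivalent to an equation of the
second kind for the density: the auxiliary function `∑ linkTerm` has the boundary values
`∓ np ∑ h± u + (second kind side)`, so the first equation says that it has no jump, the second that
its quotient by the root has none; in either case it vanishes by Liouville's theorem. -/
theorem link (h : IsCutRoot S A B X n np) {c : Fin 2 → ℂ} {f u U w hp hm : Fin 2 → ℝ → ℂ}
    {y : ℝ → ℂ}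
    (hf : ∀ b, IntegrableOn (f b) S) (hK0 : 0 ≤ K)
    (hu : ∀ b, ∀ x ∈ S, ∀ y ∈ S, ‖u b x - u b y‖ ≤ K * |x - y|)
    (hU : ∀ b, ∀ x ∈ S, ∀ y ∈ S, ‖U b x - U b y‖ ≤ K * |x - y|)
    (hUu : ∀ b, ∀ σ ∈ S, U b σ = u b σ - 1 / (Real.pi * Complex.I) * subInt S np (u b) (u b σ) σ)
    (hfy : ∀ b, ∀ σ ∈ A, f b σ = (np σ)⁻¹ * (y σ * w b σ))
    (hwu : ∀ σ ∈ A, w 0 σ * u 0 σ + w 1 σ * u 1 σ = 1)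
    (hplus : ∀ b, ∀ σ ∈ A, Tendsto (fun τ => c b + 1 / (Real.pi * Complex.I) * cauchyInt S (f b) τ)
      (fromAbove σ) (𝓝 (hp b σ)))
    (hminus : ∀ b, ∀ σ ∈ A, Tendsto (fun τ => c b + 1 / (Real.pi * Complex.I) * cauchyInt S (f b) τ)
      (fromBelow σ) (𝓝 (hm b σ)))
    (hjump : ∀ b, ∀ σ ∈ A, hp b σ - hm b σ = 2 * f b σ)
    (hB : ∀ b, ∀ e ∈ B, e ∈ S → ∃ C, ∀ᶠ τ : ℂ in 𝓝 (e : ℂ), τ.im ≠ 0 →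
      ‖n τ * (c b + 1 / (Real.pi * Complex.I) * cauchyInt S (f b) τ)‖ ≤ C)
    (hX : ∀ b, ∀ e ∈ X, e ∈ S → ∃ C, ∀ᶠ τ : ℂ in 𝓝 (e : ℂ), τ.im ≠ 0 →
      ‖c b + 1 / (Real.pi * Complex.I) * cauchyInt S (f b) τ‖ ≤ C) :
    (∀ σ ∈ A, (hp 0 σ + hm 0 σ) * u 0 σ + (hp 1 σ + hm 1 σ) * u 1 σ = 0) ↔
    ∀ σ ∈ A, y σ = c 0 * U 0 σ + c 1 * U 1 σ - 1 / (Real.pi * Complex.I) *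
      (subInt S (f 0) (U 0) (U 0 σ) σ + subInt S (f 1) (U 1) (U 1 σ) σ) := by
  rcases S.eq_empty_or_nonempty with rfl | hne
  · have : A = ∅ := subset_empty_iff.1 h.subset
    subst this
    simp
  have t := fun b => h.isSectHolo_linkTerm hne (hf b) hK0 (hu b) (hU b) (hUu b) (hplus b)
    (hminus b) (hB b) (hX b)
  have h1 := (t 0).1.add (t 1).1
  have h2 := (t 0).2.add (t 1).2
  have hsum : ∀ σ ∈ A, np σ * ((hp 0 σ - hm 0 σ) * u 0 σ + (hp 1 σ - hm 1 σ) * u 1 σ) =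
      2 * y σ := by
    intro σ hσ
    rw [hjump 0 σ hσ, hjump 1 σ hσ, hfy 0 σ hσ, hfy 1 σ hσ]
    have hnp := h.np_ne_zero σ hσ
    field_simp
    linear_combination y σ * hwu σ hσ
  -- a function without jump is zero, hence so are its boundary values
  have hz : ∀ {g : ℂ → ℂ} {gp gm : ℝ → ℂ}, IsSectHolo S (B ∪ X) g (0 + 0) gp gm →
      (∀ σ ∈ A, gp σ = gm σ) → ∀ σ ∈ A, gp σ = 0 := by
    intro g gp gm hg hj σ hσ
    have hσE : σ ∉ B ∪ X := fun hE => (Finset.mem_union.1 hE).elim (h.notMem σ hσ).1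
      (h.notMem σ hσ).2
    refine tendsto_nhds_unique (hg.plus σ (h.subset hσ) hσE) ?_
    refine tendsto_const_nhds.congr' ?_
    filter_upwards [eventually_im_pos σ] with τ hτ
    rw [hg.eq_const h.compact (fun s hs hsE => hj s (h.mem_arcs hs hsE))
      (notMem_image_of_im_ne_zero S hτ.ne'), add_zero]
  constructor
  · intro hq σ hσ
    have h3 := hz h1 (fun s hs => by linear_combination -(np s) * hq s hs) σ hσ
    linear_combination -(1 / 2) * hsum σ hσ - (1 / 2) * np σ * hq σ hσ - h3
  · intro hq σ hσ
    have h3 := hz h2 (fun s hs => by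
      have hnp := h.np_ne_zero s hs
      rw [← add_div, ← add_div, div_neg, eq_neg_iff_add_eq_zero, ← add_div, div_eq_zero_iff]
      left
      linear_combination -2 * hq s hs - hsum s hs) σ hσ
    have hnp := h.np_ne_zero σ hσ
    rw [← add_div, div_eq_zero_iff, or_iff_left hnp] at h3
    have h4 : np σ * ((hp 0 σ + hm 0 σ) * u 0 σ + (hp 1 σ + hm 1 σ) * u 1 σ) = 0 := by
      linear_combination -2 * h3 - 2 * hq σ hσ - hsum σ hσ
    exact (mul_eq_zero.1 h4).resolve_left hnp

end IsCutRoot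

/-! ### The root `ν` -/

theorem exists_lipschitz_of_eventually_differentiableAt {g : ℂ → ℂ} {σ : ℝ}
    (hg : ∀ᶠ τ in 𝓝 (σ : ℂ), DifferentiableAt ℂ g τ) :
    ∃ C, 0 ≤ C ∧ ∃ ρ > 0, ∀ x y : ℝ, |x - σ| < ρ → |y - σ| < ρ → ‖g x - g y‖ ≤ C * |x - y| := by
  have h1 : AnalyticAt ℂ g σ := Complex.analyticAt_iff_eventually_differentiableAt.2 hg
  have h2 : ContDiffAt ℂ 1 g σ := h1.contDiffAt
  obtain ⟨K, t, ht, hK⟩ := h2.exists_lipschitzOnWith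
  obtain ⟨ρ, hρ, hρt⟩ := Metric.mem_nhds_iff.1 ht
  have hm : ∀ x : ℝ, |x - σ| < ρ → (x : ℂ) ∈ t := fun x hx => hρt (by
    rwa [Metric.mem_ball, dist_eq_norm, ← Complex.ofReal_sub, Complex.norm_real,
      Real.norm_eq_abs])
  refine ⟨K, K.2, ρ, hρ, fun x y hx hy => ?_⟩
  have := hK.dist_le_mul _ (hm x hx) _ (hm y hy)
  rwa [dist_eq_norm, dist_eq_norm, ← Complex.ofReal_sub, Complex.norm_real,
    Real.norm_eq_abs] at this

theorem mem_ends_of_mem_closure {b a σ : ℝ} (h : σ ∈ closure (Ioo (min a b) (max a b)))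
    (h' : σ ∉ Ioo (min a b) (max a b)) : σ = a ∨ σ = b := by
  by_cases hab : a = b
  · subst hab
    simp at h
  · rw [closure_Ioo_min_max hab] at h
    rcases lt_or_gt_of_ne hab with hlt | hlt
    · rw [min_eq_left hlt.le, max_eq_right hlt.le] at h h'
      by_contra! hc
      exact h' ⟨lt_of_le_of_ne h.1 hc.1.symm, lt_of_le_of_ne h.2 hc.2⟩
    · rw [min_eq_right hlt.le, max_eq_left hlt.le] at h h'
      by_contra! hc
      exact h' ⟨lt_of_le_of_ne h.1 hc.2.symm, lt_of_le_of_ne h.2 hc.1⟩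

theorem ne_of_mem_Ioo_min_max {b a σ : ℝ} (h : σ ∈ Ioo (min a b) (max a b)) : σ ≠ a ∧ σ ≠ b := by
  constructor
  · rintro rfl
    rcases le_total σ b with hl | hl
    · rw [min_eq_left hl] at h
      exact lt_irrefl _ h.1
    · rw [max_eq_left hl] at h
      exact lt_irrefl _ h.2
  · rintro rfl
    rcases le_total a σ with hl | hl
    · rw [max_eq_right hl] at h
      exact lt_irrefl _ h.2
    · rw [min_eq_right hl] at h
      exact lt_irrefl _ h.1

theorem endWeight_pair {a b : ℝ} (h : a ≠ b) (τ : ℂ) :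
    endWeight {a, b} τ = 1 + (‖τ - a‖ ^ (-(1 / 2) : ℝ) + ‖τ - b‖ ^ (-(1 / 2) : ℝ)) := by
  unfold endWeight
  rw [Finset.sum_pair h]

/-- Of two distinct singularities only one matters at a time. -/
theorem mul_le_endWeight_pair {a b : ℝ} (h : a ≠ b) : ∃ C, 0 ≤ C ∧ ∀ τ : ℂ,
    (1 + ‖τ - a‖ ^ (-(1 / 2) : ℝ)) * (1 + ‖τ - b‖ ^ (-(1 / 2) : ℝ)) ≤ C * endWeight {a, b} τ := by
  have hd : 0 < |a - b| / 2 := by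
    have := abs_pos.2 (sub_ne_zero.2 h)
    linarith
  set D : ℝ := (|a - b| / 2) ^ (-(1 / 2) : ℝ) with hD
  have hD0 : 0 ≤ D := by positivity
  refine ⟨1 + D, by positivity, fun τ => ?_⟩
  rw [endWeight_pair h]
  set α : ℝ := ‖τ - a‖ ^ (-(1 / 2) : ℝ) with hα
  set β : ℝ := ‖τ - b‖ ^ (-(1 / 2) : ℝ) with hβ
  have hα0 : 0 ≤ α := by positivity
  have hβ0 : 0 ≤ β := by positivity
  have h1 : |a - b| ≤ ‖τ - a‖ + ‖τ - b‖ := by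
    have h2 : ((a - b : ℝ) : ℂ) = (τ - b) - (τ - a) := by push_cast; ring
    have h3 := norm_sub_le (τ - b) (τ - (a : ℂ))
    rw [← h2, Complex.norm_real, Real.norm_eq_abs] at h3
    linarith
  rcases le_total (|a - b| / 2) ‖τ - a‖ with h2 | h2
  · have h3 : α ≤ D := Real.rpow_le_rpow_of_nonpos hd h2 (by norm_num)
    nlinarith
  · have h3 : β ≤ D := Real.rpow_le_rpow_of_nonpos hd (by linarith) (by norm_num)
    nlinarith

namespace NullDomain

variable (G : NullDomain) {x : ℝ × ℝ}

theorem max_lt_min (hx : x ∈ G.D) : max x.1 G.r₀ < min x.2 G.s₀ := by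
  obtain ⟨h1, h2, h3⟩ := hx
  exact max_lt (lt_min h3 (G.segment_r _ h1.1 h1.2))
    (lt_min (G.segment_s _ h2.1 h2.2) G.r₀_lt_s₀)

theorem closure_I₃_subset (x : ℝ × ℝ) : closure (G.I₃ x) ⊆ Icc (min x.1 G.r₀) (max x.1 G.r₀) :=
  isClosed_Icc.closure_subset_iff.2 Ioo_subset_Icc_self

theorem closure_I₄_subset (x : ℝ × ℝ) : closure (G.I₄ x) ⊆ Icc (min x.2 G.s₀) (max x.2 G.s₀) :=
  isClosed_Icc.closure_subset_iff.2 Ioo_subset_Icc_self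

theorem lt_of_mem_closure (hx : x ∈ G.D) {σ σ' : ℝ} (hσ : σ ∈ closure (G.I₃ x))
    (hσ' : σ' ∈ closure (G.I₄ x)) : σ < σ' :=
  ((G.closure_I₃_subset x hσ).2.trans_lt (G.max_lt_min hx)).trans_le (G.closure_I₄_subset x hσ').1

theorem differentiableAt_nu {τ : ℂ} (hτ : τ ∉ (fun σ : ℝ => (σ : ℂ)) '' G.arcsBar x) :
    DifferentiableAt ℂ (G.nu x) τ ∧ G.nu x τ ≠ 0 := by
  have h3 := differentiableAt_rootFactor (b := G.r₀) (a := x.1) (τ := τ) fun σ hσ h =>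
    hτ ⟨σ, Or.inl hσ, h⟩
  have h4 := differentiableAt_rootFactor (b := G.s₀) (a := x.2) (τ := τ) fun σ hσ h =>
    hτ ⟨σ, Or.inr hσ, h⟩
  exact ⟨h3.1.mul h4.1, mul_ne_zero h3.2 h4.2⟩

theorem eventually_differentiableAt_rootFactor {b a σ : ℝ}
    (hσ : σ ∉ closure (Ioo (min a b) (max a b))) :
    ∀ᶠ τ in 𝓝 (σ : ℂ), DifferentiableAt ℂ (rootFactor b a) τ := by
  have hc : IsCompact (closure (Ioo (min a b) (max a b))) :=
    isCompact_Icc.of_isClosed_subset isClosed_closure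
      (isClosed_Icc.closure_subset_iff.2 Ioo_subset_Icc_self)
  have h1 : (σ : ℂ) ∈ ((fun σ : ℝ => (σ : ℂ)) '' closure (Ioo (min a b) (max a b)))ᶜ := by
    rintro ⟨s, hs, h⟩
    exact hσ (by rwa [← show s = σ from Complex.ofReal_injective h])
  filter_upwards [(isClosed_image_ofReal hc).isOpen_compl.mem_nhds h1] with τ hτ
  exact (differentiableAt_rootFactor fun s hs h => hτ ⟨s, hs, h⟩).1

theorem exists_branch_nu (hx : x ∈ G.D) {σ : ℝ} (hσ : σ ∈ G.arcs x) :
    ∃ g : ℂ → ℂ, g σ ≠ 0 ∧ (∀ᶠ τ in 𝓝 (σ : ℂ), DifferentiableAt ℂ g τ) ∧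
      ∀ τ : ℂ, (0 < τ.im → G.nu x τ = g τ) ∧ (τ.im < 0 → G.nu x τ = -g τ) := by
  rcases hσ with hσ | hσ
  · obtain ⟨g, -, hg0, hg, hgb⟩ := exists_branch_rootFactor hσ
    have hn : σ ∉ closure (Ioo (min x.2 G.s₀) (max x.2 G.s₀)) := fun h =>
      lt_irrefl _ (G.lt_of_mem_closure hx (subset_closure hσ) h)
    refine ⟨fun τ => g τ * rootFactor G.s₀ x.2 τ, mul_ne_zero hg0 ?_, ?_, fun τ => ⟨?_, ?_⟩⟩
    · exact (differentiableAt_rootFactor fun s hs h => hn (by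
        rwa [← show s = σ by exact_mod_cast h])).2
    · filter_upwards [hg, eventually_differentiableAt_rootFactor hn] with τ h1 h2 using h1.mul h2
    · intro hτ
      rw [nu, (hgb τ).1 hτ]
    · intro hτ
      rw [nu, (hgb τ).2 hτ, neg_mul]
  · obtain ⟨g, -, hg0, hg, hgb⟩ := exists_branch_rootFactor hσ
    have hn : σ ∉ closure (Ioo (min x.1 G.r₀) (max x.1 G.r₀)) := fun h =>
      lt_irrefl _ (G.lt_of_mem_closure hx h (subset_closure hσ))
    refine ⟨fun τ => rootFactor G.r₀ x.1 τ * g τ, mul_ne_zero ?_ hg0, ?_, fun τ => ⟨?_, ?_⟩⟩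
    · exact (differentiableAt_rootFactor fun s hs h => hn (by
        rwa [← show s = σ by exact_mod_cast h])).2
    · filter_upwards [hg, eventually_differentiableAt_rootFactor hn] with τ h1 h2 using h2.mul h1
    · intro hτ
      rw [nu, (hgb τ).1 hτ]
    · intro hτ
      rw [nu, (hgb τ).2 hτ, mul_neg]

theorem tendsto_nu_of_branch {g : ℂ → ℂ} {σ : ℝ} (hg : ContinuousAt g σ)
    (h : ∀ τ : ℂ, (0 < τ.im → G.nu x τ = g τ) ∧ (τ.im < 0 → G.nu x τ = -g τ)) :
    Tendsto (G.nu x) (fromAbove σ) (𝓝 (g σ)) ∧ Tendsto (G.nu x) (fromBelow σ) (𝓝 (-g σ)) ∧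
      G.nuPlus x σ = g σ := by
  have h1 : Tendsto (G.nu x) (fromAbove σ) (𝓝 (g σ)) :=
    (hg.tendsto.mono_left (fromAbove_le σ)).congr' (by
      filter_upwards [eventually_im_pos σ] with τ hτ using ((h τ).1 hτ).symm)
  refine ⟨h1, ?_, plusValue_eq h1⟩
  exact (hg.tendsto.mono_left (fromBelow_le σ)).neg.congr' (by
    filter_upwards [eventually_im_neg σ] with τ hτ using ((h τ).2 hτ).symm)

theorem isOpen_arcs (x : ℝ × ℝ) : IsOpen (G.arcs x) := isOpen_Ioo.union isOpen_Ioo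

theorem isCompact_arcsBar (x : ℝ × ℝ) : IsCompact (G.arcsBar x) :=
  (isCompact_Icc.of_isClosed_subset isClosed_closure (G.closure_I₃_subset x)).union
    (isCompact_Icc.of_isClosed_subset isClosed_closure (G.closure_I₄_subset x))

theorem holder_nuPlus (hx : x ∈ G.D) {σ : ℝ} (hσ : σ ∈ G.arcs x) :
    ∃ ρ > 0, Ioo (σ - 2 * ρ) (σ + 2 * ρ) ⊆ G.arcs x ∧
      IsHolder (G.nuPlus x) (Ioo (σ - 2 * ρ) (σ + 2 * ρ)) ∧
      IsHolder (fun σ => (G.nuPlus x σ)⁻¹) (Ioo (σ - 2 * ρ) (σ + 2 * ρ)) := by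
  obtain ⟨g, hg0, hg, hgb⟩ := G.exists_branch_nu hx hσ
  have hgi : ∀ᶠ τ in 𝓝 (σ : ℂ), DifferentiableAt ℂ (fun τ => (g τ)⁻¹) τ := by
    filter_upwards [hg, hg.self_of_nhds.continuousAt.eventually_ne hg0] with τ h1 h2
      using h1.inv h2
  obtain ⟨C₁, hC₁0, ρ₁, hρ₁, hC₁⟩ := exists_lipschitz_of_eventually_differentiableAt hg
  obtain ⟨C₂, hC₂0, ρ₂, hρ₂, hC₂⟩ := exists_lipschitz_of_eventually_differentiableAt hgi
  obtain ⟨ρ₃, hρ₃, hρ₃A⟩ := Metric.isOpen_iff.1 (G.isOpen_arcs x) σ hσ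
  obtain ⟨ρ₄, hρ₄, hρ₄d⟩ := Metric.mem_nhds_iff.1 hg
  set ρ := min (min ρ₁ ρ₂) (min ρ₃ ρ₄) with hρ
  have hρ0 : 0 < ρ := lt_min (lt_min hρ₁ hρ₂) (lt_min hρ₃ hρ₄)
  have hI : ∀ y ∈ Ioo (σ - 2 * (ρ / 2)) (σ + 2 * (ρ / 2)), |y - σ| < ρ := fun y hy => by
    rw [abs_lt]
    constructor <;> linarith [hy.1, hy.2]
  have h1 : ρ ≤ ρ₁ := (min_le_left _ _).trans (min_le_left _ _)
  have h2 : ρ ≤ ρ₂ := (min_le_left _ _).trans (min_le_right _ _)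
  have h3 : ρ ≤ ρ₃ := (min_le_right _ _).trans (min_le_left _ _)
  have h4 : ρ ≤ ρ₄ := (min_le_right _ _).trans (min_le_right _ _)
  have hnp : ∀ y ∈ Ioo (σ - 2 * (ρ / 2)) (σ + 2 * (ρ / 2)), g y = G.nuPlus x y := fun y hy => by
    refine (G.tendsto_nu_of_branch (DifferentiableAt.continuousAt (𝕜 := ℂ) ?_) hgb).2.2.symm
    apply hρ₄d
    rw [Metric.mem_ball, dist_eq_norm, ← Complex.ofReal_sub, Complex.norm_real, Real.norm_eq_abs]
    exact (hI y hy).trans_le h4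
  have hb : Bornology.IsBounded (Ioo (σ - 2 * (ρ / 2)) (σ + 2 * (ρ / 2))) := Metric.isBounded_Ioo _ _
  refine ⟨ρ / 2, by positivity, fun y hy => hρ₃A ((hI y hy).trans_le h3), ?_, ?_⟩
  · refine (IsHolder.of_lipschitz (f := fun y : ℝ => g y) hb hC₁0 fun y hy z hz => ?_).congr hnp
    exact hC₁ y z ((hI y hy).trans_le h1) ((hI z hz).trans_le h1)
  · refine (IsHolder.of_lipschitz (f := fun y : ℝ => (g y)⁻¹) hb hC₂0 fun y hy z hz => ?_).congr
      fun y hy => by simp only [hnp y hy]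
    exact hC₂ y z ((hI y hy).trans_le h2) ((hI z hz).trans_le h2)

theorem nu_growth (hx : x ∈ G.D) : ∃ C, 0 ≤ C ∧ ∀ τ : ℂ, τ.im ≠ 0 →
    ‖G.nu x τ‖ ≤ C * endWeight {x.1, x.2} τ ∧ ‖(G.nu x τ)⁻¹‖ ≤ C * endWeight {G.r₀, G.s₀} τ := by
  obtain ⟨C₁, hC₁0, hC₁⟩ := mul_le_endWeight_pair hx.2.2.ne
  obtain ⟨C₂, hC₂0, hC₂⟩ := mul_le_endWeight_pair G.r₀_lt_s₀.ne
  set k₃ : ℝ := 1 + |x.1 - G.r₀| ^ (1 / 2 : ℝ) with hk₃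
  set k₄ : ℝ := 1 + |x.2 - G.s₀| ^ (1 / 2 : ℝ) with hk₄
  have hk₃0 : 0 ≤ k₃ := by positivity
  have hk₄0 : 0 ≤ k₄ := by positivity
  refine ⟨k₃ * k₄ * (C₁ + C₂), by positivity, fun τ hτ => ?_⟩
  have w1 := one_le_endWeight {x.1, x.2} τ
  have w2 := one_le_endWeight {G.r₀, G.s₀} τ
  have h3 := norm_rootFactor_le (b := G.r₀) (a := x.1) hτ
  have h4 := norm_rootFactor_le (b := G.s₀) (a := x.2) hτ
  constructor
  · rw [nu, norm_mul]
    refine (mul_le_mul h3.1 h4.1 (norm_nonneg _) (by positivity)).trans ?_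
    calc _ = k₃ * k₄ * ((1 + ‖τ - x.1‖ ^ (-(1 / 2) : ℝ)) * (1 + ‖τ - x.2‖ ^ (-(1 / 2) : ℝ))) := by
          ring
      _ ≤ k₃ * k₄ * ((C₁ + C₂) * endWeight {x.1, x.2} τ) := by
          refine mul_le_mul_of_nonneg_left ((hC₁ τ).trans ?_) (by positivity)
          exact mul_le_mul_of_nonneg_right (by linarith) (by linarith)
      _ = _ := by ring
  · rw [nu, mul_inv, norm_mul]
    refine (mul_le_mul h3.2 h4.2 (norm_nonneg _) (by positivity)).trans ?_
    calc _ = k₃ * k₄ * ((1 + ‖τ - G.r₀‖ ^ (-(1 / 2) : ℝ)) *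
            (1 + ‖τ - G.s₀‖ ^ (-(1 / 2) : ℝ))) := by
          ring
      _ ≤ k₃ * k₄ * ((C₁ + C₂) * endWeight {G.r₀, G.s₀} τ) := by
          refine mul_le_mul_of_nonneg_left ((hC₂ τ).trans ?_) (by positivity)
          exact mul_le_mul_of_nonneg_right (by linarith) (by linarith)
      _ = _ := by ring

theorem mem_arcsBar_base (hx : x ∈ G.D) :
    (G.r₀ ∈ G.arcsBar x → G.r₀ ≠ x.1) ∧ (G.s₀ ∈ G.arcsBar x → G.s₀ ≠ x.2) := by
  have hlt := G.max_lt_min hx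
  constructor
  · rintro (h | h) he
    · rw [I₃, he] at h
      simp at h
    · have h1 := (G.closure_I₄_subset x h).1
      have h2 := le_max_right x.1 G.r₀
      linarith
  · rintro (h | h) he
    · have h1 := (G.closure_I₃_subset x h).2
      have h2 := min_le_right x.2 G.s₀
      linarith
    · rw [I₄, he] at h
      simp at h

theorem nu_zero (hx : x ∈ G.D) {b : ℝ} (hb : b ∈ ({G.r₀, G.s₀} : Finset ℝ))
    (hbS : b ∈ G.arcsBar x) :
    ∃ C, 0 ≤ C ∧ ∀ᶠ τ : ℂ in 𝓝 (b : ℂ), ‖G.nu x τ‖ ≤ C * ‖τ - b‖ ^ (1 / 2 : ℝ) := by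
  have hlt := G.max_lt_min hx
  have key : ∀ {f g : ℂ → ℂ} {b : ℝ}, (∃ C, 0 ≤ C ∧ ∀ᶠ τ : ℂ in 𝓝 (b : ℂ),
      ‖f τ‖ ≤ C * ‖τ - b‖ ^ (1 / 2 : ℝ)) → ContinuousAt g (b : ℂ) →
      ∃ C, 0 ≤ C ∧ ∀ᶠ τ : ℂ in 𝓝 (b : ℂ), ‖f τ * g τ‖ ≤ C * ‖τ - b‖ ^ (1 / 2 : ℝ) := by
    rintro f g b ⟨C, hC0, hC⟩ hg
    refine ⟨C * (‖g b‖ + 1), by positivity, ?_⟩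
    filter_upwards [hC, hg.norm.eventually (eventually_le_nhds (lt_add_one _))] with τ h1 h2
    rw [norm_mul]
    exact (mul_le_mul h1 h2 (norm_nonneg _) (by positivity)).trans_eq (by ring)
  have hrr := (G.mem_arcsBar_base hx).1
  have hss := (G.mem_arcsBar_base hx).2
  rw [Finset.mem_insert, Finset.mem_singleton] at hb
  rcases hb with rfl | rfl
  · refine key (norm_rootFactor_le_of_zero (hrr hbS).symm) ?_
    refine (eventually_differentiableAt_rootFactor fun h => ?_).self_of_nhds.continuousAt
    have h1 := (G.closure_I₄_subset x h).1
    have h2 := le_max_right x.1 G.r₀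
    linarith
  · have := key (norm_rootFactor_le_of_zero (hss hbS).symm)
      (eventually_differentiableAt_rootFactor (b := G.r₀) (a := x.1)
        fun h => ?_).self_of_nhds.continuousAt
    · simpa only [nu, mul_comm] using this
    · have h1 := (G.closure_I₃_subset x h).2
      have h2 := min_le_right x.2 G.s₀
      linarith

theorem isCutRoot_nu (hx : x ∈ G.D) :
    IsCutRoot (G.arcsBar x) (G.arcs x) {G.r₀, G.s₀} {x.1, x.2} (G.nu x) (G.nuPlus x) where
  compact := G.isCompact_arcsBar x
  subset := union_subset_union subset_closure subset_closure
  dense := by rw [arcs, closure_union]; rfl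
  ends σ hσ hA := by
    simp only [Finset.mem_insert, Finset.mem_singleton]
    rcases hσ with h | h
    · have := mem_ends_of_mem_closure h fun h' => hA (Or.inl h')
      tauto
    · have := mem_ends_of_mem_closure h fun h' => hA (Or.inr h')
      tauto
  notMem σ hσ := by
    have hlt := G.max_lt_min hx
    have h1 := min_le_left x.2 G.s₀
    have h2 := min_le_right x.2 G.s₀
    have h3 := le_max_left x.1 G.r₀
    have h4 := le_max_right x.1 G.r₀
    simp only [Finset.mem_insert, Finset.mem_singleton]
    rcases hσ with h | h
    · have h5 := ne_of_mem_Ioo_min_max h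
      have h6 := h.2
      refine ⟨?_, ?_⟩ <;> rintro (h | h)
      · exact h5.2 h
      · linarith
      · exact h5.1 h
      · linarith
    · have h5 := ne_of_mem_Ioo_min_max h
      have h6 := h.1
      refine ⟨?_, ?_⟩ <;> rintro (h | h)
      · linarith
      · exact h5.2 h
      · linarith
      · exact h5.1 h
  disj b hb hbS := by
    have hlt := G.max_lt_min hx
    have h1 := min_le_left x.2 G.s₀
    have h2 := min_le_right x.2 G.s₀
    have h3 := le_max_left x.1 G.r₀
    have h4 := le_max_right x.1 G.r₀
    have h5 := G.mem_arcsBar_base hx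
    simp only [Finset.mem_insert, Finset.mem_singleton] at hb ⊢
    rcases hb with rfl | rfl <;> rintro (h | h)
    · exact h5.1 hbS h
    · linarith
    · linarith
    · exact h5.2 hbS h
  diff τ hτ := (G.differentiableAt_nu hτ).1
  ne_zero τ hτ := (G.differentiableAt_nu hτ).2
  inf := by
    have := (tendsto_rootFactor_cocompact G.r₀ x.1).mul (tendsto_rootFactor_cocompact G.s₀ x.2)
    rwa [one_mul] at this
  plus σ hσ := by
    obtain ⟨g, -, hg, hgb⟩ := G.exists_branch_nu hx hσ
    obtain ⟨h1, -, h3⟩ := G.tendsto_nu_of_branch hg.self_of_nhds.continuousAt hgb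
    rwa [h3]
  minus σ hσ := by
    obtain ⟨g, -, hg, hgb⟩ := G.exists_branch_nu hx hσ
    obtain ⟨-, h2, h3⟩ := G.tendsto_nu_of_branch hg.self_of_nhds.continuousAt hgb
    rwa [h3]
  np_ne_zero σ hσ := by
    obtain ⟨g, h0, hg, hgb⟩ := G.exists_branch_nu hx hσ
    rwa [(G.tendsto_nu_of_branch hg.self_of_nhds.continuousAt hgb).2.2]
  holder σ hσ := G.holder_nuPlus hx hσ
  growth := G.nu_growth hx
  zero b hb hbS := G.nu_zero hx hb hbS

end NullDomain

/-! ### Functions on the line with locally Hölder continuous highest derivative -/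

/-- `f` is `k` times differentiable on the line and its `k`-th derivative obeys a Hölder condition
on every bounded interval. -/
def IsCHolder : ℕ → (ℝ → ℂ) → Prop
  | 0, f => ∀ R : ℝ, IsHolder f (Icc (-R) R)
  | k + 1, f => ∃ f' : ℝ → ℂ, (∀ σ, HasDerivAt f (f' σ) σ) ∧ IsCHolder k f'

namespace IsCHolder

theorem continuous {k : ℕ} {f : ℝ → ℂ} (hf : IsCHolder k f) : Continuous f := by
  cases k with
  | zero =>
    refine continuous_iff_continuousAt.2 fun σ => ?_
    refine (hf (|σ| + 1)).continuousOn.continuousAt (Icc_mem_nhds ?_ ?_)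
    · linarith [neg_abs_le σ]
    · linarith [le_abs_self σ]
  | succ k =>
    obtain ⟨f', h, -⟩ := hf
    exact continuous_iff_continuousAt.2 fun σ => (h σ).continuousAt

theorem exists_lipschitz {k : ℕ} {f : ℝ → ℂ} (hf : IsCHolder (k + 1) f) (R : ℝ) :
    ∃ C, 0 ≤ C ∧ ∀ x ∈ Icc (-R) R, ∀ y ∈ Icc (-R) R, ‖f x - f y‖ ≤ C * |x - y| := by
  obtain ⟨f', h, hf'⟩ := hf
  obtain ⟨C, hC⟩ := isCompact_Icc.exists_bound_of_continuousOn
    (hf'.continuous.continuousOn (s := Icc (-R) R))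
  refine ⟨max C 0, le_max_right _ _, fun x hx y hy => ?_⟩
  exact (convex_Icc (-R) R).norm_image_sub_le_of_norm_hasDerivWithin_le
    (fun z _ => (h z).hasDerivWithinAt) (fun z hz => (hC z hz).trans (le_max_left _ _)) hy hx

theorem of_succ {k : ℕ} {f : ℝ → ℂ} (hf : IsCHolder (k + 1) f) : IsCHolder k f := by
  induction k generalizing f with
  | zero =>
    intro R
    obtain ⟨C, hC0, hC⟩ := hf.exists_lipschitz R
    exact IsHolder.of_lipschitz (Metric.isBounded_Icc _ _) hC0 hC
  | succ k ih =>
    obtain ⟨f', h, hf'⟩ := hf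
    exact ⟨f', h, ih hf'⟩

theorem add {k : ℕ} {f g : ℝ → ℂ} (hf : IsCHolder k f) (hg : IsCHolder k g) :
    IsCHolder k (fun σ => f σ + g σ) := by
  induction k generalizing f g with
  | zero => exact fun R => (hf R).add (Metric.isBounded_Icc _ _) (hg R)
  | succ k ih =>
    obtain ⟨f', h, hf'⟩ := hf
    obtain ⟨g', h', hg'⟩ := hg
    exact ⟨fun σ => f' σ + g' σ, fun σ => (h σ).add (h' σ), ih hf' hg'⟩

theorem mul {k : ℕ} {f g : ℝ → ℂ} (hf : IsCHolder k f) (hg : IsCHolder k g) :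
    IsCHolder k (fun σ => f σ * g σ) := by
  induction k generalizing f g with
  | zero => exact fun R => (hf R).mul (Metric.isBounded_Icc _ _) (hg R)
  | succ k ih =>
    have hf₀ := hf.of_succ
    have hg₀ := hg.of_succ
    obtain ⟨f', h, hf'⟩ := hf
    obtain ⟨g', h', hg'⟩ := hg
    exact ⟨fun σ => f' σ * g σ + f σ * g' σ, fun σ => (h σ).mul (h' σ),
      (ih hf' hg₀).add (ih hf₀ hg')⟩

theorem of_contDiff {k : ℕ} {f : ℝ → ℂ} (hf : ContDiff ℝ (k + 1) f) : IsCHolder k f := by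
  induction k generalizing f with
  | zero =>
    intro R
    have hf : ContDiff ℝ 1 f := by simpa using hf
    have hc : Continuous (deriv f) := hf.continuous_deriv le_rfl
    obtain ⟨C, hC⟩ := isCompact_Icc.exists_bound_of_continuousOn (hc.continuousOn (s := Icc (-R) R))
    refine IsHolder.of_lipschitz (Metric.isBounded_Icc _ _) (le_max_right C 0) fun x hx y hy => ?_
    exact (convex_Icc (-R) R).norm_image_sub_le_of_norm_hasDerivWithin_le
      (fun z _ => (hf.differentiable one_ne_zero z).hasDerivAt.hasDerivWithinAt)
      (fun z hz => (hC z hz).trans (le_max_left _ _)) hy hx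
  | succ k ih =>
    have h1 : ContDiff ℝ ((k : ℕ∞) + 1 + 1) f := by exact_mod_cast hf
    refine ⟨deriv f, fun σ => (h1.differentiable (by simp) σ).hasDerivAt, ih ?_⟩
    have := (contDiff_succ_iff_deriv (n := (k : WithTop ℕ∞) + 1)).1 (by exact_mod_cast hf)
    exact this.2.2

theorem const (k : ℕ) (c : ℂ) : IsCHolder k (fun _ => c) := of_contDiff contDiff_const

/-- Extension by integration of an extension of the derivative. -/
theorem exists_extension {k : ℕ} {g g' f' : ℝ → ℂ} {a b : ℝ}
    (hg : ∀ σ ∈ Icc a b, HasDerivAt g (g' σ) σ) (hf' : IsCHolder k f') (h : EqOn f' g' (Icc a b)) :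
    ∃ f, (∀ σ, HasDerivAt f (f' σ) σ) ∧ IsCHolder (k + 1) f ∧ EqOn f g (Icc a b) := by
  have hc := hf'.continuous
  have hd : ∀ σ, HasDerivAt (fun σ => g a + ∫ t in a..σ, f' t) (f' σ) σ := fun σ =>
    (intervalIntegral.integral_hasDerivAt_right (hc.intervalIntegrable _ _)
      hc.aestronglyMeasurable.stronglyMeasurableAtFilter hc.continuousAt).const_add _
  refine ⟨fun σ => g a + ∫ t in a..σ, f' t, hd, ⟨f', hd, hf'⟩, fun σ hσ => ?_⟩
  have hsub : uIcc a σ ⊆ Icc a b := by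
    rw [uIcc_of_le hσ.1]
    exact Icc_subset_Icc_right hσ.2
  have h1 : ∫ t in a..σ, f' t = ∫ t in a..σ, g' t :=
    intervalIntegral.integral_congr fun t ht => h (hsub ht)
  have h2 : IntervalIntegrable g' volume a σ :=
    (hc.intervalIntegrable a σ).congr fun t ht => h (hsub (uIoc_subset_uIcc ht))
  simp only
  rw [h1, intervalIntegral.integral_eq_sub_of_hasDerivAt (fun t ht => hg t (hsub ht)) h2]
  ring

end IsCHolder

/-- A function of class `C^{2+}` on an open set agrees on a given closed subinterval with a function
of the same kind on the whole line: the second derivative is continued by constants. -/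
theorem IsCPlus.exists_isCHolder {g : ℝ → ℂ} {D : Set ℝ} (hg : IsCPlus 2 g D) (hD : IsOpen D)
    {a b : ℝ} (hab : a ≤ b) (hI : Icc a b ⊆ D) : ∃ f, IsCHolder 2 f ∧ EqOn f g (Icc a b) := by
  obtain ⟨hc, hh⟩ := hg
  obtain ⟨γ, hγ0, hγ1, M, hM⟩ := hh a b hI
  have hh2 := IsHolder.of_holderOnWith (Metric.isBounded_Icc a b) hγ0 hγ1 hM
  obtain ⟨δ, hδ0, hδ1, C, hC0, hC⟩ := hh2
  set g₂ := iteratedDerivWithin 2 g D with hg₂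
  have h1 : ∀ σ ∈ D, HasDerivAt g (derivWithin g D σ) σ := fun σ hσ =>
    ((hc.differentiableOn (by norm_num) σ hσ).hasDerivWithinAt).hasDerivAt (hD.mem_nhds hσ)
  have hc1 : ContDiffOn ℝ 1 (derivWithin g D) D :=
    ((contDiffOn_succ_iff_derivWithin (n := 1) hD.uniqueDiffOn).1
      (by rw [one_add_one_eq_two]; exact_mod_cast hc)).2.2
  have h2 : ∀ σ ∈ D, HasDerivAt (derivWithin g D) (g₂ σ) σ := by
    intro σ hσ
    have := ((hc1.differentiableOn (by norm_num) σ hσ).hasDerivWithinAt).hasDerivAt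
      (hD.mem_nhds hσ)
    have e : g₂ σ = derivWithin (derivWithin g D) D σ := by
      rw [hg₂, iteratedDerivWithin_succ]
      refine derivWithin_congr (fun t _ => ?_) ?_ <;> rw [iteratedDerivWithin_one]
    rwa [e]
  set cl : ℝ → ℝ := fun σ => max a (min b σ) with hcl
  have hclI : ∀ σ, cl σ ∈ Icc a b := fun σ => ⟨le_max_left _ _, max_le hab (min_le_left _ _)⟩
  have hcl1 : ∀ σ ρ, |cl σ - cl ρ| ≤ |σ - ρ| := fun σ ρ =>
    (abs_max_sub_max_le_max a (min b σ) a (min b ρ)).trans (by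
      rw [sub_self, abs_zero, max_eq_right (abs_nonneg _)]
      refine (abs_min_sub_min_le_max b σ b ρ).trans ?_
      rw [sub_self, abs_zero, max_eq_right (abs_nonneg _)])
  have hclE : ∀ σ ∈ Icc a b, cl σ = σ := fun σ hσ => by
    simp only [hcl]
    rw [min_eq_right hσ.2, max_eq_right hσ.1]
  have hf₂ : IsCHolder 0 (fun σ => g₂ (cl σ)) := fun R => ⟨δ, hδ0, hδ1, C, hC0, fun σ _ ρ _ =>
    (hC _ (hclI σ) _ (hclI ρ)).trans (mul_le_mul_of_nonneg_left
      (Real.rpow_le_rpow dist_nonneg (hcl1 σ ρ) hδ0.le) hC0)⟩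
  obtain ⟨f₁, -, hf₁, he₁⟩ := IsCHolder.exists_extension (fun σ hσ => h2 σ (hI hσ)) hf₂
    (fun σ hσ => by simp only [hclE σ hσ])
  obtain ⟨f, -, hf, he⟩ := IsCHolder.exists_extension (fun σ hσ => h1 σ (hI hσ)) hf₁ he₁
  exact ⟨f, hf, he⟩

/-- Two functions of class `C^{k+}` on the line can be glued across a gap. -/
theorem IsCHolder.exists_glue {k : ℕ} {f g : ℝ → ℂ} (hf : IsCHolder k f) (hg : IsCHolder k g)
    {m M : ℝ} (hm : m < M) :
    ∃ q, IsCHolder k q ∧ (∀ σ ≤ m, q σ = f σ) ∧ ∀ σ, M ≤ σ → q σ = g σ := by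
  set χ : ℝ → ℝ := fun σ => Real.smoothTransition ((σ - m) / (M - m)) with hχ
  have hχs : ContDiff ℝ (k + 1) (fun σ => (χ σ : ℂ)) := by
    refine Complex.ofRealCLM.contDiff.comp (ContDiff.comp Real.smoothTransition.contDiff ?_)
    fun_prop
  have hχ1 := IsCHolder.of_contDiff hχs
  refine ⟨fun σ => f σ + χ σ * (g σ + (-1) * f σ), hf.add (hχ1.mul (hg.add ((const k _).mul hf))),
    fun σ hσ => ?_, fun σ hσ => ?_⟩
  · have : χ σ = 0 := Real.smoothTransition.zero_of_nonpos
      (div_nonpos_of_nonpos_of_nonneg (by linarith) (by linarith))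
    simp [this]
  · have : χ σ = 1 := Real.smoothTransition.one_of_one_le
      ((one_le_div (by linarith)).2 (by linarith))
    simp [this]

/-! ### Averages -/

/-- The derivative of a superposition of affine reparametrizations. -/
theorem hasDerivAt_average {T : Type*} [MeasurableSpace T] {μ : Measure T} {φ : T → ℂ}
    (hφ : Integrable φ μ) {a b : T → ℝ} (ha : Measurable a) (hb : Measurable b) {R : ℝ}
    (haR : ∀ᵐ t ∂μ, |a t| ≤ R) (hbR : ∀ᵐ t ∂μ, |b t| ≤ R) {f f' : ℝ → ℂ}
    (hf : ∀ σ, HasDerivAt f (f' σ) σ) (hf' : Continuous f') (σ : ℝ) :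
    HasDerivAt (fun σ => ∫ t, φ t * f (a t * σ + b t) ∂μ)
      (∫ t, φ t * (a t * f' (a t * σ + b t)) ∂μ) σ := by
  have hfc : Continuous f := continuous_iff_continuousAt.2 fun σ => (hf σ).continuousAt
  set Q := |R| * (|σ| + 1) + |R| with hQ
  obtain ⟨C, hC⟩ := isCompact_Icc.exists_bound_of_continuousOn (hf'.continuousOn (s := Icc (-Q) Q))
  obtain ⟨C', hC'⟩ := isCompact_Icc.exists_bound_of_continuousOn (hfc.continuousOn (s := Icc (-Q) Q))
  have hin : ∀ t, |a t| ≤ R → |b t| ≤ R → ∀ s ∈ Metric.ball σ 1, a t * s + b t ∈ Icc (-Q) Q := by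
    intro t h1 h2 s hs
    rw [mem_Icc, ← abs_le]
    have h3 : |s| ≤ |σ| + 1 := by
      rw [Metric.mem_ball, Real.dist_eq] at hs
      have := abs_sub_abs_le_abs_sub s σ
      linarith
    calc |a t * s + b t| ≤ |a t| * |s| + |b t| := by
          rw [← abs_mul]
          exact abs_add_le _ _
      _ ≤ Q := add_le_add (mul_le_mul (h1.trans (le_abs_self R)) h3 (abs_nonneg _) (abs_nonneg _))
          (h2.trans (le_abs_self R))
  have hm : ∀ s, Measurable fun t => a t * s + b t := fun s => (ha.mul_const s).add hb
  refine (hasDerivAt_integral_of_dominated_loc_of_deriv_le (μ := μ) (s := Metric.ball σ 1)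
    (F := fun s t => φ t * f (a t * s + b t)) (F' := fun s t => φ t * (a t * f' (a t * s + b t)))
    (bound := fun t => ‖φ t‖ * (|R| * max C 0)) (Metric.ball_mem_nhds σ one_pos) ?_ ?_ ?_ ?_ ?_ ?_).2
  · exact Eventually.of_forall fun s => hφ.aestronglyMeasurable.mul
      (hfc.measurable.comp (hm s)).aestronglyMeasurable
  · refine Integrable.mono' (hφ.norm.mul_const (max C' 0)) (hφ.aestronglyMeasurable.mul
      (hfc.measurable.comp (hm σ)).aestronglyMeasurable) ?_
    filter_upwards [haR, hbR] with t h1 h2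
    rw [norm_mul]
    exact mul_le_mul_of_nonneg_left ((hC' _ (hin t h1 h2 σ (Metric.mem_ball_self one_pos))).trans
      (le_max_left _ _)) (norm_nonneg _)
  · exact hφ.aestronglyMeasurable.mul ((Complex.measurable_ofReal.comp ha).mul
      (hf'.measurable.comp (hm σ))).aestronglyMeasurable
  · filter_upwards [haR, hbR] with t h1 h2 s hs
    rw [norm_mul, norm_mul, Complex.norm_real, Real.norm_eq_abs]
    exact mul_le_mul_of_nonneg_left (mul_le_mul (h1.trans (le_abs_self R))
      ((hC _ (hin t h1 h2 s hs)).trans (le_max_left _ _)) (norm_nonneg _) (abs_nonneg _))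
      (norm_nonneg _)
  · exact hφ.norm.mul_const _
  · refine Eventually.of_forall fun t s _ => HasDerivAt.const_mul (φ t) ?_
    have h1 : HasDerivAt (fun s => a t * s + b t) (a t) s := by
      simpa using ((hasDerivAt_id s).const_mul (a t)).add_const (b t)
    have := (hf (a t * s + b t)).scomp s h1
    rwa [Complex.real_smul] at this

theorem isCHolder_average {T : Type*} [MeasurableSpace T] {μ : Measure T} {φ : T → ℂ}
    (hφ : Integrable φ μ) {a b : T → ℝ} (ha : Measurable a) (hb : Measurable b) {R : ℝ}
    (haR : ∀ᵐ t ∂μ, |a t| ≤ R) (hbR : ∀ᵐ t ∂μ, |b t| ≤ R) {k : ℕ} {f : ℝ → ℂ}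
    (hf : IsCHolder k f) : IsCHolder k (fun σ => ∫ t, φ t * f (a t * σ + b t) ∂μ) := by
  induction k generalizing f φ with
  | zero =>
    intro P
    have hfc := hf.continuous
    set Q := |R| * |P| + |R| with hQ
    have hin : ∀ t, |a t| ≤ R → |b t| ≤ R → ∀ s ∈ Icc (-P) P, a t * s + b t ∈ Icc (-Q) Q := by
      intro t h1 h2 s hs
      rw [mem_Icc, ← abs_le] at hs ⊢
      calc |a t * s + b t| ≤ |a t| * |s| + |b t| := by
            rw [← abs_mul]
            exact abs_add_le _ _
        _ ≤ Q := add_le_add (mul_le_mul (h1.trans (le_abs_self R)) (hs.trans (le_abs_self P))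
            (abs_nonneg _) (abs_nonneg _)) (h2.trans (le_abs_self R))
    have hm : ∀ s, Measurable fun t => a t * s + b t := fun s => (ha.mul_const s).add hb
    obtain ⟨C', hC'⟩ := isCompact_Icc.exists_bound_of_continuousOn
      (hfc.continuousOn (s := Icc (-Q) Q))
    have hint : ∀ s ∈ Icc (-P) P, Integrable (fun t => φ t * f (a t * s + b t)) μ := by
      intro s hs
      refine Integrable.mono' (hφ.norm.mul_const (max C' 0)) (hφ.aestronglyMeasurable.mul
        (hfc.measurable.comp (hm s)).aestronglyMeasurable) ?_
      filter_upwards [haR, hbR] with t h1 h2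
      rw [norm_mul]
      exact mul_le_mul_of_nonneg_left ((hC' _ (hin t h1 h2 s hs)).trans (le_max_left _ _))
        (norm_nonneg _)
    obtain ⟨γ, hγ, hγ1, C, hC0, hC⟩ := hf Q
    refine ⟨γ, hγ, hγ1, (∫ t, ‖φ t‖ ∂μ) * (C * |R| ^ γ), by
      have : 0 ≤ ∫ t, ‖φ t‖ ∂μ := integral_nonneg fun _ => norm_nonneg _
      positivity, fun x hx y hy => ?_⟩
    rw [← integral_sub (hint x hx) (hint y hy), mul_assoc, ← integral_mul_const]
    refine norm_integral_le_of_norm_le (hφ.norm.mul_const _) ?_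
    filter_upwards [haR, hbR] with t h1 h2
    rw [← mul_sub, norm_mul]
    refine mul_le_mul_of_nonneg_left ((hC _ (hin t h1 h2 x hx) _ (hin t h1 h2 y hy)).trans ?_)
      (norm_nonneg _)
    rw [mul_assoc, ← Real.mul_rpow (abs_nonneg _) dist_nonneg]
    refine mul_le_mul_of_nonneg_left (Real.rpow_le_rpow dist_nonneg ?_ hγ.le) hC0
    rw [Real.dist_eq, Real.dist_eq, add_sub_add_right_eq_sub, ← mul_sub, abs_mul]
    exact mul_le_mul_of_nonneg_right (h1.trans (le_abs_self R)) (abs_nonneg _)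
  | succ k ih =>
    obtain ⟨f', h, hf'⟩ := hf
    refine ⟨_, hasDerivAt_average hφ ha hb haR hbR h hf'.continuous, ?_⟩
    have hφa : Integrable (fun t => φ t * a t) μ := by
      refine Integrable.mono' (hφ.norm.mul_const |R|) (hφ.aestronglyMeasurable.mul
        (Complex.measurable_ofReal.comp ha).aestronglyMeasurable) ?_
      filter_upwards [haR] with t h1
      rw [norm_mul, Complex.norm_real, Real.norm_eq_abs]
      exact mul_le_mul_of_nonneg_left (h1.trans (le_abs_self R)) (norm_nonneg _)
    simpa only [mul_assoc] using ih hφa hf'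

/-! ### The regularized transform and its kernel -/

/-- The mean of `g` over the segment from `σ` to `τ`. -/
def segAvg (g : ℝ → ℂ) (σ τ : ℝ) : ℂ := ∫ θ in (0 : ℝ)..1, g ((1 - θ) * σ + θ * τ)

theorem continuous_segAvg {g : ℝ → ℂ} (hg : Continuous g) (σ : ℝ) : Continuous (segAvg g σ) := by
  refine intervalIntegral.continuous_parametric_intervalIntegral_of_continuous' ?_ 0 1
  unfold Function.uncurry
  fun_prop

theorem segAvg_self (g : ℝ → ℂ) (σ : ℝ) : segAvg g σ σ = g σ := by
  have : ∀ θ : ℝ, (1 - θ) * σ + θ * σ = σ := fun θ => by ring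
  simp [segAvg, this]

theorem hasDerivAt_segment (σ τ θ : ℝ) :
    HasDerivAt (fun θ : ℝ => (1 - θ) * σ + θ * τ) (τ - σ) θ := by
  have h1 : HasDerivAt (fun θ : ℝ => (1 - θ) * σ + θ * τ) (-1 * σ + 1 * τ) θ :=
    (((hasDerivAt_id θ).const_sub 1).mul_const σ).add ((hasDerivAt_id θ).mul_const τ)
  exact h1.congr_deriv (by ring)

theorem sub_mul_segAvg {f f' : ℝ → ℂ} (hf : ∀ σ, HasDerivAt f (f' σ) σ) (hf' : Continuous f')
    (σ τ : ℝ) : ((τ - σ : ℝ) : ℂ) * segAvg f' σ τ = f τ - f σ := by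
  have h1 : ∀ θ ∈ uIcc (0 : ℝ) 1, HasDerivAt (fun θ : ℝ => f ((1 - θ) * σ + θ * τ))
      (((τ - σ : ℝ) : ℂ) * f' ((1 - θ) * σ + θ * τ)) θ := fun θ _ => by
    have := (hf ((1 - θ) * σ + θ * τ)).scomp θ (hasDerivAt_segment σ τ θ)
    rwa [Complex.real_smul] at this
  have h2 : Continuous fun θ : ℝ => ((τ - σ : ℝ) : ℂ) * f' ((1 - θ) * σ + θ * τ) := by fun_prop
  have h3 := intervalIntegral.integral_eq_sub_of_hasDerivAt h1 (h2.intervalIntegrable _ _)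
  rw [intervalIntegral.integral_const_mul] at h3
  rw [segAvg, h3]
  simp

theorem segAvg_eq_div {f f' : ℝ → ℂ} (hf : ∀ σ, HasDerivAt f (f' σ) σ) (hf' : Continuous f')
    {σ τ : ℝ} (h : τ ≠ σ) : segAvg f' σ τ = (f τ - f σ) / (τ - σ) := by
  rw [← sub_mul_segAvg hf hf', ← Complex.ofReal_sub, mul_div_cancel_left₀]
  exact_mod_cast sub_ne_zero.2 h

/-- Taylor's formula of the second order with integral remainder. -/
theorem integral_one_sub_mul {f' f'' : ℝ → ℂ} (hf : ∀ σ, HasDerivAt f' (f'' σ) σ)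
    (hf'' : Continuous f'') {σ τ : ℝ} (h : τ ≠ σ) :
    ∫ θ in (0 : ℝ)..1, ((1 - θ : ℝ) : ℂ) * f'' ((1 - θ) * σ + θ * τ) =
      (segAvg f' σ τ - f' σ) / (τ - σ) := by
  have hf' : Continuous f' := continuous_iff_continuousAt.2 fun σ => (hf σ).continuousAt
  have h1 : ∀ θ ∈ uIcc (0 : ℝ) 1, HasDerivAt
      (fun θ : ℝ => ((1 - θ : ℝ) : ℂ) * f' ((1 - θ) * σ + θ * τ))
      (-f' ((1 - θ) * σ + θ * τ) +
        ((τ - σ : ℝ) : ℂ) * (((1 - θ : ℝ) : ℂ) * f'' ((1 - θ) * σ + θ * τ))) θ := fun θ _ => by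
    have e1 := (hf ((1 - θ) * σ + θ * τ)).scomp θ (hasDerivAt_segment σ τ θ)
    have e2 : HasDerivAt (fun θ : ℝ => ((1 - θ : ℝ) : ℂ)) ((-1 : ℝ) : ℂ) θ :=
      ((hasDerivAt_id θ).const_sub 1).ofReal_comp
    rw [Complex.real_smul] at e1
    refine (e2.mul e1).congr_deriv ?_
    push_cast
    simp only [Function.comp]
    ring
  have c1 : Continuous fun θ : ℝ => -f' ((1 - θ) * σ + θ * τ) := by fun_prop
  have c2 : Continuous fun θ : ℝ =>
    ((τ - σ : ℝ) : ℂ) * (((1 - θ : ℝ) : ℂ) * f'' ((1 - θ) * σ + θ * τ)) := by fun_prop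
  have h3 := intervalIntegral.integral_eq_sub_of_hasDerivAt h1
    ((c1.add c2).intervalIntegrable _ _)
  rw [intervalIntegral.integral_add (c1.intervalIntegrable _ _) (c2.intervalIntegrable _ _),
    intervalIntegral.integral_neg, intervalIntegral.integral_const_mul] at h3
  have hne : (τ : ℂ) - σ ≠ 0 := by
    rw [← Complex.ofReal_sub]
    exact_mod_cast sub_ne_zero.2 h
  rw [eq_div_iff hne, segAvg]
  push_cast at h3 ⊢
  simp at h3
  linear_combination h3

theorem segAvg_mem {R σ τ θ : ℝ} (hσ : σ ∈ Icc (-R) R) (hτ : τ ∈ Icc (-R) R)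
    (hθ : θ ∈ Icc (0 : ℝ) 1) : (1 - θ) * σ + θ * τ ∈ Icc (-R) R := by
  obtain ⟨h0, h1⟩ := hθ
  constructor <;> nlinarith [hσ.1, hσ.2, hτ.1, hτ.2]

/-- Means over segments inherit a Hölder condition, in both end points jointly. -/
theorem isHolder_segAvg {g : ℝ → ℂ} (hg : IsCHolder 0 g) (R : ℝ) :
    IsHolder (fun p : ℝ × ℝ => segAvg g p.1 p.2) (Icc (-R) R ×ˢ Icc (-R) R) := by
  obtain ⟨γ, hγ, hγ1, C, hC0, hC⟩ := hg R
  have hgc := hg.continuous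
  refine ⟨γ, hγ, hγ1, C, hC0, fun p hp q hq => ?_⟩
  have hi : ∀ p : ℝ × ℝ, IntervalIntegrable (fun θ : ℝ => g ((1 - θ) * p.1 + θ * p.2)) volume 0 1 :=
    fun p => Continuous.intervalIntegrable (by fun_prop) _ _
  have h1 : segAvg g p.1 p.2 - segAvg g q.1 q.2 = ∫ θ in (0 : ℝ)..1,
      (g ((1 - θ) * p.1 + θ * p.2) - g ((1 - θ) * q.1 + θ * q.2)) := by
    rw [intervalIntegral.integral_sub (hi p) (hi q)]
    rfl
  simp only
  rw [h1]
  have h2 := intervalIntegral.norm_integral_le_of_norm_le_const (a := (0 : ℝ)) (b := 1)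
    (C := C * dist p q ^ γ)
    (f := fun θ : ℝ => g ((1 - θ) * p.1 + θ * p.2) - g ((1 - θ) * q.1 + θ * q.2)) ?_
  · simpa using h2
  · intro θ hθ
    rw [uIoc_of_le zero_le_one] at hθ
    have hθ' : θ ∈ Icc (0 : ℝ) 1 := ⟨hθ.1.le, hθ.2⟩
    refine (hC _ (segAvg_mem hp.1 hp.2 hθ') _ (segAvg_mem hq.1 hq.2 hθ')).trans ?_
    refine mul_le_mul_of_nonneg_left (Real.rpow_le_rpow dist_nonneg ?_ hγ.le) hC0
    have e1 : |p.1 - q.1| ≤ dist p q := (Real.dist_eq p.1 q.1).symm ▸ le_max_left _ _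
    have e2 : |p.2 - q.2| ≤ dist p q := (Real.dist_eq p.2 q.2).symm ▸ le_max_right _ _
    rw [Real.dist_eq]
    have e3 : (1 - θ) * p.1 + θ * p.2 - ((1 - θ) * q.1 + θ * q.2) =
        (1 - θ) * (p.1 - q.1) + θ * (p.2 - q.2) := by ring
    rw [e3]
    refine (abs_add_le _ _).trans ?_
    rw [abs_mul, abs_mul, abs_of_nonneg hθ'.1, abs_of_nonneg (by linarith [hθ'.2] : 0 ≤ 1 - θ)]
    nlinarith [hθ'.1, hθ'.2]

/-- The transform that replaces the singular integral of `np u` by an absolutely convergent one. -/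
def regTransform (S : Set ℝ) (np u : ℝ → ℂ) (σ : ℝ) : ℂ :=
  u σ - 1 / (Real.pi * Complex.I) * subInt S np u (u σ) σ

/-- The derivative of `regTransform`; `u'` and `u''` are the derivatives of `u`. -/
def regDeriv (S : Set ℝ) (np u' u'' : ℝ → ℂ) (σ : ℝ) : ℂ :=
  u' σ - 1 / (Real.pi * Complex.I) *
    ∫ p : ℝ × ℝ, np p.1 * (((1 - p.2 : ℝ) : ℂ) * u'' ((1 - p.2) * σ + p.2 * p.1))
      ∂((volume.restrict S).prod (volume.restrict (Ioc 0 1)))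

section RegTransform

variable {S : Set ℝ} {np : ℝ → ℂ}

/-- A superposition over the product of the cut and the unit interval, as an iterated integral. -/
theorem integral_prod_segment (hS : IsCompact S) (hnp : IntegrableOn np S) {g : ℝ → ℝ → ℂ}
    (hg : Continuous fun p : ℝ × ℝ => g p.1 p.2) :
    ∫ p : ℝ × ℝ, np p.1 * g p.1 p.2 ∂((volume.restrict S).prod (volume.restrict (Ioc 0 1))) =
      ∫ τ in S, np τ * ∫ θ in (0 : ℝ)..1, g τ θ := by
  have hcomp : IsCompact (S ×ˢ Icc (0 : ℝ) 1) := hS.prod isCompact_Icc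
  obtain ⟨C, hC⟩ := hcomp.exists_bound_of_continuousOn hg.continuousOn
  have h1 : Integrable (fun p : ℝ × ℝ => np p.1)
      ((volume.restrict S).prod (volume.restrict (Ioc (0 : ℝ) 1))) :=
    Integrable.comp_fst hnp _
  have hint : Integrable (fun p : ℝ × ℝ => np p.1 * g p.1 p.2)
      ((volume.restrict S).prod (volume.restrict (Ioc (0 : ℝ) 1))) := by
    refine Integrable.mono' (h1.norm.mul_const C) (h1.aestronglyMeasurable.mul
      hg.aestronglyMeasurable) ?_
    rw [Measure.prod_restrict]
    refine (ae_restrict_iff' (hS.measurableSet.prod measurableSet_Ioc)).2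
      (Eventually.of_forall fun p hp => ?_)
    rw [norm_mul]
    exact mul_le_mul_of_nonneg_left (hC p ⟨hp.1, Ioc_subset_Icc_self hp.2⟩) (norm_nonneg _)
  rw [integral_prod _ hint]
  refine integral_congr_ae (Eventually.of_forall fun τ => ?_)
  simp only
  rw [integral_const_mul, intervalIntegral.integral_of_le zero_le_one]

theorem integrableOn_subInt (hS : IsCompact S) (hnp : IntegrableOn np S) {q : ℝ → ℂ}
    (hq : Continuous q) {c : ℂ} {σ K : ℝ} (hK : ∀ τ ∈ S, ‖q τ - c‖ ≤ K * |τ - σ|) :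
    IntegrableOn (fun τ : ℝ => np τ * (q τ - c) / (τ - σ)) S := by
  refine Integrable.mono' (hnp.norm.mul_const |K|) ?_ ?_
  · exact (hnp.aestronglyMeasurable.mul
      (hq.aestronglyMeasurable.sub aestronglyMeasurable_const)).div₀
      (Continuous.aestronglyMeasurable (by fun_prop))
  · refine (ae_restrict_iff' hS.measurableSet).2 (Eventually.of_forall fun τ hτ => ?_)
    rw [norm_div, norm_mul, ← Complex.ofReal_sub, Complex.norm_real, Real.norm_eq_abs]
    rcases eq_or_ne τ σ with rfl | h
    · rw [sub_self, abs_zero, div_zero]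
      positivity
    · rw [div_le_iff₀ (abs_pos.2 (sub_ne_zero.2 h)), mul_assoc]
      refine mul_le_mul_of_nonneg_left ((hK τ hτ).trans ?_) (norm_nonneg _)
      exact mul_le_mul_of_nonneg_right (le_abs_self K) (abs_nonneg _)

theorem exists_Icc_subset (hS : IsCompact S) : ∃ R, 1 ≤ R ∧ S ⊆ Icc (-R) R := by
  obtain ⟨R, hR⟩ := hS.isBounded.exists_norm_le
  refine ⟨max R 1, le_max_right _ _, fun σ hσ => abs_le.1 ((hR σ hσ).trans (le_max_left _ _))⟩

variable {u u' u'' : ℝ → ℂ}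

/-- The difference quotient of `u` written as a mean of its derivative over the segment. -/
theorem subInt_eq_integral_prod (hS : IsCompact S) (hnp : IntegrableOn np S)
    (hu : ∀ σ, HasDerivAt u (u' σ) σ) (hu' : Continuous u') (σ : ℝ) :
    subInt S np u (u σ) σ = ∫ p : ℝ × ℝ, np p.1 * u' ((1 - p.2) * σ + p.2 * p.1)
      ∂((volume.restrict S).prod (volume.restrict (Ioc 0 1))) := by
  rw [integral_prod_segment hS hnp (g := fun τ θ => u' ((1 - θ) * σ + θ * τ)) (by fun_prop)]
  refine integral_congr_ae ?_
  filter_upwards [ae_restrict_of_ae (Measure.ae_ne volume σ)] with τ hτ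
  have := segAvg_eq_div hu hu' hτ
  rw [segAvg] at this
  rw [this, mul_div_assoc]

theorem ae_prod_segment (hS : IsCompact S) {R : ℝ} (hR : 1 ≤ R) (hSR : S ⊆ Icc (-R) R) :
    ∀ᵐ p : ℝ × ℝ ∂((volume.restrict S).prod (volume.restrict (Ioc 0 1))),
      |1 - p.2| ≤ R ∧ |p.2 * p.1| ≤ R := by
  rw [Measure.prod_restrict]
  refine (ae_restrict_iff' (hS.measurableSet.prod measurableSet_Ioc)).2
    (Eventually.of_forall fun p hp => ?_)
  have h1 := hSR hp.1
  rw [mem_Icc, ← abs_le] at h1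
  have h2 : 0 < p.2 ∧ p.2 ≤ 1 := hp.2
  refine ⟨?_, ?_⟩
  · rw [abs_of_nonneg (by linarith)]
    linarith
  · rw [abs_mul, abs_of_pos h2.1]
    nlinarith [abs_nonneg p.1]

theorem hasDerivAt_regTransform (hS : IsCompact S) (hnp : IntegrableOn np S)
    (hu : ∀ σ, HasDerivAt u (u' σ) σ) (hu' : ∀ σ, HasDerivAt u' (u'' σ) σ)
    (hu'' : Continuous u'') (σ : ℝ) :
    HasDerivAt (regTransform S np u) (regDeriv S np u' u'' σ) σ := by
  obtain ⟨R, hR, hSR⟩ := exists_Icc_subset hS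
  have hae := ae_prod_segment hS hR hSR
  have hc' : Continuous u' := continuous_iff_continuousAt.2 fun σ => (hu' σ).continuousAt
  have h1 := hasDerivAt_average (μ := (volume.restrict S).prod (volume.restrict (Ioc (0 : ℝ) 1)))
    (φ := fun p => np p.1) (a := fun p => 1 - p.2) (b := fun p => p.2 * p.1)
    (Integrable.comp_fst hnp _) (by fun_prop) (by fun_prop) (hae.mono fun _ h => h.1)
    (hae.mono fun _ h => h.2) hu' hu'' σ
  have h2 := (hu σ).sub (h1.const_mul (1 / (Real.pi * Complex.I) : ℂ))
  have e : regTransform S np u = fun σ => u σ - 1 / (Real.pi * Complex.I) *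
      ∫ p : ℝ × ℝ, np p.1 * u' ((1 - p.2) * σ + p.2 * p.1)
        ∂((volume.restrict S).prod (volume.restrict (Ioc 0 1))) := by
    funext σ
    rw [regTransform, subInt_eq_integral_prod hS hnp hu hc']
  rw [e]
  exact h2

theorem isCHolder_regDeriv (hS : IsCompact S) (hnp : IntegrableOn np S)
    (hu' : ∀ σ, HasDerivAt u' (u'' σ) σ) (hu'' : IsCHolder 0 u'') :
    IsCHolder 0 (regDeriv S np u' u'') := by
  obtain ⟨R, hR, hSR⟩ := exists_Icc_subset hS
  have hae := ae_prod_segment hS hR hSR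
  have hφ : Integrable (fun p : ℝ × ℝ => np p.1 * ((1 - p.2 : ℝ) : ℂ))
      ((volume.restrict S).prod (volume.restrict (Ioc (0 : ℝ) 1))) := by
    have h1 : Integrable (fun p : ℝ × ℝ => np p.1)
      ((volume.restrict S).prod (volume.restrict (Ioc (0 : ℝ) 1))) := Integrable.comp_fst hnp _
    refine Integrable.mono' (h1.norm.mul_const R) (h1.aestronglyMeasurable.mul
      (Continuous.aestronglyMeasurable (by fun_prop))) ?_
    filter_upwards [hae] with p hp
    rw [norm_mul, Complex.norm_real, Real.norm_eq_abs]
    exact mul_le_mul_of_nonneg_left hp.1 (norm_nonneg _)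
  have h1 := isCHolder_average (μ := (volume.restrict S).prod (volume.restrict (Ioc (0 : ℝ) 1)))
    (a := fun p => 1 - p.2) (b := fun p => p.2 * p.1) hφ (by fun_prop) (by fun_prop)
    (hae.mono fun _ h => h.1) (hae.mono fun _ h => h.2) hu''
  have h2 : IsCHolder 0 u' := IsCHolder.of_succ ⟨u'', hu', hu''⟩
  have h3 := h2.add ((IsCHolder.const 0 (-(1 / (Real.pi * Complex.I)) : ℂ)).mul h1)
  convert h3 using 2 with σ
  simp only [regDeriv, mul_assoc]
  ring

/-- The mean of the derivative of the transform is the transform of the means of the derivative: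
second divided differences are symmetric. -/
theorem segAvg_regDeriv (hS : IsCompact S) (hnp : IntegrableOn np S)
    (hu : ∀ σ, HasDerivAt u (u' σ) σ) (hu' : ∀ σ, HasDerivAt u' (u'' σ) σ)
    (hu'' : IsCHolder 0 u'') {σ' σ : ℝ} (hσ' : σ' ∈ S) (hσ : σ ∈ S) :
    IntegrableOn (fun τ : ℝ => np τ * (segAvg u' σ' τ - segAvg u' σ' σ) / (τ - σ)) S ∧
    segAvg (regDeriv S np u' u'') σ' σ = segAvg u' σ' σ - 1 / (Real.pi * Complex.I) *
      ∫ τ in S, np τ * (segAvg u' σ' τ - segAvg u' σ' σ) / (τ - σ) := by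
  obtain ⟨R, hR, hSR⟩ := exists_Icc_subset hS
  have hC1 : IsCHolder 1 u' := ⟨u'', hu', hu''⟩
  have hc' : Continuous u' := hC1.continuous
  obtain ⟨C, hC0, hC⟩ := hC1.exists_lipschitz R
  obtain ⟨D, hD0, hD⟩ := (show IsCHolder 1 u from ⟨u', hu, hC1.of_succ⟩).exists_lipschitz R
  have hlip : ∀ τ ∈ S, ‖segAvg u' σ' τ - segAvg u' σ' σ‖ ≤ C * |τ - σ| := by
    intro τ hτ
    have hi : ∀ τ : ℝ, IntervalIntegrable (fun θ : ℝ => u' ((1 - θ) * σ' + θ * τ)) volume 0 1 :=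
      fun p => Continuous.intervalIntegrable (by fun_prop) _ _
    rw [segAvg, segAvg, ← intervalIntegral.integral_sub (hi _) (hi _)]
    have h2 := intervalIntegral.norm_integral_le_of_norm_le_const (a := (0 : ℝ)) (b := 1)
      (C := C * |τ - σ|)
      (f := fun θ : ℝ => u' ((1 - θ) * σ' + θ * τ) - u' ((1 - θ) * σ' + θ * σ)) ?_
    · simpa using h2
    · intro θ hθ
      rw [uIoc_of_le zero_le_one] at hθ
      have hθ' : θ ∈ Icc (0 : ℝ) 1 := ⟨hθ.1.le, hθ.2⟩
      refine (hC _ (segAvg_mem (hSR hσ') (hSR hτ) hθ') _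
        (segAvg_mem (hSR hσ') (hSR hσ) hθ')).trans ?_
      refine mul_le_mul_of_nonneg_left ?_ hC0
      rw [add_sub_add_left_eq_sub, ← mul_sub, abs_mul, abs_of_nonneg hθ'.1]
      exact mul_le_of_le_one_left (abs_nonneg _) hθ'.2
  have hint := integrableOn_subInt hS hnp (continuous_segAvg hc' σ') hlip
  refine ⟨hint, ?_⟩
  rcases eq_or_ne σ σ' with rfl | hne
  · rw [segAvg_self, segAvg_self, regDeriv, integral_prod_segment hS hnp
      (g := fun τ θ => ((1 - θ : ℝ) : ℂ) * u'' ((1 - θ) * σ + θ * τ))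
      (by have := hu''.continuous; fun_prop)]
    congr 2
    refine integral_congr_ae ?_
    filter_upwards [ae_restrict_of_ae (Measure.ae_ne volume σ)] with τ hτ
    rw [integral_one_sub_mul hu' hu''.continuous hτ, mul_div_assoc]
  · -- off the diagonal both means are difference quotients: the identity is one of
    -- partial fractions
    have hUd := hasDerivAt_regTransform hS hnp hu hu' hu''.continuous
    have hUc := (isCHolder_regDeriv hS hnp hu' hu'').continuous
    have hUc' : Continuous u := continuous_iff_continuousAt.2 fun σ => (hu σ).continuousAt
    rw [segAvg_eq_div hUd hUc hne, segAvg_eq_div hu hc' hne]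
    have h1 : ∀ ρ ∈ S, IntegrableOn (fun τ : ℝ => np τ * (u τ - u ρ) / (τ - ρ)) S := fun ρ hρ =>
      integrableOn_subInt hS hnp hUc' fun τ hτ => hD τ (hSR hτ) ρ (hSR hρ)
    have hne' : (σ : ℂ) - σ' ≠ 0 := sub_ne_zero.2 fun h => hne (Complex.ofReal_injective h)
    have h2 : subInt S np u (u σ) σ - subInt S np u (u σ') σ' = (σ - σ') *
        ∫ τ in S, np τ * (segAvg u' σ' τ - (u σ - u σ') / (σ - σ')) / (τ - σ) := by
      unfold subInt
      rw [← integral_sub (h1 σ hσ) (h1 σ' hσ'), ← integral_const_mul]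
      refine integral_congr_ae ?_
      filter_upwards [ae_restrict_of_ae (Measure.ae_ne volume σ),
        ae_restrict_of_ae (Measure.ae_ne volume σ')] with τ h3 h4
      rw [segAvg_eq_div hu hc' h4]
      have e3 : (τ : ℂ) - σ ≠ 0 := sub_ne_zero.2 fun h => h3 (Complex.ofReal_injective h)
      have e4 : (τ : ℂ) - σ' ≠ 0 := sub_ne_zero.2 fun h => h4 (Complex.ofReal_injective h)
      field_simp
      ring
    have h3 : regTransform S np u σ - regTransform S np u σ' = (u σ - u σ') -
        1 / (Real.pi * Complex.I) * (subInt S np u (u σ) σ - subInt S np u (u σ') σ') := by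
      unfold regTransform
      ring
    rw [h3, h2]
    field_simp

end RegTransform

/-! ### The columns of `W`, the inhomogeneous term and the kernel -/

namespace HasPVIntegral

variable {S P : Set ℝ} {f : ℝ → Fin 2 → ℂ} {L : Fin 2 → ℂ}

theorem pi (h : ∀ b, HasPVIntegral S P (fun t => f t b) (L b)) : HasPVIntegral S P f L := by
  refine ⟨fun ε hε => Integrable.of_eval fun b => (h b).1 ε hε, tendsto_pi_nhds.2 fun b => ?_⟩
  refine (h b).2.congr' ?_
  filter_upwards [self_mem_nhdsWithin] with ε hε
  rw [eval_integral fun b => (h b).1 ε hε]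

theorem eval (h : HasPVIntegral S P f L) (b : Fin 2) :
    HasPVIntegral S P (fun t => f t b) (L b) :=
  h.clm (ContinuousLinearMap.proj (R := ℝ) (φ := fun _ : Fin 2 => ℂ) b)

end HasPVIntegral

namespace IsCutRoot

variable {S A : Set ℝ} {B X : Finset ℝ} {n : ℂ → ℂ} {np : ℝ → ℂ}

/-- Off the points where the root is infinite the transform is a principal value integral. -/
theorem hasPVIntegral_mul (h : IsCutRoot S A B X n np) {u : ℝ → ℂ} {k : ℕ}
    (hu : IsCHolder (k + 1) u) {σ : ℝ} (hσ : σ ∈ S) (hX : σ ∉ X) :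
    HasPVIntegral S {σ} (fun τ => np τ * u τ / (τ - σ))
      (-(Real.pi * Complex.I) * regTransform S np u σ) := by
  have h1 : HasPVIntegral S {σ} (fun τ => np τ / (τ - σ)) (-(Real.pi * Complex.I)) := by
    by_cases hA : σ ∈ A
    · exact h.hasPVIntegral hA
    · obtain ⟨h2, h3⟩ := h.integral_div_base ((h.ends σ hσ hA).resolve_right hX) hσ
      rw [← h3]
      exact HasPVIntegral.of_integrableOn (finite_singleton σ) h2
  obtain ⟨R, hR, hSR⟩ := exists_Icc_subset h.compact
  obtain ⟨C, hC0, hC⟩ := hu.exists_lipschitz R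
  have h2 := HasPVIntegral.of_integrableOn (finite_singleton σ)
    (integrableOn_subInt h.compact h.integrableOn hu.continuous (c := u σ) (σ := σ)
      fun τ hτ => hC τ (hSR hτ) σ (hSR hσ))
  have h3 := (h2.add (h1.const_mul (u σ))).congr (g := fun τ => np τ * u τ / (τ - σ))
    h.compact.measurableSet fun τ _ _ => by ring
  convert h3 using 1
  rw [regTransform, subInt]
  have := pi_I_ne
  field_simp
  ring

end IsCutRoot

namespace NullDomain

variable (G : NullDomain) {v : (ℝ → Mat2) × (ℝ → Mat2)} {x : ℝ × ℝ}

/-- `u` is a continuation to the whole line of the first column of `W`, and `w` one of the first row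
`(W₂₂, -W₁₂)` of the inverse of `W`. -/
structure IsFrame (v : (ℝ → Mat2) × (ℝ → Mat2)) (x : ℝ × ℝ) (u w : Fin 2 → ℝ → ℂ) : Prop where
  u_smooth : ∀ b, IsCHolder 2 (u b)
  w_smooth : ∀ b, IsCHolder 2 (w b)
  W_zero : ∀ σ ∈ G.arcsBar x, ∀ b, G.W v x σ b 0 = u b σ
  W_one : ∀ σ ∈ G.arcsBar x, G.W v x σ 1 1 = w 0 σ ∧ G.W v x σ 0 1 = -w 1 σ
  dot : ∀ σ ∈ G.arcsBar x, w 0 σ * u 0 σ + w 1 σ * u 1 σ = 1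

theorem isOpen_dom₃ : IsOpen G.dom₃ := by
  have : G.dom₃ = (fun r : ℝ => (r : EReal)) ⁻¹' Ioi G.r₁ ∩ Iio G.r₂ := by
    ext r
    simp [dom₃]
  rw [this]
  exact (isOpen_Ioi.preimage continuous_coe_real_ereal).inter isOpen_Iio

theorem isOpen_dom₄ : IsOpen G.dom₄ := by
  have : G.dom₄ = Ioi G.s₂ ∩ (fun r : ℝ => (r : EReal)) ⁻¹' Iio G.s₁ := by
    ext r
    simp [dom₄]
  rw [this]
  exact isOpen_Ioi.inter (isOpen_Iio.preimage continuous_coe_real_ereal)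

theorem Icc_subset_dom₃ (hx : x ∈ G.D) : Icc (min x.1 G.r₀) (max x.1 G.r₀) ⊆ G.dom₃ := by
  intro σ hσ
  have h1 : G.r₁ < ((min x.1 G.r₀ : ℝ) : EReal) := by
    rcases min_choice x.1 G.r₀ with h | h <;> rw [h]
    exacts [hx.1.1, G.r₁_lt_r₀]
  exact ⟨h1.trans_le (EReal.coe_le_coe_iff.2 hσ.1), hσ.2.trans_lt (max_lt hx.1.2 G.r₀_lt_r₂)⟩

theorem Icc_subset_dom₄ (hx : x ∈ G.D) : Icc (min x.2 G.s₀) (max x.2 G.s₀) ⊆ G.dom₄ := by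
  intro σ hσ
  have h1 : ((max x.2 G.s₀ : ℝ) : EReal) < G.s₁ := by
    rcases max_choice x.2 G.s₀ with h | h <;> rw [h]
    exacts [hx.2.1.2, G.s₀_lt_s₁]
  exact ⟨(lt_min hx.2.1.1 G.s₂_lt_s₀).trans_le hσ.1,
    (EReal.coe_le_coe_iff.2 hσ.2).trans_lt h1⟩

theorem exists_isFrame (hv : v ∈ G.KPlus 2) (hx : x ∈ G.D) : ∃ u w, G.IsFrame v x u w := by
  have h3 : ∀ a b, ∃ f, IsCHolder 2 f ∧ EqOn f (fun σ => v.1 σ a b)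
      (Icc (min x.1 G.r₀) (max x.1 G.r₀)) := fun a b =>
    (hv.1.1 a b).exists_isCHolder G.isOpen_dom₃ min_le_max (G.Icc_subset_dom₃ hx)
  have h4 : ∀ a b, ∃ f, IsCHolder 2 f ∧ EqOn f (fun σ => v.2 σ a b)
      (Icc (min x.2 G.s₀) (max x.2 G.s₀)) := fun a b =>
    (hv.2.1 a b).exists_isCHolder G.isOpen_dom₄ min_le_max (G.Icc_subset_dom₄ hx)
  choose f₃ hf₃ he₃ using h3
  choose f₄ hf₄ he₄ using h4
  choose q hq hq₃ hq₄ using fun a b => (hf₃ a b).exists_glue (hf₄ a b) (G.max_lt_min hx)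
  classical
  set V : ℝ → Mat2 := fun σ => if σ ∈ closure (G.I₃ x) then v.1 σ else v.2 σ with hV
  have hVq : ∀ σ ∈ G.arcsBar x, (∀ a b, V σ a b = q a b σ) ∧ (V σ).det = 1 := by
    intro σ hσ
    by_cases h : σ ∈ closure (G.I₃ x)
    · have hI := G.closure_I₃_subset x h
      simp only [hV, if_pos h]
      exact ⟨fun a b => by rw [hq₃ a b σ hI.2, he₃ a b hI],
        hv.1.2.1 σ (G.Icc_subset_dom₃ hx hI)⟩
    · have hI := G.closure_I₄_subset x (hσ.resolve_left h)
      simp only [hV, if_neg h]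
      exact ⟨fun a b => by rw [hq₄ a b σ hI.1, he₄ a b hI],
        hv.2.2.1 σ (G.Icc_subset_dom₄ hx hI)⟩
  set l : ℝ → ℂ := fun σ => -Complex.I * ((σ - G.z₀ : ℝ) : ℂ) with hl
  have hls : IsCHolder 2 l := IsCHolder.of_contDiff
    (contDiff_const.mul (Complex.ofRealCLM.contDiff.comp (contDiff_id.sub contDiff_const)))
  have hW : ∀ σ, G.W v x σ = V σ * unip (l σ) := fun σ => rfl
  have hW0 : ∀ σ b, G.W v x σ b 0 = V σ b 0 := fun σ b => by
    rw [hW]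
    simp [unip, Matrix.mul_apply, Fin.sum_univ_two]
  have hW1 : ∀ σ b, G.W v x σ b 1 = V σ b 0 * l σ + V σ b 1 := fun σ b => by
    rw [hW]
    simp [unip, Matrix.mul_apply, Fin.sum_univ_two]
  refine ⟨fun b => q b 0, ![fun σ => q 1 0 σ * l σ + q 1 1 σ,
    fun σ => -1 * (q 0 0 σ * l σ + q 0 1 σ)], fun b => hq b 0, ?_, fun σ hσ b => ?_,
    fun σ hσ => ⟨?_, ?_⟩, fun σ hσ => ?_⟩
  · intro b
    fin_cases b
    · exact ((hq 1 0).mul hls).add (hq 1 1)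
    · exact (IsCHolder.const 2 (-1)).mul (((hq 0 0).mul hls).add (hq 0 1))
  · rw [hW0, (hVq σ hσ).1]
  · rw [hW1, (hVq σ hσ).1, (hVq σ hσ).1]
    rfl
  · rw [hW1, (hVq σ hσ).1, (hVq σ hσ).1]
    simp
  · have hd := (hVq σ hσ).2
    rw [Matrix.det_fin_two, (hVq σ hσ).1, (hVq σ hσ).1, (hVq σ hσ).1, (hVq σ hσ).1] at hd
    simp only [Matrix.cons_val_zero, Matrix.cons_val_one]
    linear_combination hd

theorem uniqueDiffOn_arcsBar (x : ℝ × ℝ) : UniqueDiffOn ℝ (G.arcsBar x) := by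
  have key : ∀ a b : ℝ, UniqueDiffOn ℝ (closure (Ioo a b)) := by
    intro a b
    rcases eq_or_ne a b with rfl | h
    · simpa using uniqueDiffOn_empty
    · rcases lt_or_gt_of_ne h with hl | hl
      · rw [closure_Ioo h]
        exact uniqueDiffOn_Icc hl
      · rw [Ioo_eq_empty (not_lt.2 hl.le), closure_empty]
        exact uniqueDiffOn_empty
  rintro σ (h | h)
  · exact (key _ _ σ h).mono subset_union_left
  · exact (key _ _ σ h).mono subset_union_right

namespace IsFrame

variable {G} {u w u' u'' : Fin 2 → ℝ → ℂ}

theorem W₁_eq (hF : G.IsFrame v x u w) {σ : ℝ} (hσ : σ ∈ G.arcsBar x) :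
    G.W₁ v x σ = fun b => u b σ := funext fun b => hF.W_zero σ hσ b

theorem d₂₁_eq (hF : G.IsFrame v x u w) {σ' σ : ℝ} (hσ' : σ' ∈ G.arcsBar x)
    (hσ : σ ∈ G.arcsBar x) : G.d₂₁ v x σ' σ = w 0 σ' * u 0 σ + w 1 σ' * u 1 σ := by
  rw [d₂₁, hF.W_zero σ hσ, hF.W_zero σ hσ, (hF.W_one σ' hσ').1, (hF.W_one σ' hσ').2]
  ring

theorem U₁_eq (hF : G.IsFrame v x u w) (hx : x ∈ G.D) {σ : ℝ} (hσ : σ ∈ G.arcsBar x) (b : Fin 2) :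
    G.U₁ v x σ b = regTransform (G.arcsBar x) (G.nuPlus x) (u b) σ := by
  have h := G.isCutRoot_nu hx
  obtain ⟨R, hR, hSR⟩ := exists_Icc_subset h.compact
  have e : ∀ τ ∈ G.arcsBar x, ∀ b : Fin 2,
      ((G.nuPlus x τ / ((τ - σ : ℝ) : ℂ)) • (G.W₁ v x τ - G.W₁ v x σ)) b =
        G.nuPlus x τ * (u b τ - u b σ) / (τ - σ) := by
    intro τ hτ b
    rw [hF.W₁_eq hτ, hF.W₁_eq hσ, Pi.smul_apply, Pi.sub_apply, smul_eq_mul]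
    push_cast
    ring
  have hint : ∀ b : Fin 2, IntegrableOn
      (fun τ => ((G.nuPlus x τ / ((τ - σ : ℝ) : ℂ)) • (G.W₁ v x τ - G.W₁ v x σ)) b)
      (G.arcsBar x) := by
    intro b
    obtain ⟨C, hC0, hC⟩ := (hF.u_smooth b).exists_lipschitz R
    exact (integrableOn_subInt h.compact h.integrableOn (hF.u_smooth b).continuous (c := u b σ)
      (σ := σ) fun τ hτ => hC τ (hSR hτ) σ (hSR hσ)).congr_fun (fun τ hτ => (e τ hτ b).symm)
      h.compact.measurableSet
  rw [U₁, Pi.sub_apply, Pi.smul_apply, eval_integral hint,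
    setIntegral_congr_fun h.compact.measurableSet fun τ hτ => e τ hτ b, hF.W₁_eq hσ, smul_eq_mul]
  rfl

/-- The kernel `k₂₁` by means of the derivative of the first column; on the diagonal,
differentiating the relation `det W = 1` turns derivatives of `w` into derivatives of `u`. -/
theorem k₂₁_eq (hF : G.IsFrame v x u w) (hu : ∀ b σ, HasDerivAt (u b) (u' b σ) σ)
    (hu' : ∀ b, Continuous (u' b)) {σ' σ : ℝ} (hσ' : σ' ∈ G.arcsBar x) (hσ : σ ∈ G.arcsBar x) :
    G.k₂₁ v x σ' σ = -(w 0 σ' * segAvg (u' 0) σ' σ + w 1 σ' * segAvg (u' 1) σ' σ) := by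
  unfold k₂₁
  by_cases h : σ' = σ
  · subst h
    rw [if_pos rfl, segAvg_self, segAvg_self]
    -- `w · u` is constant on the cut, where derivatives are determined by the values there
    obtain ⟨w₀', hw₀, -⟩ := hF.w_smooth 0
    obtain ⟨w₁', hw₁, -⟩ := hF.w_smooth 1
    have hU := G.uniqueDiffOn_arcsBar x σ' hσ
    have h1 : HasDerivAt (fun t => w 0 t * u 0 σ' + w 1 t * u 1 σ')
        (w₀' σ' * u 0 σ' + w₁' σ' * u 1 σ') σ' :=
      ((hw₀ σ').mul_const _).add ((hw₁ σ').mul_const _)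
    have h2 : HasDerivAt (fun t => w 0 t * u 0 t + w 1 t * u 1 t)
        ((w₀' σ' * u 0 σ' + w 0 σ' * u' 0 σ') + (w₁' σ' * u 1 σ' + w 1 σ' * u' 1 σ')) σ' :=
      ((hw₀ σ').mul (hu 0 σ')).add ((hw₁ σ').mul (hu 1 σ'))
    have h3 : HasDerivWithinAt (fun _ : ℝ => (1 : ℂ))
        ((w₀' σ' * u 0 σ' + w 0 σ' * u' 0 σ') + (w₁' σ' * u 1 σ' + w 1 σ' * u' 1 σ'))
        (G.arcsBar x) σ' :=
      h2.hasDerivWithinAt.congr (fun t ht => (hF.dot t ht).symm) (hF.dot σ' hσ).symm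
    have h4 := hU.eq_deriv _ h3 (hasDerivWithinAt_const σ' _ (1 : ℂ))
    rw [derivWithin_congr (fun t ht => hF.d₂₁_eq ht hσ) (hF.d₂₁_eq hσ hσ),
      h1.hasDerivWithinAt.derivWithin hU]
    linear_combination h4
  · rw [if_neg h, segAvg_eq_div (hu 0) (hu' 0) (Ne.symm h), segAvg_eq_div (hu 1) (hu' 1) (Ne.symm h),
      hF.d₂₁_eq hσ' hσ, ← hF.dot σ' hσ', Complex.ofReal_sub]
    have e1 : (σ' : ℂ) - σ ≠ 0 := sub_ne_zero.2 fun h' => h (Complex.ofReal_injective h')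
    have e2 : (σ : ℂ) - σ' ≠ 0 := sub_ne_zero.2 fun h' => h (Complex.ofReal_injective h').symm
    field_simp
    ring

/-- The kernel by means of the derivative of the transform, which makes sense on the diagonal. -/
theorem K₂₁_eq (hF : G.IsFrame v x u w) (hx : x ∈ G.D)
    (hu : ∀ b σ, HasDerivAt (u b) (u' b σ) σ) (hu' : ∀ b σ, HasDerivAt (u' b) (u'' b σ) σ)
    (hu'' : ∀ b, IsCHolder 0 (u'' b)) {σ' σ : ℝ} (hσ' : σ' ∈ G.arcsBar x)
    (hσ : σ ∈ G.arcsBar x) :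
    G.K₂₁ v x σ' σ =
      -(w 0 σ' * segAvg (regDeriv (G.arcsBar x) (G.nuPlus x) (u' 0) (u'' 0)) σ' σ +
        w 1 σ' * segAvg (regDeriv (G.arcsBar x) (G.nuPlus x) (u' 1) (u'' 1)) σ' σ) := by
  have h := G.isCutRoot_nu hx
  have hc : ∀ b, Continuous (u' b) := fun b =>
    continuous_iff_continuousAt.2 fun σ => (hu' b σ).continuousAt
  have t := fun b => segAvg_regDeriv h.compact h.integrableOn (hu b) (hu' b) (hu'' b) hσ' hσ
  have e : ∫ τ in G.arcsBar x, G.nuPlus x τ * (G.k₂₁ v x σ' τ - G.k₂₁ v x σ' σ) /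
        ((τ - σ : ℝ) : ℂ) =
      -w 0 σ' * (∫ τ in G.arcsBar x,
        G.nuPlus x τ * (segAvg (u' 0) σ' τ - segAvg (u' 0) σ' σ) / (τ - σ)) +
      -w 1 σ' * (∫ τ in G.arcsBar x,
        G.nuPlus x τ * (segAvg (u' 1) σ' τ - segAvg (u' 1) σ' σ) / (τ - σ)) := by
    rw [← integral_const_mul, ← integral_const_mul,
      ← integral_add ((t 0).1.const_mul _) ((t 1).1.const_mul _)]
    refine setIntegral_congr_fun h.compact.measurableSet fun τ hτ => ?_
    rw [hF.k₂₁_eq hu hc hσ' hτ, hF.k₂₁_eq hu hc hσ' hσ]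
    push_cast
    ring
  rw [K₂₁, e, hF.k₂₁_eq hu hc hσ' hσ, (t 0).2, (t 1).2]
  ring

theorem exists_deriv (hF : G.IsFrame v x u w) : ∃ u' u'' : Fin 2 → ℝ → ℂ,
    (∀ b σ, HasDerivAt (u b) (u' b σ) σ) ∧ (∀ b σ, HasDerivAt (u' b) (u'' b σ) σ) ∧
      ∀ b, IsCHolder 0 (u'' b) := by
  choose u' h1 h2 using hF.u_smooth
  choose u'' h3 h4 using h2
  exact ⟨u', u'', h1, h3, h4⟩

/-- Off the diagonal the kernel is a difference quotient of the transform. -/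
theorem K₂₁_eq_div (hF : G.IsFrame v x u w) (hx : x ∈ G.D) {σ' σ : ℝ} (hσ' : σ' ∈ G.arcsBar x)
    (hσ : σ ∈ G.arcsBar x) (hne : σ' ≠ σ) :
    G.K₂₁ v x σ' σ = -(w 0 σ' * ((regTransform (G.arcsBar x) (G.nuPlus x) (u 0) σ -
        regTransform (G.arcsBar x) (G.nuPlus x) (u 0) σ') / (σ - σ')) +
      w 1 σ' * ((regTransform (G.arcsBar x) (G.nuPlus x) (u 1) σ -
        regTransform (G.arcsBar x) (G.nuPlus x) (u 1) σ') / (σ - σ'))) := by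
  have h := G.isCutRoot_nu hx
  obtain ⟨u', u'', hu, hu', hu''⟩ := hF.exists_deriv
  have hd := fun b => hasDerivAt_regTransform h.compact h.integrableOn (hu b) (hu' b)
    (hu'' b).continuous
  have hc := fun b => (isCHolder_regDeriv h.compact h.integrableOn (hu' b) (hu'' b)).continuous
  rw [hF.K₂₁_eq hx hu hu' hu'' hσ' hσ, segAvg_eq_div (hd 0) (hc 0) hne.symm,
    segAvg_eq_div (hd 1) (hc 1) hne.symm]

theorem isHolder_K₂₁ (hF : G.IsFrame v x u w) (hx : x ∈ G.D) :
    IsHolder (fun p : ℝ × ℝ => G.K₂₁ v x p.1 p.2) (G.arcsBar x ×ˢ G.arcsBar x) := by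
  have h := G.isCutRoot_nu hx
  obtain ⟨R, hR, hSR⟩ := exists_Icc_subset h.compact
  obtain ⟨u', u'', hu, hu', hu''⟩ := hF.exists_deriv
  have hb : Bornology.IsBounded (G.arcsBar x ×ˢ G.arcsBar x) :=
    h.compact.isBounded.prod h.compact.isBounded
  have h1 : ∀ b, IsHolder (fun p : ℝ × ℝ => segAvg (regDeriv (G.arcsBar x) (G.nuPlus x) (u' b)
      (u'' b)) p.1 p.2) (G.arcsBar x ×ˢ G.arcsBar x) := fun b =>
    (isHolder_segAvg (isCHolder_regDeriv h.compact h.integrableOn (hu' b) (hu'' b)) R).mono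
      (prod_mono hSR hSR)
  have h2 : ∀ b, IsHolder (fun p : ℝ × ℝ => w b p.1) (G.arcsBar x ×ˢ G.arcsBar x) := by
    intro b
    obtain ⟨C, hC0, hC⟩ := (hF.w_smooth b).exists_lipschitz R
    refine IsHolder.of_lipschitz hb hC0 fun p hp q hq =>
      (hC _ (hSR hp.1) _ (hSR hq.1)).trans (mul_le_mul_of_nonneg_left ?_ hC0)
    exact (Real.dist_eq p.1 q.1).symm ▸ le_max_left _ _
  refine ((isHolder_const (-1 : ℂ)).mul hb (((h2 0).mul hb (h1 0)).add hb
    ((h2 1).mul hb (h1 1)))).congr fun p hp => ?_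
  simp only
  rw [hF.K₂₁_eq hx hu hu' hu'' hp.1 hp.2]
  ring

theorem isCZeroPlus₂_K₂₁ (hF : G.IsFrame v x u w) (hx : x ∈ G.D) :
    IsCZeroPlus₂ (fun p => G.K₂₁ v x p.1 p.2) (G.arcsBar x ×ˢ G.arcsBar x) :=
  ⟨(hF.isHolder_K₂₁ hx).continuousOn, fun _ _ _ _ h =>
    ((hF.isHolder_K₂₁ hx).mono h).exists_holderOnWith⟩

theorem isCPlus_U₁ (hF : G.IsFrame v x u w) (hx : x ∈ G.D) :
    IsCPlus 1 (G.U₁ v x) (G.arcsBar x) := by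
  have h := G.isCutRoot_nu hx
  obtain ⟨u', u'', hu, hu', hu''⟩ := hF.exists_deriv
  set T : Fin 2 → ℝ → ℂ := fun b => regTransform (G.arcsBar x) (G.nuPlus x) (u b) with hT
  set V : Fin 2 → ℝ → ℂ := fun b => regDeriv (G.arcsBar x) (G.nuPlus x) (u' b) (u'' b) with hV
  have hd : ∀ σ, HasDerivAt (fun σ b => T b σ) (fun b => V b σ) σ := fun σ =>
    hasDerivAt_pi.2 fun b => hasDerivAt_regTransform h.compact h.integrableOn (hu b) (hu' b)
      (hu'' b).continuous σ
  have hc : ∀ b, IsCHolder 0 (V b) := fun b =>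
    isCHolder_regDeriv h.compact h.integrableOn (hu' b) (hu'' b)
  have heq : EqOn (G.U₁ v x) (fun σ b => T b σ) (G.arcsBar x) := fun σ hσ =>
    funext fun b => hF.U₁_eq hx hσ b
  have hC1 : ContDiff ℝ 1 (fun σ b => T b σ) := by
    refine contDiff_one_iff_deriv.2 ⟨fun σ => (hd σ).differentiableAt, ?_⟩
    rw [show deriv (fun σ b => T b σ) = fun σ b => V b σ from funext fun σ => (hd σ).deriv]
    exact continuous_pi fun b => (hc b).continuous
  refine ⟨?_, fun a b hab => ?_⟩
  · exact_mod_cast hC1.contDiffOn.congr heq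
  · have e : EqOn (fun σ b => V b σ) (iteratedDerivWithin 1 (G.U₁ v x) (G.arcsBar x))
        (Icc a b) := by
      intro σ hσ
      rw [iteratedDerivWithin_one, derivWithin_congr heq (heq (hab hσ)),
        (hd σ).hasDerivWithinAt.derivWithin (G.uniqueDiffOn_arcsBar x σ (hab hσ))]
    refine IsHolder.exists_holderOnWith (IsHolder.congr ?_ e)
    obtain ⟨R, hR, hSR⟩ := exists_Icc_subset h.compact
    obtain ⟨γ, hγ, hγ1, C, hC0, hC⟩ := IsHolder.common (Metric.isBounded_Icc _ _) (hc 0 R) (hc 1 R)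
    refine ⟨γ, hγ, hγ1, C, hC0, fun y hy z hz => ?_⟩
    have := hC y (hSR (hab hy)) z (hSR (hab hz))
    refine (pi_norm_le_iff_of_nonneg (by positivity)).2 fun i => ?_
    fin_cases i
    exacts [this.1, this.2]

theorem exists_hasPVIntegral_U₁ (hF : G.IsFrame v x u w) (hx : x ∈ G.D) :
    ∀ σ ∈ G.arcsBar x \ {x.1, x.2}, ∃ L : Fin 2 → ℂ,
      HasPVIntegral (G.arcsBar x) {σ}
        (fun σ' => (G.nuPlus x σ' / ((σ' - σ : ℝ) : ℂ)) • G.W₁ v x σ') L ∧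
      G.U₁ v x σ = -(1 / (Real.pi * Complex.I)) • L := by
  have h := G.isCutRoot_nu hx
  rintro σ ⟨hσ, hσX⟩
  have hX : σ ∉ ({x.1, x.2} : Finset ℝ) := by simpa using hσX
  refine ⟨fun b => -(Real.pi * Complex.I) *
    regTransform (G.arcsBar x) (G.nuPlus x) (u b) σ, HasPVIntegral.pi fun b => ?_, funext fun b => ?_⟩
  · refine (h.hasPVIntegral_mul (hF.u_smooth b) hσ hX).congr h.compact.measurableSet
      fun τ hτ _ => ?_
    rw [hF.W₁_eq hτ, Pi.smul_apply, smul_eq_mul]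
    push_cast
    ring
  · rw [hF.U₁_eq hx hσ, Pi.smul_apply, smul_eq_mul]
    have := IsCutRoot.pi_I_ne
    field_simp

theorem exists_hasPVIntegral_K₂₁ (hF : G.IsFrame v x u w) (hx : x ∈ G.D) :
    ∀ σ' ∈ G.arcsBar x \ {x.1, x.2}, ∀ σ ∈ G.arcsBar x \ {x.1, x.2}, σ' ≠ σ → ∃ L : ℂ,
      HasPVIntegral (G.arcsBar x) {σ, σ'}
        (fun σ'' => G.nuPlus x σ'' * (G.d₂₁ v x σ' σ'' /
          ((((σ'' - σ) * (σ' - σ'') : ℝ)) : ℂ))) L ∧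
      G.K₂₁ v x σ' σ = -(1 / (Real.pi * Complex.I)) * L := by
  have h := G.isCutRoot_nu hx
  rintro σ' ⟨hσ', hσX'⟩ σ ⟨hσ, hσX⟩ hne
  have hX : σ ∉ ({x.1, x.2} : Finset ℝ) := by simpa using hσX
  have hX' : σ' ∉ ({x.1, x.2} : Finset ℝ) := by simpa using hσX'
  set T : Fin 2 → ℝ → ℂ := fun b => regTransform (G.arcsBar x) (G.nuPlus x) (u b) with hT
  have hm := h.compact.measurableSet
  -- partial fractions reduce the integrand with two poles to integrands with one
  have p1 := fun b => (h.hasPVIntegral_mul (hF.u_smooth b) hσ hX).pair hm hne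
  have p2 := fun b => (h.hasPVIntegral_mul (hF.u_smooth b) hσ' hX').pair hm hne.symm
  simp only [pair_comm σ' σ] at p2
  have q := fun b => ((p1 b).add ((p2 b).const_mul (-1))).const_mul (w b σ' / (σ' - σ))
  refine ⟨_, ((q 0).add (q 1)).congr hm fun τ hτ hτP => ?_, ?_⟩
  · have h1 : τ ≠ σ ∧ τ ≠ σ' := by simpa [not_or] using hτP
    have e1 : (τ : ℂ) - σ ≠ 0 := sub_ne_zero.2 fun h' => h1.1 (Complex.ofReal_injective h')
    have e2 : (τ : ℂ) - σ' ≠ 0 := sub_ne_zero.2 fun h' => h1.2 (Complex.ofReal_injective h')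
    have e2' : (σ' : ℂ) - τ ≠ 0 := sub_ne_zero.2 fun h' => h1.2 (Complex.ofReal_injective h').symm
    have e3 : (σ' : ℂ) - σ ≠ 0 := sub_ne_zero.2 fun h' => hne (Complex.ofReal_injective h')
    rw [hF.d₂₁_eq hσ' hτ]
    push_cast
    have e4 : (σ' : ℂ) - τ = -(τ - σ') := by ring
    rw [e4]
    field_simp
    ring
  · rw [hF.K₂₁_eq_div hx hσ' hσ hne]
    have := IsCutRoot.pi_I_ne
    have e3 : (σ' : ℂ) - σ ≠ 0 := sub_ne_zero.2 fun h' => hne (Complex.ofReal_injective h')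
    have e4 : (σ : ℂ) - σ' = -(σ' - σ) := by ring
    rw [e4]
    field_simp
    ring

end IsFrame

end NullDomain

/-! ### Densities and the equation of the second kind -/

namespace IsCutRoot

variable {S A : Set ℝ} {B X : Finset ℝ} {n : ℂ → ℂ} {np q : ℝ → ℂ}

theorem integrableOn_inv_mul (h : IsCutRoot S A B X n np) (hq : ContinuousOn q S) :
    IntegrableOn (fun σ => (np σ)⁻¹ * q σ) S :=
  h.integrableOn_inv.mul_continuousOn hq h.compact

theorem plemelj_inv_mul (h : IsCutRoot S A B X n np) (hq : IsHolder q S) {σ : ℝ} (hσ : σ ∈ A) :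
    ∃ L : ℂ, HasPVIntegral S {σ} (fun x => (np x)⁻¹ * q x / (x - σ)) L ∧
      Tendsto (cauchyInt S fun x => (np x)⁻¹ * q x) (fromAbove σ)
        (𝓝 (L + Real.pi * Complex.I * ((np σ)⁻¹ * q σ))) ∧
      Tendsto (cauchyInt S fun x => (np x)⁻¹ * q x) (fromBelow σ)
        (𝓝 (L - Real.pi * Complex.I * ((np σ)⁻¹ * q σ))) := by
  obtain ⟨ρ, hρ, hI, -, hH⟩ := h.holder σ hσ
  have hIS := hI.trans h.subset
  obtain ⟨γ, hγ, hγ1, C, hC0, hC⟩ := hH.mul (Metric.isBounded_Ioo _ _) (hq.mono hIS)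
  exact plemelj h.compact (h.integrableOn_inv_mul hq.continuousOn) hρ hIS hγ hC

/-- The Cauchy integral of `q / np` with `q` of Hölder class grows at most like the inverse square
root of the distance from the zeros of the root. -/
theorem exists_norm_cauchyInt_le (h : IsCutRoot S A B X n np) (hne : S.Nonempty)
    (hq : IsHolder q S) (c : ℂ) : ∃ C, 0 ≤ C ∧ ∀ τ : ℂ, τ.im ≠ 0 →
      ‖c + 1 / (Real.pi * Complex.I) * cauchyInt S (fun x => (np x)⁻¹ * q x) τ‖ ≤
        C * endWeight B τ := by
  obtain ⟨p, hpS, hp⟩ := exists_nearest h.compact hne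
  obtain ⟨C₁, hC₁0, hC₁⟩ := h.norm_inv_le
  obtain ⟨C₂, hC₂0, hC₂⟩ := exists_norm_subInt_le h.compact hC₁0 hC₁ hpS hp hq
  obtain ⟨C₃, hC₃0, hC₃⟩ := h.growth
  obtain ⟨M, hM0, hM⟩ := hq.exists_bound h.compact.isBounded
  set k : ℝ := ‖(1 / (Real.pi * Complex.I) : ℂ)‖ with hk
  refine ⟨‖c‖ + k * C₂ + M * (C₃ + 1), by positivity, fun τ him => ?_⟩
  have hτ := notMem_image_of_im_ne_zero S him
  have hw := one_le_endWeight B τ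
  rw [cauchyInt_mul_eq h.compact h.integrableOn_inv hq.continuousOn (q (p τ)) hτ,
    h.cauchyInt_inv_eq hτ]
  have e : c + 1 / (Real.pi * Complex.I) * (subInt S (fun σ => (np σ)⁻¹) q (q (p τ)) τ +
      q (p τ) * (Real.pi * Complex.I * ((n τ)⁻¹ - 1))) =
      c + 1 / (Real.pi * Complex.I) * subInt S (fun σ => (np σ)⁻¹) q (q (p τ)) τ +
        q (p τ) * ((n τ)⁻¹ - 1) := by
    have := pi_I_ne
    field_simp
    ring
  rw [e]
  have t1 : ‖c‖ ≤ ‖c‖ * endWeight B τ := le_mul_of_one_le_right (norm_nonneg _) hw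
  have t2 : ‖1 / (Real.pi * Complex.I) * subInt S (fun σ => (np σ)⁻¹) q (q (p τ)) τ‖ ≤
      k * C₂ * endWeight B τ := by
    rw [norm_mul, mul_assoc]
    exact mul_le_mul_of_nonneg_left (hC₂ τ him) (norm_nonneg _)
  have t3 : ‖q (p τ) * ((n τ)⁻¹ - 1)‖ ≤ M * (C₃ + 1) * endWeight B τ := by
    rw [norm_mul, mul_assoc]
    refine mul_le_mul (hM _ (hpS τ)) ((norm_sub_le _ _).trans ?_) (norm_nonneg _) hM0
    rw [norm_one, add_mul, one_mul]
    exact add_le_add (hC₃ τ him).2 hw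
  refine (norm_add_le _ _).trans ((add_le_add ((norm_add_le _ _).trans (add_le_add t1 t2))
    t3).trans_eq (by ring))

/-- At a zero of the root the product of the root with the Cauchy integral is bounded. -/
theorem cauchyInt_bounded_base (h : IsCutRoot S A B X n np) (hq : IsHolder q S) (c : ℂ)
    {b : ℝ} (hb : b ∈ B) (hbS : b ∈ S) : ∃ C, ∀ᶠ τ : ℂ in 𝓝 (b : ℂ), τ.im ≠ 0 →
      ‖n τ * (c + 1 / (Real.pi * Complex.I) * cauchyInt S (fun x => (np x)⁻¹ * q x) τ)‖ ≤ C := by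
  obtain ⟨C₁, hC₁0, hC₁⟩ := h.exists_norm_cauchyInt_le ⟨b, hbS⟩ hq c
  obtain ⟨C₂, hC₂0, hC₂⟩ := h.zero b hb hbS
  obtain ⟨C₃, hC₃0, hC₃⟩ := exists_endWeight_le_rpow (E := B) b
  refine ⟨C₂ * (C₁ * C₃), ?_⟩
  filter_upwards [hC₂, hC₃] with τ h2 h3 him
  have hne : τ ≠ b := fun h0 => him (by rw [h0, Complex.ofReal_im])
  have hpos : 0 < ‖τ - b‖ := norm_pos_iff.2 (sub_ne_zero.2 hne)
  rw [norm_mul]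
  calc _ ≤ (C₂ * ‖τ - b‖ ^ (1 / 2 : ℝ)) * (C₁ * (C₃ * ‖τ - b‖ ^ (-(1 / 2) : ℝ))) :=
        mul_le_mul h2 ((hC₁ τ him).trans (mul_le_mul_of_nonneg_left (h3 hne) hC₁0))
          (norm_nonneg _) (by positivity)
    _ = C₂ * (C₁ * C₃) * (‖τ - b‖ ^ (1 / 2 : ℝ) * ‖τ - b‖ ^ (-(1 / 2) : ℝ)) := by ring
    _ = C₂ * (C₁ * C₃) := by
        rw [← Real.rpow_add hpos]
        norm_num

/-- Where the root is infinite, the Cauchy integral of `q / np` is bounded. -/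
theorem cauchyInt_bounded_point (h : IsCutRoot S A B X n np) (hq : IsHolder q S) (c : ℂ)
    {e : ℝ} (he : e ∈ X) (heS : e ∈ S) : ∃ C, ∀ᶠ τ : ℂ in 𝓝 (e : ℂ), τ.im ≠ 0 →
      ‖c + 1 / (Real.pi * Complex.I) * cauchyInt S (fun x => (np x)⁻¹ * q x) τ‖ ≤ C := by
  obtain ⟨C₁, hC₁0, hC₁⟩ := h.exists_norm_cauchyInt_le ⟨e, heS⟩ hq c
  obtain ⟨C₂, hC₂0, hC₂⟩ := exists_endWeight_le (E := B) (p := e) fun hB => h.disj e hB heS he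
  refine ⟨C₁ * C₂, ?_⟩
  filter_upwards [hC₂] with τ h2 him
  exact (hC₁ τ him).trans (mul_le_mul_of_nonneg_left h2 hC₁0)

end IsCutRoot

/-- The data of the two integral equations: `u` and `w` are the first column of a matrix function
and the first row of its inverse, `U` is the transform of `u` and `K` the kernel built from `U`. -/
structure IsKernelData (S A : Set ℝ) (B X : Finset ℝ) (n : ℂ → ℂ) (np : ℝ → ℂ)
    (u w U : Fin 2 → ℝ → ℂ) (K : ℝ → ℝ → ℂ) : Prop where
  root : IsCutRoot S A B X n np
  lip : ∃ C, 0 ≤ C ∧ ∀ b, ∀ x ∈ S, ∀ y ∈ S, ‖u b x - u b y‖ ≤ C * |x - y| ∧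
    ‖w b x - w b y‖ ≤ C * |x - y| ∧ ‖U b x - U b y‖ ≤ C * |x - y|
  U_eq : ∀ b, ∀ σ ∈ S, U b σ = u b σ - 1 / (Real.pi * Complex.I) * subInt S np (u b) (u b σ) σ
  dot : ∀ σ ∈ S, w 0 σ * u 0 σ + w 1 σ * u 1 σ = 1
  K_eq : ∀ τ ∈ S, ∀ σ ∈ S, τ ≠ σ → K τ σ =
    -(w 0 τ * ((U 0 σ - U 0 τ) / (σ - τ)) + w 1 τ * ((U 1 σ - U 1 τ) / (σ - τ)))
  K_holder : IsHolder (fun p : ℝ × ℝ => K p.1 p.2) (S ×ˢ S)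

namespace IsKernelData

variable {S A : Set ℝ} {B X : Finset ℝ} {n : ℂ → ℂ} {np : ℝ → ℂ} {u w U : Fin 2 → ℝ → ℂ}
  {K : ℝ → ℝ → ℂ} {y : ℝ → ℂ}

theorem w_holder (h : IsKernelData S A B X n np u w U K) (b : Fin 2) : IsHolder (w b) S := by
  obtain ⟨C, hC0, hC⟩ := h.lip
  exact IsHolder.of_lipschitz h.root.compact.isBounded hC0 fun x hx y hy => (hC b x hx y hy).2.1

theorem U_continuousOn (h : IsKernelData S A B X n np u w U K) (b : Fin 2) :
    ContinuousOn (U b) S := by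
  obtain ⟨C, hC0, hC⟩ := h.lip
  exact continuousOn_of_lipschitz hC0 fun x hx y hy => (hC b x hx y hy).2.2

theorem U_holder (h : IsKernelData S A B X n np u w U K) (b : Fin 2) : IsHolder (U b) S := by
  obtain ⟨C, hC0, hC⟩ := h.lip
  exact IsHolder.of_lipschitz h.root.compact.isBounded hC0 fun x hx y hy => (hC b x hx y hy).2.2

theorem K_continuousOn (h : IsKernelData S A B X n np u w U K) {σ : ℝ} (hσ : σ ∈ S) :
    ContinuousOn (fun τ => K τ σ) S :=
  h.K_holder.continuousOn.comp (f := fun τ => (τ, σ)) (by fun_prop) fun τ hτ => ⟨hτ, hσ⟩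

/-- An integral operator with the kernel `K` maps into a Hölder class. -/
theorem isHolder_integral (h : IsKernelData S A B X n np u w U K) {g : ℝ → ℂ}
    (hg : IntegrableOn g S) : IsHolder (fun σ => ∫ τ in S, g τ * K τ σ) S := by
  obtain ⟨γ, hγ, hγ1, C, hC0, hC⟩ := h.K_holder
  have hi : ∀ σ ∈ S, IntegrableOn (fun τ => g τ * K τ σ) S := fun σ hσ =>
    hg.mul_continuousOn (h.K_continuousOn hσ) h.root.compact
  refine ⟨γ, hγ, hγ1, (∫ τ in S, ‖g τ‖) * C, by
    have : 0 ≤ ∫ τ in S, ‖g τ‖ := integral_nonneg fun _ => norm_nonneg _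
    positivity, fun σ hσ ρ hρ => ?_⟩
  rw [← integral_sub (hi σ hσ) (hi ρ hρ), mul_assoc, ← integral_mul_const]
  refine norm_integral_le_of_norm_le (hg.norm.mul_const _)
    ((ae_restrict_iff' h.root.compact.measurableSet).2 (Eventually.of_forall fun τ hτ => ?_))
  rw [← mul_sub, norm_mul]
  refine mul_le_mul_of_nonneg_left ((hC (τ, σ) ⟨hτ, hσ⟩ (τ, ρ) ⟨hτ, hρ⟩).trans_eq ?_)
    (norm_nonneg _)
  rw [Prod.dist_eq]
  simp

/-- The integral operator of the equation of the second kind in terms of the transform. -/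
theorem integral_K_eq (h : IsKernelData S A B X n np u w U K)
    (hy : IntegrableOn (fun τ => (np τ)⁻¹ * y τ) S) {σ : ℝ} (hσ : σ ∈ S) :
    ∫ τ in S, (np τ)⁻¹ * K τ σ * y τ =
      -(subInt S (fun τ => (np τ)⁻¹ * (y τ * w 0 τ)) (U 0) (U 0 σ) σ +
        subInt S (fun τ => (np τ)⁻¹ * (y τ * w 1 τ)) (U 1) (U 1 σ) σ) := by
  obtain ⟨C, hC0, hC⟩ := h.lip
  have hf : ∀ b, IntegrableOn (fun τ => (np τ)⁻¹ * (y τ * w b τ)) S := fun b => by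
    simpa only [mul_assoc] using hy.mul_continuousOn (h.w_holder b).continuousOn h.root.compact
  have hm := h.root.compact.measurableSet
  have hi : ∀ b, IntegrableOn (fun τ : ℝ => (np τ)⁻¹ * (y τ * w b τ) * (U b τ - U b σ) / (τ - σ))
      S := by
    intro b
    refine Integrable.mono' ((hf b).norm.mul_const C) (((hf b).aestronglyMeasurable.mul
      (((h.U_continuousOn b).aestronglyMeasurable hm).sub aestronglyMeasurable_const)).div₀
      (Continuous.aestronglyMeasurable (by fun_prop)))
      ((ae_restrict_iff' hm).2 (Eventually.of_forall fun τ hτ => ?_))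
    rw [norm_div, norm_mul, ← Complex.ofReal_sub, Complex.norm_real, Real.norm_eq_abs]
    rcases eq_or_ne τ σ with rfl | hne
    · rw [sub_self τ, abs_zero, div_zero]
      positivity
    · rw [div_le_iff₀ (abs_pos.2 (sub_ne_zero.2 hne)), mul_assoc]
      exact mul_le_mul_of_nonneg_left (hC b τ hτ σ hσ).2.2 (norm_nonneg _)
  unfold subInt
  rw [← integral_add (hi 0) (hi 1), ← integral_neg]
  refine setIntegral_congr_ae hm ?_
  filter_upwards [Measure.ae_ne volume σ] with τ hne hτ
  rw [h.K_eq τ hτ σ hσ hne]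
  have e1 : (τ : ℂ) - σ ≠ 0 := sub_ne_zero.2 fun h' => hne (Complex.ofReal_injective h')
  have e2 : (σ : ℂ) - τ = -(τ - σ) := by ring
  rw [e2]
  field_simp
  ring

/-- The boundary values of the Cauchy integrals of a density of Hölder class: their jumps, the form
that the singular equation takes in terms of their sums, and the bounded combination that
corresponds to the second column of the matrix function. -/
theorem exists_boundary_values (h : IsKernelData S A B X n np u w U K) (hy : IsHolder y S)
    (c : Fin 2 → ℂ) : ∃ hp hm : Fin 2 → ℝ → ℂ,
    (∀ b, ∀ σ ∈ A, Tendsto (fun τ => c b + 1 / (Real.pi * Complex.I) *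
      cauchyInt S (fun x => (np x)⁻¹ * (y x * w b x)) τ) (fromAbove σ) (𝓝 (hp b σ))) ∧
    (∀ b, ∀ σ ∈ A, Tendsto (fun τ => c b + 1 / (Real.pi * Complex.I) *
      cauchyInt S (fun x => (np x)⁻¹ * (y x * w b x)) τ) (fromBelow σ) (𝓝 (hm b σ))) ∧
    (∀ b, ∀ σ ∈ A, hp b σ - hm b σ = 2 * ((np σ)⁻¹ * (y σ * w b σ))) ∧
    (∀ σ ∈ A, (∃ L, HasPVIntegral S {σ} (fun τ => (np τ)⁻¹ *
        -(w 0 τ * u 0 σ + w 1 τ * u 1 σ) / (τ - σ) * y τ) L ∧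
      0 = c 0 * u 0 σ + c 1 * u 1 σ - 1 / (Real.pi * Complex.I) * L) ↔
      (hp 0 σ + hm 0 σ) * u 0 σ + (hp 1 σ + hm 1 σ) * u 1 σ = 0) ∧
    ∃ M, ∀ σ ∈ A, ‖hp 1 σ * w 0 σ - hp 0 σ * w 1 σ‖ ≤ M := by
  have hm := h.root.compact.measurableSet
  have hb := h.root.compact.isBounded
  have hq : ∀ b, IsHolder (fun τ => y τ * w b τ) S := fun b => hy.mul hb (h.w_holder b)
  choose! L hL hLp hLm using fun b σ (hσ : σ ∈ A) => h.root.plemelj_inv_mul (hq b) hσ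
  have hpi := IsCutRoot.pi_I_ne
  refine ⟨fun b σ => c b + 1 / (Real.pi * Complex.I) *
      (L b σ + Real.pi * Complex.I * ((np σ)⁻¹ * (y σ * w b σ))),
    fun b σ => c b + 1 / (Real.pi * Complex.I) *
      (L b σ - Real.pi * Complex.I * ((np σ)⁻¹ * (y σ * w b σ))),
    fun b σ hσ => ((hLp b σ hσ).const_mul _).const_add _,
    fun b σ hσ => ((hLm b σ hσ).const_mul _).const_add _, fun b σ _ => ?_, fun σ hσ => ?_, ?_⟩
  · field_simp
    ring
  · have hpv : HasPVIntegral S {σ} (fun τ => (np τ)⁻¹ *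
        -(w 0 τ * u 0 σ + w 1 τ * u 1 σ) / (τ - σ) * y τ)
        (-u 0 σ * L 0 σ + -u 1 σ * L 1 σ) :=
      (((hL 0 σ hσ).const_mul (-u 0 σ)).add ((hL 1 σ hσ).const_mul (-u 1 σ))).congr hm
        fun τ _ _ => by ring
    constructor
    · rintro ⟨L', hL', h0⟩
      rw [hL'.unique hpv] at h0
      linear_combination -2 * h0
    · intro h0
      refine ⟨_, hpv, ?_⟩
      linear_combination -(1 / 2) * h0
  · obtain ⟨C, hC0, hC⟩ := h.lip
    have hyi := h.root.integrableOn_inv_mul hy.continuousOn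
    obtain ⟨M₀, hM₀0, hM₀⟩ := (h.w_holder 0).exists_bound hb
    obtain ⟨M₁, hM₁0, hM₁⟩ := (h.w_holder 1).exists_bound hb
    refine ⟨‖c 1‖ * M₀ + ‖c 0‖ * M₁ + ‖(1 / (Real.pi * Complex.I) : ℂ)‖ *
      ((∫ τ in S, ‖(np τ)⁻¹ * y τ‖) * (C * (M₀ + M₁))), fun σ hσ => ?_⟩
    have hσS := h.root.subset hσ
    set g : ℝ → ℂ := fun τ => (np τ)⁻¹ * y τ * (w 1 τ * w 0 σ - w 0 τ * w 1 σ) / (τ - σ) with hg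
    -- the numerator vanishes on the diagonal
    have hgb : ∀ τ ∈ S, ‖g τ‖ ≤ ‖(np τ)⁻¹ * y τ‖ * (C * (M₀ + M₁)) := by
      intro τ hτ
      simp only [hg]
      rw [norm_div, norm_mul, ← Complex.ofReal_sub, Complex.norm_real, Real.norm_eq_abs]
      rcases eq_or_ne τ σ with rfl | hne
      · rw [sub_self τ, abs_zero, div_zero]
        positivity
      · rw [div_le_iff₀ (abs_pos.2 (sub_ne_zero.2 hne)), mul_assoc]
        refine mul_le_mul_of_nonneg_left ?_ (norm_nonneg _)
        have e : w 1 τ * w 0 σ - w 0 τ * w 1 σ =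
            (w 1 τ - w 1 σ) * w 0 σ - (w 0 τ - w 0 σ) * w 1 σ := by ring
        rw [e]
        refine (norm_sub_le _ _).trans ?_
        rw [norm_mul, norm_mul]
        have t0 := mul_le_mul (hC 0 τ hτ σ hσS).2.1 (hM₁ σ hσS) (norm_nonneg _) (by positivity)
        have t1 := mul_le_mul (hC 1 τ hτ σ hσS).2.1 (hM₀ σ hσS) (norm_nonneg _) (by positivity)
        linarith
    have hgi : IntegrableOn g S := by
      refine Integrable.mono' (hyi.norm.mul_const (C * (M₀ + M₁))) ?_
        ((ae_restrict_iff' hm).2 (Eventually.of_forall hgb))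
      refine (hyi.aestronglyMeasurable.mul (ContinuousOn.aestronglyMeasurable ?_ hm)).div₀
        (Continuous.aestronglyMeasurable (by fun_prop))
      exact ((h.w_holder 1).continuousOn.mul continuousOn_const).sub
        ((h.w_holder 0).continuousOn.mul continuousOn_const)
    have hpv : HasPVIntegral S {σ} g (w 0 σ * L 1 σ + -w 1 σ * L 0 σ) :=
      (((hL 1 σ hσ).const_mul (w 0 σ)).add ((hL 0 σ hσ).const_mul (-w 1 σ))).congr hm
        fun τ _ _ => by
          simp only [hg]
          ring
    have hLg := hpv.unique (HasPVIntegral.of_integrableOn (finite_singleton σ) hgi)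
    have e : (c 1 + 1 / (Real.pi * Complex.I) *
          (L 1 σ + Real.pi * Complex.I * ((np σ)⁻¹ * (y σ * w 1 σ)))) * w 0 σ -
        (c 0 + 1 / (Real.pi * Complex.I) *
          (L 0 σ + Real.pi * Complex.I * ((np σ)⁻¹ * (y σ * w 0 σ)))) * w 1 σ =
        c 1 * w 0 σ - c 0 * w 1 σ + 1 / (Real.pi * Complex.I) * ∫ τ in S, g τ := by
      rw [← hLg]
      ring
    simp only
    rw [e]
    refine (norm_add_le _ _).trans (add_le_add ((norm_sub_le _ _).trans ?_) ?_)
    · rw [norm_mul, norm_mul]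
      exact add_le_add (mul_le_mul_of_nonneg_left (hM₀ σ hσS) (norm_nonneg _))
        (mul_le_mul_of_nonneg_left (hM₁ σ hσS) (norm_nonneg _))
    · rw [norm_mul, ← integral_mul_const]
      exact mul_le_mul_of_nonneg_left (norm_integral_le_of_norm_le (hyi.norm.mul_const _)
        ((ae_restrict_iff' hm).2 (Eventually.of_forall hgb))) (norm_nonneg _)

/-- For a continuous density the equation of the second kind extends from the open arcs to their
end points. -/
theorem second_kind_iff (h : IsKernelData S A B X n np u w U K) (hy : ContinuousOn y S)
    (c : Fin 2 → ℂ) :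
    (∀ σ ∈ A, y σ = c 0 * U 0 σ + c 1 * U 1 σ - 1 / (Real.pi * Complex.I) *
      (subInt S (fun τ => (np τ)⁻¹ * (y τ * w 0 τ)) (U 0) (U 0 σ) σ +
        subInt S (fun τ => (np τ)⁻¹ * (y τ * w 1 τ)) (U 1) (U 1 σ) σ)) ↔
    ∀ σ ∈ S, y σ - 1 / (Real.pi * Complex.I) * ∫ τ in S, (np τ)⁻¹ * K τ σ * y τ =
      c 0 * U 0 σ + c 1 * U 1 σ := by
  have hyi := h.root.integrableOn_inv_mul hy
  have hκ : IsHolder (fun σ => ∫ τ in S, (np τ)⁻¹ * K τ σ * y τ) S := by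
    refine (h.isHolder_integral hyi).congr fun σ _ => ?_
    simp only [mul_right_comm]
  constructor
  · intro h2
    have hE : EqOn (fun σ => y σ - 1 / (Real.pi * Complex.I) *
        ∫ τ in S, (np τ)⁻¹ * K τ σ * y τ) (fun σ => c 0 * U 0 σ + c 1 * U 1 σ) A := by
      intro σ hσ
      simp only
      rw [h.integral_K_eq hyi (h.root.subset hσ), h2 σ hσ]
      ring
    exact hE.of_subset_closure
      (hy.sub (continuousOn_const.mul hκ.continuousOn))
      ((continuousOn_const.mul (h.U_continuousOn 0)).add
        (continuousOn_const.mul (h.U_continuousOn 1))) h.root.subset h.root.dense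
  · intro h2 σ hσ
    have h3 := h2 σ (h.root.subset hσ)
    rw [h.integral_K_eq hyi (h.root.subset hσ)] at h3
    linear_combination h3

/-- For a density of Hölder class, the singular equation is equivalent to the one of the second
kind. -/
theorem singular_iff (h : IsKernelData S A B X n np u w U K) (hy : IsHolder y S)
    (c : Fin 2 → ℂ) :
    (∀ σ ∈ A, ∃ L, HasPVIntegral S {σ} (fun τ => (np τ)⁻¹ *
        -(w 0 τ * u 0 σ + w 1 τ * u 1 σ) / (τ - σ) * y τ) L ∧
      0 = c 0 * u 0 σ + c 1 * u 1 σ - 1 / (Real.pi * Complex.I) * L) ↔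
    ∀ σ ∈ S, y σ - 1 / (Real.pi * Complex.I) * ∫ τ in S, (np τ)⁻¹ * K τ σ * y τ =
      c 0 * U 0 σ + c 1 * U 1 σ := by
  obtain ⟨C, hC0, hC⟩ := h.lip
  have hq : ∀ b, IsHolder (fun τ => y τ * w b τ) S := fun b =>
    hy.mul h.root.compact.isBounded (h.w_holder b)
  obtain ⟨hp, hm, hplus, hminus, hjump, hiff, -⟩ := h.exists_boundary_values hy c
  refine (forall₂_congr hiff).trans (Iff.trans ?_ (h.second_kind_iff hy.continuousOn c))
  exact h.root.link (K := C) (c := c) (f := fun b τ => (np τ)⁻¹ * (y τ * w b τ)) (u := u)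
    (U := U) (w := w) (hp := hp) (hm := hm) (y := y)
    (fun b => h.root.integrableOn_inv_mul (hq b).continuousOn) hC0
    (fun b x hx y hy => (hC b x hx y hy).1) (fun b x hx y hy => (hC b x hx y hy).2.2) h.U_eq
    (fun _ _ _ => rfl) (fun σ hσ => h.dot σ (h.root.subset hσ)) hplus hminus hjump
    (fun b e he heS => h.root.cauchyInt_bounded_base (hq b) (c b) he heS)
    (fun b e he heS => h.root.cauchyInt_bounded_point (hq b) (c b) he heS)

/-- Near each point of the cut the integrands of the equation of the second kind have a common
integrable bound. At a zero `e` of `np` there are two cases: if `K e σ ≠ 0` for some `σ`, then the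
density divided by `np` is integrable near `e` because the equation makes sense at `σ`; if
`K e` vanishes identically, then `K τ σ` is of the order of `τ - e`. -/
theorem exists_local_bound (h : IsKernelData S A B X n np u w U K) (hy : IntegrableOn y S)
    (hi : ∀ σ ∈ S, IntegrableOn (fun τ => (np τ)⁻¹ * K τ σ * y τ) S) {e : ℝ} (he : e ∈ S) :
    ∃ t ∈ 𝓝[S] e, ∃ g : ℝ → ℝ, IntegrableOn g S ∧
      ∀ σ ∈ S, ∀ τ ∈ t, τ ∈ A → τ ≠ σ → ‖(np τ)⁻¹ * K τ σ * y τ‖ ≤ g τ := by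
  obtain ⟨D, hD0, hD⟩ := h.root.norm_le
  obtain ⟨M, hM0, hM⟩ := h.K_holder.exists_bound
    (h.root.compact.isBounded.prod h.root.compact.isBounded)
  have hreal : ∀ {P : ℂ → Prop}, (∀ᶠ τ in 𝓝 (e : ℂ), P τ) → ∀ᶠ τ : ℝ in 𝓝[S] e, P τ :=
    fun hP => ((Complex.continuous_ofReal.tendsto e).mono_left nhdsWithin_le_nhds).eventually hP
  have hw : ∀ τ : ℝ, 1 + ∑ b ∈ B, |τ - b| ^ (-(1 / 2) : ℝ) = endWeight B τ := by
    intro τ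
    unfold endWeight
    congr 1
    refine Finset.sum_congr rfl fun b _ => ?_
    rw [← Complex.ofReal_sub, Complex.norm_real, Real.norm_eq_abs]
  by_cases heB : e ∈ B
  · by_cases hK : ∃ σ₀ ∈ S, K e σ₀ ≠ 0
    · obtain ⟨σ₀, hσ₀, hne⟩ := hK
      have hc : ContinuousWithinAt (fun τ => ‖K τ σ₀‖) S e :=
        (h.K_continuousOn hσ₀ e he).norm
      have hpos : 0 < ‖K e σ₀‖ / 2 := by
        have := norm_pos_iff.2 hne
        positivity
      have h1 : ∀ᶠ τ in 𝓝[S] e, ‖K e σ₀‖ / 2 < ‖K τ σ₀‖ :=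
        hc.eventually (lt_mem_nhds (by linarith))
      refine ⟨_, inter_mem h1 self_mem_nhdsWithin,
        fun τ => M / (‖K e σ₀‖ / 2) * ‖(np τ)⁻¹ * K τ σ₀ * y τ‖,
        ((hi σ₀ hσ₀).norm).const_mul _, fun σ hσ τ hτ _ _ => ?_⟩
      have h2 : ‖K e σ₀‖ / 2 < ‖K τ σ₀‖ := hτ.1
      simp only [norm_mul]
      rw [div_mul_eq_mul_div, le_div_iff₀ hpos]
      have h3 : ‖K τ σ‖ ≤ M := hM (τ, σ) ⟨hτ.2, hσ⟩
      calc ‖(np τ)⁻¹‖ * ‖K τ σ‖ * ‖y τ‖ * (‖K e σ₀‖ / 2)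
          = (‖(np τ)⁻¹‖ * ‖y τ‖) * (‖K τ σ‖ * (‖K e σ₀‖ / 2)) := by ring
        _ ≤ (‖(np τ)⁻¹‖ * ‖y τ‖) * (M * ‖K τ σ₀‖) :=
            mul_le_mul_of_nonneg_left (mul_le_mul h3 h2.le hpos.le hM0) (by positivity)
        _ = _ := by ring
    · push Not at hK
      obtain ⟨C, hC0, hC⟩ := h.lip
      obtain ⟨Q, hQ0, hQ⟩ := exists_endWeight_le_rpow (E := B) e
      have hQ' := hreal (hQ.and (Metric.ball_mem_nhds (e : ℂ) one_pos))
      -- the vector `w e` is orthogonal to all differences of values of `U`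
      have hperp : ∀ σ ∈ S, w 0 e * U 0 σ + w 1 e * U 1 σ = w 0 e * U 0 e + w 1 e * U 1 e := by
        intro σ hσ
        rcases eq_or_ne e σ with rfl | hne
        · rfl
        · have h1 := h.K_eq e he σ hσ hne
          rw [hK σ hσ] at h1
          have e1 : (σ : ℂ) - e ≠ 0 :=
            sub_ne_zero.2 fun h' => hne (Complex.ofReal_injective h').symm
          field_simp at h1
          linear_combination h1
      refine ⟨_, inter_mem hQ' self_mem_nhdsWithin, fun τ => D * Q * (2 * C * C) * ‖y τ‖,
        hy.norm.const_mul _, fun σ hσ τ hτ hτA hne => ?_⟩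
      have hτS : τ ∈ S := hτ.2
      have hτe : τ ≠ e := fun h0 => (h.root.notMem τ hτA).1 (h0 ▸ heB)
      have hd : 0 < |τ - e| := abs_pos.2 (sub_ne_zero.2 hτe)
      have hnorm : ‖(τ : ℂ) - e‖ = |τ - e| := by
        rw [← Complex.ofReal_sub, Complex.norm_real, Real.norm_eq_abs]
      have h1 : ‖(np τ)⁻¹‖ ≤ D * (Q * |τ - e| ^ (-(1 / 2) : ℝ)) := by
        refine (hD τ hτA).2.trans (mul_le_mul_of_nonneg_left ?_ hD0)
        rw [hw, ← hnorm]
        exact hτ.1.1 fun h0 => hτe (Complex.ofReal_injective h0)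
      have hd1 : |τ - e| ≤ 1 := by
        have := hτ.1.2
        rw [dist_eq_norm, hnorm] at this
        exact this.le
      have h2 : ‖K τ σ‖ ≤ 2 * C * C * |τ - e| := by
        have hp : 0 < |σ - τ| := abs_pos.2 (sub_ne_zero.2 hne.symm)
        have e0 : (σ : ℂ) - τ ≠ 0 := sub_ne_zero.2 fun h' => hne (Complex.ofReal_injective h').symm
        have e1 : K τ σ = -(((w 0 τ - w 0 e) * (U 0 σ - U 0 τ) +
            (w 1 τ - w 1 e) * (U 1 σ - U 1 τ)) / (σ - τ)) := by
          rw [h.K_eq τ hτS σ hσ hne]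
          field_simp
          linear_combination hperp τ hτS - hperp σ hσ
        rw [e1, norm_neg, norm_div, ← Complex.ofReal_sub, Complex.norm_real, Real.norm_eq_abs,
          div_le_iff₀ hp]
        have t : ∀ b, ‖(w b τ - w b e) * (U b σ - U b τ)‖ ≤ (C * |τ - e|) * (C * |σ - τ|) :=
          fun b => by
            rw [norm_mul]
            exact mul_le_mul (hC b τ hτS e he).2.1 (hC b σ hσ τ hτS).2.2 (norm_nonneg _)
              (by positivity)
        refine (norm_add_le _ _).trans ((add_le_add (t 0) (t 1)).trans_eq (by ring))
      have h3 : |τ - e| ^ (-(1 / 2) : ℝ) * |τ - e| ≤ 1 := by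
        rw [← Real.rpow_add_one hd.ne']
        exact Real.rpow_le_one hd.le hd1 (by norm_num)
      rw [norm_mul, norm_mul]
      refine mul_le_mul_of_nonneg_right ?_ (norm_nonneg _)
      calc ‖(np τ)⁻¹‖ * ‖K τ σ‖ ≤ (D * (Q * |τ - e| ^ (-(1 / 2) : ℝ))) * (2 * C * C * |τ - e|) :=
            mul_le_mul h1 h2 (norm_nonneg _) (by positivity)
        _ = D * Q * (2 * C * C) * (|τ - e| ^ (-(1 / 2) : ℝ) * |τ - e|) := by ring
        _ ≤ D * Q * (2 * C * C) * 1 := mul_le_mul_of_nonneg_left h3 (by positivity)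
        _ = _ := mul_one _
  · obtain ⟨Q, hQ0, hQ⟩ := exists_endWeight_le heB
    refine ⟨_, inter_mem (hreal hQ) self_mem_nhdsWithin, fun τ => D * Q * M * ‖y τ‖,
      hy.norm.const_mul _, fun σ hσ τ hτ hτA _ => ?_⟩
    rw [norm_mul, norm_mul]
    refine mul_le_mul_of_nonneg_right ?_ (norm_nonneg _)
    refine mul_le_mul ((hD τ hτA).2.trans (mul_le_mul_of_nonneg_left ?_ hD0))
      (hM (τ, σ) ⟨hτ.2, hσ⟩) (norm_nonneg _) (by positivity)
    rw [hw]
    exact hτ.1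

/-- Summable solutions of the equation of the second kind are of Hölder class. -/
theorem isHolder_of_fredholm (h : IsKernelData S A B X n np u w U K) (hy : IntegrableOn y S)
    (hi : ∀ σ ∈ S, IntegrableOn (fun τ => (np τ)⁻¹ * K τ σ * y τ) S) {c : Fin 2 → ℂ}
    (he : ∀ σ ∈ S, y σ - 1 / (Real.pi * Complex.I) * ∫ τ in S, (np τ)⁻¹ * K τ σ * y τ =
      c 0 * U 0 σ + c 1 * U 1 σ) : IsHolder y S := by
  have hm := h.root.compact.measurableSet
  have hb := h.root.compact.isBounded
  obtain ⟨g, hg, hgb⟩ : ∃ g : ℝ → ℝ, IntegrableOn g S ∧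
      ∀ σ ∈ S, ∀ τ ∈ S, τ ∈ A → τ ≠ σ → ‖(np τ)⁻¹ * K τ σ * y τ‖ ≤ g τ := by
    refine h.root.compact.induction_on (p := fun t => ∃ g : ℝ → ℝ, IntegrableOn g S ∧
      ∀ σ ∈ S, ∀ τ ∈ t, τ ∈ A → τ ≠ σ → ‖(np τ)⁻¹ * K τ σ * y τ‖ ≤ g τ)
      ⟨0, integrableOn_zero, by simp⟩ ?_ ?_ fun e he => h.exists_local_bound hy hi he
    · rintro s t hst ⟨g, hg, hgb⟩
      exact ⟨g, hg, fun σ hσ τ hτ => hgb σ hσ τ (hst hτ)⟩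
    · rintro s t ⟨g, hg, hgb⟩ ⟨g', hg', hgb'⟩
      refine ⟨fun τ => ‖g τ‖ + ‖g' τ‖, hg.norm.add hg'.norm, fun σ hσ τ hτ hA hne => ?_⟩
      rcases hτ with hτ | hτ
      · exact (hgb σ hσ τ hτ hA hne).trans ((Real.le_norm_self _).trans
          (le_add_of_nonneg_right (norm_nonneg _)))
      · exact (hgb' σ hσ τ hτ hA hne).trans ((Real.le_norm_self _).trans
          (le_add_of_nonneg_left (norm_nonneg _)))
  have hUc : IsHolder (fun σ => c 0 * U 0 σ + c 1 * U 1 σ) S :=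
    ((isHolder_const (c 0)).mul hb (h.U_holder 0)).add hb ((isHolder_const (c 1)).mul hb
      (h.U_holder 1))
  obtain ⟨MU, hMU0, hMU⟩ := hUc.exists_bound hb
  have hA : ∀ᵐ τ : ℝ, τ ∉ S \ A :=
    measure_eq_zero_iff_ae_notMem.1 (h.root.finite_sdiff.measure_zero _)
  -- the equation and the common integrable bound give a bound for the density
  set Q : ℝ := MU + ‖(1 / (Real.pi * Complex.I) : ℂ)‖ * ∫ τ in S, g τ with hQ
  have hyb : ∀ σ ∈ S, ‖y σ‖ ≤ Q := by
    intro σ hσ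
    have h1 : y σ = c 0 * U 0 σ + c 1 * U 1 σ +
        1 / (Real.pi * Complex.I) * ∫ τ in S, (np τ)⁻¹ * K τ σ * y τ := by
      rw [← he σ hσ]
      ring
    rw [h1]
    refine (norm_add_le _ _).trans (add_le_add (hMU σ hσ) ?_)
    rw [norm_mul]
    refine mul_le_mul_of_nonneg_left (norm_integral_le_of_norm_le hg ?_) (norm_nonneg _)
    filter_upwards [ae_restrict_of_ae hA, ae_restrict_of_ae (Measure.ae_ne volume σ),
      ae_restrict_mem hm] with τ h1 h2 h3
    exact hgb σ hσ τ h3 (by_contra fun h4 => h1 ⟨h3, h4⟩) h2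
  have hyi : IntegrableOn (fun τ => (np τ)⁻¹ * y τ) S := by
    refine Integrable.mono' (h.root.integrableOn_inv.norm.mul_const Q)
      (h.root.integrableOn_inv.aestronglyMeasurable.mul hy.aestronglyMeasurable) ?_
    filter_upwards [ae_restrict_mem hm] with τ hτ
    rw [norm_mul]
    exact mul_le_mul_of_nonneg_left (hyb τ hτ) (norm_nonneg _)
  -- now `y / np` is integrable, so that the equation exhibits `y` as a function of Hölder class
  refine (hUc.add hb ((isHolder_const (1 / (Real.pi * Complex.I) : ℂ)).mul hb
    (h.isHolder_integral hyi))).congr fun σ hσ => ?_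
  simp only
  rw [← he σ hσ]
  have e : ∀ τ, (np τ)⁻¹ * y τ * K τ σ = (np τ)⁻¹ * K τ σ * y τ := fun τ => by ring
  simp only [e]
  ring

end IsKernelData

/-! ### The equivalence of the Alekseev-type equation and the Fredholm equation -/

/-- Hölder conditions on two sets at a positive distance combine. -/
theorem IsHolder.union {X E : Type*} [PseudoMetricSpace X] [SeminormedAddCommGroup E] {f : X → E}
    {s t : Set X} (hs : IsHolder f s) (ht : IsHolder f t) (hsb : Bornology.IsBounded s)
    (htb : Bornology.IsBounded t) {δ : ℝ} (hδ : 0 < δ) (hd : ∀ x ∈ s, ∀ y ∈ t, δ ≤ dist x y) :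
    IsHolder f (s ∪ t) := by
  obtain ⟨M, hM0, hM⟩ := hs.exists_bound hsb
  obtain ⟨M', hM0', hM'⟩ := ht.exists_bound htb
  obtain ⟨R, hR⟩ := (Metric.isBounded_iff.1 (hsb.union htb))
  obtain ⟨γ, hγ, hγ1, C, hC0, hC⟩ := hs
  obtain ⟨γ', hγ', hγ1', C', hC0', hC'⟩ := ht
  set β := min γ γ' with hβ
  have hβ0 : 0 < β := lt_min hγ hγ'
  set Q := max R 1 with hQ
  have hQ1 : 1 ≤ Q := le_max_right _ _
  have hcross : ∀ x ∈ s, ∀ y ∈ t, ‖f x - f y‖ ≤ (M + M') / δ ^ β * dist x y ^ β := by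
    intro x hx y hy
    rw [div_mul_eq_mul_div, le_div_iff₀ (by positivity)]
    exact mul_le_mul ((norm_sub_le _ _).trans (add_le_add (hM x hx) (hM' y hy)))
      (Real.rpow_le_rpow hδ.le (hd x hx y hy) hβ0.le) (by positivity) (by positivity)
  refine ⟨β, hβ0, (min_le_left _ _).trans hγ1, C * Q + C' * Q + (M + M') / δ ^ β, by positivity,
    fun x hx y hy => ?_⟩
  have hp : 0 ≤ dist x y ^ β := by positivity
  have hdR : dist x y ≤ R := hR hx hy
  have hrest : 0 ≤ (M + M') / δ ^ β := by positivity
  have hs' : 0 ≤ C * Q := by positivity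
  have ht' : 0 ≤ C' * Q := by positivity
  rcases hx with hx | hx <;> rcases hy with hy | hy
  · refine (hC x hx y hy).trans ?_
    have := mul_le_mul_of_nonneg_left (rpow_le_of_index_le dist_nonneg hdR hβ0 (min_le_left γ γ')
      (by linarith)) hC0
    rw [← mul_assoc] at this
    exact this.trans (mul_le_mul_of_nonneg_right (by linarith) hp)
  · exact (hcross x hx y hy).trans (mul_le_mul_of_nonneg_right (by linarith) hp)
  · rw [norm_sub_rev]
    refine (hcross y hy x hx).trans ?_
    rw [dist_comm]
    exact mul_le_mul_of_nonneg_right (by linarith) hp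
  · refine (hC' x hx y hy).trans ?_
    have := mul_le_mul_of_nonneg_left (rpow_le_of_index_le dist_nonneg hdR hβ0 (min_le_right γ γ')
      (by linarith)) hC0'
    rw [← mul_assoc] at this
    exact this.trans (mul_le_mul_of_nonneg_right (by linarith) hp)

theorem isHolder_pi {X : Type*} [PseudoMetricSpace X] {f : X → Fin 2 → ℂ} {s : Set X}
    (hs : Bornology.IsBounded s) (h : ∀ b, IsHolder (fun x => f x b) s) : IsHolder f s := by
  obtain ⟨γ, hγ, hγ1, C, hC0, hC⟩ := IsHolder.common hs (h 0) (h 1)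
  refine ⟨γ, hγ, hγ1, C, hC0, fun y hy z hz => ?_⟩
  refine (pi_norm_le_iff_of_nonneg (by positivity)).2 fun i => ?_
  fin_cases i
  exacts [(hC y hy z hz).1, (hC y hy z hz).2]

namespace NullDomain

variable (G : NullDomain) {v : (ℝ → Mat2) × (ℝ → Mat2)} {x : ℝ × ℝ} {u w : Fin 2 → ℝ → ℂ}
  {Y₁ : ℝ → Fin 2 → ℂ}

/-- On the closed arcs, which are two separated closed intervals, `C^{0+}` is a global Hölder
condition. -/
theorem isCPlus_zero_iff (hx : x ∈ G.D) :
    IsCPlus 0 Y₁ (G.arcsBar x) ↔ ∀ b, IsHolder (fun σ => Y₁ σ b) (G.arcsBar x) := by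
  have hb := (G.isCompact_arcsBar x).isBounded
  constructor
  · intro h
    suffices H : IsHolder Y₁ (G.arcsBar x) by
      intro b
      obtain ⟨γ, hγ, hγ1, C, hC0, hC⟩ := H
      exact ⟨γ, hγ, hγ1, C, hC0, fun y hy z hz =>
        (norm_le_pi_norm (Y₁ y - Y₁ z) b).trans (hC y hy z hz)⟩
    have key : ∀ a b : ℝ, closure (Ioo a b) ⊆ G.arcsBar x → IsHolder Y₁ (closure (Ioo a b)) := by
      intro a b hab
      rcases lt_or_ge a b with hl | hl
      · rw [closure_Ioo hl.ne] at hab ⊢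
        obtain ⟨γ, h0, h1, M, hM⟩ := h.2 a b hab
        refine IsHolder.of_holderOnWith (Metric.isBounded_Icc a b) h0 h1 (M := M) ?_
        intro y hy z hz
        have := hM y hy z hz
        rwa [iteratedDerivWithin_zero] at this
      · rw [Ioo_eq_empty (not_lt.2 hl), closure_empty]
        exact ⟨1 / 2, by norm_num, le_rfl, 0, le_rfl, by simp⟩
    refine IsHolder.union (key _ _ subset_union_left) (key _ _ subset_union_right)
      (hb.subset subset_union_left) (hb.subset subset_union_right)
      (sub_pos.2 (G.max_lt_min hx)) fun y hy z hz => ?_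
    have h1 := (G.closure_I₃_subset x hy).2
    have h2 := (G.closure_I₄_subset x hz).1
    rw [dist_comm, Real.dist_eq]
    exact le_trans (by linarith) (le_abs_self _)
  · intro h
    have H := isHolder_pi hb h
    refine ⟨?_, fun a b hab => ?_⟩
    · exact contDiffOn_zero.2 H.continuousOn
    · rw [iteratedDerivWithin_zero]
      exact (H.mono hab).exists_holderOnWith

theorem single_dot (a : Fin 2) (f : Fin 2 → ℂ) :
    (Pi.single a 1 : Fin 2 → ℂ) 0 * f 0 + (Pi.single a 1 : Fin 2 → ℂ) 1 * f 1 = f a := by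
  fin_cases a <;> simp

namespace IsFrame

variable {G}

/-- The transform of the first column of `W`. -/
abbrev T (G : NullDomain) (x : ℝ × ℝ) (u : Fin 2 → ℝ → ℂ) (b : Fin 2) : ℝ → ℂ :=
  regTransform (G.arcsBar x) (G.nuPlus x) (u b)

/-- The root `ν`, the columns of `W` and the kernel `K₂₁` satisfy the hypotheses of the equivalence
of the singular equation with the one of the second kind. -/
theorem isKernelData (hF : G.IsFrame v x u w) (hx : x ∈ G.D) :
    IsKernelData (G.arcsBar x) (G.arcs x) {G.r₀, G.s₀} {x.1, x.2} (G.nu x) (G.nuPlus x) u w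
      (T G x u) (G.K₂₁ v x) where
  root := G.isCutRoot_nu hx
  lip := by
    have h := G.isCutRoot_nu hx
    obtain ⟨R, hR, hSR⟩ := exists_Icc_subset h.compact
    obtain ⟨u', u'', hu, hu', hu''⟩ := hF.exists_deriv
    have hT : ∀ b, IsCHolder 1 (T G x u b) := fun b =>
      ⟨_, hasDerivAt_regTransform h.compact h.integrableOn (hu b) (hu' b) (hu'' b).continuous,
        isCHolder_regDeriv h.compact h.integrableOn (hu' b) (hu'' b)⟩
    choose C₁ h₁0 h₁ using fun b => (hF.u_smooth b).exists_lipschitz R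
    choose C₂ h₂0 h₂ using fun b => (hF.w_smooth b).exists_lipschitz R
    choose C₃ h₃0 h₃ using fun b => (hT b).exists_lipschitz R
    refine ⟨∑ b, (C₁ b + C₂ b + C₃ b), Finset.sum_nonneg fun b _ =>
      add_nonneg (add_nonneg (h₁0 b) (h₂0 b)) (h₃0 b), fun b y hy z hz => ?_⟩
    have hle : C₁ b + C₂ b + C₃ b ≤ ∑ b, (C₁ b + C₂ b + C₃ b) :=
      Finset.single_le_sum (f := fun b => C₁ b + C₂ b + C₃ b)
        (fun b _ => add_nonneg (add_nonneg (h₁0 b) (h₂0 b)) (h₃0 b)) (Finset.mem_univ b)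
    have e₁ := h₁0 b
    have e₂ := h₂0 b
    have e₃ := h₃0 b
    exact ⟨(h₁ b y (hSR hy) z (hSR hz)).trans
        (mul_le_mul_of_nonneg_right (by linarith) (abs_nonneg _)),
      (h₂ b y (hSR hy) z (hSR hz)).trans
        (mul_le_mul_of_nonneg_right (by linarith) (abs_nonneg _)),
      (h₃ b y (hSR hy) z (hSR hz)).trans
        (mul_le_mul_of_nonneg_right (by linarith) (abs_nonneg _))⟩
  U_eq _ _ _ := rfl
  dot := hF.dot
  K_eq _ hτ _ hσ hne := hF.K₂₁_eq_div hx hτ hσ hne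
  K_holder := hF.isHolder_K₂₁ hx

theorem alekseev_integrand (hF : G.IsFrame v x u w) {σ τ : ℝ} (hσ : σ ∈ G.arcsBar x)
    (hτ : τ ∈ G.arcsBar x) (a : Fin 2) :
    (((G.nuPlus x τ)⁻¹ * (G.W₂ v x τ ⬝ᵥ matJ *ᵥ G.W₁ v x σ) /
        ((τ - σ : ℝ) : ℂ)) • Y₁ τ) a =
      (G.nuPlus x τ)⁻¹ * -(w 0 τ * u 0 σ + w 1 τ * u 1 σ) / (τ - σ) * Y₁ τ a := by
  have e : G.W₂ v x τ ⬝ᵥ matJ *ᵥ G.W₁ v x σ = -(w 0 τ * u 0 σ + w 1 τ * u 1 σ) := by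
    rw [hF.W₁_eq hσ]
    simp only [W₂, matJ, dotProduct, Matrix.mulVec, Fin.sum_univ_two, Matrix.col_apply,
      (hF.W_one τ hτ).1, (hF.W_one τ hτ).2, Matrix.of_apply, Matrix.cons_val_zero,
      Matrix.cons_val_one, Matrix.cons_val', Matrix.cons_val_fin_one]
    ring
  rw [e, Pi.smul_apply, smul_eq_mul]
  push_cast
  ring

/-- The Alekseev-type equation, one component of the density at a time. -/
theorem solvesAlekseev_iff (hF : G.IsFrame v x u w) :
    G.SolvesAlekseev v x Y₁ ↔ ∀ a, ∀ σ ∈ G.arcs x, ∃ L : ℂ,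
      HasPVIntegral (G.arcsBar x) {σ} (fun τ => (G.nuPlus x τ)⁻¹ *
        -(w 0 τ * u 0 σ + w 1 τ * u 1 σ) / (τ - σ) * Y₁ τ a) L ∧
      0 = (Pi.single a 1 : Fin 2 → ℂ) 0 * u 0 σ + (Pi.single a 1 : Fin 2 → ℂ) 1 * u 1 σ -
        1 / (Real.pi * Complex.I) * L := by
  have hm := (G.isCompact_arcsBar x).measurableSet
  have hsub : G.arcs x ⊆ G.arcsBar x := union_subset_union subset_closure subset_closure
  constructor
  · intro h a σ hσ
    obtain ⟨L, hL, h0⟩ := h σ hσ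
    refine ⟨L a, (hL.eval a).congr hm fun τ hτ _ => hF.alekseev_integrand (hsub hσ) hτ a, ?_⟩
    have := congrFun h0 a
    rw [hF.W₁_eq (hsub hσ)] at this
    rw [single_dot a fun b => u b σ]
    exact this
  · intro h σ hσ
    choose L hL h0 using fun a => h a σ hσ
    refine ⟨L, HasPVIntegral.pi fun a => (hL a).congr hm fun τ hτ _ =>
      (hF.alekseev_integrand (hsub hσ) hτ a).symm, funext fun a => ?_⟩
    rw [hF.W₁_eq (hsub hσ)]
    have := h0 a
    rw [single_dot a fun b => u b σ] at this
    exact this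

/-- The Fredholm equation, one component of the density at a time. -/
theorem solvesFredholm_iff (hF : G.IsFrame v x u w) (hx : x ∈ G.D) :
    G.SolvesFredholm v x Y₁ ↔ ∀ a,
      (∀ σ ∈ G.arcsBar x, IntegrableOn (fun τ => (G.nuPlus x τ)⁻¹ * G.K₂₁ v x τ σ * Y₁ τ a)
        (G.arcsBar x)) ∧
      ∀ σ ∈ G.arcsBar x, Y₁ σ a - 1 / (Real.pi * Complex.I) *
        ∫ τ in G.arcsBar x, (G.nuPlus x τ)⁻¹ * G.K₂₁ v x τ σ * Y₁ τ a =
          (Pi.single a 1 : Fin 2 → ℂ) 0 * T G x u 0 σ +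
            (Pi.single a 1 : Fin 2 → ℂ) 1 * T G x u 1 σ := by
  constructor
  · intro h a
    refine ⟨fun σ hσ => Integrable.eval (h σ hσ).1 a, fun σ hσ => ?_⟩
    have h1 := congrFun (h σ hσ).2 a
    rw [hF.U₁_eq hx hσ, Pi.sub_apply, Pi.smul_apply,
      eval_integral fun a => Integrable.eval (h σ hσ).1 a] at h1
    rw [single_dot a fun b => T G x u b σ]
    exact h1
  · intro h σ hσ
    have hi : ∀ a, IntegrableOn
        (fun τ => (((G.nuPlus x τ)⁻¹ * G.K₂₁ v x τ σ) • Y₁ τ) a) (G.arcsBar x) :=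
      fun a => (h a).1 σ hσ
    refine ⟨Integrable.of_eval hi, funext fun a => ?_⟩
    have h1 := (h a).2 σ hσ
    rw [single_dot a fun b => T G x u b σ] at h1
    rw [hF.U₁_eq hx hσ, Pi.sub_apply, Pi.smul_apply, eval_integral hi]
    exact h1

theorem alekseev_iff_fredholm (hF : G.IsFrame v x u w) (hx : x ∈ G.D) :
    (IsCPlus 0 Y₁ (G.arcsBar x) ∧ G.SolvesAlekseev v x Y₁) ↔
      (IntegrableOn Y₁ (G.arcsBar x) ∧ G.SolvesFredholm v x Y₁) := by
  have h := hF.isKernelData hx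
  rw [G.isCPlus_zero_iff hx, hF.solvesAlekseev_iff, hF.solvesFredholm_iff hx]
  constructor
  · rintro ⟨hY, hA⟩
    refine ⟨Integrable.of_eval fun a => (hY a).continuousOn.integrableOn_compact h.root.compact,
      fun a => ⟨fun σ hσ => ?_, (h.singular_iff (hY a) _).1 (hA a)⟩⟩
    have := (h.root.integrableOn_inv_mul (hY a).continuousOn).mul_continuousOn
      (h.K_continuousOn hσ) h.root.compact
    simpa only [mul_right_comm] using this
  · rintro ⟨hi, hS⟩
    have hY : ∀ a, IsHolder (fun σ => Y₁ σ a) (G.arcsBar x) := fun a =>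
      h.isHolder_of_fredholm (Integrable.eval hi a) (hS a).1 (hS a).2
    exact ⟨hY, fun a => (h.singular_iff (hY a) _).2 (hS a).2⟩

end IsFrame

end NullDomain

/-! ### The homogeneous Hilbert problem -/

/-- For a function holomorphic off the cut, a bound at the non-real points near `e` holds at all
points off the cut near `e`. -/
theorem exists_bound_near {S : Set ℝ} {f : ℂ → ℂ}
    (hd : ∀ τ ∉ (fun σ : ℝ => (σ : ℂ)) '' S, DifferentiableAt ℂ f τ) {e : ℝ}
    (hb : e ∈ S → ∃ C, ∀ᶠ τ : ℂ in 𝓝 (e : ℂ), τ.im ≠ 0 → ‖f τ‖ ≤ C) :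
    ∃ C, ∀ᶠ τ : ℂ in 𝓝 (e : ℂ), τ ∉ (fun σ : ℝ => (σ : ℂ)) '' S → ‖f τ‖ ≤ C := by
  by_cases he : e ∈ S
  · obtain ⟨C, hC⟩ := hb he
    refine ⟨C, ?_⟩
    filter_upwards [hC.eventually_nhds] with τ h1 hτ
    by_cases him : τ.im = 0
    · -- real points off the cut are limits of non-real ones
      have hre : (τ.re : ℂ) = τ := Complex.ext rfl (by simp [him])
      have hl : fromAbove τ.re ≤ 𝓝 τ := by
        have := fromAbove_le τ.re
        rwa [hre] at this
      refine le_of_tendsto (((hd τ hτ).continuousAt.tendsto.mono_left hl).norm) ?_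
      filter_upwards [hl h1, eventually_im_pos τ.re] with ζ h2 h3 using h2 h3.ne'
    · exact h1.self_of_nhds him
  · have hτ : (e : ℂ) ∉ (fun σ : ℝ => (σ : ℂ)) '' S := by
      rintro ⟨s, hs, h⟩
      exact he (Complex.ofReal_injective h ▸ hs)
    refine ⟨‖f e‖ + 1, ?_⟩
    filter_upwards [(hd _ hτ).continuousAt.norm.eventually (eventually_le_nhds (lt_add_one _))]
      with τ h1 _ using h1

theorem boundedAt_pair {X : Type*} [TopologicalSpace X] {F : X → Mat2} {S : Set X} {a b : X}
    (h : ∀ e, e = a ∨ e = b → ∀ i j, ∃ C, ∀ᶠ t in 𝓝 e, t ∉ S → ‖F t i j‖ ≤ C) :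
    BoundedAt {a, b} S F := by
  choose Ca hCa using h a (Or.inl rfl)
  choose Cb hCb using h b (Or.inr rfl)
  have hle : ∀ (C : Fin 2 → Fin 2 → ℝ) i j, C i j ≤ ∑ i, ∑ j, |C i j| := fun C i j =>
    (le_abs_self _).trans ((Finset.single_le_sum (f := fun j => |C i j|)
      (fun _ _ => abs_nonneg _) (Finset.mem_univ j)).trans
      (Finset.single_le_sum (f := fun i => ∑ j, |C i j|)
        (fun _ _ => Finset.sum_nonneg fun _ _ => abs_nonneg _) (Finset.mem_univ i)))
  have hnn : ∀ C : Fin 2 → Fin 2 → ℝ, 0 ≤ ∑ i, ∑ j, |C i j| := fun C =>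
    Finset.sum_nonneg fun _ _ => Finset.sum_nonneg fun _ _ => abs_nonneg _
  set M := ∑ i, ∑ j, |Ca i j| + ∑ i, ∑ j, |Cb i j| with hM
  refine ⟨{t | t ∉ S → ∀ i j, ‖F t i j‖ ≤ M}, mem_nhdsSet_iff_forall.2 fun e he => ?_, M,
    fun t ht => ht.1 ht.2⟩
  have key : ∀ C : Fin 2 → Fin 2 → ℝ, (∀ i j, C i j ≤ M) →
      (∀ i j, ∀ᶠ t in 𝓝 e, t ∉ S → ‖F t i j‖ ≤ C i j) →
      {t | t ∉ S → ∀ i j, ‖F t i j‖ ≤ M} ∈ 𝓝 e := by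
    intro C hC h
    filter_upwards [eventually_all.2 fun i => eventually_all.2 fun j => h i j] with t ht hS i j
    exact (ht i j hS).trans (hC i j)
  rcases he with rfl | he
  · exact key Ca (fun i j => (hle Ca i j).trans (le_add_of_nonneg_right (hnn Cb))) hCa
  · rw [mem_singleton_iff] at he
    subst he
    exact key Cb (fun i j => (hle Cb i j).trans (le_add_of_nonneg_left (hnn Ca))) hCb

theorem BoundedAt.eventually {F : ℂ → Mat2} {S : Set ℝ} {P : Set ℂ}
    (h : BoundedAt P ((fun σ : ℝ => (σ : ℂ)) '' S) F) {e : ℂ} (he : e ∈ P) (i j : Fin 2) :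
    ∃ C, ∀ᶠ τ : ℂ in 𝓝 e, τ.im ≠ 0 → ‖F τ i j‖ ≤ C := by
  obtain ⟨U, hU, M, hM⟩ := h
  refine ⟨M, ?_⟩
  filter_upwards [mem_nhdsSet_iff_forall.1 hU e he] with τ hτ him
  exact hM τ ⟨hτ, notMem_image_of_im_ne_zero S him⟩ i j

theorem continuous_unip : Continuous unip := by
  refine continuous_matrix fun i j => ?_
  fin_cases i <;> fin_cases j <;> simp [unip] <;> fun_prop

theorem continuous_diag_one : Continuous fun z : ℂ => (!![1, 0; 0, z] : Mat2) := by
  refine continuous_matrix fun i j => ?_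
  fin_cases i <;> fin_cases j <;> simp <;> fun_prop

theorem unip_mul_diag_mul_unip_inv (a b : ℂ) {N : ℂ} (hN : N ≠ 0) :
    (unip (-a) * !![1, 0; 0, N] * unip b)⁻¹ = unip (-b) * !![1, 0; 0, N⁻¹] * unip a := by
  refine Matrix.inv_eq_right_inv ?_
  ext i j
  fin_cases i <;> fin_cases j <;> simp [unip, Matrix.mul_apply, Fin.sum_univ_two] <;>
    field_simp <;> ring

theorem mul_diag_mul_unip_apply (Q : Mat2) (N c : ℂ) (a : Fin 2) :
    (Q * !![1, 0; 0, N] * unip c) a 0 = Q a 0 ∧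
      (Q * !![1, 0; 0, N] * unip c) a 1 = Q a 0 * c + Q a 1 * N := by
  simp [unip, Matrix.mul_apply, Fin.sum_univ_two]

namespace NullDomain

variable (G : NullDomain) {v : (ℝ → Mat2) × (ℝ → Mat2)} {x : ℝ × ℝ} {u w : Fin 2 → ℝ → ℂ}
  {Y₁ : ℝ → Fin 2 → ℂ} {F : ℂ → Mat2}

theorem tendsto_FM {l : Filter ℂ} {σ : ℝ} (hl : l ≤ 𝓝 (σ : ℂ)) {N : ℂ}
    (hN : Tendsto (G.nu x) l (𝓝 N)) : Tendsto (G.FM x) l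
      (𝓝 (unip (-(Complex.I * (σ - ((x.1 + x.2) / 2 : ℝ)))) * !![1, 0; 0, N] *
        unip (Complex.I * (σ - G.z₀)))) := by
  have h1 : Tendsto (fun τ : ℂ => unip (-Complex.I * (τ - ((x.1 + x.2) / 2 : ℝ)))) l
      (𝓝 (unip (-Complex.I * (σ - ((x.1 + x.2) / 2 : ℝ))))) :=
    ((continuous_unip.comp (by fun_prop : Continuous fun τ : ℂ =>
      -Complex.I * (τ - ((x.1 + x.2) / 2 : ℝ)))).tendsto (σ : ℂ)).mono_left hl
  have h2 : Tendsto (fun τ : ℂ => unip (Complex.I * (τ - G.z₀))) l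
      (𝓝 (unip (Complex.I * (σ - G.z₀)))) :=
    ((continuous_unip.comp (by fun_prop : Continuous fun τ : ℂ =>
      Complex.I * (τ - G.z₀))).tendsto (σ : ℂ)).mono_left hl
  rw [← neg_mul]
  exact (h1.mul ((continuous_diag_one.tendsto N).comp hN)).mul h2

/-- The inverses of the boundary values of the given solution, in which only the sign of `ν` changes
across the cut. -/
theorem FM_values (hx : x ∈ G.D) {σ : ℝ} (hσ : σ ∈ G.arcs x) :
    (plusValue (G.FM x) σ)⁻¹ = unip (-(Complex.I * (σ - G.z₀))) *
      !![1, 0; 0, (G.nuPlus x σ)⁻¹] * unip (Complex.I * (σ - ((x.1 + x.2) / 2 : ℝ))) ∧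
    (minusValue (G.FM x) σ)⁻¹ = unip (-(Complex.I * (σ - G.z₀))) *
      !![1, 0; 0, -(G.nuPlus x σ)⁻¹] * unip (Complex.I * (σ - ((x.1 + x.2) / 2 : ℝ))) := by
  have h := G.isCutRoot_nu hx
  rw [plusValue_eq (G.tendsto_FM (fromAbove_le σ) (h.plus σ hσ)),
    minusValue_eq (G.tendsto_FM (fromBelow_le σ) (h.minus σ hσ)),
    unip_mul_diag_mul_unip_inv _ _ (h.np_ne_zero σ hσ),
    unip_mul_diag_mul_unip_inv _ _ (neg_ne_zero.2 (h.np_ne_zero σ hσ)), inv_neg]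
  exact ⟨rfl, rfl⟩

theorem notMem_I₃ (hx : x ∈ G.D) {σ : ℝ} (hσ : σ ∈ G.I₄ x) : σ ∉ closure (G.I₃ x) := fun h =>
  lt_irrefl _ (G.lt_of_mem_closure hx h (subset_closure hσ))

theorem mul_unip_eq_W (hx : x ∈ G.D) (σ : ℝ) :
    (σ ∈ G.I₃ x → v.1 σ * unip (-(Complex.I * (σ - G.z₀))) = G.W v x σ) ∧
    (σ ∈ G.I₄ x → v.2 σ * unip (-(Complex.I * (σ - G.z₀))) = G.W v x σ) := by
  refine ⟨fun h => ?_, fun h => ?_⟩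
  · rw [W, if_pos (subset_closure h), Complex.ofReal_sub, neg_mul]
  · rw [W, if_neg (G.notMem_I₃ hx h), Complex.ofReal_sub, neg_mul]

theorem hhpY_eq (hx : x ∈ G.D) {σ : ℝ} (hσ : σ ∈ G.arcs x) :
    G.hhpY v x (G.FM x) F σ = plusValue F σ * G.W v x σ * !![1, 0; 0, (G.nuPlus x σ)⁻¹] *
      unip (Complex.I * (σ - ((x.1 + x.2) / 2 : ℝ))) := by
  rw [hhpY, (G.FM_values hx hσ).1]
  by_cases h : σ ∈ G.I₃ x
  · rw [if_pos h, ← (G.mul_unip_eq_W hx σ).1 h]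
    simp only [mul_assoc]
  · rw [if_neg h, ← (G.mul_unip_eq_W hx σ).2 (hσ.resolve_left h)]
    simp only [mul_assoc]

/-- The two jump conditions in terms of the columns of `𝓕± W`. -/
theorem jump_iff (hx : x ∈ G.D) {σ : ℝ} (hσ : σ ∈ G.arcs x) {V : Mat2}
    (hV : V * unip (-(Complex.I * (σ - G.z₀))) = G.W v x σ) (P M : Mat2) :
    P * V * (plusValue (G.FM x) σ)⁻¹ = M * V * (minusValue (G.FM x) σ)⁻¹ ↔
      ∀ a, (P * G.W v x σ) a 0 = (M * G.W v x σ) a 0 ∧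
        (P * G.W v x σ) a 1 = -(M * G.W v x σ) a 1 := by
  have hN : (G.nuPlus x σ)⁻¹ ≠ 0 := inv_ne_zero ((G.isCutRoot_nu hx).np_ne_zero σ hσ)
  have e : ∀ (Q : Mat2) (N c : ℂ), Q * V * (unip (-(Complex.I * (σ - G.z₀))) * !![1, 0; 0, N] *
      unip c) = Q * G.W v x σ * !![1, 0; 0, N] * unip c := by
    intro Q N c
    rw [← hV]
    simp only [mul_assoc]
  rw [(G.FM_values hx hσ).1, (G.FM_values hx hσ).2, e, e]
  set c : ℂ := Complex.I * (σ - ((x.1 + x.2) / 2 : ℝ)) with hc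
  constructor
  · intro h a
    have h0 := congrFun (congrFun h a) 0
    have h1 := congrFun (congrFun h a) 1
    rw [(mul_diag_mul_unip_apply _ _ _ a).1, (mul_diag_mul_unip_apply _ _ _ a).1] at h0
    rw [(mul_diag_mul_unip_apply _ _ _ a).2, (mul_diag_mul_unip_apply _ _ _ a).2, h0] at h1
    refine ⟨h0, mul_right_cancel₀ hN ?_⟩
    linear_combination h1
  · intro h
    ext a b
    fin_cases b
    · have := (h a).1
      simpa only [Fin.zero_eta, (mul_diag_mul_unip_apply _ _ _ a).1] using this
    · simp only [Fin.mk_one, (mul_diag_mul_unip_apply _ _ _ a).2, (h a).1, (h a).2]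
      ring

namespace IsFrame

variable {G}

theorem mul_W_apply (hF : G.IsFrame v x u w) {σ : ℝ} (hσ : σ ∈ G.arcsBar x) (Q : Mat2)
    (a : Fin 2) : (Q * G.W v x σ) a 0 = Q a 0 * u 0 σ + Q a 1 * u 1 σ ∧
      (Q * G.W v x σ) a 1 = Q a 1 * w 0 σ - Q a 0 * w 1 σ := by
  simp only [Matrix.mul_apply, Fin.sum_univ_two, hF.W_zero σ hσ, (hF.W_one σ hσ).1,
    (hF.W_one σ hσ).2]
  exact ⟨trivial, by ring⟩

/-- The representation by the density, entry by entry. -/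
theorem isFOfY_iff (hF : G.IsFrame v x u w) :
    G.IsFOfY v x F Y₁ ↔ ∀ τ ∉ (fun σ : ℝ => (σ : ℂ)) '' G.arcsBar x, ∀ a b,
      (G.nu x τ)⁻¹ * F τ a b = (Pi.single a 1 : Fin 2 → ℂ) b + 1 / (Real.pi * Complex.I) *
        cauchyInt (G.arcsBar x) (fun t => (G.nuPlus x t)⁻¹ * (Y₁ t a * w b t)) τ := by
  refine forall₂_congr fun τ _ => ?_
  have e : ∀ a b, (∫ t in G.arcsBar x, (G.nuPlus x t)⁻¹ *
        (vecMulVec (Y₁ t) (G.W₂ v x t) * matJ) a b / (t - τ)) =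
      -cauchyInt (G.arcsBar x) (fun t => (G.nuPlus x t)⁻¹ * (Y₁ t a * w b t)) τ := by
    intro a b
    rw [cauchyInt, ← integral_neg]
    refine setIntegral_congr_fun (G.isCompact_arcsBar x).measurableSet fun t ht => ?_
    have e1 : (vecMulVec (Y₁ t) (G.W₂ v x t) * matJ) a b = -(Y₁ t a * w b t) := by
      fin_cases b <;> simp [Matrix.mul_apply, Fin.sum_univ_two, vecMulVec_apply, matJ, W₂,
        (hF.W_one t ht).1, (hF.W_one t ht).2]
    rw [e1]
    ring
  have e2 : ∀ a b : Fin 2, (1 : Mat2) a b = (Pi.single a 1 : Fin 2 → ℂ) b := by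
    intro a b
    fin_cases a <;> fin_cases b <;> simp
  constructor
  · intro h a b
    have h1 := congrFun (congrFun h a) b
    rw [Matrix.smul_apply, Matrix.sub_apply, Matrix.smul_apply, Matrix.of_apply, e, e2] at h1
    rw [smul_eq_mul, smul_eq_mul] at h1
    rw [h1]
    ring
  · intro h
    ext a b
    rw [Matrix.smul_apply, Matrix.sub_apply, Matrix.smul_apply, Matrix.of_apply, e, e2]
    rw [smul_eq_mul, smul_eq_mul, h a b]
    ring

/-- A solution of the Hilbert problem is the Cauchy integral of the density belonging to it, and
this density solves the equation of the second kind. -/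
theorem fredholm_of_hhp (hF : G.IsFrame v x u w) (hx : x ∈ G.D)
    (hH : G.IsHHPSolution v x (G.FM x) F) (hY : G.IsYOfF v x F Y₁) :
    (IntegrableOn Y₁ (G.arcsBar x) ∧ G.SolvesFredholm v x Y₁) ∧ G.IsFOfY v x F Y₁ := by
  have hK := hF.isKernelData hx
  have h := hK.root
  obtain ⟨hYc, hYF⟩ := hY
  have hYc' : ∀ a, ContinuousOn (fun σ => Y₁ σ a) (G.arcsBar x) := fun a =>
    (continuous_apply a).comp_continuousOn hYc
  have hp : ∀ σ ∈ G.arcs x, Tendsto F (fromAbove σ) (𝓝 (plusValue F σ)) := fun σ hσ => by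
    obtain ⟨L, hL⟩ := hH.plus_exists σ hσ
    rwa [plusValue_eq hL]
  have hm : ∀ σ ∈ G.arcs x, Tendsto F (fromBelow σ) (𝓝 (minusValue F σ)) := fun σ hσ => by
    obtain ⟨L, hL⟩ := hH.minus_exists σ hσ
    rwa [minusValue_eq hL]
  have hjump : ∀ σ ∈ G.arcs x, ∀ a,
      (plusValue F σ * G.W v x σ) a 0 = (minusValue F σ * G.W v x σ) a 0 ∧
        (plusValue F σ * G.W v x σ) a 1 = -(minusValue F σ * G.W v x σ) a 1 := by
    intro σ hσ
    rcases hσ with h3 | h4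
    · exact (G.jump_iff hx (Or.inl h3) ((G.mul_unip_eq_W hx σ).1 h3) _ _).1 (hH.jump₃ σ h3)
    · exact (G.jump_iff hx (Or.inr h4) ((G.mul_unip_eq_W hx σ).2 h4) _ _).1 (hH.jump₄ σ h4)
  -- `𝓕⁺ + 𝓕⁻` annihilates the second column of `W` and takes the first one to twice the density
  have hsum : ∀ σ ∈ G.arcs x, ∀ a b,
      plusValue F σ a b + minusValue F σ a b = 2 * (Y₁ σ a * w b σ) := by
    intro σ hσ a
    have hσS := h.subset hσ
    obtain ⟨h0, h1⟩ := hjump σ hσ a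
    rw [(hF.mul_W_apply hσS _ a).1, (hF.mul_W_apply hσS _ a).1] at h0
    rw [(hF.mul_W_apply hσS _ a).2, (hF.mul_W_apply hσS _ a).2] at h1
    have h2 := congrFun (hYF σ hσ) a
    rw [hF.W₁_eq hσS] at h2
    simp only [Matrix.mulVec, dotProduct, Fin.sum_univ_two, Matrix.smul_apply, Matrix.add_apply,
      smul_eq_mul] at h2
    have hd := hF.dot σ hσS
    intro b
    fin_cases b
    · simp only [Fin.zero_eta]
      linear_combination (-(plusValue F σ a 0 + minusValue F σ a 0)) * hd - 2 * w 0 σ * h2 -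
        u 1 σ * h1
    · simp only [Fin.mk_one]
      linear_combination (-(plusValue F σ a 1 + minusValue F σ a 1)) * hd - 2 * w 1 σ * h2 +
        u 0 σ * h1
  obtain ⟨Cn, hCn0, hCn⟩ := h.growth
  have hentry : ∀ {l : Filter ℂ} {Q : Mat2}, Tendsto F l (𝓝 Q) → ∀ a b,
      Tendsto (fun τ => F τ a b) l (𝓝 (Q a b)) := fun hQ a b =>
    tendsto_pi_nhds.1 (tendsto_pi_nhds.1 hQ a) b
  have hbase : ∀ a b, ∀ e ∈ ({G.r₀, G.s₀} : Finset ℝ), ∃ C, ∀ᶠ τ : ℂ in 𝓝 (e : ℂ), τ.im ≠ 0 →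
      ‖F τ a b‖ ≤ C := by
    intro a b e he
    refine hH.bounded_base.eventually ?_ a b
    rw [Finset.mem_insert, Finset.mem_singleton] at he
    rcases he with rfl | rfl <;> simp
  have hpoint : ∀ a b, ∀ e ∈ ({x.1, x.2} : Finset ℝ), ∃ C, ∀ᶠ τ : ℂ in 𝓝 (e : ℂ), τ.im ≠ 0 →
      ‖(G.nu x τ)⁻¹ * F τ a b‖ ≤ C := by
    intro a b e he
    refine hH.bounded_point.eventually ?_ a b
    rw [Finset.mem_insert, Finset.mem_singleton] at he
    rcases he with rfl | rfl <;> simp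
  have hcut : IsOpen (G.cut x)ᶜ := (isClosed_image_ofReal h.compact).isOpen_compl
  have hsect : ∀ a b, IsSectHolo (G.arcsBar x) ({G.r₀, G.s₀} ∪ {x.1, x.2})
      (fun τ => (G.nu x τ)⁻¹ * F τ a b) ((Pi.single a 1 : Fin 2 → ℂ) b)
      (fun σ => (G.nuPlus x σ)⁻¹ * plusValue F σ a b)
      (fun σ => (-G.nuPlus x σ)⁻¹ * minusValue F σ a b) := by
    intro a b
    refine ⟨fun τ hτ => ((h.diff τ hτ).inv (h.ne_zero τ hτ)).mul
      ((hH.holomorphic a b τ hτ).differentiableAt (hcut.mem_nhds hτ)), ?_, fun σ hσ hE => ?_,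
      fun σ hσ hE => ?_, fun e he _ => ?_⟩
    · have h1 := (h.inf.inv₀ one_ne_zero).mul (hentry hH.at_infinity a b)
      have e2 : (1 : ℂ)⁻¹ * (1 : Mat2) a b = (Pi.single a 1 : Fin 2 → ℂ) b := by
        fin_cases a <;> fin_cases b <;> simp
      rwa [e2] at h1
    · have hA := h.mem_arcs hσ hE
      exact ((h.plus σ hA).inv₀ (h.np_ne_zero σ hA)).mul (hentry (hp σ hA) a b)
    · have hA := h.mem_arcs hσ hE
      exact ((h.minus σ hA).inv₀ (neg_ne_zero.2 (h.np_ne_zero σ hA))).mul (hentry (hm σ hA) a b)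
    · rcases Finset.mem_union.1 he with heB | heX
      · obtain ⟨C, hC⟩ := hbase a b e heB
        refine ⟨Cn * C, ?_⟩
        filter_upwards [hC] with τ h1 him
        have hw := (endWeight_mono (Finset.subset_union_left (s₂ := {x.1, x.2})) τ :
          endWeight {G.r₀, G.s₀} τ ≤ _)
        have hC0 : 0 ≤ C := (norm_nonneg _).trans (h1 him)
        rw [norm_mul]
        refine (mul_le_mul ((hCn τ him).2.trans (mul_le_mul_of_nonneg_left hw hCn0)) (h1 him)
          (norm_nonneg _) ?_).trans_eq (by ring)
        have := one_le_endWeight ({G.r₀, G.s₀} ∪ {x.1, x.2}) τ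
        positivity
      · obtain ⟨C, hC⟩ := hpoint a b e heX
        exact IsSectHolo.growth_of_le (le_max_right C 0)
          (hC.mono fun τ hτ him => (hτ him).trans (le_max_left _ _))
  have hdiffeq : ∀ a b, ∀ σ ∈ G.arcs x, (G.nuPlus x σ)⁻¹ * plusValue F σ a b -
      (-G.nuPlus x σ)⁻¹ * minusValue F σ a b =
      2 * ((G.nuPlus x σ)⁻¹ * (Y₁ σ a * w b σ)) := by
    intro a b σ hσ
    rw [inv_neg]
    linear_combination (G.nuPlus x σ)⁻¹ * hsum σ hσ a b
  -- Cauchy's formula for `ν⁻¹ 𝓕`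
  have hrep : ∀ τ ∉ (fun σ : ℝ => (σ : ℂ)) '' G.arcsBar x, ∀ a b,
      (G.nu x τ)⁻¹ * F τ a b = (Pi.single a 1 : Fin 2 → ℂ) b + 1 / (Real.pi * Complex.I) *
        cauchyInt (G.arcsBar x) (fun t => (G.nuPlus x t)⁻¹ * (Y₁ t a * w b t)) τ := by
    intro τ hτ a b
    have h1 := (hsect a b).eq_cauchyInt h.compact hτ
    rw [cauchyInt_congr h.compact.measurableSet h.finite_sdiff (hdiffeq a b) τ,
      cauchyInt_const_mul] at h1
    rw [h1]
    have := IsCutRoot.pi_I_ne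
    field_simp
  obtain ⟨C, hC0, hC⟩ := hK.lip
  have hyi : ∀ a, IntegrableOn (fun τ => (G.nuPlus x τ)⁻¹ * Y₁ τ a) (G.arcsBar x) := fun a =>
    h.integrableOn_inv_mul (hYc' a)
  have hcongr : ∀ a b (l : Filter ℂ), (∀ᶠ τ in l, τ.im ≠ 0) → ∀ L : ℂ,
      Tendsto (fun τ => (G.nu x τ)⁻¹ * F τ a b) l (𝓝 L) →
      Tendsto (fun τ => (Pi.single a 1 : Fin 2 → ℂ) b + 1 / (Real.pi * Complex.I) *
        cauchyInt (G.arcsBar x) (fun t => (G.nuPlus x t)⁻¹ * (Y₁ t a * w b t)) τ) l (𝓝 L) := by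
    intro a b l hl L hL
    refine hL.congr' ?_
    filter_upwards [hl] with τ him using hrep τ (notMem_image_of_im_ne_zero _ him) a b
  have hE : ∀ σ ∈ G.arcs x, σ ∉ ({G.r₀, G.s₀} ∪ {x.1, x.2} : Finset ℝ) := fun σ hσ hE =>
    (Finset.mem_union.1 hE).elim (h.notMem σ hσ).1 (h.notMem σ hσ).2
  refine ⟨⟨hYc.integrableOn_compact h.compact, (hF.solvesFredholm_iff hx).2 fun a =>
    ⟨fun σ hσ => ?_, ?_⟩⟩, hF.isFOfY_iff.2 hrep⟩
  · have := (hyi a).mul_continuousOn (hK.K_continuousOn hσ) h.compact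
    simpa only [mul_right_comm] using this
  · refine (hK.second_kind_iff (hYc' a) _).1 ?_
    refine (h.link (K := C) (c := (Pi.single a 1 : Fin 2 → ℂ))
      (f := fun b t => (G.nuPlus x t)⁻¹ * (Y₁ t a * w b t)) (u := u) (U := T G x u) (w := w)
      (hp := fun b σ => (G.nuPlus x σ)⁻¹ * plusValue F σ a b)
      (hm := fun b σ => (-G.nuPlus x σ)⁻¹ * minusValue F σ a b) (y := fun σ => Y₁ σ a)
      (fun b => h.integrableOn_inv_mul ((hYc' a).mul (hK.w_holder b).continuousOn)) hC0
      (fun b x hx y hy => (hC b x hx y hy).1) (fun b x hx y hy => (hC b x hx y hy).2.2) hK.U_eq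
      (fun _ _ _ => rfl) (fun σ hσ => hK.dot σ (h.subset hσ))
      (fun b σ hσ => hcongr a b _ ((eventually_im_pos σ).mono fun _ h => ne_of_gt h) _
        ((hsect a b).plus σ (h.subset hσ) (hE σ hσ)))
      (fun b σ hσ => hcongr a b _ ((eventually_im_neg σ).mono fun _ h => ne_of_lt h) _
        ((hsect a b).minus σ (h.subset hσ) (hE σ hσ)))
      (fun b σ hσ => hdiffeq a b σ hσ) (fun b e he _ => ?_) (fun b e he _ => ?_)).1
      fun σ hσ => ?_
    · obtain ⟨M, hM⟩ := hbase a b e he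
      refine ⟨M, hM.mono fun τ hτ him => ?_⟩
      have hcτ := notMem_image_of_im_ne_zero (G.arcsBar x) him
      rw [← hrep τ hcτ a b, mul_inv_cancel_left₀ (h.ne_zero τ hcτ)]
      exact hτ him
    · obtain ⟨M, hM⟩ := hpoint a b e he
      refine ⟨M, hM.mono fun τ hτ him => ?_⟩
      rw [← hrep τ (notMem_image_of_im_ne_zero (G.arcsBar x) him) a b]
      exact hτ him
    · have h0 := (hjump σ hσ a).1
      rw [(hF.mul_W_apply (h.subset hσ) _ a).1, (hF.mul_W_apply (h.subset hσ) _ a).1] at h0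
      rw [inv_neg]
      linear_combination (G.nuPlus x σ)⁻¹ * h0

/-- A solution of the Alekseev-type equation yields a solution of the Hilbert problem. -/
theorem hhp_of_alekseev (hF : G.IsFrame v x u w) (hx : x ∈ G.D)
    (hY : IsCPlus 0 Y₁ (G.arcsBar x)) (hA : G.SolvesAlekseev v x Y₁) (hB : G.IsFOfY v x F Y₁) :
    G.IsHHPSolution v x (G.FM x) F ∧ G.IsYOfF v x F Y₁ := by
  have hK := hF.isKernelData hx
  have h := hK.root
  have hb := h.compact.isBounded
  have hYH := (G.isCPlus_zero_iff hx).1 hY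
  have hq : ∀ a b, IsHolder (fun τ => Y₁ τ a * w b τ) (G.arcsBar x) := fun a b =>
    (hYH a).mul hb (hK.w_holder b)
  choose hp hm hplus hminus hjump hiff M hM using fun a =>
    hK.exists_boundary_values (hYH a) (Pi.single a 1 : Fin 2 → ℂ)
  have hzero : ∀ a, ∀ σ ∈ G.arcs x,
      (hp a 0 σ + hm a 0 σ) * u 0 σ + (hp a 1 σ + hm a 1 σ) * u 1 σ = 0 := fun a σ hσ =>
    (hiff a σ hσ).1 (hF.solvesAlekseev_iff.1 hA a σ hσ)
  -- `H` is the matrix `ν⁻¹ 𝓕`, with the boundary values `hp` and `hm`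
  set H : Fin 2 → Fin 2 → ℂ → ℂ := fun a b τ => (Pi.single a 1 : Fin 2 → ℂ) b +
    1 / (Real.pi * Complex.I) *
      cauchyInt (G.arcsBar x) (fun t => (G.nuPlus x t)⁻¹ * (Y₁ t a * w b t)) τ with hHdef
  have hFH : ∀ τ ∉ (fun σ : ℝ => (σ : ℂ)) '' G.arcsBar x, ∀ a b,
      F τ a b = G.nu x τ * H a b τ := by
    intro τ hτ a b
    rw [hHdef]
    simp only
    rw [← hF.isFOfY_iff.1 hB τ hτ a b, mul_inv_cancel_left₀ (h.ne_zero τ hτ)]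
  have hHd : ∀ a b, ∀ τ ∉ (fun σ : ℝ => (σ : ℂ)) '' G.arcsBar x, DifferentiableAt ℂ (H a b) τ :=
    fun a b τ hτ => ((differentiableAt_cauchyInt h.compact
      (h.integrableOn_inv_mul (hq a b).continuousOn) hτ).const_mul _).const_add _
  have hcut : IsOpen (G.cut x)ᶜ := (isClosed_image_ofReal h.compact).isOpen_compl
  have hFd : ∀ a b, ∀ τ ∉ (fun σ : ℝ => (σ : ℂ)) '' G.arcsBar x,
      DifferentiableAt ℂ (fun τ => F τ a b) τ := by
    intro a b τ hτ
    refine ((h.diff τ hτ).mul (hHd a b τ hτ)).congr_of_eventuallyEq ?_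
    filter_upwards [hcut.mem_nhds hτ] with ζ hζ using hFH ζ hζ a b
  have hFp : ∀ σ ∈ G.arcs x, Tendsto F (fromAbove σ)
      (𝓝 (Matrix.of fun a b => G.nuPlus x σ * hp a b σ)) := by
    intro σ hσ
    refine tendsto_pi_nhds.2 fun a => tendsto_pi_nhds.2 fun b => ?_
    refine ((h.plus σ hσ).mul (hplus a b σ hσ)).congr' ?_
    filter_upwards [eventually_im_pos σ] with τ hτ
    exact (hFH τ (notMem_image_of_im_ne_zero _ hτ.ne') a b).symm
  have hFm : ∀ σ ∈ G.arcs x, Tendsto F (fromBelow σ)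
      (𝓝 (Matrix.of fun a b => -G.nuPlus x σ * hm a b σ)) := by
    intro σ hσ
    refine tendsto_pi_nhds.2 fun a => tendsto_pi_nhds.2 fun b => ?_
    refine ((h.minus σ hσ).mul (hminus a b σ hσ)).congr' ?_
    filter_upwards [eventually_im_neg σ] with τ hτ
    exact (hFH τ (notMem_image_of_im_ne_zero _ hτ.ne) a b).symm
  have hjump' : ∀ σ ∈ G.arcs x, ∀ a,
      (plusValue F σ * G.W v x σ) a 0 = (minusValue F σ * G.W v x σ) a 0 ∧
        (plusValue F σ * G.W v x σ) a 1 = -(minusValue F σ * G.W v x σ) a 1 := by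
    intro σ hσ a
    have hσS := h.subset hσ
    rw [plusValue_eq (hFp σ hσ), minusValue_eq (hFm σ hσ), (hF.mul_W_apply hσS _ a).1,
      (hF.mul_W_apply hσS _ a).1, (hF.mul_W_apply hσS _ a).2, (hF.mul_W_apply hσS _ a).2]
    simp only [Matrix.of_apply]
    refine ⟨by linear_combination G.nuPlus x σ * hzero a σ hσ, ?_⟩
    linear_combination G.nuPlus x σ * (w 0 σ * hjump a 1 σ hσ - w 1 σ * hjump a 0 σ hσ)
  -- the first column of `𝓕⁺ W` is the density itself
  have hcol : ∀ σ ∈ G.arcs x, ∀ a, (plusValue F σ * G.W v x σ) a 0 = Y₁ σ a := by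
    intro σ hσ a
    have hσS := h.subset hσ
    have hnp := h.np_ne_zero σ hσ
    have hd := hF.dot σ hσS
    rw [plusValue_eq (hFp σ hσ), (hF.mul_W_apply hσS _ a).1]
    simp only [Matrix.of_apply]
    have e0 := hjump a 0 σ hσ
    have e1 := hjump a 1 σ hσ
    have e2 : G.nuPlus x σ * (G.nuPlus x σ)⁻¹ = 1 := mul_inv_cancel₀ hnp
    linear_combination (1 / 2) * G.nuPlus x σ * (u 0 σ * e0 + u 1 σ * e1 + hzero a σ hσ) +
      Y₁ σ a * (w 0 σ * u 0 σ + w 1 σ * u 1 σ) * e2 + Y₁ σ a * hd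
  -- the columns of `Y` are the density and a combination of it with the second column of `ν⁻¹ 𝓕⁺ W`
  have hYb : ∃ Q, ∀ σ ∈ G.arcs x, ∀ a b, ‖G.hhpY v x (G.FM x) F σ a b‖ ≤ Q := by
    choose Q hQ0 hQ using fun a => (hYH a).exists_bound hb
    obtain ⟨R, hR⟩ := h.compact.exists_bound_of_continuousOn
      (f := fun σ : ℝ => Complex.I * ((σ : ℂ) - ((x.1 + x.2) / 2 : ℝ)))
      (Continuous.continuousOn (by fun_prop))
    refine ⟨∑ a, (Q a + Q a * |R| + |M a|), fun σ hσ a b => ?_⟩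
    have hσS := h.subset hσ
    have hle : Q a + Q a * |R| + |M a| ≤ ∑ a, (Q a + Q a * |R| + |M a|) :=
      Finset.single_le_sum (f := fun a => Q a + Q a * |R| + |M a|)
        (fun a _ => by have := hQ0 a; positivity) (Finset.mem_univ a)
    refine le_trans ?_ hle
    have h1 : ‖Y₁ σ a‖ ≤ Q a := hQ a σ hσS
    have h2 := (hR σ hσS).trans (le_abs_self R)
    have h3 := (hM a σ hσ).trans (le_abs_self (M a))
    have hQa := hQ0 a
    rw [G.hhpY_eq hx hσ]
    fin_cases b
    · simp only [Fin.zero_eta]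
      rw [(mul_diag_mul_unip_apply _ _ _ a).1, hcol σ hσ a]
      have : 0 ≤ Q a * |R| := by positivity
      have := abs_nonneg (M a)
      linarith
    · simp only [Fin.mk_one]
      rw [(mul_diag_mul_unip_apply _ _ _ a).2, hcol σ hσ a, (hF.mul_W_apply hσS _ a).2,
        plusValue_eq (hFp σ hσ)]
      simp only [Matrix.of_apply]
      have e : (G.nuPlus x σ * hp a 1 σ * w 0 σ - G.nuPlus x σ * hp a 0 σ * w 1 σ) *
          (G.nuPlus x σ)⁻¹ = hp a 1 σ * w 0 σ - hp a 0 σ * w 1 σ := by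
        have hnp := h.np_ne_zero σ hσ
        field_simp
      rw [e]
      refine (norm_add_le _ _).trans ?_
      rw [norm_mul]
      have := mul_le_mul h1 h2 (norm_nonneg _) hQa
      linarith
  have hYbd : ∀ a b : ℝ, BoundedAt {a, b} (G.arcs x)ᶜ (G.hhpY v x (G.FM x) F) := by
    intro a b
    obtain ⟨Q, hQ⟩ := hYb
    exact ⟨univ, univ_mem, Q, fun σ hσ => hQ σ (not_not.1 hσ.2)⟩
  refine ⟨⟨fun a b τ hτ => (hFd a b τ hτ).differentiableWithinAt, ?_, fun σ hσ => ⟨_, hFp σ hσ⟩,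
    fun σ hσ => ⟨_, hFm σ hσ⟩, fun σ hσ => ?_, fun σ hσ => ?_, ?_, ?_, hYbd _ _, hYbd _ _⟩,
    ?_, fun σ hσ => ?_⟩
  · refine tendsto_pi_nhds.2 fun a => tendsto_pi_nhds.2 fun b => ?_
    have h1 := h.inf.mul (((tendsto_cauchyInt_cocompact h.compact
      (h.integrableOn_inv_mul (hq a b).continuousOn)).const_mul
      (1 / (Real.pi * Complex.I) : ℂ)).const_add ((Pi.single a 1 : Fin 2 → ℂ) b))
    have e2 : 1 * ((Pi.single a 1 : Fin 2 → ℂ) b + 1 / (Real.pi * Complex.I) * 0) =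
        (1 : Mat2) a b := by
      fin_cases a <;> fin_cases b <;> simp
    rw [e2] at h1
    refine h1.congr' ?_
    filter_upwards [(h.compact.image Complex.continuous_ofReal).compl_mem_cocompact] with τ hτ
    exact (hFH τ hτ a b).symm
  · exact (G.jump_iff hx (Or.inl hσ) ((G.mul_unip_eq_W hx σ).1 hσ) _ _).2 (hjump' σ (Or.inl hσ))
  · exact (G.jump_iff hx (Or.inr hσ) ((G.mul_unip_eq_W hx σ).2 hσ) _ _).2 (hjump' σ (Or.inr hσ))
  · refine boundedAt_pair fun e he a b => ?_
    obtain ⟨e', he', heB⟩ : ∃ e' : ℝ, (e' : ℂ) = e ∧ e' ∈ ({G.r₀, G.s₀} : Finset ℝ) := by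
      rcases he with rfl | rfl
      exacts [⟨_, rfl, by simp⟩, ⟨_, rfl, by simp⟩]
    subst he'
    refine exists_bound_near (hFd a b) fun heS => ?_
    obtain ⟨C, hC⟩ := h.cauchyInt_bounded_base (hq a b) ((Pi.single a 1 : Fin 2 → ℂ) b) heB heS
    refine ⟨C, hC.mono fun τ hτ him => ?_⟩
    rw [hFH τ (notMem_image_of_im_ne_zero _ him) a b]
    exact hτ him
  · refine boundedAt_pair fun e he a b => ?_
    obtain ⟨e', he', heX⟩ : ∃ e' : ℝ, (e' : ℂ) = e ∧ e' ∈ ({x.1, x.2} : Finset ℝ) := by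
      rcases he with rfl | rfl
      exacts [⟨_, rfl, by simp⟩, ⟨_, rfl, by simp⟩]
    subst he'
    refine exists_bound_near (f := fun τ => (G.nu x τ)⁻¹ * F τ a b)
      (fun τ hτ => ((h.diff τ hτ).inv (h.ne_zero τ hτ)).mul (hFd a b τ hτ)) fun heS => ?_
    obtain ⟨C, hC⟩ := h.cauchyInt_bounded_point (hq a b) ((Pi.single a 1 : Fin 2 → ℂ) b) heX heS
    refine ⟨C, hC.mono fun τ hτ him => ?_⟩
    have hcτ := notMem_image_of_im_ne_zero (G.arcsBar x) him
    rw [hFH τ hcτ a b, inv_mul_cancel_left₀ (h.ne_zero τ hcτ)]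
    exact hτ him
  · exact (isHolder_pi hb hYH).continuousOn
  · have hσS := h.subset hσ
    funext a
    have e1 := hcol σ hσ a
    have e2 := (hjump' σ hσ a).1
    rw [e1, (hF.mul_W_apply hσS _ a).1] at e2
    rw [(hF.mul_W_apply hσS _ a).1] at e1
    rw [hF.W₁_eq hσS]
    simp only [Matrix.mulVec, dotProduct, Fin.sum_univ_two, Matrix.smul_apply, Matrix.add_apply,
      smul_eq_mul]
    linear_combination -(1 / 2) * e1 + (1 / 2) * e2

end IsFrame

end NullDomain

end

theorem mainTheorem6 (G : NullDomain) (v : (ℝ → Mat2) × (ℝ → Mat2)) (hv : v ∈ G.KPlus 2)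
    (x : ℝ × ℝ) (hx : x ∈ G.D) :
    -- `U₁` and `K₂₁` are the singular integrals that define them, wherever these make sense
    (∀ σ ∈ G.arcsBar x \ {x.1, x.2}, ∃ L : Fin 2 → ℂ,
      HasPVIntegral (G.arcsBar x) {σ}
        (fun σ' => (G.nuPlus x σ' / ((σ' - σ : ℝ) : ℂ)) • G.W₁ v x σ') L ∧
      G.U₁ v x σ = -(1 / (Real.pi * Complex.I)) • L) ∧
    (∀ σ' ∈ G.arcsBar x \ {x.1, x.2}, ∀ σ ∈ G.arcsBar x \ {x.1, x.2}, σ' ≠ σ → ∃ L : ℂ,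
      HasPVIntegral (G.arcsBar x) {σ, σ'}
        (fun σ'' => G.nuPlus x σ'' * (G.d₂₁ v x σ' σ'' /
          ((((σ'' - σ) * (σ' - σ'') : ℝ)) : ℂ))) L ∧
      G.K₂₁ v x σ' σ = -(1 / (Real.pi * Complex.I)) * L) ∧
    -- regularity of the inhomogeneous term and of the kernel
    IsCPlus 1 (G.U₁ v x) (G.arcsBar x) ∧
    IsCZeroPlus₂ (fun p => G.K₂₁ v x p.1 p.2) (G.arcsBar x ×ˢ G.arcsBar x) ∧
    -- equivalence of the Alekseev-type equation and the Fredholm equation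
    (∀ Y₁ : ℝ → Fin 2 → ℂ,
      (IsCPlus 0 Y₁ (G.arcsBar x) ∧ G.SolvesAlekseev v x Y₁) ↔
        (IntegrableOn Y₁ (G.arcsBar x) ∧ G.SolvesFredholm v x Y₁)) ∧
    -- equivalence of the homogeneous Hilbert problem and the two integral equations
    (∀ (F : ℂ → Mat2) (Y₁ : ℝ → Fin 2 → ℂ), List.TFAE [
      G.IsHHPSolution v x (G.FM x) F ∧ G.IsYOfF v x F Y₁,
      (IsCPlus 0 Y₁ (G.arcsBar x) ∧ G.SolvesAlekseev v x Y₁) ∧ G.IsFOfY v x F Y₁,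
      (IntegrableOn Y₁ (G.arcsBar x) ∧ G.SolvesFredholm v x Y₁) ∧ G.IsFOfY v x F Y₁]) := by
  obtain ⟨u, w, hF⟩ := G.exists_isFrame hv hx
  refine ⟨hF.exists_hasPVIntegral_U₁ hx, hF.exists_hasPVIntegral_K₂₁ hx, hF.isCPlus_U₁ hx,
    hF.isCZeroPlus₂_K₂₁ hx, fun Y₁ => hF.alekseev_iff_fredholm hx, fun F Y₁ => ?_⟩
  tfae_have 1 → 3 := fun ⟨hH, hY⟩ => hF.fredholm_of_hhp hx hH hY
  tfae_have 2 ↔ 3 := and_congr_left' (hF.alekseev_iff_fredholm hx)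
  tfae_have 2 → 1 := fun ⟨hA, hB⟩ => hF.hhp_of_alekseev hx hA.1 hA.2 hB
  tfae_finish
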